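/- For an integer $d\ge 2$ let $\mathbb{T}_d$ be the infinite rooted $d$-ary tree, in which the root has degree $d$ and every other vertex has degree $d+1$. The frog model on $\mathbb{T}_d$ with $\operatorname{Poi}(\mu)$ sleeping frogs per site ($\mu\ge 0$) is the following process in discrete time. At time $0$ one frog is awake at the root, and at the vertices other than the root there are independent $\operatorname{Poi}(\mu)$ numbers of sleeping frogs. Every awake frog performs a simple random walk on $\mathbb{T}_d$, one step per unit of time, and all these walks are independent of one another and of the numbers of sleeping frogs. When a vertex with sleeping frogs is first visited by an awake frog, all frogs sleeping there wake up and begin their own walks. A realization is recurrent if the root is visited infinitely often by frogs, and transient otherwise. Theorem. For every $d\ge 2$ there is a critical value $\mu_c(d)\in(0,\infty)$ such that the frog model on $\mathbb{T}_d$ with $\operatorname{Poi}(\mu)$ sleeping frogs per site is almost surely recurrent if $\mu>\mu_c(d)$ and almost surely transient if $0\le\mu<\mu_c(d)$. Moreover, there are absolute constants $C,C'>0$, not depending on $d$, such that \[ C\,d<\mu_c(d)<C'\,d\log d\qquad\text{for all } d\ge 2 . \] -/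

import Mathlib

open MeasureTheory ProbabilityTheory Filter
open scoped NNReal

namespace FrogModel

/-- Vertices of the infinite rooted `d`-ary tree, as finite words over `d` letters: the root is
`[]`, and the children of `v` are the words `i :: v`. -/
abbrev Vertex (d : ℕ) : Type := List (Fin d)

/-- The vertex set is countable and carries the discrete σ-algebra. -/
instance (d : ℕ) : MeasurableSpace (Vertex d) := ⊤

instance (d : ℕ) : DiscreteMeasurableSpace (Vertex d) := ⟨fun _ => trivial⟩

/-- The infinite `d`-ary tree: every vertex is adjacent to its `d` children (and hence every
vertex except the root is also adjacent to its parent). -/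
def tree (d : ℕ) : SimpleGraph (Vertex d) where
  Adj v w := (∃ i, w = i :: v) ∨ (∃ i, v = i :: w)
  symm := ⟨fun _ _ h => h.symm⟩
  loopless := ⟨fun v h => by rcases h with ⟨i, h⟩ | ⟨i, h⟩ <;> simp at h⟩

/-- The transition probability of simple random walk on the tree: a uniformly random neighbour
of the present position `v`. -/
noncomputable def step (d : ℕ) (v : Vertex d) : Measure (Vertex d) :=
  uniformOn ((tree d).neighborSet v)

/-- The path started at `v` that, when it is at `w` after `n` steps, moves to `ξ (n, w)`. -/
def path {d : ℕ} (v : Vertex d) (ξ : ℕ × Vertex d → Vertex d) : ℕ → Vertex d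
  | 0 => v
  | n + 1 => ξ (n, path v ξ n)

/-- The law of simple random walk on the tree started at `v`, as a measure on paths. It is
constructed by giving every time `n` and vertex `w` an independent, uniformly random neighbour
of `w`, to which the walk moves if it is at `w` at time `n`. -/
noncomputable def walkLaw (d : ℕ) (v : Vertex d) : Measure (ℕ → Vertex d) :=
  (Measure.infinitePi fun p : ℕ × Vertex d => step d p.2).map (path v)

/-- Frogs are labelled by their home vertex and a number. -/
abbrev Frog (d : ℕ) : Type := Vertex d × ℕ

/-- The randomness of the frog model: `sleepers v` is the number of frogs initially sleeping
at `v` (not used when `v` is the root), and `walk f n` is the position of the frog `f` when it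
has made `n` steps after waking up. -/
abbrev Sample (d : ℕ) : Type := (Vertex d → ℕ) × (Frog d → ℕ → Vertex d)

/-- The law of the randomness of the frog model with i.i.d. `Poi(μ)` sleeping frogs per site:
the numbers of sleeping frogs are i.i.d. Poisson with mean `μ`, the walks of the frogs are
independent simple random walks started at their homes, and numbers and walks are
independent. -/
noncomputable def law (d : ℕ) (μ : ℝ≥0) : Measure (Sample d) :=
  (Measure.infinitePi fun _ : Vertex d => poissonMeasure μ).prod
    (Measure.infinitePi fun f : Frog d => walkLaw d f.1)

/-- The frogs that exist and are asleep at time `0`: at each vertex `v` other than the root, the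
frogs `(v, 0), …, (v, sleepers v - 1)`. -/
def IsSleeper {d : ℕ} (ω : Sample d) (f : Frog d) : Prop :=
  f.1 ≠ [] ∧ f.2 < ω.1 f.1

open Classical in
/-- The state of the frog `f` at time `n`: `none` if it is not awake (or does not exist), and
`some m` if it is awake and has made `m` steps since it woke up. At time `0` only the frog
`([], 0)` at the root is awake. Every frog that is awake makes one step of its walk per
time unit, and a sleeping frog wakes up as soon as its home is visited by an awake frog. -/
noncomputable def state {d : ℕ} (ω : Sample d) : ℕ → Frog d → Option ℕ
  | 0, f => if f = ([], 0) then some 0 else none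
  | n + 1, f =>
    match state ω n f with
    | some m => some (m + 1)
    | none =>
      if IsSleeper ω f ∧ ∃ g m, state ω n g = some m ∧ ω.2 g (m + 1) = f.1 then some 0 else none

/-- At time `n`, there is an awake frog at the vertex `v`. -/
def VisitedAt {d : ℕ} (ω : Sample d) (v : Vertex d) (n : ℕ) : Prop :=
  ∃ f m, state ω n f = some m ∧ ω.2 f m = v

/-- The realization `ω` is recurrent: the root is visited infinitely often by frogs. -/
def Recurrent {d : ℕ} (ω : Sample d) : Prop :=
  ∃ᶠ n in atTop, VisitedAt ω [] n

/-- The realization `ω` is transient if it is not recurrent. -/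
def Transient {d : ℕ} (ω : Sample d) : Prop :=
  ¬ Recurrent ω

/-! The measures above are genuine probability measures, and `walkLaw` has the finite-dimensional
distributions of simple random walk. -/

theorem neighborSet_finite (d : ℕ) (v : Vertex d) : ((tree d).neighborSet v).Finite := by
  refine ((Set.finite_range fun i : Fin d => i :: v).union (Set.finite_singleton v.tail)).subset ?_
  rintro w (⟨i, rfl⟩ | ⟨i, rfl⟩)
  · exact Or.inl ⟨i, rfl⟩
  · exact Or.inr rfl

instance (d : ℕ) [NeZero d] (v : Vertex d) : IsProbabilityMeasure (step d v) :=
  isProbabilityMeasure_uniformOn (neighborSet_finite d v) ⟨0 :: v, Or.inl ⟨0, rfl⟩⟩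

theorem measurable_path {d : ℕ} (v : Vertex d) : Measurable (path v) := by
  refine measurable_pi_lambda _ fun n => ?_
  induction n with
  | zero => exact measurable_const
  | succ n ih =>
    have h : Measurable fun q : (ℕ × Vertex d → Vertex d) × Vertex d => q.1 (n, q.2) :=
      measurable_from_prod_countable_left fun w => measurable_pi_apply (n, w)
    exact h.comp (measurable_id.prodMk ih)

instance (d : ℕ) [NeZero d] (v : Vertex d) : IsProbabilityMeasure (walkLaw d v) :=
  Measure.isProbabilityMeasure_map (measurable_path v).aemeasurable

instance (d : ℕ) [NeZero d] (μ : ℝ≥0) : IsProbabilityMeasure (law d μ) := by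
  unfold law; infer_instance

theorem walkLaw_cylinder (d : ℕ) [NeZero d] (x : ℕ → Vertex d) (n : ℕ) :
    walkLaw d (x 0) {S | ∀ i ≤ n, S i = x i} =
      ∏ i ∈ Finset.range n, step d (x i) {x (i + 1)} := by
  have hm : MeasurableSet {S : ℕ → Vertex d | ∀ i ≤ n, S i = x i} := by
    have : {S : ℕ → Vertex d | ∀ i ≤ n, S i = x i} =
        ⋂ i, ⋂ (_ : i ≤ n), {S | S i = x i} := by ext; simp
    rw [this]
    exact MeasurableSet.iInter fun i => MeasurableSet.iInter fun _ =>
      measurableSet_eq_fun (measurable_pi_apply i) measurable_const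
  rw [walkLaw, Measure.map_apply (measurable_path _) hm]
  have hinj : Function.Injective fun i : ℕ => (i, x i) := fun i j h => congrArg Prod.fst h
  have hs : path (x 0) ⁻¹' {S | ∀ i ≤ n, S i = x i} =
      Set.pi ((Finset.range n).map ⟨_, hinj⟩ : Finset (ℕ × Vertex d))
        (fun p => {x (p.1 + 1)}) := by
    ext ξ
    simp only [Set.mem_preimage, Set.mem_ofPred_eq, Set.mem_pi, Finset.coe_map,
      Function.Embedding.coeFn_mk, Finset.coe_range, Set.mem_image, Set.mem_Iio,
      Set.mem_singleton_iff, forall_exists_index, and_imp, forall_apply_eq_imp_iff₂]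
    constructor
    · intro h i hi
      have := h (i + 1) hi
      rwa [path, h i hi.le] at this
    · intro h i
      induction i with
      | zero => intro _; rfl
      | succ i ih => intro hi; rw [path, ih (by omega), h i hi]
  rw [hs, Measure.infinitePi_pi _ fun _ _ => measurableSet_singleton _, Finset.prod_map]
  rfl

end FrogModel

open MeasureTheory ProbabilityTheory Filter
open scoped NNReal ENNReal symmDiff

namespace FrogModel

variable {d : ℕ}

/-! Recurrence depends only on which pairs of a frog and a step number ever occur
(`recurrent_iff_infinite`), not on real time. The frogs may therefore be moved one at a time, in
round-robin order. Such an exploration reads every random instruction at most once, so the law of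
its history is the same whether the instructions are attached to the frogs or stacked at the
vertices (`measure_frequently_eq`, `law_recurrent_eq`). With stacks the model is Abelian: no vertex
is left more often than a stable configuration allows, and almost surely transience means that a
stable configuration exists (`exists_stable_iff`). On a tree this gives a recursion: `exits e m`,
the number of frogs that leave a subtree through its top when `m` frogs enter there, is determined
by the same functions of the subtrees at the children (`exits_eq_node`).

Small density. A frog at depth `k` receives the weight `t ^ k`. If `μ < d / 16`, then `t` can be
chosen such that the expected total weight of the awake frogs never increases and drops by a fixed
amount whenever a frog moves from the root (`weight_decrease`). The expected number of moves from
the root is finite, and Borel–Cantelli gives transience.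

Positive probability of recurrence implies probability one. If the process at the root, where frogs
cannot leave upwards, never stabilizes, then in an ordinary subtree with the same downward
instructions at least `m` frogs leave when `m` enter (`le_node_merge`). For many entering frogs, one
more sleeper anywhere has the effect of one more entering frog, up to a nonsingular change of the
stacks (`aeEventuallyLE_addSleeper`). Zero-one laws for exchangeable events then show that the
surplus of exits over entrances tends to infinity almost surely (`ae_eventuallyLE`). The surpluses
of two children add up, while the number of frogs required grows by a factor `4 / 3` only.
Iterating, the surplus overtakes the scale at which it is guaranteed and then sustains itself, so
that infinitely many frogs leave with positive probability when enough enter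
(`exists_exits_eq_top_pos`), and then also when a single one enters (`exits_one_eq_top_pos`).
Finally, whatever the environment is up to a finite depth, there is a vertex at this depth whose
untouched subtree can make the whole model recurrent on its own (`exists_pivot_or_le`). The
conditional probability of recurrence given any finite part of the environment is thus bounded
below, which forces probability one (`exits_rootEnv_ae_eq_top`).

Large density. The positions of the frogs are compared at one fixed number `T` of steps after waking
up. A walk from `u` is then in the subtree at a vertex `x` with probability at least half of `d ^
(-D)`, where `D` is the distance of `u` and `x` (`exists_time_walk`), and by Poisson thinning the
resulting particles are independent (`map_frogConfig`). A frog that is found in the subtree at `x`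
and started outside has woken up all vertices on its way down. This yields an activation process on
a finite tree, in which a vertex of depth `k` has mass `d ^ (-k)`, the order of its chance to send a
particle across the root. The exponential moment of minus the active mass is at most `γ ^ n` at
depth `n`, with `γ = exp (-s) * (1 + exp (-s)) ^ (d - 1)` (`lintegral_mass_le`), and `γ < 1` as soon
as `s ≥ log d` (`expWeight_mul_lt_one`); this is the origin of `d log d`. In deep trees arbitrarily
many particles therefore cross the root with probability bounded away from zero, whereas a transient
realization allows a bounded number only (`exists_returns_le`).

The probability of recurrence is monotone in `μ`, since Poisson numbers can be superposed
(`law_recurrent_mono`). Hence the supremum of the transient densities separates the two phases and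
inherits both bounds. -/

/-! ### Sequential exploration of the model and its histories -/

/-- An awake frog in the queue: its label, the number of steps made, and its position. -/
abbrev Entry (d : ℕ) : Type := Frog d × ℕ × Vertex d

/-- State of the sequential exploration: a queue of awake frogs, the vertices seen so far, and
the number of departures from every vertex. -/
structure Exploration (d : ℕ) where
  queue : List (Entry d)
  seen : Finset (Vertex d)
  count : Vertex d → ℕ

namespace Exploration

def newFrogs (y : Vertex d) (j : ℕ) : List (Entry d) :=
  (List.range j).map fun i => ((y, i), 0, y)

/-- The answer `b` consists of the vertex to which the frog at the head moves and the number of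
frogs woken up there. The frog rejoins the queue behind all frogs already waiting, so that every
awake frog is served infinitely often. The case of an empty queue never occurs, by `queue_ne_nil`.
-/
def next (s : Exploration d) (b : Vertex d × ℕ) : Exploration d :=
  match s.queue with
  | [] => s
  | p :: t =>
    ⟨t ++ (p.1, p.2.1 + 1, b.1) :: (if b.1 ∈ s.seen then [] else newFrogs b.1 b.2),
      insert b.1 s.seen, Function.update s.count p.2.2 (s.count p.2.2 + 1)⟩

/-- The root counts as seen from the beginning, so a number of sleepers at the root is never read.
-/
def start : Exploration d := ⟨[(([], 0), 0, [])], {[]}, fun _ => 0⟩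

def head (s : Exploration d) : Entry d := s.queue.headD (([], 0), 0, [])

/-- The state after a history of answers, the most recent answer being the first. -/
def after : List (Vertex d × ℕ) → Exploration d
  | [] => start
  | b :: h => (after h).next b

theorem queue_ne_nil (h : List (Vertex d × ℕ)) : (after h).queue ≠ [] := by
  induction h with
  | nil => simp [after, start]
  | cons b h ih =>
    obtain ⟨p, t, hp⟩ := List.exists_cons_of_ne_nil ih
    simp [after, next, hp]

theorem queue_eq (h : List (Vertex d × ℕ)) :
    (after h).queue = (after h).head :: (after h).queue.tail := by
  obtain ⟨p, t, hp⟩ := List.exists_cons_of_ne_nil (queue_ne_nil h)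
  simp [head, hp]

theorem head_mem (h : List (Vertex d × ℕ)) : (after h).head ∈ (after h).queue := by
  rw [queue_eq h]; exact List.mem_cons_self

theorem after_cons_queue (b : Vertex d × ℕ) (h : List (Vertex d × ℕ)) :
    (after (b :: h)).queue = (after h).queue.tail ++
      ((after h).head.1, (after h).head.2.1 + 1, b.1) ::
        (if b.1 ∈ (after h).seen then [] else newFrogs b.1 b.2) := by
  rw [after, next]
  split
  · next h0 => exact absurd h0 (queue_ne_nil h)
  · next p t hp => simp [head, hp]

theorem after_cons_seen (b : Vertex d × ℕ) (h : List (Vertex d × ℕ)) :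
    (after (b :: h)).seen = insert b.1 (after h).seen := by
  rw [after, next]
  split
  · next h0 => exact absurd h0 (queue_ne_nil h)
  · rfl

theorem after_cons_count (b : Vertex d × ℕ) (h : List (Vertex d × ℕ)) :
    (after (b :: h)).count = Function.update (after h).count (after h).head.2.2
      ((after h).count (after h).head.2.2 + 1) := by
  rw [after, next]
  split
  · next h0 => exact absurd h0 (queue_ne_nil h)
  · next p t hp => simp [head, hp]

theorem nil_mem_seen (h : List (Vertex d × ℕ)) : [] ∈ (after h).seen := by
  induction h with
  | nil => simp [after, start]
  | cons b h ih => rw [after_cons_seen]; exact Finset.mem_insert_of_mem ih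

end Exploration

open Exploration

/-- The answer read off from the numbers of sleepers `N` and the instructions `ξ`, when the
instruction used in a state is the one at the coordinate `coord`. -/
def answer {I : Type*} (coord : Exploration d → I) (x : (Vertex d → ℕ) × (I → Vertex d))
    (s : Exploration d) : Vertex d × ℕ :=
  (x.2 (coord s), if x.2 (coord s) ∈ s.seen then 0 else x.1 (x.2 (coord s)))

/-- The history of the exploration after `n` steps. -/
def history {I : Type*} (coord : Exploration d → I) (x : (Vertex d → ℕ) × (I → Vertex d)) :
    ℕ → List (Vertex d × ℕ)
  | 0 => []
  | n + 1 => answer coord x (after (history coord x n)) :: history coord x n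

@[simp] theorem length_history {I : Type*} (coord : Exploration d → I)
    (x : (Vertex d → ℕ) × (I → Vertex d)) (n : ℕ) : (history coord x n).length = n := by
  induction n with
  | zero => rfl
  | succ n ih => simp [history, ih]

/-- The probability of an answer in a given state. -/
noncomputable def answerProb (μ : ℝ≥0) (s : Exploration d) (b : Vertex d × ℕ) : ℝ≥0∞ :=
  step d s.head.2.2 {b.1} *
    (if b.1 ∈ s.seen then (if b.2 = 0 then 1 else 0) else poissonMeasure μ {b.2})

noncomputable def historyProb (μ : ℝ≥0) : List (Vertex d × ℕ) → ℝ≥0∞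
  | [] => 1
  | b :: h => historyProb μ h * answerProb μ (after h) b

/-- Along every history, every coordinate is read at most once. -/
def ReadsOnce {I : Type*} (coord : Exploration d → I) : Prop :=
  ∀ h l : List (Vertex d × ℕ), l ≠ [] → coord (after h) ≠ coord (after (l ++ h))

/-- A possible history prescribes the values of finitely many coordinates. They are pairwise
distinct: instructions by `ReadsOnce`, and numbers of sleepers because these are read at unseen
vertices only. Hence the probabilities multiply, and the product does not depend on the choice of
`coord`. The first alternative covers histories that report new frogs at a vertex seen before. -/
theorem history_event {I : Type*} (coord : Exploration d → I)
    (hco : ReadsOnce coord) (μ : ℝ≥0) [NeZero d] (p : I → Measure (Vertex d))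
    (hp : ∀ h, p (coord (after h)) = step d (after h).head.2.2)
    (h : List (Vertex d × ℕ)) :
    (historyProb μ h = 0 ∧ {x | history coord x h.length = h} = ∅) ∨
    ∃ (K : Finset I) (t : I → Vertex d) (L : Finset (Vertex d)) (n : Vertex d → ℕ),
      {x | history coord x h.length = h} =
        (Set.pi L fun v => {n v}) ×ˢ (Set.pi K fun i => {t i}) ∧
      (∏ v ∈ L, poissonMeasure μ {n v}) * ∏ i ∈ K, p i {t i} = historyProb μ h ∧
      (∀ i ∈ K, ∃ l h', l ≠ [] ∧ l ++ h' = h ∧ i = coord (after h')) ∧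
      L ⊆ (after h).seen := by
  classical
  induction h with
  | nil =>
    refine Or.inr ⟨∅, fun _ => [], ∅, fun _ => 0, ?_, by simp [historyProb], by simp, by simp⟩
    ext x; simp [history]
  | cons b h ih =>
    have hset : {x | history coord x (b :: h).length = b :: h} =
        {x | history coord x h.length = h} ∩ {x | answer coord x (after h) = b} := by
      ext x
      simp only [List.length_cons, history, List.cons.injEq, Set.mem_ofPred_eq, Set.mem_inter_iff]
      constructor
      · rintro ⟨h1, h2⟩; rw [h2] at h1; exact ⟨h2, h1⟩
      · rintro ⟨h1, h2⟩; rw [h1]; exact ⟨h2, rfl⟩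
    rw [hset]
    rcases ih with ⟨h0, h1⟩ | ⟨K, t, L, n, hE, hprod, hK, hL⟩
    · left; simp [historyProb, h0, h1]
    have hnot : coord (after h) ∉ K := by
      intro hmem
      obtain ⟨l, h', hl, rfl, he⟩ := hK _ hmem
      exact hco h' l hl he.symm
    have hK' : ∀ i ∈ insert (coord (after h)) K,
        ∃ l h', l ≠ [] ∧ l ++ h' = b :: h ∧ i = coord (after h') := by
      intro i hi
      rcases Finset.mem_insert.1 hi with rfl | hi
      · exact ⟨[b], h, by simp, by simp, rfl⟩
      · obtain ⟨l, h', hl, rfl, he⟩ := hK _ hi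
        exact ⟨b :: l, h', by simp, by simp, he⟩
    have hne : ∀ i ∈ K, i ≠ coord (after h) := fun i hi he => hnot (he ▸ hi)
    have hprodK : ∏ i ∈ K, p i {Function.update t (coord (after h)) b.1 i} = ∏ i ∈ K, p i {t i} :=
      Finset.prod_congr rfl fun i hi => by rw [Function.update_of_ne (hne i hi)]
    have hpi : ∀ ξ : I → Vertex d, ξ ∈ Set.pi (↑(insert (coord (after h)) K))
        (fun i => ({Function.update t (coord (after h)) b.1 i} : Set (Vertex d))) ↔
        ξ (coord (after h)) = b.1 ∧ ξ ∈ Set.pi K (fun i => {t i}) := by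
      intro ξ
      simp only [Finset.coe_insert, Set.mem_pi, Set.mem_insert_iff, forall_eq_or_imp,
        Function.update_self, Set.mem_singleton_iff]
      refine and_congr_right fun _ => forall₂_congr fun i hi => ?_
      rw [Function.update_of_ne (hne i hi)]
    by_cases hs : b.1 ∈ (after h).seen
    · by_cases hb : b.2 = 0
      · right
        refine ⟨insert (coord (after h)) K, Function.update t (coord (after h)) b.1, L, n, ?_, ?_,
          hK', ?_⟩
        · rw [hE]
          ext ⟨N, ξ⟩
          simp only [Set.mem_inter_iff, Set.mem_prod, hpi, Set.mem_ofPred_eq, answer]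
          constructor
          · rintro ⟨⟨h1, h2⟩, h3⟩
            exact ⟨h1, congrArg Prod.fst h3, h2⟩
          · rintro ⟨h1, h2, h3⟩
            refine ⟨⟨h1, h3⟩, Prod.ext h2 ?_⟩
            simp [h2, hs, hb]
        · rw [Finset.prod_insert hnot, hprodK, Function.update_self, historyProb, ← hprod,
            answerProb, if_pos hs, if_pos hb, hp]
          ring
        · rw [after_cons_seen]; exact hL.trans (Finset.subset_insert _ _)
      · left
        refine ⟨by simp [historyProb, answerProb, hs, hb], ?_⟩
        ext ⟨N, ξ⟩
        simp only [Set.mem_inter_iff, Set.mem_ofPred_eq, answer, Set.mem_empty_iff_false, iff_false]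
        rintro ⟨-, h3⟩
        have h1 := congrArg Prod.fst h3
        have h2 := congrArg Prod.snd h3
        simp only at h1 h2
        rw [h1, if_pos hs] at h2
        exact hb h2.symm
    · right
      have hbL : b.1 ∉ L := fun hm => hs (hL hm)
      have hneL : ∀ v ∈ L, v ≠ b.1 := fun v hv he => hbL (he ▸ hv)
      refine ⟨insert (coord (after h)) K, Function.update t (coord (after h)) b.1, insert b.1 L,
        Function.update n b.1 b.2, ?_, ?_, hK', ?_⟩
      · rw [hE]
        ext ⟨N, ξ⟩
        have hpiL : N ∈ Set.pi (↑(insert b.1 L))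
            (fun i => ({Function.update n b.1 b.2 i} : Set ℕ)) ↔
            N b.1 = b.2 ∧ N ∈ Set.pi L (fun i => {n i}) := by
          simp only [Finset.coe_insert, Set.mem_pi, Set.mem_insert_iff, forall_eq_or_imp,
            Function.update_self, Set.mem_singleton_iff]
          refine and_congr_right fun _ => forall₂_congr fun i hi => ?_
          rw [Function.update_of_ne (hneL i hi)]
        simp only [Set.mem_inter_iff, Set.mem_prod, hpi, Set.mem_ofPred_eq, answer, hpiL]
        constructor
        · rintro ⟨⟨h1, h2⟩, h3⟩
          have e1 := congrArg Prod.fst h3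
          have e2 := congrArg Prod.snd h3
          simp only at e1 e2
          rw [e1, if_neg hs] at e2
          exact ⟨⟨e2, h1⟩, e1, h2⟩
        · rintro ⟨⟨h1, h2⟩, h3, h4⟩
          refine ⟨⟨h2, h4⟩, Prod.ext h3 ?_⟩
          simp [h3, hs, h1]
      · rw [Finset.prod_insert hnot, Finset.prod_insert hbL, hprodK, Function.update_self,
          Function.update_self, historyProb, ← hprod, answerProb, if_neg hs, hp]
        have : ∏ v ∈ L, poissonMeasure μ {Function.update n b.1 b.2 v} =
            ∏ v ∈ L, poissonMeasure μ {n v} :=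
          Finset.prod_congr rfl fun i hi => by rw [Function.update_of_ne (hneL i hi)]
        rw [this]; ring
      · rw [after_cons_seen]; exact Finset.insert_subset_insert _ hL

/-- The law of the randomness `(N, ξ)` used by an exploration. -/
noncomputable def sampleLaw {I : Type*} (μ : ℝ≥0) (p : I → Measure (Vertex d)) :
    Measure ((Vertex d → ℕ) × (I → Vertex d)) :=
  (Measure.infinitePi fun _ : Vertex d => poissonMeasure μ).prod (Measure.infinitePi p)

instance {I : Type*} (μ : ℝ≥0) (p : I → Measure (Vertex d)) [∀ i, IsProbabilityMeasure (p i)] :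
    IsProbabilityMeasure (sampleLaw μ p) := by
  unfold sampleLaw; infer_instance

theorem sampleLaw_history {I : Type*} (coord : Exploration d → I)
    (hco : ReadsOnce coord) (μ : ℝ≥0) [NeZero d] (p : I → Measure (Vertex d))
    [∀ i, IsProbabilityMeasure (p i)]
    (hp : ∀ h, p (coord (after h)) = step d (after h).head.2.2) (h : List (Vertex d × ℕ)) :
    sampleLaw μ p {x | history coord x h.length = h} = historyProb μ h := by
  rcases history_event coord hco μ p hp h with ⟨h0, h1⟩ | ⟨K, t, L, n, hE, hprod, -, -⟩
  · rw [h1, h0, measure_empty]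
  · rw [hE, sampleLaw, Measure.prod_prod, Measure.infinitePi_pi _ (fun _ _ => measurableSet_singleton _),
      Measure.infinitePi_pi _ (fun _ _ => measurableSet_singleton _), hprod]

theorem measurable_history {I : Type*} [Countable I] (coord : Exploration d → I) (n : ℕ) :
    @Measurable _ (List (Vertex d × ℕ)) _ ⊤ fun x => history coord x n := by
  induction n with
  | zero => exact @measurable_const _ _ ⊤ _ _
  | succ n ih =>
    let : MeasurableSpace (List (Vertex d × ℕ)) := ⊤
    have : DiscreteMeasurableSpace (List (Vertex d × ℕ)) := ⟨fun _ => trivial⟩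
    have h1 : Measurable fun x : (Vertex d → ℕ) × (I → Vertex d) =>
        fun l : List (Vertex d × ℕ) => answer coord x (after l) := by
      refine measurable_pi_lambda _ fun l => ?_
      have h2 : Measurable fun x : (Vertex d → ℕ) × (I → Vertex d) => x.2 (coord (after l)) :=
        (measurable_pi_apply _).comp measurable_snd
      refine h2.prodMk ?_
      have h3 : Measurable fun q : (Vertex d → ℕ) × Vertex d =>
          if q.2 ∈ (after l).seen then 0 else q.1 q.2 :=
        measurable_from_prod_countable_left fun w => by
          by_cases hw : w ∈ (after l).seen
          · simp [hw]
          · simpa [hw] using measurable_pi_apply w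
      exact h3.comp (measurable_fst.prodMk h2)
    have h4 : Measurable fun q : (List (Vertex d × ℕ) → Vertex d × ℕ) × List (Vertex d × ℕ) =>
        q.1 q.2 :: q.2 :=
      measurable_from_prod_countable_left fun w =>
        (measurable_from_top (f := fun b : Vertex d × ℕ => b :: w)).comp
          ((measurable_pi_apply w).mono le_rfl (by
            intro s _; exact (Set.to_countable s).measurableSet))
    exact h4.comp (h1.prodMk ih)

/-! ### Comparison of the laws of histories -/

instance : MeasurableSpace (List (Vertex d × ℕ)) := ⊤

instance : DiscreteMeasurableSpace (List (Vertex d × ℕ)) := ⟨fun _ => trivial⟩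

theorem map_history_singleton {I : Type*} [Countable I] (coord : Exploration d → I)
    (hco : ReadsOnce coord) (μ : ℝ≥0) [NeZero d] (p : I → Measure (Vertex d))
    [∀ i, IsProbabilityMeasure (p i)]
    (hp : ∀ h, p (coord (after h)) = step d (after h).head.2.2) (n : ℕ)
    (h : List (Vertex d × ℕ)) :
    (sampleLaw μ p).map (fun x => history coord x n) {h} =
      if h.length = n then historyProb μ h else 0 := by
  rw [Measure.map_apply (measurable_history coord n) (measurableSet_singleton h)]
  split_ifs with hn
  · subst hn
    exact sampleLaw_history coord hco μ p hp h
  · convert measure_empty (μ := sampleLaw μ p)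
    ext x
    simp only [Set.mem_preimage, Set.mem_singleton_iff, Set.mem_empty_iff_false, iff_false]
    rintro rfl
    simp at hn

theorem history_drop {I : Type*} (coord : Exploration d → I)
    (x : (Vertex d → ℕ) × (I → Vertex d)) (k m : ℕ) :
    (history coord x (k + m)).drop m = history coord x k := by
  induction m with
  | zero => rfl
  | succ m ih => rw [← Nat.add_assoc, history, List.drop_succ_cons, ih]

/-- Earlier histories are tails of later ones, so an event about all times up to `n` is an event
about the history at time `n`. Two monotone limits express the probability by `historyProb` alone.
-/
theorem measure_frequently {I : Type*} [Countable I] (μ : ℝ≥0) [NeZero d]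
    (cI : Exploration d → I) (hI : ReadsOnce cI) (p : I → Measure (Vertex d))
    [∀ i, IsProbabilityMeasure (p i)]
    (hp : ∀ h, p (cI (after h)) = step d (after h).head.2.2)
    (T : Set (List (Vertex d × ℕ))) :
    sampleLaw μ p {x | ∃ᶠ n in atTop, history cI x n ∈ T} =
      ⨅ K : ℕ, ⨆ n : ℕ, ∑' h : {h : List (Vertex d × ℕ) |
        ∃ k, K ≤ k ∧ k ≤ n ∧ h.drop (n - k) ∈ T},
        if h.1.length = n then historyProb μ h.1 else 0 := by
  set S : ℕ → ℕ → Set (List (Vertex d × ℕ)) := fun K n =>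
    {h | ∃ k, K ≤ k ∧ k ≤ n ∧ h.drop (n - k) ∈ T} with hS
  have hmem : ∀ K n x, history cI x n ∈ S K n ↔ ∃ k, K ≤ k ∧ k ≤ n ∧ history cI x k ∈ T := by
    intro K n x
    refine exists_congr fun k => and_congr_right fun _ => and_congr_right fun hk => ?_
    obtain ⟨m, rfl⟩ := Nat.exists_eq_add_of_le hk
    rw [Nat.add_sub_cancel_left, history_drop]
  have hev : {x | ∃ᶠ n in atTop, history cI x n ∈ T} =
      ⋂ K : ℕ, ⋃ n : ℕ, {x | history cI x n ∈ S K n} := by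
    ext x
    simp only [Set.mem_ofPred_eq, Set.mem_iInter, Set.mem_iUnion, hmem, frequently_atTop]
    exact forall_congr' fun K => ⟨fun ⟨n, h1, h2⟩ => ⟨n, n, h1, le_rfl, h2⟩,
      fun ⟨n, k, h1, _, h2⟩ => ⟨k, h1, h2⟩⟩
  have hmeas : ∀ K n, MeasurableSet {x | history cI x n ∈ S K n} := fun K n =>
    measurable_history cI n (MeasurableSet.of_discrete (s := S K n))
  have hmono : ∀ K, Monotone fun n => {x | history cI x n ∈ S K n} := by
    intro K n n' hn x hx
    simp only [Set.mem_ofPred_eq, hmem] at hx ⊢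
    obtain ⟨k, h1, h2, h3⟩ := hx
    exact ⟨k, h1, h2.trans hn, h3⟩
  rw [hev, Antitone.measure_iInter]
  · refine iInf_congr fun K => ?_
    rw [(hmono K).measure_iUnion]
    refine iSup_congr fun n => ?_
    refine (tsum_measure_preimage_singleton (μ := sampleLaw μ p) (f := fun x => history cI x n)
      (S K n).to_countable fun h _ =>
        measurable_history cI n (measurableSet_singleton h)).symm.trans ?_
    refine tsum_congr fun h => ?_
    rw [← map_history_singleton cI hI μ p hp n h,
      Measure.map_apply (measurable_history cI n) (measurableSet_singleton _)]
  · intro K K' hK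
    refine Set.iUnion_mono fun n x hx => ?_
    simp only [Set.mem_ofPred_eq, hmem] at hx ⊢
    obtain ⟨k, h1, h2, h3⟩ := hx
    exact ⟨k, hK.trans h1, h2, h3⟩
  · exact fun K => (MeasurableSet.iUnion fun n => hmeas K n).nullMeasurableSet
  · exact ⟨0, measure_ne_top _ _⟩

/-- The transfer principle: `measure_frequently` evaluates both sides by an expression that mentions
neither coordinate system. -/
theorem measure_frequently_eq {I J : Type*} [Countable I] [Countable J] (μ : ℝ≥0) [NeZero d]
    (cI : Exploration d → I) (hI : ReadsOnce cI) (p : I → Measure (Vertex d))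
    [∀ i, IsProbabilityMeasure (p i)]
    (hp : ∀ h, p (cI (after h)) = step d (after h).head.2.2)
    (cJ : Exploration d → J) (hJ : ReadsOnce cJ) (q : J → Measure (Vertex d))
    [∀ i, IsProbabilityMeasure (q i)]
    (hq : ∀ h, q (cJ (after h)) = step d (after h).head.2.2)
    (T : Set (List (Vertex d × ℕ))) :
    sampleLaw μ p {x | ∃ᶠ n in atTop, history cI x n ∈ T} =
      sampleLaw μ q {x | ∃ᶠ n in atTop, history cJ x n ∈ T} := by
  rw [measure_frequently μ cI hI p hp, measure_frequently μ cJ hJ q hq]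

/-- The expectation of a function of the history after one more step. -/
theorem lintegral_history_succ {I : Type*} [Countable I] (coord : Exploration d → I)
    (hco : ReadsOnce coord) (μ : ℝ≥0) [NeZero d] (p : I → Measure (Vertex d))
    [∀ i, IsProbabilityMeasure (p i)]
    (hp : ∀ h, p (coord (after h)) = step d (after h).head.2.2) (n : ℕ)
    (F : List (Vertex d × ℕ) → ℝ≥0∞) :
    ∫⁻ x, F (history coord x (n + 1)) ∂(sampleLaw μ p) =
      ∫⁻ x, ∑' b, F (b :: history coord x n) * answerProb μ (after (history coord x n)) b
        ∂(sampleLaw μ p) := by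
  have hF : ∀ (G : List (Vertex d × ℕ) → ℝ≥0∞) (n : ℕ),
      ∫⁻ x, G (history coord x n) ∂(sampleLaw μ p) =
        ∑' h, G h * (if h.length = n then historyProb μ h else 0) := by
    intro G n
    rw [← lintegral_map (f := G) measurable_from_top (measurable_history coord n),
      lintegral_countable']
    exact tsum_congr fun h => by rw [map_history_singleton coord hco μ p hp]
  rw [hF F, hF fun h => ∑' b, F (b :: h) * answerProb μ (after h) b]
  -- The empty history does not contribute at time `n + 1`; every other history is an answer put in
  -- front of a shorter one.
  have hsplit : ∀ G : List (Vertex d × ℕ) → ℝ≥0∞, G [] = 0 →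
      ∑' h, G h = ∑' h, ∑' b, G (b :: h) := by
    intro G h0
    rw [← ENNReal.tsum_prod' (f := fun q : List (Vertex d × ℕ) × (Vertex d × ℕ) => G (q.2 :: q.1))]
    have hinj : Function.Injective fun q : List (Vertex d × ℕ) × (Vertex d × ℕ) => q.2 :: q.1 := by
      rintro ⟨h, b⟩ ⟨h', b'⟩ he
      simp only [List.cons.injEq] at he
      rw [he.1, he.2]
    refine (hinj.tsum_eq (f := G) ?_).symm
    intro h hh
    cases h with
    | nil => exact absurd h0 hh
    | cons b h => exact ⟨(h, b), rfl⟩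
  rw [hsplit _ (by simp)]
  refine tsum_congr fun h => ?_
  rw [← ENNReal.tsum_mul_right]
  refine tsum_congr fun b => ?_
  simp only [List.length_cons, add_left_inj, historyProb]
  split_ifs
  · ring
  · simp

/-! ### Instructions attached to the frogs -/

def frogCoord (s : Exploration d) : Frog d × (ℕ × Vertex d) := s.head

theorem label_home_mem_seen (h : List (Vertex d × ℕ)) :
    ∀ e ∈ (after h).queue, e.1.1 ∈ (after h).seen := by
  induction h with
  | nil => simp [after, start]
  | cons b h ih =>
    intro e he
    rw [after_cons_queue] at he
    rw [after_cons_seen]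
    rcases List.mem_append.1 he with he | he
    · exact Finset.mem_insert_of_mem (ih e (List.mem_of_mem_tail he))
    rcases List.mem_cons.1 he with rfl | he
    · exact Finset.mem_insert_of_mem (ih (after h).head (head_mem h))
    · split_ifs at he
      · simp at he
      · simp only [newFrogs, List.mem_map] at he
        obtain ⟨i, -, rfl⟩ := he
        exact Finset.mem_insert_self _ _

theorem nodup_labels (h : List (Vertex d × ℕ)) : ((after h).queue.map Prod.fst).Nodup := by
  induction h with
  | nil => simp [after, start]
  | cons b h ih =>
    have hq := queue_eq h
    rw [hq, List.map_cons, List.nodup_cons] at ih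
    rw [after_cons_queue, List.map_append, List.map_cons, List.nodup_append, List.nodup_cons]
    have hnew : ∀ e : Frog d,
        e ∈ List.map Prod.fst (if b.1 ∈ (after h).seen then [] else newFrogs b.1 b.2) →
        e.1 ∉ (after h).seen := by
      intro e he
      split_ifs at he with hs
      · simp at he
      · simp only [newFrogs, List.map_map, List.mem_map] at he
        obtain ⟨i, -, rfl⟩ := he
        exact hs
    refine ⟨ih.2, ⟨fun hm => hnew _ hm (label_home_mem_seen h (after h).head (head_mem h)), ?_⟩, ?_⟩
    · split_ifs
      · simp
      · rw [newFrogs, List.map_map]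
        exact List.nodup_range.map (fun i j hij => by simpa using hij)
    · rintro a ha c hc rfl
      rcases List.mem_cons.1 hc with rfl | hc
      · exact ih.1 ha
      · obtain ⟨e, he, rfl⟩ := List.mem_map.1 ha
        exact hnew _ hc (label_home_mem_seen h _ (List.mem_of_mem_tail he))

theorem entry_unique {h : List (Vertex d × ℕ)} {e e' : Entry d} (he : e ∈ (after h).queue)
    (he' : e' ∈ (after h).queue) (hl : e.1 = e'.1) : e = e' :=
  List.inj_on_of_nodup_map (nodup_labels h) he he' hl

theorem head_succ_mem (b : Vertex d × ℕ) (h : List (Vertex d × ℕ)) :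
    ((after h).head.1, (after h).head.2.1 + 1, b.1) ∈ (after (b :: h)).queue := by
  rw [after_cons_queue]; simp

theorem exists_later_entry {h : List (Vertex d × ℕ)} {e : Entry d} (he : e ∈ (after h).queue)
    (l : List (Vertex d × ℕ)) :
    ∃ e' ∈ (after (l ++ h)).queue, e'.1 = e.1 ∧ e.2.1 ≤ e'.2.1 := by
  induction l with
  | nil => exact ⟨e, he, rfl, le_rfl⟩
  | cons b l ih =>
    obtain ⟨e', he', h1, h2⟩ := ih
    rw [queue_eq] at he'
    rcases List.mem_cons.1 he' with rfl | he'
    · exact ⟨_, head_succ_mem b (l ++ h), h1, h2.trans (Nat.le_succ _)⟩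
    · refine ⟨e', ?_, h1, h2⟩
      rw [List.cons_append, after_cons_queue]
      exact List.mem_append_left _ he'

/-- Labels in the queue are distinct, and the step number of a label never decreases and grows by
one when it is served. So no step of a frog is carried out twice. -/
theorem head_ne_of_later (h l : List (Vertex d × ℕ)) (hl : l ≠ []) :
    ((after (l ++ h)).head.1, (after (l ++ h)).head.2.1) ≠
      ((after h).head.1, (after h).head.2.1) := by
  intro he
  rw [Prod.mk.injEq] at he
  obtain ⟨l', b, rfl⟩ := (List.eq_nil_or_concat l).resolve_left hl
  obtain ⟨e', h1, h2, h3⟩ := exists_later_entry (head_succ_mem b h) l'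
  rw [List.concat_eq_append, List.append_assoc, List.singleton_append] at he
  have := entry_unique h1 (head_mem _) (h2.trans he.1.symm)
  rw [this, he.2] at h3
  simp at h3

theorem readsOnce_frogCoord : ReadsOnce (frogCoord (d := d)) := by
  intro h l hl he
  refine head_ne_of_later h l hl ?_
  simp only [frogCoord] at he
  rw [he]

/-! ### Instructions attached to the vertices -/

def stackCoord (s : Exploration d) : Vertex d × ℕ := (s.head.2.2, s.count s.head.2.2)

theorem count_mono (h l : List (Vertex d × ℕ)) (v : Vertex d) :
    (after h).count v ≤ (after (l ++ h)).count v := by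
  induction l with
  | nil => exact le_rfl
  | cons b l ih =>
    refine ih.trans ?_
    rw [List.cons_append, after_cons_count]
    by_cases hv : v = (after (l ++ h)).head.2.2
    · subst hv; simp
    · rw [Function.update_of_ne hv]

/-- Reading an instruction at a vertex increases the number of departures there, which never
decreases afterwards. -/
theorem readsOnce_stackCoord : ReadsOnce (stackCoord (d := d)) := by
  intro h l hl he
  obtain ⟨l', b, rfl⟩ := (List.eq_nil_or_concat l).resolve_left hl
  simp only [stackCoord, Prod.mk.injEq] at he
  rw [← he.1] at he
  have h1 := count_mono (b :: h) l' (after h).head.2.2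
  rw [after_cons_count, Function.update_self] at h1
  rw [List.concat_eq_append, List.append_assoc, List.singleton_append] at he
  omega

/-! ### The time evolution of the frog model -/

theorem state_succ_of_some {ω : Sample d} {n m : ℕ} {f : Frog d} (h : state ω n f = some m) :
    state ω (n + 1) f = some (m + 1) := by
  simp [state, h]

theorem state_add_of_some {ω : Sample d} {n m : ℕ} {f : Frog d} (h : state ω n f = some m)
    (k : ℕ) : state ω (n + k) f = some (m + k) := by
  induction k with
  | zero => exact h
  | succ k ih => exact state_succ_of_some ih

theorem state_time_unique {ω : Sample d} {n n' m : ℕ} {f : Frog d} (h : state ω n f = some m)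
    (h' : state ω n' f = some m) : n = n' := by
  rcases le_total n n' with hn | hn
  · obtain ⟨k, rfl⟩ := Nat.exists_eq_add_of_le hn
    rw [state_add_of_some h k, Option.some_inj] at h'
    omega
  · obtain ⟨k, rfl⟩ := Nat.exists_eq_add_of_le hn
    rw [state_add_of_some h' k, Option.some_inj] at h
    omega

def Active (ω : Sample d) (f : Frog d) : Prop := ∃ n, state ω n f = some 0

theorem active_of_state {ω : Sample d} {n m : ℕ} {f : Frog d} (h : state ω n f = some m) :
    Active ω f := by
  induction n generalizing m with
  | zero =>
    refine ⟨0, ?_⟩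
    simp only [state] at h ⊢
    split_ifs at h ⊢
    rfl
  | succ n ih =>
    cases h0 : state ω n f with
    | some m' => exact ih h0
    | none =>
      refine ⟨n + 1, ?_⟩
      simp only [state, h0] at h ⊢
      split_ifs at h ⊢
      rfl

theorem Active.exists_state {ω : Sample d} {f : Frog d} (h : Active ω f) (m : ℕ) :
    ∃ n, state ω n f = some m := by
  obtain ⟨n, hn⟩ := h
  exact ⟨n + m, by simpa using state_add_of_some hn m⟩

theorem active_root (ω : Sample d) : Active ω ([], 0) := ⟨0, by simp [state]⟩

theorem Active.wake {ω : Sample d} {f g : Frog d} (hg : Active ω g) (hf : IsSleeper ω f) {m : ℕ}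
    (hm : ω.2 g (m + 1) = f.1) : Active ω f := by
  obtain ⟨n, hn⟩ := hg.exists_state m
  cases h0 : state ω n f with
  | some m' => exact active_of_state h0
  | none =>
    refine ⟨n + 1, ?_⟩
    have : IsSleeper ω f ∧ ∃ g m, state ω n g = some m ∧ ω.2 g (m + 1) = f.1 :=
      ⟨hf, g, m, hn, hm⟩
    simp only [state, h0]
    rw [if_pos this]

/-- Induction over the frogs that ever wake up. -/
theorem Active.induction {ω : Sample d} {P : Frog d → Prop} (h0 : P ([], 0))
    (h1 : ∀ f g m, P g → IsSleeper ω f → ω.2 g (m + 1) = f.1 → P f) {f : Frog d}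
    (hf : Active ω f) : P f := by
  obtain ⟨n, hn⟩ := hf
  have key : ∀ n f m, state ω n f = some m → P f := by
    intro n
    induction n with
    | zero =>
      intro f m h
      simp only [state] at h
      split_ifs at h with hf
      exact hf ▸ h0
    | succ n ih =>
      intro f m h
      cases h2 : state ω n f with
      | some m' => exact ih f m' h2
      | none =>
        simp only [state, h2] at h
        split_ifs at h with hf
        obtain ⟨hs, g, k, hg, hk⟩ := hf
        exact h1 f g k (ih g k hg) hs hk
  exact key n f 0 hn

theorem finite_awake (ω : Sample d) (n : ℕ) : {f | ∃ m, state ω n f = some m}.Finite := by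
  induction n with
  | zero =>
    refine (Set.finite_singleton (([], 0) : Frog d)).subset ?_
    rintro f ⟨m, h⟩
    simp only [state] at h
    split_ifs at h with hf
    exact hf
  | succ n ih =>
    have hV : {v : Vertex d | ∃ g m, state ω n g = some m ∧ ω.2 g (m + 1) = v}.Finite := by
      refine (ih.image fun g => ω.2 g ((state ω n g).getD 0 + 1)).subset ?_
      rintro v ⟨g, m, h1, rfl⟩
      exact ⟨g, ⟨m, h1⟩, by simp [h1]⟩
    refine (ih.union (hV.biUnion fun v _ =>
      (Set.finite_Iio (ω.1 v)).image fun i => ((v, i) : Frog d))).subset ?_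
    rintro f ⟨m, h⟩
    cases h2 : state ω n f with
    | some m' => exact Or.inl ⟨m', h2⟩
    | none =>
      right
      simp only [state, h2] at h
      split_ifs at h with hf
      obtain ⟨hs, hg⟩ := hf
      simp only [Set.mem_iUnion]
      exact ⟨f.1, hg, f.2, hs.2, rfl⟩

/-- Each pair of a frog and a step number occurs at no more than one time, and finitely many frogs
are awake at any time. Infinitely many visit times are therefore the same as infinitely many
visiting pairs. This is where real time disappears. -/
theorem recurrent_iff_infinite (ω : Sample d) :
    Recurrent ω ↔ {q : Frog d × ℕ | Active ω q.1 ∧ ω.2 q.1 q.2 = []}.Infinite := by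
  unfold Recurrent
  rw [Nat.frequently_atTop_iff_infinite]
  constructor
  · intro h hfin
    have : ∀ n ∈ {n | VisitedAt ω [] n}, ∃ q : Frog d × ℕ,
        state ω n q.1 = some q.2 ∧ ω.2 q.1 q.2 = [] := fun n ⟨f, m, h1, h2⟩ => ⟨(f, m), h1, h2⟩
    choose! F hF using this
    refine h (Set.Finite.of_finite_image (f := F) (hfin.subset ?_) ?_)
    · rintro _ ⟨n, hn, rfl⟩
      exact ⟨active_of_state (hF n hn).1, (hF n hn).2⟩
    · intro n hn n' hn' he
      have h1 := (hF n hn).1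
      rw [he] at h1
      exact state_time_unique h1 (hF n' hn').1
  · intro h hfin
    refine h ((hfin.biUnion fun n _ => (finite_awake ω n).image fun f =>
      (f, (state ω n f).getD 0)).subset ?_)
    rintro ⟨f, m⟩ ⟨h1, h2⟩
    obtain ⟨n, hn⟩ := h1.exists_state m
    simp only [Set.mem_iUnion]
    exact ⟨n, ⟨f, m, hn, h2⟩, f, ⟨m, hn⟩, by simp [hn]⟩

theorem measurableSet_recurrent : MeasurableSet {ω : Sample d | Recurrent ω} := by
  have hw : ∀ (f : Frog d) (m : ℕ) (v : Vertex d), MeasurableSet {ω : Sample d | ω.2 f m = v} :=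
    fun f m v => measurableSet_eq_fun ((measurable_pi_apply m).comp
      ((measurable_pi_apply f).comp measurable_snd)) measurable_const
  have hs : ∀ n f m, MeasurableSet {ω : Sample d | state ω n f = some m} := by
    intro n
    induction n with
    | zero =>
      intro f m
      simp only [state]
      exact MeasurableSet.const _
    | succ n ih =>
      intro f m
      have hset : {ω : Sample d | state ω (n + 1) f = some m} =
          (⋃ k, {ω | state ω n f = some k} ∩ {ω | k + 1 = m}) ∪
          ((⋃ k, {ω | state ω n f = some k})ᶜ ∩ ({ω | 0 = m} ∩ ({ω | IsSleeper ω f} ∩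
            ⋃ g, ⋃ k, {ω | state ω n g = some k} ∩ {ω | ω.2 g (k + 1) = f.1}))) := by
        ext ω
        simp only [Set.mem_ofPred_eq, Set.mem_union, Set.mem_iUnion, Set.mem_inter_iff,
          Set.mem_compl_iff, not_exists]
        cases h2 : state ω n f with
        | some k => simp [state, h2]
        | none =>
          simp only [state, h2]
          split_ifs with hc
          · simp [hc]
          · simp only [false_and, exists_false, false_iff, false_or]
            rintro ⟨-, -, h⟩
            exact hc h
      rw [hset]
      refine (MeasurableSet.iUnion fun k => (ih f k).inter (MeasurableSet.const _)).union
        ((MeasurableSet.iUnion fun k => ih f k).compl.inter ((MeasurableSet.const _).inter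
          (MeasurableSet.inter ?_ (MeasurableSet.iUnion fun g => MeasurableSet.iUnion fun k =>
            (ih g k).inter (hw g (k + 1) f.1)))))
      have : {ω : Sample d | IsSleeper ω f} = {ω | f.1 ≠ []} ∩ {ω | f.2 < ω.1 f.1} := rfl
      rw [this]
      exact (MeasurableSet.const _).inter (measurableSet_lt measurable_const
        ((measurable_pi_apply f.1).comp measurable_fst))
  have : {ω : Sample d | Recurrent ω} = ⋂ N, ⋃ n, ⋃ (_ : N ≤ n), ⋃ f, ⋃ m,
      {ω | state ω n f = some m} ∩ {ω | ω.2 f m = []} := by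
    ext ω
    simp [Recurrent, frequently_atTop, VisitedAt]
  rw [this]
  exact MeasurableSet.iInter fun N => MeasurableSet.iUnion fun n => MeasurableSet.iUnion fun _ =>
    MeasurableSet.iUnion fun f => MeasurableSet.iUnion fun m => (hs n f m).inter (hw f m [])

/-! ### The exploration follows the frogs -/

/-- The sample of the frog model given by instructions attached to the frogs. -/
def frogSample (x : (Vertex d → ℕ) × (Frog d × (ℕ × Vertex d) → Vertex d)) : Sample d :=
  (x.1, fun f => path f.1 fun q => x.2 (f, q))

section

variable (x : (Vertex d → ℕ) × (Frog d × (ℕ × Vertex d) → Vertex d))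

theorem entry_position (n : ℕ) : ∀ e ∈ (after (history frogCoord x n)).queue,
    e.2.2 = (frogSample x).2 e.1 e.2.1 := by
  induction n with
  | zero => simp [history, after, start, frogSample, path]
  | succ n ih =>
    intro e he
    rw [history, after_cons_queue] at he
    rcases List.mem_append.1 he with he | he
    · exact ih e (List.mem_of_mem_tail he)
    rcases List.mem_cons.1 he with rfl | he
    · have := ih _ (head_mem _)
      simp only [answer, frogCoord, frogSample, path] at this ⊢
      rw [← this]
    · split_ifs at he
      · simp at he
      · simp only [newFrogs, List.mem_map] at he
        obtain ⟨i, -, rfl⟩ := he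
        rfl

theorem active_of_entry (n : ℕ) : ∀ e ∈ (after (history frogCoord x n)).queue,
    Active (frogSample x) e.1 := by
  induction n with
  | zero =>
    intro e he
    simp only [history, after, start, List.mem_singleton] at he
    subst he
    exact active_root _
  | succ n ih =>
    intro e he
    rw [history, after_cons_queue] at he
    rcases List.mem_append.1 he with he | he
    · exact ih e (List.mem_of_mem_tail he)
    rcases List.mem_cons.1 he with rfl | he
    · exact ih (after (history frogCoord x n)).head (head_mem _)
    · split_ifs at he with hs
      · simp at he
      · simp only [newFrogs, List.mem_map, List.mem_range] at he
        obtain ⟨i, hi, rfl⟩ := he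
        refine (ih _ (head_mem _)).wake (m := (after (history frogCoord x n)).head.2.1) ⟨?_, ?_⟩ ?_
        · intro h0
          simp only at h0
          rw [h0] at hs
          exact hs (nil_mem_seen _)
        · simp only [answer] at hi hs ⊢
          rw [if_neg hs] at hi
          exact hi
        · have := entry_position x n _ (head_mem _)
          simp only [answer, frogCoord, frogSample, path] at this ⊢
          rw [← this]

/-- An entry at position `i` of the queue is at the head after `i` steps. -/
theorem exists_head_eq (n i : ℕ) (e : Entry d)
    (h : (after (history frogCoord x n)).queue[i]? = some e) :
    (after (history frogCoord x (n + i))).head = e := by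
  induction i generalizing n with
  | zero =>
    rw [queue_eq] at h
    simpa using h
  | succ i ih =>
    rw [show n + (i + 1) = (n + 1) + i by ring]
    refine ih (n + 1) ?_
    rw [history, after_cons_queue]
    rw [queue_eq, List.getElem?_cons_succ] at h
    rw [List.getElem?_append_left (List.getElem?_eq_some_iff.1 h).1, h]

theorem exists_head_of_mem {n : ℕ} {e : Entry d}
    (h : e ∈ (after (history frogCoord x n)).queue) (k : ℕ) :
    ∃ n', (after (history frogCoord x n')).head.1 = e.1 ∧
      (after (history frogCoord x n')).head.2.1 = e.2.1 + k := by
  induction k with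
  | zero =>
    obtain ⟨i, hi⟩ := List.mem_iff_getElem?.1 h
    have := exists_head_eq x n i e hi
    exact ⟨n + i, by rw [this], by rw [this]; rfl⟩
  | succ k ih =>
    obtain ⟨n', h1, h2⟩ := ih
    have := head_succ_mem (answer frogCoord x (after (history frogCoord x n')))
      (history frogCoord x n')
    obtain ⟨i, hi⟩ := List.mem_iff_getElem?.1 this
    have := exists_head_eq x (n' + 1) i _ hi
    refine ⟨n' + 1 + i, ?_, ?_⟩
    · rw [this]; exact h1
    · rw [this, h2]; rfl

theorem exists_entry_of_seen (n : ℕ) : ∀ v ∈ (after (history frogCoord x n)).seen, v ≠ [] →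
    ∀ i < x.1 v, ∃ n', ∃ e ∈ (after (history frogCoord x n')).queue, e.1 = (v, i) ∧ e.2.1 = 0 := by
  induction n with
  | zero =>
    intro v hv h0
    simp only [history, after, start, Finset.mem_singleton] at hv
    exact absurd hv h0
  | succ n ih =>
    intro v hv h0 i hi
    by_cases hs : v ∈ (after (history frogCoord x n)).seen
    · exact ih v hs h0 i hi
    rw [history, after_cons_seen] at hv
    have hv := (Finset.mem_insert.1 hv).resolve_right hs
    refine ⟨n + 1, ((v, i), 0, v), ?_, rfl, rfl⟩
    rw [history, after_cons_queue]
    refine List.mem_append_right _ (List.mem_cons_of_mem _ ?_)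
    rw [← hv, if_neg hs]
    refine List.mem_map.2 ⟨i, ?_, rfl⟩
    simp only [answer] at hv ⊢
    rw [← hv, if_neg hs, List.mem_range]
    exact hi

theorem exists_entry_of_active {f : Frog d} (hf : Active (frogSample x) f) :
    ∃ n, ∃ e ∈ (after (history frogCoord x n)).queue, e.1 = f ∧ e.2.1 = 0 := by
  refine Active.induction (P := fun f => ∃ n, ∃ e ∈ (after (history frogCoord x n)).queue,
    e.1 = f ∧ e.2.1 = 0) ⟨0, (([], 0), 0, []), by simp [history, after, start], rfl, rfl⟩ ?_ hf
  rintro f g m ⟨n, e, he, rfl, h0⟩ ⟨hs1, hs2⟩ hm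
  obtain ⟨n', h1, h2⟩ := exists_head_of_mem x he m
  rw [h0, zero_add] at h2
  refine exists_entry_of_seen x (n' + 1) f.1 ?_ hs1 f.2 hs2
  rw [history, after_cons_seen]
  have := entry_position x n' _ (head_mem _)
  refine Finset.mem_insert.2 (Or.inl ?_)
  rw [← hm]
  simp only [answer, frogCoord, frogSample, path] at this ⊢
  rw [← h1, ← h2, ← this]

/-- The heads of the queue enumerate, without repetition, all pairs of an awake frog and a step: no
pair is served twice, and fairness of the queue brings up every pair. -/
theorem recurrent_frogSample_iff :
    Recurrent (frogSample x) ↔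
      ∃ᶠ n in atTop, history frogCoord x n ∈ {h | (after h).head.2.2 = []} := by
  rw [recurrent_iff_infinite, Nat.frequently_atTop_iff_infinite]
  set F : ℕ → Frog d × ℕ := fun n =>
    ((after (history frogCoord x n)).head.1, (after (history frogCoord x n)).head.2.1) with hF
  have hinj : Function.Injective F := by
    have hlt : ∀ n k, F n ≠ F (n + (k + 1)) := by
      intro n k he
      have h1 := history_drop frogCoord x n (k + 1)
      have h2 := List.take_append_drop (k + 1) (history frogCoord x (n + (k + 1)))
      rw [h1] at h2
      refine head_ne_of_later (history frogCoord x n)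
        ((history frogCoord x (n + (k + 1))).take (k + 1)) ?_ ?_
      · intro h0
        have := congrArg List.length h0
        simp at this
      · rw [h2]; exact he.symm
    intro n n' he
    rcases lt_trichotomy n n' with h | h | h
    · obtain ⟨k, rfl⟩ := Nat.exists_eq_add_of_lt h
      exact absurd he (hlt n k)
    · exact h
    · obtain ⟨k, rfl⟩ := Nat.exists_eq_add_of_lt h
      exact absurd he.symm (hlt n' k)
  have himg : {q : Frog d × ℕ | Active (frogSample x) q.1 ∧ (frogSample x).2 q.1 q.2 = []} =
      F '' {n | history frogCoord x n ∈ {h | (after h).head.2.2 = []}} := by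
    ext ⟨f, m⟩
    simp only [Set.mem_ofPred_eq, Set.mem_image, hF, Prod.mk.injEq]
    constructor
    · rintro ⟨h1, h2⟩
      obtain ⟨n, e, he, rfl, h0⟩ := exists_entry_of_active x h1
      obtain ⟨n', h3, h4⟩ := exists_head_of_mem x he m
      rw [h0, zero_add] at h4
      refine ⟨n', ?_, h3, h4⟩
      rw [entry_position x n' _ (head_mem _), h3, h4, h2]
    · rintro ⟨n, h1, rfl, rfl⟩
      exact ⟨active_of_entry x n _ (head_mem _),
        by rw [← entry_position x n _ (head_mem _), h1]⟩
  rw [himg, Set.infinite_image_iff hinj.injOn]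

end

/-! ### Transfer to instructions attached to the vertices -/

/-- `walkLaw` is built from independent instructions at times and vertices; currying over the frogs
turns the family of all instructions into independent walks. -/
theorem law_eq_map [NeZero d] (μ : ℝ≥0) :
    law d μ = (sampleLaw μ fun i : Frog d × (ℕ × Vertex d) => step d i.2.2).map frogSample := by
  have h1 : (Measure.infinitePi fun i : Frog d × (ℕ × Vertex d) => step d i.2.2).map
      (fun ξ (f : Frog d) (q : ℕ × Vertex d) => ξ (f, q)) =
      Measure.infinitePi fun _ : Frog d => Measure.infinitePi fun q : ℕ × Vertex d =>
        step d q.2 := by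
    have := Measure.infinitePi_map_curry (fun (_ : Frog d) (q : ℕ × Vertex d) => step d q.2)
    exact this
  have h2 : (Measure.infinitePi fun i : Frog d × (ℕ × Vertex d) => step d i.2.2).map
      (fun ξ (f : Frog d) => path f.1 fun q => ξ (f, q)) =
      Measure.infinitePi fun f : Frog d => walkLaw d f.1 := by
    have := Measure.infinitePi_map_pi (μ := fun _ : Frog d => Measure.infinitePi
      fun q : ℕ × Vertex d => step d q.2) (f := fun f => path f.1) (fun f => measurable_path f.1)
    rw [← h1, Measure.map_map] at this
    · exact this
    · exact measurable_pi_lambda _ fun f => (measurable_path f.1).comp (measurable_pi_apply f)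
    · fun_prop
  unfold law sampleLaw
  rw [← h2]
  have h3 := Measure.map_prod_map (Measure.infinitePi fun _ : Vertex d => poissonMeasure μ)
    (Measure.infinitePi fun i : Frog d × (ℕ × Vertex d) => step d i.2.2) measurable_id
    (g := fun ξ (f : Frog d) => path f.1 fun q => ξ (f, q)) (by
      refine measurable_pi_lambda _ fun f => (measurable_path f.1).comp ?_
      fun_prop)
  rw [Measure.map_id] at h3
  rw [h3]
  rfl

theorem measurable_frogSample : Measurable (frogSample (d := d)) := by
  refine measurable_fst.prodMk (measurable_pi_lambda _ fun f => (measurable_path f.1).comp ?_)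
  fun_prop

/-- From here on the instructions belong to the vertices: the `k`-th departure from `v` uses the
`k`-th instruction there, whichever frog departs. -/
theorem law_recurrent_eq [NeZero d] (μ : ℝ≥0) :
    law d μ {ω | Recurrent ω} = sampleLaw μ (fun i : Vertex d × ℕ => step d i.1)
      {x | ∃ᶠ n in atTop, history stackCoord x n ∈ {h | (after h).head.2.2 = []}} := by
  rw [law_eq_map, Measure.map_apply measurable_frogSample measurableSet_recurrent,
    ← measure_frequently_eq μ frogCoord readsOnce_frogCoord (fun i => step d i.2.2)
      (fun _ => rfl) stackCoord readsOnce_stackCoord _ (fun _ => rfl)]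
  congr 1
  ext x
  exact recurrent_frogSample_iff x

/-! ### Environments and stable configurations -/

instance : MeasurableSpace (Option (Fin d)) := ⊤

instance : DiscreteMeasurableSpace (Option (Fin d)) := ⟨fun _ => trivial⟩

/-- The number of sleepers at a site and its stack of instructions: `none` sends a frog to the
parent, `some i` to the `i`-th child. -/
abbrev Site (d : ℕ) : Type := ℕ × (ℕ → Option (Fin d))

abbrev Env (d : ℕ) : Type := Vertex d → Site d

def instrCount (s : ℕ → Option (Fin d)) (o : Option (Fin d)) (n : ℕ) : ℕ :=
  Nat.count (fun k => s k = o) n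

theorem instrCount_zero (s : ℕ → Option (Fin d)) (o : Option (Fin d)) : instrCount s o 0 = 0 :=
  Nat.count_zero _

theorem instrCount_mono (s : ℕ → Option (Fin d)) (o : Option (Fin d)) :
    Monotone (instrCount s o) := Nat.count_monotone _

theorem instrCount_succ (s : ℕ → Option (Fin d)) (o : Option (Fin d)) (n : ℕ) :
    instrCount s o (n + 1) = instrCount s o n + if s n = o then 1 else 0 := Nat.count_succ _ _

/-- The number of frogs that enter `v` from above when `m` frogs enter the top and `c w` frogs
have left every vertex `w`. -/
def fromAbove (e : Env d) (m : ℕ) (c : Vertex d → ℕ) : Vertex d → ℕ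
  | [] => m
  | i :: w => instrCount (e w).2 (some i) (c w)

def fromBelow (e : Env d) (c : Vertex d → ℕ) (v : Vertex d) : ℕ :=
  ∑ i : Fin d, instrCount (e (i :: v)).2 none (c (i :: v))

/-- The number of frogs ever present at `v`. -/
def inflow (e : Env d) (m : ℕ) (c : Vertex d → ℕ) (v : Vertex d) : ℕ :=
  fromAbove e m c v + (if fromAbove e m c v = 0 then 0 else (e v).1) + fromBelow e c v

/-- A supersolution: `u` allows at least as many departures from each vertex as there are frogs ever
present there. The sleepers at `v` enter `inflow` only if some frog comes from above, because the
first visit to a vertex below the top always comes from its parent. -/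
def Stable (e : Env d) (m : ℕ) (u : Vertex d → ℕ) : Prop := ∀ v, inflow e m u v ≤ u v

theorem fromAbove_mono (e : Env d) {m m' : ℕ} (hm : m ≤ m') {c c' : Vertex d → ℕ} (h : c ≤ c')
    (v : Vertex d) : fromAbove e m c v ≤ fromAbove e m' c' v := by
  cases v with
  | nil => exact hm
  | cons i w => exact instrCount_mono _ _ (h w)

/-- Monotonicity in the numbers of departures is the source of the Abelian property and of all later
comparisons. -/
theorem inflow_mono (e : Env d) {m m' : ℕ} (hm : m ≤ m') {c c' : Vertex d → ℕ} (h : c ≤ c')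
    (v : Vertex d) : inflow e m c v ≤ inflow e m' c' v := by
  have h1 := fromAbove_mono e hm h v
  refine Nat.add_le_add (Nat.add_le_add h1 ?_)
    (Finset.sum_le_sum fun i _ => instrCount_mono _ _ (h _))
  split_ifs with h2 h3 <;> omega

/-! ### The exploration with stacks -/

/-- At the root `none` would leave the frog in place; `RootSite` excludes this instruction. -/
def move (v : Vertex d) : Option (Fin d) → Vertex d
  | none => v.tail
  | some i => i :: v

/-- The numbers and instructions of an environment, as read by the exploration. -/
def Env.sample (e : Env d) : (Vertex d → ℕ) × (Vertex d × ℕ → Vertex d) :=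
  (fun v => (e v).1, fun p => move p.1 ((e p.1).2 p.2))

/-- The root has no sleepers and no parent. -/
def RootSite (e : Env d) : Prop := (e []).1 = 0 ∧ ∀ k, (e []).2 k ≠ none

section

variable (e : Env d)

def stateAt (n : ℕ) : Exploration d := after (history stackCoord e.sample n)

theorem stateAt_head_mem (n : ℕ) : (stateAt e n).head ∈ (stateAt e n).queue := head_mem _

theorem stateAt_queue_eq (n : ℕ) :
    (stateAt e n).queue = (stateAt e n).head :: (stateAt e n).queue.tail := queue_eq _

theorem nil_mem_stateAt_seen (n : ℕ) : [] ∈ (stateAt e n).seen := nil_mem_seen _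

theorem stateAt_succ_count (n : ℕ) : (stateAt e (n + 1)).count =
    Function.update (stateAt e n).count (stateAt e n).head.2.2
      ((stateAt e n).count (stateAt e n).head.2.2 + 1) := by
  simp only [stateAt, history, after_cons_count]

def nextPos (n : ℕ) : Vertex d :=
  move (stateAt e n).head.2.2
    ((e (stateAt e n).head.2.2).2 ((stateAt e n).count (stateAt e n).head.2.2))

theorem stateAt_succ_seen (n : ℕ) :
    (stateAt e (n + 1)).seen = insert (nextPos e n) (stateAt e n).seen := by
  simp only [stateAt, history, after_cons_seen]; rfl

theorem stateAt_succ_queue (n : ℕ) : (stateAt e (n + 1)).queue = (stateAt e n).queue.tail ++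
      ((stateAt e n).head.1, (stateAt e n).head.2.1 + 1, nextPos e n) ::
        (if nextPos e n ∈ (stateAt e n).seen then [] else newFrogs (nextPos e n)
          (e (nextPos e n)).1) := by
  simp only [stateAt, history, after_cons_queue]
  have h1 : (answer stackCoord e.sample (after (history stackCoord e.sample n))).1 =
      nextPos e n := rfl
  have h2 : nextPos e n ∉ (after (history stackCoord e.sample n)).seen →
      (answer stackCoord e.sample (after (history stackCoord e.sample n))).2 =
      (e (nextPos e n)).1 := fun h => if_neg h
  rw [h1]
  change _ ++ _ :: (if nextPos e n ∈ (after (history stackCoord e.sample n)).seen then _ else _) =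
    _ ++ _ :: (if nextPos e n ∈ (after (history stackCoord e.sample n)).seen then _ else _)
  by_cases h : nextPos e n ∈ (after (history stackCoord e.sample n)).seen
  · rw [if_pos h, if_pos h]
  · rw [if_neg h, if_neg h, h2 h]

theorem stateAt_count_mono {n n' : ℕ} (h : n ≤ n') (v : Vertex d) :
    (stateAt e n).count v ≤ (stateAt e n').count v := by
  induction n', h using Nat.le_induction with
  | base => exact le_rfl
  | succ k _ ih =>
    refine ih.trans ?_
    rw [stateAt_succ_count]
    by_cases hv : v = (stateAt e k).head.2.2
    · rw [hv, Function.update_self]; omega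
    · rw [Function.update_of_ne hv]

theorem position_mem_seen (n : ℕ) : ∀ q ∈ (stateAt e n).queue, q.2.2 ∈ (stateAt e n).seen := by
  induction n with
  | zero => simp [stateAt, history, after, start]
  | succ n ih =>
    intro q hq
    rw [stateAt_succ_queue] at hq
    rw [stateAt_succ_seen]
    rcases List.mem_append.1 hq with hq | hq
    · exact Finset.mem_insert_of_mem (ih q (List.mem_of_mem_tail hq))
    rcases List.mem_cons.1 hq with rfl | hq
    · exact Finset.mem_insert_self _ _
    · split_ifs at hq
      · simp at hq
      · simp only [newFrogs, List.mem_map] at hq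
        obtain ⟨i, -, rfl⟩ := hq
        exact Finset.mem_insert_self _ _

theorem fromAbove_update (c : Vertex d → ℕ) (x : Vertex d) (i : Fin d) (w : Vertex d) :
    fromAbove e 1 (Function.update c x (c x + 1)) (i :: w) = fromAbove e 1 c (i :: w) +
        if move x ((e x).2 (c x)) = i :: w ∧ x = w then 1 else 0 := by
  simp only [fromAbove]
  by_cases hx : w = x
  · subst hx
    rw [Function.update_self, instrCount_succ]
    congr 1
    refine if_congr ?_ rfl rfl
    simp only [and_true]
    cases h : (e w).2 (c w) with
    | none =>
      simp only [move, reduceCtorEq, false_iff]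
      intro h2
      have := congrArg List.length h2
      simp at this
    | some j => simp [move]
  · rw [Function.update_of_ne hx, if_neg fun h => hx h.2.symm, add_zero]

theorem fromAbove_step (n : ℕ) (i : Fin d) (w : Vertex d) :
    fromAbove e 1 (stateAt e (n + 1)).count (i :: w) =
      fromAbove e 1 (stateAt e n).count (i :: w) +
        if nextPos e n = i :: w ∧ (stateAt e n).head.2.2 = w then 1 else 0 := by
  rw [stateAt_succ_count]
  exact fromAbove_update e _ _ i w

theorem fromBelow_update (c : Vertex d → ℕ) (x : Vertex d) (v : Vertex d) :
    fromBelow e (Function.update c x (c x + 1)) v = fromBelow e c v +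
        if move x ((e x).2 (c x)) = v ∧ ∃ i, x = i :: v then 1 else 0 := by
  simp only [fromBelow]
  by_cases hx : ∃ i, x = i :: v
  · obtain ⟨i, rfl⟩ := hx
    rw [← Finset.add_sum_erase _ _ (Finset.mem_univ i),
      ← Finset.add_sum_erase _ _ (Finset.mem_univ i), Function.update_self, instrCount_succ]
    have : ∀ j ∈ Finset.univ.erase i, instrCount (e (j :: v)).2 none
        (Function.update c (i :: v) (c (i :: v) + 1) (j :: v)) =
        instrCount (e (j :: v)).2 none (c (j :: v)) := by
      intro j hj
      rw [Function.update_of_ne]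
      intro h
      simp only [List.cons.injEq, and_true] at h
      exact Finset.ne_of_mem_erase hj h
    rw [Finset.sum_congr rfl this, add_right_comm]
    congr 1
    refine if_congr ?_ rfl rfl
    simp only [List.cons.injEq, and_true, exists_eq', and_true]
    cases h : (e (i :: v)).2 (c (i :: v)) with
    | none => simp [move]
    | some j =>
      simp only [move, reduceCtorEq, false_iff]
      intro h2
      have := congrArg List.length h2
      simp at this
      omega
  · rw [if_neg fun h => hx h.2, add_zero]
    refine Finset.sum_congr rfl fun j _ => ?_
    rw [Function.update_of_ne]
    exact fun h => hx ⟨j, h.symm⟩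

theorem fromBelow_step (n : ℕ) (v : Vertex d) :
    fromBelow e (stateAt e (n + 1)).count v = fromBelow e (stateAt e n).count v +
        if nextPos e n = v ∧ ∃ i, (stateAt e n).head.2.2 = i :: v then 1 else 0 := by
  rw [stateAt_succ_count]
  exact fromBelow_update e _ _ v

theorem nextPos_cases (h0 : RootSite e) (n : ℕ) :
    (∃ i, nextPos e n = i :: (stateAt e n).head.2.2) ∨
      ∃ i, (stateAt e n).head.2.2 = i :: nextPos e n := by
  simp only [nextPos]
  generalize (stateAt e n).head.2.2 = x
  cases h : (e x).2 ((stateAt e n).count x) with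
  | some i => exact Or.inl ⟨i, rfl⟩
  | none =>
    cases x with
    | nil => exact absurd h (h0.2 _)
    | cons i w => exact Or.inr ⟨i, rfl⟩

/-- The seen vertices are closed under passing to the parent. A vertex entered from a child has thus
been seen before, and a new vertex must be entered from its parent. -/
theorem mem_seen_iff (h0 : RootSite e) (n : ℕ) (i : Fin d) (w : Vertex d) :
    i :: w ∈ (stateAt e n).seen ↔ fromAbove e 1 (stateAt e n).count (i :: w) ≠ 0 := by
  have htail : ∀ n v, v ∈ (stateAt e n).seen → v.tail ∈ (stateAt e n).seen := by
    intro n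
    induction n with
    | zero =>
      intro v hv
      simp only [stateAt, history, after, start, Finset.mem_singleton] at hv ⊢
      rw [hv]; rfl
    | succ n ih =>
      intro v hv
      rw [stateAt_succ_seen] at hv ⊢
      rcases Finset.mem_insert.1 hv with rfl | hv
      · refine Finset.mem_insert_of_mem ?_
        have hx := position_mem_seen e n _ (stateAt_head_mem e _)
        rcases nextPos_cases e h0 n with ⟨i, hi⟩ | ⟨i, hi⟩
        · rw [hi]; exact hx
        · have h1 := ih _ (ih _ hx)
          rw [hi] at h1
          exact h1
      · exact Finset.mem_insert_of_mem (ih v hv)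
  induction n with
  | zero => simp [stateAt, history, after, start, fromAbove, instrCount_zero]
  | succ n ih =>
    rw [stateAt_succ_seen, fromAbove_step e, Finset.mem_insert]
    refine (or_congr_right ih).trans ?_
    constructor
    · rintro (h | h)
      · rcases nextPos_cases e h0 n with ⟨j, hj⟩ | ⟨j, hj⟩
        · rw [← h] at hj
          rw [if_pos ⟨h.symm, (List.cons.inj hj).2.symm⟩]
          omega
        · have hx := htail n _ (position_mem_seen e n _ (stateAt_head_mem e _))
          rw [hj, List.tail_cons, ← h] at hx
          have := ih.1 hx
          omega
      · omega
    · intro h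
      by_cases h1 : i :: w = nextPos e n
      · exact Or.inl h1
      · rw [if_neg fun h' => h1 h'.1.symm] at h
        exact Or.inr h

/-- Balance at `v`: a frog that has ever been there came from above, from below or woke up there,
and it has either left or is in the queue at `v`. Each step of the exploration changes both sides
equally. -/
theorem conservation (h0 : RootSite e) (n : ℕ) (v : Vertex d) :
    (stateAt e n).queue.countP (fun q => q.2.2 = v) + (stateAt e n).count v =
      inflow e 1 (stateAt e n).count v := by
  induction n with
  | zero =>
    simp only [stateAt, history, after, start, inflow, fromBelow, instrCount_zero]
    cases v with
    | nil => simp [fromAbove, h0.1]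
    | cons i w => simp [fromAbove, instrCount_zero]
  | succ n ih =>
    rw [stateAt_succ_queue]
    rw [stateAt_queue_eq] at ih
    simp only [List.countP_append, List.countP_cons, decide_eq_true_eq] at ih ⊢
    have hcount : (stateAt e (n + 1)).count v = (stateAt e n).count v +
        if (stateAt e n).head.2.2 = v then 1 else 0 := by
      rw [stateAt_succ_count]
      split_ifs with hv
      · rw [hv, Function.update_self]
      · rw [Function.update_of_ne (Ne.symm hv), add_zero]
    have hnew : List.countP (fun q : Entry d => decide (q.2.2 = v))
        (if nextPos e n ∈ (stateAt e n).seen then []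
          else newFrogs (nextPos e n) (e (nextPos e n)).1) =
        if nextPos e n = v ∧ v ∉ (stateAt e n).seen then (e v).1 else 0 := by
      by_cases hs : nextPos e n ∈ (stateAt e n).seen
      · rw [if_pos hs, if_neg (by rintro ⟨rfl, h⟩; exact h hs)]; rfl
      · rw [if_neg hs]
        by_cases hv : nextPos e n = v
        · subst hv
          rw [if_pos ⟨rfl, hs⟩, newFrogs, List.countP_map]
          rw [List.countP_eq_length.2 (by simp)]
          simp
        · rw [if_neg (fun h => hv h.1), newFrogs, List.countP_map]
          refine List.countP_eq_zero.2 ?_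
          simp [hv]
    have hin : inflow e 1 (stateAt e (n + 1)).count v = inflow e 1 (stateAt e n).count v +
        ((if nextPos e n = v then 1 else 0) +
          if nextPos e n = v ∧ v ∉ (stateAt e n).seen then (e v).1 else 0) := by
      unfold inflow
      rw [fromBelow_step e]
      cases v with
      | nil =>
        simp only [fromAbove, h0.1, nil_mem_stateAt_seen, not_true_eq_false, and_false, if_false]
        have : (nextPos e n = [] ∧ ∃ i, (stateAt e n).head.2.2 = [i]) ↔ nextPos e n = [] := by
          refine ⟨fun h => h.1, fun h => ⟨h, ?_⟩⟩
          rcases nextPos_cases e h0 n with ⟨i, hi⟩ | ⟨i, hi⟩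
          · rw [h] at hi; simp at hi
          · rw [h] at hi; exact ⟨i, hi⟩
        rw [if_congr this rfl rfl]
        omega
      | cons i w =>
        have h1 := mem_seen_iff e h0 n i w
        have h2 := mem_seen_iff e h0 (n + 1) i w
        rw [fromAbove_step e] at h2 ⊢
        rw [stateAt_succ_seen, Finset.mem_insert] at h2
        have h3 : (if nextPos e n = i :: w then 1 else 0) =
            (if nextPos e n = i :: w ∧ (stateAt e n).head.2.2 = w then 1 else 0) +
            (if nextPos e n = i :: w ∧ ∃ j, (stateAt e n).head.2.2 = j :: i :: w then 1 else 0) := by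
          by_cases hn : nextPos e n = i :: w
          · simp only [hn, true_and, if_true]
            rcases nextPos_cases e h0 n with ⟨j, hj⟩ | ⟨j, hj⟩
            · have hw : (stateAt e n).head.2.2 = w := by
                rw [hn] at hj; simp only [List.cons.injEq] at hj; exact hj.2.symm
              rw [if_pos hw, if_neg]
              rintro ⟨j', hj'⟩
              rw [hw] at hj'
              have := congrArg List.length hj'
              simp at this
              omega
            · rw [hn] at hj
              rw [if_neg, if_pos ⟨j, hj⟩]
              intro hw
              rw [hw] at hj
              have := congrArg List.length hj
              simp at this
              omega
          · simp [hn]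
        generalize fromAbove e 1 (stateAt e n).count (i :: w) = a at h1 h2 ⊢
        rw [h3]
        generalize (if nextPos e n = i :: w ∧ (stateAt e n).head.2.2 = w then 1 else 0) = p at h2 h3 ⊢
        generalize (if nextPos e n = i :: w ∧ ∃ j, (stateAt e n).head.2.2 = j :: i :: w then 1
          else 0) = r at h3 ⊢
        by_cases ha : a = 0
        · have h4 : i :: w ∉ (stateAt e n).seen := fun h => h1.1 h ha
          by_cases hn : nextPos e n = i :: w
          · have h5 : a + p ≠ 0 := h2.1 (Or.inl hn.symm)
            rw [if_neg h5, if_pos ha, if_pos ⟨hn, h4⟩]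
            omega
          · have h5 : a + p = 0 := by
              by_contra h6
              rcases h2.2 h6 with h | h
              · exact hn h.symm
              · exact h4 h
            rw [if_pos h5, if_pos ha, if_neg fun h => hn h.1]
            omega
        · have h4 : i :: w ∈ (stateAt e n).seen := h1.2 ha
          rw [if_neg (by omega : a + p ≠ 0), if_neg ha, if_neg fun h => h.2 h4]
          omega
    rw [hcount, hnew, hin, ← ih]
    omega

/-- Least action principle. To exceed `u` for the first time, a frog would have to leave `v` when
already `u v` frogs have left; but the inflow is at most `u v` then, and by `conservation` no frog
is left at `v`. -/
theorem count_le_of_stable (h0 : RootSite e) {u : Vertex d → ℕ} (hu : Stable e 1 u) (n : ℕ)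
    (v : Vertex d) : (stateAt e n).count v ≤ u v := by
  induction n generalizing v with
  | zero => simp [stateAt, history, after, start]
  | succ n ih =>
    rw [stateAt_succ_count]
    by_cases hv : v = (stateAt e n).head.2.2
    · rw [hv, Function.update_self]
      have h1 := conservation e h0 n (stateAt e n).head.2.2
      have h2 : 0 < (stateAt e n).queue.countP
          (fun q => q.2.2 = (stateAt e n).head.2.2) :=
        List.countP_pos_iff.2 ⟨_, stateAt_head_mem e _, by simp⟩
      have h3 := (inflow_mono e le_rfl ih (stateAt e n).head.2.2).trans (hu _)
      omega
    · rw [Function.update_of_ne hv]; exact ih v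

theorem stateAt_head_eq (n i : ℕ) (q : Entry d) (h : (stateAt e n).queue[i]? = some q) :
    (stateAt e (n + i)).head = q := by
  induction i generalizing n with
  | zero =>
    rw [stateAt_queue_eq] at h
    simpa using h
  | succ i ih =>
    rw [show n + (i + 1) = (n + 1) + i by ring]
    refine ih (n + 1) ?_
    rw [stateAt_succ_queue]
    rw [stateAt_queue_eq, List.getElem?_cons_succ] at h
    rw [List.getElem?_append_left (List.getElem?_eq_some_iff.1 h).1, h]

/-- A frog present at `v` is somewhere in the queue, reaches its head and departs. -/
theorem exists_count_lt_of_inflow (h0 : RootSite e) (n : ℕ) (v : Vertex d)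
    (h : (stateAt e n).count v < inflow e 1 (stateAt e n).count v) :
    ∃ n' ≥ n, (stateAt e n).count v < (stateAt e n').count v := by
  have h1 := conservation e h0 n v
  have h2 : 0 < (stateAt e n).queue.countP (fun q => q.2.2 = v) := by omega
  obtain ⟨q, hq, hv⟩ := List.countP_pos_iff.1 h2
  obtain ⟨i, hi⟩ := List.mem_iff_getElem?.1 hq
  have h3 := stateAt_head_eq e n i q hi
  refine ⟨n + i + 1, by omega, ?_⟩
  have h4 := stateAt_count_mono e (Nat.le_add_right n i) v
  rw [stateAt_succ_count, h3, of_decide_eq_true hv, Function.update_self]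
  omega

/-- The root is visited finitely often by the exploration if and only if there is a stable
configuration. -/
theorem exists_stable_iff (h0 : RootSite e)
    (hup : ∀ v ≠ [], ∀ a, ∃ n, a ≤ instrCount (e v).2 none n) :
    (∃ u, Stable e 1 u) ↔ ∃ B, ∀ n, (stateAt e n).count [] ≤ B := by
  constructor
  · rintro ⟨u, hu⟩
    exact ⟨u [], fun n => count_le_of_stable e h0 hu n []⟩
  rintro ⟨B, hB⟩
  -- If the departures from `v` are bounded, they stop at some time, and by fairness no frog is at
  -- `v` afterwards; so the inflow equals the number of departures.
  have hfin : ∀ v, (∃ b, ∀ n, (stateAt e n).count v ≤ b) →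
      ∃ n0, ∀ n ≥ n0, (stateAt e n).count v = (stateAt e n0).count v ∧
        inflow e 1 (stateAt e n).count v = (stateAt e n0).count v := by
    rintro v ⟨b, hb⟩
    have hbdd : BddAbove (Set.range fun n => (stateAt e n).count v) :=
      ⟨b, by rintro _ ⟨n, rfl⟩; exact hb n⟩
    obtain ⟨n0, hn0⟩ := Nat.sSup_mem (Set.range_nonempty _) hbdd
    have hmax : ∀ n, (stateAt e n).count v ≤ (stateAt e n0).count v := fun n => by
      simp only at hn0
      rw [hn0]
      exact le_csSup hbdd ⟨n, rfl⟩
    refine ⟨n0, fun n hn => ?_⟩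
    have h1 : (stateAt e n).count v = (stateAt e n0).count v :=
      le_antisymm (hmax n) (stateAt_count_mono e hn v)
    refine ⟨h1, ?_⟩
    have h2 := conservation e h0 n v
    by_contra h3
    obtain ⟨n', -, h4⟩ := exists_count_lt_of_inflow e h0 n v (by omega)
    have := hmax n'
    omega
  -- Boundedness passes from `w` to its child: unboundedly many departures from the child would use
  -- unboundedly many upward instructions (`hup`) and flood `w`.
  have hall : ∀ v, ∃ b, ∀ n, (stateAt e n).count v ≤ b := by
    intro v
    induction v with
    | nil => exact ⟨B, hB⟩
    | cons i w ih =>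
      obtain ⟨n0, hn0⟩ := hfin w ih
      by_contra hc
      push Not at hc
      obtain ⟨a, ha⟩ := hup (i :: w) (by simp) ((stateAt e n0).count w + 1)
      obtain ⟨n, hn⟩ := hc (max a ((stateAt e n0).count (i :: w)))
      have hle : n0 ≤ n := by
        by_contra h
        have := stateAt_count_mono e (not_le.1 h).le (i :: w)
        omega
      have h1 := (hn0 n hle).2
      have h2 : instrCount (e (i :: w)).2 none ((stateAt e n).count (i :: w)) ≤
          fromBelow e (stateAt e n).count w :=
        Finset.single_le_sum (f := fun j => instrCount (e (j :: w)).2 none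
          ((stateAt e n).count (j :: w))) (fun _ _ => Nat.zero_le _) (Finset.mem_univ i)
      have h3 := instrCount_mono (e (i :: w)).2 none ((le_max_left _ _).trans hn.le)
      unfold inflow at h1
      omega
  choose T hT using fun v => hfin v (hall v)
  -- The final numbers of departures are stable. The condition at `v` involves only `v`, its parent
  -- and its children, so that it can be checked at one late time `n`.
  refine ⟨fun v => (stateAt e (T v)).count v, fun v => ?_⟩
  obtain ⟨n, h1, h2, h3⟩ : ∃ n, T v ≤ n ∧ T v.tail ≤ n ∧ ∀ i, T (i :: v) ≤ n := by
    refine ⟨T v + T v.tail + ∑ i, T (i :: v), by omega, by omega, fun i => ?_⟩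
    have := Finset.single_le_sum (f := fun i => T (i :: v)) (fun _ _ => Nat.zero_le _)
      (Finset.mem_univ i)
    omega
  have h4 := (hT v n h1).2
  have h5 : inflow e 1 (fun v => (stateAt e (T v)).count v) v =
      inflow e 1 (stateAt e n).count v := by
    have hA : fromAbove e 1 (fun v => (stateAt e (T v)).count v) v =
        fromAbove e 1 (stateAt e n).count v := by
      cases v with
      | nil => rfl
      | cons i w => simp only [fromAbove]; rw [(hT w n h2).1]
    have hB : fromBelow e (fun v => (stateAt e (T v)).count v) v =
        fromBelow e (stateAt e n).count v :=
      Finset.sum_congr rfl fun i _ => by rw [(hT (i :: v) n (h3 i)).1]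
    unfold inflow
    rw [hA, hB]
  rw [h5, h4]

theorem frequently_root_iff :
    (∃ᶠ n in atTop, history stackCoord e.sample n ∈ {h | (after h).head.2.2 = []}) ↔
      ¬ ∃ B, ∀ n, (stateAt e n).count [] ≤ B := by
  constructor
  · rintro h ⟨B, hB⟩
    have : ∀ a, ∃ n, a ≤ (stateAt e n).count [] := by
      intro a
      induction a with
      | zero => exact ⟨0, Nat.zero_le _⟩
      | succ a ih =>
        obtain ⟨n, hn⟩ := ih
        obtain ⟨n', hn', h2⟩ := (frequently_atTop.1 h) n
        simp only [Set.mem_ofPred_eq] at h2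
        refine ⟨n' + 1, ?_⟩
        have h3 := stateAt_count_mono e hn' []
        rw [stateAt_succ_count]
        have h4 : (stateAt e n').head.2.2 = [] := h2
        rw [h4, Function.update_self]
        omega
    obtain ⟨n, hn⟩ := this (B + 1)
    have := hB n
    omega
  · intro h hc
    apply h
    obtain ⟨n0, hn0⟩ := eventually_atTop.1 hc
    refine ⟨(stateAt e n0).count [], fun n => ?_⟩
    rcases le_total n n0 with hn | hn
    · exact stateAt_count_mono e hn []
    · induction n, hn using Nat.le_induction with
      | base => exact le_rfl
      | succ k hk ih =>
        rw [stateAt_succ_count, Function.update_of_ne]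
        · exact ih
        · exact fun h2 => hn0 k hk h2.symm

end

/-! ### Products of infinite product measures -/

section Product

variable {ι κ : Type*} {X : ι → Type*} {Z : κ → Type*} [∀ i, MeasurableSpace (X i)]
  [∀ i, MeasurableSpace (Z i)]

theorem nonempty_spanning_squareCylinders (m : Measure (∀ i, X i)) [IsProbabilityMeasure m] :
    Nonempty (m.FiniteSpanningSetsIn
      (squareCylinders fun i => {s : Set (X i) | MeasurableSet s})) :=
  ⟨⟨fun _ => Set.univ, fun _ => ⟨∅, fun _ => Set.univ, fun i _ => MeasurableSet.univ,
    by simp⟩, fun _ => measure_lt_top _ _, Set.iUnion_const _⟩⟩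

theorem prod_infinitePi_eq (μ : ∀ i, Measure (X i)) (ν : ∀ i, Measure (Z i))
    [∀ i, IsProbabilityMeasure (μ i)] [∀ i, IsProbabilityMeasure (ν i)]
    {ρ : Measure ((∀ i, X i) × (∀ i, Z i))}
    (h : ∀ (s : Finset ι) (t : ∀ i, Set (X i)) (k : Finset κ) (r : ∀ i, Set (Z i)),
      (∀ i, MeasurableSet (t i)) → (∀ i, MeasurableSet (r i)) →
      ρ ((Set.pi s t) ×ˢ (Set.pi k r)) = (∏ i ∈ s, μ i (t i)) * ∏ i ∈ k, ν i (r i)) :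
    (Measure.infinitePi μ).prod (Measure.infinitePi ν) = ρ := by
  refine Measure.prod_eq_generateFrom generateFrom_squareCylinders generateFrom_squareCylinders
    (isPiSystem_squareCylinders (fun i => MeasurableSpace.isPiSystem_measurableSet)
      fun i => MeasurableSet.univ)
    (isPiSystem_squareCylinders (fun i => MeasurableSpace.isPiSystem_measurableSet)
      fun i => MeasurableSet.univ) (nonempty_spanning_squareCylinders _).some
    (nonempty_spanning_squareCylinders _).some ?_
  rintro _ ⟨s, t, ht, rfl⟩ _ ⟨k, r, hr, rfl⟩
  have ht' : ∀ i, MeasurableSet (t i) := fun i => ht i (Set.mem_univ i)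
  have hr' : ∀ i, MeasurableSet (r i) := fun i => hr i (Set.mem_univ i)
  rw [h s t k r ht' hr', Measure.infinitePi_pi _ fun i _ => ht' i,
    Measure.infinitePi_pi _ fun i _ => hr' i]

end Product

theorem infinitePi_map_unzip {ι Ω Ω' : Type*} [MeasurableSpace Ω] [MeasurableSpace Ω']
    (p : ι → Measure Ω) (q : ι → Measure Ω') [∀ i, IsProbabilityMeasure (p i)]
    [∀ i, IsProbabilityMeasure (q i)] :
    (Measure.infinitePi fun i => (p i).prod (q i)).map (fun x => (fun i => (x i).1, fun i => (x i).2)) =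
      (Measure.infinitePi p).prod (Measure.infinitePi q) := by
  classical
  symm
  refine prod_infinitePi_eq p q fun s t k r ht hr => ?_
  rw [Measure.map_apply (by fun_prop) ((MeasurableSet.pi s.countable_toSet fun i _ => ht i).prod
    (MeasurableSet.pi k.countable_toSet fun i _ => hr i))]
  have hset : (fun x : ι → Ω × Ω' => (fun i => (x i).1, fun i => (x i).2)) ⁻¹'
      ((Set.pi s t) ×ˢ (Set.pi k r)) = Set.pi (↑(s ∪ k)) fun i =>
        (if i ∈ s then t i else Set.univ) ×ˢ (if i ∈ k then r i else Set.univ) := by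
    ext x
    simp only [Set.mem_preimage, Set.mem_prod, Set.mem_pi, Finset.mem_coe, Finset.mem_union]
    constructor
    · rintro ⟨h1, h2⟩ i -
      constructor
      · split_ifs with h
        · exact h1 i h
        · trivial
      · split_ifs with h
        · exact h2 i h
        · trivial
    · intro h
      refine ⟨fun i hi => ?_, fun i hi => ?_⟩
      · have := (h i (Or.inl hi)).1
        rwa [if_pos hi] at this
      · have := (h i (Or.inr hi)).2
        rwa [if_pos hi] at this
  rw [hset, Measure.infinitePi_pi]
  · simp_rw [Measure.prod_prod, Finset.prod_mul_distrib]
    congr 1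
    · rw [← Finset.prod_subset (Finset.subset_union_left (s₁ := s) (s₂ := k))]
      · exact Finset.prod_congr rfl fun i hi => by rw [if_pos hi]
      · intro i _ hi
        rw [if_neg hi, measure_univ]
    · rw [← Finset.prod_subset (Finset.subset_union_right (s₁ := s) (s₂ := k))]
      · exact Finset.prod_congr rfl fun i hi => by rw [if_pos hi]
      · intro i _ hi
        rw [if_neg hi, measure_univ]
  · intro i _
    refine MeasurableSet.prod ?_ ?_
    · split_ifs
      exacts [ht i, MeasurableSet.univ]
    · split_ifs
      exacts [hr i, MeasurableSet.univ]

/-- Coordinates along two families of indices with disjoint ranges are independent. This is used for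
disjoint parts of the tree and for displaced finite sets of coordinates. -/
theorem infinitePi_map_split {ι α β Ω : Type*} [MeasurableSpace Ω]
    (p : ι → Measure Ω) [∀ i, IsProbabilityMeasure (p i)] {f : α → ι} {g : β → ι}
    (hf : Function.Injective f) (hg : Function.Injective g) (hfg : ∀ a b, f a ≠ g b) :
    (Measure.infinitePi p).map (fun x => (fun a => x (f a), fun b => x (g b))) =
      (Measure.infinitePi fun a => p (f a)).prod (Measure.infinitePi fun b => p (g b)) := by
  classical
  symm
  refine prod_infinitePi_eq _ _ fun s t k r ht hr => ?_
  rw [Measure.map_apply (by fun_prop) ((MeasurableSet.pi s.countable_toSet fun i _ => ht i).prod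
    (MeasurableSet.pi k.countable_toSet fun i _ => hr i))]
  set T : ι → Set Ω := Function.extend f t (Function.extend g r fun _ => Set.univ) with hT
  have hTf : ∀ a, T (f a) = t a := fun a => hf.extend_apply _ _ _
  have hTg : ∀ b, T (g b) = r b := fun b => by
    rw [hT, Function.extend_apply' _ _ _ (by rintro ⟨a, ha⟩; exact hfg a b ha), hg.extend_apply]
  have hset : (fun x : ι → Ω => (fun a => x (f a), fun b => x (g b))) ⁻¹'
      ((Set.pi s t) ×ˢ (Set.pi k r)) = Set.pi (↑(s.map ⟨f, hf⟩ ∪ k.map ⟨g, hg⟩)) T := by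
    ext x
    simp only [Set.mem_preimage, Set.mem_prod, Set.mem_pi, Finset.mem_coe, Finset.mem_union,
      Finset.mem_map, Function.Embedding.coeFn_mk]
    constructor
    · rintro ⟨h1, h2⟩ i (⟨a, ha, rfl⟩ | ⟨b, hb, rfl⟩)
      · rw [hTf]; exact h1 a ha
      · rw [hTg]; exact h2 b hb
    · intro h
      exact ⟨fun a ha => hTf a ▸ h (f a) (Or.inl ⟨a, ha, rfl⟩),
        fun b hb => hTg b ▸ h (g b) (Or.inr ⟨b, hb, rfl⟩)⟩
  have hdisj : Disjoint (s.map ⟨f, hf⟩) (k.map ⟨g, hg⟩) := by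
    rw [Finset.disjoint_left]
    simp only [Finset.mem_map, Function.Embedding.coeFn_mk]
    rintro _ ⟨a, -, rfl⟩ ⟨b, -, hb⟩
    exact hfg a b hb.symm
  rw [hset, Measure.infinitePi_pi]
  · rw [Finset.prod_union hdisj, Finset.prod_map, Finset.prod_map]
    simp only [Function.Embedding.coeFn_mk, hTf, hTg]
  · intro i hi
    rcases Finset.mem_union.1 hi with hi | hi
    · obtain ⟨a, -, rfl⟩ := Finset.mem_map.1 hi
      exact (hTf a).symm ▸ ht a
    · obtain ⟨b, -, rfl⟩ := Finset.mem_map.1 hi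
      exact (hTg b).symm ▸ hr b

/-! ### The number of frogs leaving a tree through its top -/

def sub (i : Fin d) (e : Env d) : Env d := fun v => e (v ++ [i])

/-- The number of frogs that leave through the top when `m` frogs enter there. -/
noncomputable def exits (e : Env d) (m : ℕ) : ℕ∞ :=
  ⨅ u : {u : Vertex d → ℕ // Stable e m u}, (instrCount (e []).2 none (u.1 []) : ℕ∞)

/-- The number of exits at a vertex with `N` sleepers and stack `s`, as a function of the
numbers of exits of the trees at its children. -/
noncomputable def node (N : ℕ) (s : ℕ → Option (Fin d)) (Y : Fin d → ℕ → ℕ∞) (m : ℕ) : ℕ∞ :=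
  ⨅ A : {A : ℕ // ((m + if m = 0 then 0 else N : ℕ) : ℕ∞) +
    ∑ i, Y i (instrCount s (some i) A) ≤ A}, (instrCount s none A.1 : ℕ∞)

theorem le_node_iff {N : ℕ} {s : ℕ → Option (Fin d)} {Y : Fin d → ℕ → ℕ∞} {m : ℕ} {k : ℕ∞} :
    k ≤ node N s Y m ↔ ∀ A : ℕ, ((m + if m = 0 then 0 else N : ℕ) : ℕ∞) +
      ∑ i, Y i (instrCount s (some i) A) ≤ A → k ≤ instrCount s none A := by
  simp only [node, le_iInf_iff, Subtype.forall]

theorem iInf_natCast_le {ι : Sort*} {f : ι → ℕ} {k : ℕ} (h : (⨅ i, (f i : ℕ∞)) ≤ k) :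
    ∃ i, f i ≤ k := by
  by_contra hc
  push Not at hc
  have : ((k + 1 : ℕ) : ℕ∞) ≤ ⨅ i, (f i : ℕ∞) := le_iInf fun i => by exact_mod_cast hc i
  have h2 := this.trans h
  norm_cast at h2
  omega

theorem node_le_iff {N : ℕ} {s : ℕ → Option (Fin d)} {Y : Fin d → ℕ → ℕ∞} {m k : ℕ} :
    node N s Y m ≤ k ↔ ∃ A : ℕ, ((m + if m = 0 then 0 else N : ℕ) : ℕ∞) +
      ∑ i, Y i (instrCount s (some i) A) ≤ A ∧ instrCount s none A ≤ k := by
  constructor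
  · intro h
    obtain ⟨A, hA⟩ := iInf_natCast_le h
    exact ⟨A.1, A.2, hA⟩
  · rintro ⟨A, h1, h2⟩
    exact (iInf_le _ ⟨A, h1⟩).trans (by exact_mod_cast h2)

theorem exits_le_iff {e : Env d} {m k : ℕ} :
    exits e m ≤ k ↔ ∃ u, Stable e m u ∧ instrCount (e []).2 none (u []) ≤ k := by
  constructor
  · intro h
    obtain ⟨A, hA⟩ := iInf_natCast_le h
    exact ⟨A.1, A.2, hA⟩
  · rintro ⟨A, h1, h2⟩
    exact (iInf_le _ ⟨A, h1⟩).trans (by exact_mod_cast h2)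

/-- The value `⊤` is the infimum over the empty set. It stands for a process that does not
stabilize. -/
theorem exits_eq_top_iff {e : Env d} {m : ℕ} : exits e m = ⊤ ↔ ¬ ∃ u, Stable e m u := by
  constructor
  · rintro h ⟨u, hu⟩
    have : exits e m ≤ (instrCount (e []).2 none (u []) : ℕ) := exits_le_iff.2 ⟨u, hu, le_rfl⟩
    rw [h] at this
    exact absurd this (by simp)
  · intro h
    have : IsEmpty {u : Vertex d → ℕ // Stable e m u} := ⟨fun u => h ⟨u.1, u.2⟩⟩
    exact iInf_of_empty _

theorem exits_mono (e : Env d) : Monotone (exits e) := by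
  intro m m' h
  refine le_iInf fun u => ?_
  exact exits_le_iff.2 ⟨u.1, fun v => (inflow_mono e h le_rfl v).trans (u.2 v), le_rfl⟩

theorem fromAbove_append (e : Env d) (m : ℕ) (u : Vertex d → ℕ) (i : Fin d) (w : Vertex d) :
    fromAbove e m u (w ++ [i]) = fromAbove (sub i e) (instrCount (e []).2 (some i) (u []))
      (fun v => u (v ++ [i])) w := by
  cases w <;> rfl

theorem inflow_append (e : Env d) (m : ℕ) (u : Vertex d → ℕ) (i : Fin d) (w : Vertex d) :
    inflow e m u (w ++ [i]) = inflow (sub i e) (instrCount (e []).2 (some i) (u []))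
      (fun v => u (v ++ [i])) w := by
  unfold inflow
  rw [fromAbove_append]
  rfl

/-- A stable configuration consists of the number `A` of departures from the top and of stable
configurations in the subtrees, entered by as many frogs as the first `A` instructions send there.
Choosing the best configuration in each subtree reduces the infimum to one over `A`. -/
theorem exits_eq_node (e : Env d) (m : ℕ) :
    exits e m = node (e []).1 (e []).2 (fun i => exits (sub i e)) m := by
  refine le_antisymm ?_ ?_
  · refine le_node_iff.2 fun A hA => ?_
    have hfin : ∀ i, ∃ u, Stable (sub i e) (instrCount (e []).2 (some i) A) u ∧
        (instrCount (sub i e []).2 none (u []) : ℕ∞) ≤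
          exits (sub i e) (instrCount (e []).2 (some i) A) := by
      -- A finite bound on the sum makes each summand finite, hence attained by a stable
      -- configuration.
      intro i
      have h1 : exits (sub i e) (instrCount (e []).2 (some i) A) ≠ ⊤ := by
        intro h
        have h2 := Finset.single_le_sum
          (f := fun i => exits (sub i e) (instrCount (e []).2 (some i) A))
          (fun _ _ => zero_le) (Finset.mem_univ i)
        have h3 := (h2.trans le_add_self).trans hA
        simp only [h] at h3
        exact absurd h3 (by simp)
      obtain ⟨k, hk⟩ := ENat.ne_top_iff_exists.1 h1
      obtain ⟨u, hu, h4⟩ := exits_le_iff.1 hk.ge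
      exact ⟨u, hu, by rw [← hk]; exact_mod_cast h4⟩
    choose u hu hle using hfin
    set U : Vertex d → ℕ := fun v =>
      if h : v = [] then A else u (v.getLast h) v.dropLast with hU
    have hU0 : U [] = A := by simp [hU]
    have hUi : ∀ w i, U (w ++ [i]) = u i w := fun w i => by simp [hU]
    refine exits_le_iff.2 ⟨U, fun v => ?_, by rw [hU0]⟩
    rcases List.eq_nil_or_concat v with rfl | ⟨w, i, rfl⟩
    · rw [hU0]
      have h5 : ((m + if m = 0 then 0 else (e []).1 : ℕ) : ℕ∞) +
          ∑ i, (instrCount (sub i e []).2 none (u i []) : ℕ∞) ≤ A :=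
        (add_le_add le_rfl (Finset.sum_le_sum fun i _ => hle i)).trans hA
      have h6 : m + (if m = 0 then 0 else (e []).1) +
          ∑ i, instrCount (sub i e []).2 none (u i []) ≤ A := by exact_mod_cast h5
      refine le_trans (le_of_eq ?_) h6
      simp only [inflow, fromAbove, fromBelow]
      congr 1
    · rw [List.concat_eq_append, inflow_append, hUi, hU0]
      simp only [hUi]
      exact hu i w
  · refine le_iInf fun ⟨u, hu⟩ => ?_
    refine iInf_le_of_le ⟨u [], ?_⟩ le_rfl
    have h1 := hu []
    simp only [inflow, fromAbove, fromBelow] at h1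
    refine le_trans (add_le_add le_rfl (Finset.sum_le_sum fun i _ => exits_le_iff.2
      ⟨fun v => u (v ++ [i]), fun w => ?_, le_rfl⟩)) ?_
    · rw [← inflow_append e m u i w]; exact hu _
    · exact_mod_cast h1

/-! ### Measurability -/

/-- Iteration from zero increases to the least stable configuration if there is one. It replaces a
quantifier over uncountably many `u` by countably many measurable conditions. -/
def relax (e : Env d) (m : ℕ) : ℕ → Vertex d → ℕ
  | 0 => fun _ => 0
  | n + 1 => inflow e m (relax e m n)

theorem relax_mono (e : Env d) (m : ℕ) : Monotone (relax e m) := by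
  refine monotone_nat_of_le_succ fun n => ?_
  induction n with
  | zero => exact fun v => Nat.zero_le _
  | succ n ih => exact fun v => inflow_mono e le_rfl ih v

theorem exists_stable_le_iff {e : Env d} {m k : ℕ} :
    (∃ u, Stable e m u ∧ instrCount (e []).2 none (u []) ≤ k) ↔
      (∀ v, ∃ B, ∀ n, relax e m n v ≤ B) ∧
        ∀ n, instrCount (e []).2 none (relax e m n []) ≤ k := by
  constructor
  · rintro ⟨u, hu, hk⟩
    have : ∀ n, relax e m n ≤ u := by
      intro n
      induction n with
      | zero => exact fun v => Nat.zero_le _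
      | succ n ih => exact fun v => (inflow_mono e le_rfl ih v).trans (hu v)
    exact ⟨fun v => ⟨u v, fun n => this n v⟩,
      fun n => (instrCount_mono _ _ (this n [])).trans hk⟩
  · rintro ⟨hB, hk⟩
    have hlim : ∀ v, ∃ n0, ∀ n ≥ n0, relax e m n v = relax e m n0 v := by
      intro v
      obtain ⟨B, hB⟩ := hB v
      have hbdd : BddAbove (Set.range fun n => relax e m n v) :=
        ⟨B, by rintro _ ⟨n, rfl⟩; exact hB n⟩
      obtain ⟨n0, hn0⟩ := Nat.sSup_mem (Set.range_nonempty _) hbdd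
      refine ⟨n0, fun n hn => le_antisymm ?_ (relax_mono e m hn v)⟩
      simp only at hn0
      rw [hn0]
      exact le_csSup hbdd ⟨n, rfl⟩
    choose T hT using hlim
    refine ⟨fun v => relax e m (T v) v, fun v => ?_, hk _⟩
    obtain ⟨n, h1, h2, h3⟩ : ∃ n, T v ≤ n ∧ T v.tail ≤ n ∧ ∀ i, T (i :: v) ≤ n := by
      refine ⟨T v + T v.tail + ∑ i, T (i :: v), by omega, by omega, fun i => ?_⟩
      have := Finset.single_le_sum (f := fun i => T (i :: v)) (fun _ _ => Nat.zero_le _)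
        (Finset.mem_univ i)
      omega
    have hA : fromAbove e m (fun v => relax e m (T v) v) v = fromAbove e m (relax e m n) v := by
      cases v with
      | nil => rfl
      | cons i w => simp only [fromAbove]; rw [hT w n h2]
    have hB : fromBelow e (fun v => relax e m (T v) v) v = fromBelow e (relax e m n) v :=
      Finset.sum_congr rfl fun i _ => by rw [hT (i :: v) n (h3 i)]
    have h4 : inflow e m (fun v => relax e m (T v) v) v = relax e m (n + 1) v := by
      change _ = inflow e m (relax e m n) v
      unfold inflow
      rw [hA, hB]
    rw [h4, hT v (n + 1) (by omega)]

theorem measurable_instrCount (o : Option (Fin d)) (n : ℕ) :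
    Measurable fun s : ℕ → Option (Fin d) => instrCount s o n := by
  induction n with
  | zero => simp only [instrCount_zero]; exact measurable_const
  | succ n ih =>
    simp only [instrCount_succ]
    exact ih.add (Measurable.ite (measurableSet_eq_fun (measurable_pi_apply n) measurable_const)
      measurable_const measurable_const)

theorem measurable_instrCount_comp {Ω : Type*} [MeasurableSpace Ω] (o : Option (Fin d))
    {s : Ω → ℕ → Option (Fin d)} {n : Ω → ℕ} (hs : Measurable s) (hn : Measurable n) :
    Measurable fun x => instrCount (s x) o (n x) := by
  have h : Measurable fun q : (ℕ → Option (Fin d)) × ℕ => instrCount q.1 o q.2 :=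
    measurable_from_prod_countable_left fun n => measurable_instrCount o n
  exact h.comp (hs.prodMk hn)

theorem measurable_relax (m n : ℕ) (v : Vertex d) :
    Measurable fun e : Env d => relax e m n v := by
  induction n generalizing v with
  | zero => exact measurable_const
  | succ n ih =>
    have hs : ∀ v, Measurable fun e : Env d => (e v).2 :=
      fun v => (measurable_pi_apply v).snd
    have hN : ∀ v, Measurable fun e : Env d => (e v).1 :=
      fun v => (measurable_pi_apply v).fst
    have hA : Measurable fun e : Env d => fromAbove e m (relax e m n) v := by
      cases v with
      | nil => exact measurable_const
      | cons i w => exact measurable_instrCount_comp _ (hs w) (ih w)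
    simp only [relax, inflow, fromBelow]
    refine (hA.add (Measurable.ite (hA (measurableSet_singleton 0)) measurable_const
      (hN v))).add (Finset.measurable_sum _ fun i _ =>
        measurable_instrCount_comp _ (hs _) (ih _))

theorem measurableSet_exits_le (m k : ℕ) : MeasurableSet {e : Env d | exits e m ≤ k} := by
  have : {e : Env d | exits e m ≤ k} =
      (⋂ v, ⋃ B, ⋂ n, {e | relax e m n v ≤ B}) ∩
        ⋂ n, {e | instrCount (e []).2 none (relax e m n []) ≤ k} := by
    ext e
    simp only [Set.mem_ofPred_eq, exits_le_iff, exists_stable_le_iff, Set.mem_inter_iff,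
      Set.mem_iInter, Set.mem_iUnion]
  rw [this]
  exact (MeasurableSet.iInter fun v => MeasurableSet.iUnion fun B => MeasurableSet.iInter fun n =>
    measurable_relax m n v measurableSet_Iic).inter (MeasurableSet.iInter fun n =>
      measurable_instrCount_comp none (measurable_pi_apply ([] : Vertex d)).snd
        (measurable_relax m n []) measurableSet_Iic)

theorem measurable_exits (m : ℕ) : Measurable fun e : Env d => exits e m := by
  refine measurable_to_countable' fun k => ?_
  have hIic : ∀ k : ℕ∞, MeasurableSet {e : Env d | exits e m ≤ k} := by
    intro k
    cases k using ENat.recTopCoe with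
    | top => simp
    | coe k => exact measurableSet_exits_le m k
  have hset : (fun e : Env d => exits e m) ⁻¹' {k} =
      {e | exits e m ≤ k} ∩ ⋂ j : {j : ℕ∞ // j < k}, {e | exits e m ≤ j}ᶜ := by
    ext e
    simp only [Set.mem_preimage, Set.mem_singleton_iff, Set.mem_inter_iff, Set.mem_ofPred_eq,
      Set.mem_iInter, Set.mem_compl_iff, Subtype.forall, not_le]
    constructor
    · rintro rfl
      exact ⟨le_rfl, fun j hj => hj⟩
    · rintro ⟨h1, h2⟩
      exact h1.antisymm (not_lt.1 fun h => lt_irrefl _ (h2 _ h))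
  rw [hset]
  exact (hIic k).inter (MeasurableSet.iInter fun j => (hIic j).compl)

/-! ### The law of the environment -/

/-- The law of an i.i.d. uniform sequence. -/
noncomputable def uniformSeq (α : Type*) [MeasurableSpace α] : Measure (ℕ → α) :=
  Measure.infinitePi fun _ => uniformOn Set.univ

instance isProbabilityMeasure_uniform {α : Type*} [MeasurableSpace α] [MeasurableSingletonClass α]
    [Finite α] [Nonempty α] : IsProbabilityMeasure (uniformOn (Set.univ : Set α)) :=
  isProbabilityMeasure_uniformOn Set.finite_univ Set.univ_nonempty

instance {α : Type*} [MeasurableSpace α] [MeasurableSingletonClass α] [Finite α] [Nonempty α] :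
    IsProbabilityMeasure (uniformSeq α) := by
  unfold uniformSeq; infer_instance

noncomputable def siteLaw (d : ℕ) (μ : ℝ≥0) : Measure (Site d) :=
  (poissonMeasure μ).prod (uniformSeq (Option (Fin d)))

instance (μ : ℝ≥0) : IsProbabilityMeasure (siteLaw d μ) := by
  unfold siteLaw; infer_instance

noncomputable def envLaw (d : ℕ) (μ : ℝ≥0) : Measure (Env d) :=
  Measure.infinitePi fun _ => siteLaw d μ

instance (μ : ℝ≥0) : IsProbabilityMeasure (envLaw d μ) := by
  unfold envLaw; infer_instance

/-- The environment in which the root has no sleepers and the stack `τ`. -/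
def rootEnv (τ : ℕ → Fin d) (e : Env d) : Env d :=
  Function.update e [] (0, fun k => some (τ k))

theorem rootSite_rootEnv (τ : ℕ → Fin d) (e : Env d) : RootSite (rootEnv τ e) := by
  simp [RootSite, rootEnv]

theorem rootEnv_of_ne (τ : ℕ → Fin d) (e : Env d) {v : Vertex d} (hv : v ≠ []) :
    rootEnv τ e v = e v := Function.update_of_ne hv _ _

theorem sub_rootEnv (τ : ℕ → Fin d) (e : Env d) (i : Fin d) : sub i (rootEnv τ e) = sub i e := by
  funext v
  exact rootEnv_of_ne τ e (by simp)

theorem measurable_rootEnv : Measurable fun q : (ℕ → Fin d) × Env d => rootEnv q.1 q.2 := by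
  refine measurable_pi_lambda _ fun v => ?_
  by_cases hv : v = []
  · subst hv
    simp only [rootEnv, Function.update_self]
    refine measurable_const.prodMk (measurable_pi_lambda _ fun k => ?_)
    exact measurable_from_top.comp ((measurable_pi_apply k).comp measurable_fst)
  · simp only [rootEnv, Function.update_of_ne hv]
    exact (measurable_pi_apply v).comp measurable_snd

/-! ### Frequencies -/

theorem ae_tendsto_count {α : Type*} [MeasurableSpace α] [MeasurableSingletonClass α]
    [Fintype α] [Nonempty α] [DecidableEq α] (a : α) :
    ∀ᵐ s ∂(uniformSeq α), Tendsto (fun n : ℕ => (Nat.count (fun k => s k = a) n : ℝ) / n) atTop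
      (nhds (1 / Fintype.card α)) := by
  set F : α → ℝ := fun b => if b = a then 1 else 0 with hF
  have hFm : Measurable F := measurable_of_finite _
  have hX : ∀ i : ℕ, Measurable fun s : ℕ → α => F (s i) :=
    fun i => hFm.comp (measurable_pi_apply i)
  have hint : Integrable (fun s : ℕ → α => F (s 0)) (uniformSeq α) := by
    refine Integrable.of_bound (hX 0).aestronglyMeasurable 1 (ae_of_all _ fun s => ?_)
    simp only [hF]
    split_ifs <;> simp
  have hmp : ∀ i : ℕ, (uniformSeq α).map (fun s => s i) = uniformOn Set.univ := fun i =>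
    Measure.infinitePi_map_eval (fun _ : ℕ => (uniformOn Set.univ : Measure α)) i
  have h := strong_law_ae_real (fun (i : ℕ) (s : ℕ → α) => F (s i)) hint ?_ ?_
  · have hE : ∫ s, F (s 0) ∂(uniformSeq α) = 1 / Fintype.card α := by
      have h1 : ∫ s, F (s 0) ∂(uniformSeq α) = ∫ b, F b ∂(uniformOn (Set.univ : Set α)) := by
        rw [← hmp 0, integral_map (measurable_pi_apply 0).aemeasurable hFm.aestronglyMeasurable]
      have h2 : F = Set.indicator {a} fun _ => (1 : ℝ) := by
        funext b; simp [hF, Set.indicator]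
      rw [h1, h2, integral_indicator (measurableSet_singleton a), setIntegral_const, smul_eq_mul,
        mul_one, measureReal_def, uniformOn_univ, Measure.count_singleton]
      simp
    filter_upwards [h] with s hs
    rw [hE] at hs
    refine hs.congr fun n => ?_
    congr 1
    rw [Nat.count_eq_card_filter_range, Finset.sum_boole]
  · intro i j hij
    exact (iIndepFun_infinitePi (P := fun _ : ℕ => (uniformOn Set.univ : Measure α))
      (X := fun _ => F) (fun _ => hFm)).indepFun hij
  · intro i
    refine ⟨(hX i).aemeasurable, (hX 0).aemeasurable, ?_⟩
    have : ∀ i : ℕ, (uniformSeq α).map (fun s => F (s i)) = (uniformOn Set.univ).map F :=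
      fun i => by rw [← hmp i, Measure.map_map hFm (measurable_pi_apply i)]; rfl
    rw [this, this]

/-- Stacks in which all instructions have the same positive density. -/
def Regular (s : ℕ → Option (Fin d)) : Prop :=
  ∀ o, Tendsto (fun n : ℕ => (instrCount s o n : ℝ) / n) atTop (nhds (1 / (d + 1 : ℝ)))

theorem ae_regular : ∀ᵐ s ∂(uniformSeq (Option (Fin d))), Regular s := by
  unfold Regular
  rw [ae_all_iff]
  intro o
  have := ae_tendsto_count (α := Option (Fin d)) o
  simpa [instrCount] using this

theorem ae_forall_regular (μ : ℝ≥0) : ∀ᵐ e ∂(envLaw d μ), ∀ v, Regular (e v).2 := by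
  rw [ae_all_iff]
  intro v
  have h1 : ∀ᵐ q ∂(siteLaw d μ), Regular q.2 := by
    have := ae_regular (d := d)
    rw [← Measure.snd_prod (μ := poissonMeasure μ) (ν := uniformSeq (Option (Fin d)))] at this
    exact ae_of_ae_map measurable_snd.aemeasurable this
  have h2 := Measure.infinitePi_map_eval (fun _ : Vertex d => siteLaw d μ) v
  rw [← h2] at h1
  exact ae_of_ae_map (measurable_pi_apply v).aemeasurable h1

theorem tendsto_count_atTop_of_freq {f : ℕ → ℕ} {p : ℝ} (hp : 0 < p)
    (h : Tendsto (fun n : ℕ => (f n : ℝ) / n) atTop (nhds p)) : Tendsto f atTop atTop := by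
  have h1 : Tendsto (fun n : ℕ => (f n : ℝ)) atTop atTop := by
    have h2 := h.pos_mul_atTop hp tendsto_natCast_atTop_atTop
    refine h2.congr' ?_
    filter_upwards [eventually_gt_atTop 0] with n hn
    have : (n : ℝ) ≠ 0 := by positivity
    field_simp
  exact tendsto_natCast_atTop_iff.1 h1

theorem Regular.tendsto_atTop {s : ℕ → Option (Fin d)} (hs : Regular s) (o : Option (Fin d)) :
    Tendsto (instrCount s o) atTop atTop :=
  tendsto_count_atTop_of_freq (by positivity) (hs o)

/-! ### The frog model in terms of the environment -/

theorem map_uniformOn {α Ω : Type*} [Fintype α] [Nonempty α] [MeasurableSpace α]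
    [MeasurableSingletonClass α] [MeasurableSpace Ω] [MeasurableSingletonClass Ω] [Countable Ω]
    {f : α → Ω} (hf : Function.Injective f) :
    (uniformOn (Set.univ : Set α)).map f = uniformOn (Set.range f) := by
  classical
  refine Measure.ext_of_singleton fun w => ?_
  have h1 : Set.range f = ((Finset.univ.map ⟨f, hf⟩ : Finset Ω) : Set Ω) := by simp
  rw [Measure.map_apply (measurable_of_finite f) (measurableSet_singleton w), h1,
    ← Finset.coe_singleton w, uniformOn_apply_finset, ← Finset.coe_univ, Finset.card_map]
  have h2 : f ⁻¹' (({w} : Finset Ω) : Set Ω) = ((Finset.univ.filter fun a => f a = w : Finset α) :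
      Set α) := by
    ext a; simp
  rw [h2, uniformOn_apply_finset, ← Finset.card_map ⟨f, hf⟩]
  congr 3
  ext x
  simp only [Finset.univ_inter, Finset.mem_map, Finset.mem_filter, Finset.mem_univ, true_and,
    Function.Embedding.coeFn_mk, Finset.mem_inter, Finset.mem_singleton]
  constructor
  · rintro ⟨a, rfl, rfl⟩; exact ⟨⟨a, rfl⟩, rfl⟩
  · rintro ⟨⟨a, rfl⟩, rfl⟩; exact ⟨a, rfl, rfl⟩

theorem measurableSet_frequently {I : Type*} [Countable I] (coord : Exploration d → I)
    (T : Set (List (Vertex d × ℕ))) :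
    MeasurableSet {x | ∃ᶠ n in atTop, history coord x n ∈ T} := by
  have : {x | ∃ᶠ n in atTop, history coord x n ∈ T} =
      ⋂ N, ⋃ n, ⋃ (_ : N ≤ n), {x | history coord x n ∈ T} := by
    ext x
    simp [frequently_atTop]
  rw [this]
  exact MeasurableSet.iInter fun N => MeasurableSet.iUnion fun n => MeasurableSet.iUnion fun _ =>
    measurable_history coord n (MeasurableSet.of_discrete (s := T))

/-- The root has no upward instruction, so any admissible number of departures would give the value
zero; the value is `⊤` exactly if no number of departures is admissible. -/
theorem exits_rootEnv_eq_top_iff (τ : ℕ → Fin d) (e : Env d) :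
    exits (rootEnv τ e) 1 = ⊤ ↔
      ∀ A : ℕ, (A : ℕ∞) < 1 + ∑ i, exits (sub i e) (Nat.count (fun k => τ k = i) A) := by
  rw [exits_eq_node, ← top_le_iff, le_node_iff]
  simp only [sub_rootEnv]
  refine forall_congr' fun A => ?_
  have h1 : ∀ i, instrCount (rootEnv τ e []).2 (some i) A = Nat.count (fun k => τ k = i) A := by
    intro i
    simp [rootEnv, instrCount]
  have h2 : (rootEnv τ e []).1 = 0 := by simp [rootEnv]
  simp only [h1, h2, one_ne_zero, if_false, add_zero, top_le_iff, ENat.natCast_ne_top, Nat.cast_one]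
  rw [← not_le]

/-- Joint randomness at a vertex: an instruction at the root and an instruction elsewhere. -/
abbrev Joint (d : ℕ) : Type := (Vertex d → ℕ) × (Vertex d × ℕ → Fin d × Option (Fin d))

def Joint.toRootEnv (z : Joint d) : (ℕ → Fin d) × Env d :=
  (fun k => (z.2 ([], k)).1, fun v => (z.1 v, fun k => (z.2 (v, k)).2))

/-- Every coordinate of `Joint` carries an instruction of either type. The root uses the first
component, all other vertices the second, so that both descriptions are functions of one family of
independent variables. -/
def Joint.toSample (z : Joint d) : (Vertex d → ℕ) × (Vertex d × ℕ → Vertex d) :=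
  (z.1, fun p => if p.1 = [] then [(z.2 p).1] else move p.1 (z.2 p).2)

/-- The two samples may differ in the number of sleepers at the root, which is never read. -/
theorem history_toSample (z : Joint d) (n : ℕ) : history stackCoord z.toSample n =
    history stackCoord (rootEnv z.toRootEnv.1 z.toRootEnv.2).sample n := by
  induction n with
  | zero => rfl
  | succ n ih =>
    rw [history, history, ih]
    congr 1
    have h2 : ∀ p, z.toSample.2 p = (rootEnv z.toRootEnv.1 z.toRootEnv.2).sample.2 p := by
      rintro ⟨v, k⟩
      simp only [Joint.toSample, Env.sample]
      by_cases hv : v = []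
      · subst hv
        simp [rootEnv, move, Joint.toRootEnv]
      · rw [rootEnv_of_ne _ _ hv, if_neg hv]
        rfl
    unfold answer
    rw [h2]
    refine Prod.ext rfl ?_
    dsimp only
    split_ifs with hs
    · rfl
    · have hne : (rootEnv z.toRootEnv.1 z.toRootEnv.2).sample.2 (stackCoord (after (history
          stackCoord (rootEnv z.toRootEnv.1 z.toRootEnv.2).sample n))) ≠ [] :=
        fun h => hs (h ▸ nil_mem_seen _)
      exact (congrArg Prod.fst (rootEnv_of_ne _ z.toRootEnv.2 hne)).symm

section Transfer

variable [NeZero d]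

theorem step_root : step d [] = (uniformOn (Set.univ : Set (Fin d))).map fun i => [i] := by
  rw [map_uniformOn (fun i j h => by simpa using h), step]
  congr 1
  ext w
  simp only [SimpleGraph.mem_neighborSet, tree, Set.mem_range]
  constructor
  · rintro (⟨i, rfl⟩ | ⟨i, h⟩)
    · exact ⟨i, rfl⟩
    · simp at h
  · rintro ⟨i, rfl⟩; exact Or.inl ⟨i, rfl⟩

theorem step_cons (i : Fin d) (w : Vertex d) :
    step d (i :: w) = (uniformOn (Set.univ : Set (Option (Fin d)))).map (move (i :: w)) := by
  rw [map_uniformOn, step]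
  · congr 1
    ext x
    simp only [SimpleGraph.mem_neighborSet, tree, Set.mem_range]
    constructor
    · rintro (⟨j, rfl⟩ | ⟨j, h⟩)
      · exact ⟨some j, rfl⟩
      · exact ⟨none, (List.cons.inj h).2⟩
    · rintro ⟨o, rfl⟩
      cases o with
      | none => exact Or.inr ⟨i, rfl⟩
      | some j => exact Or.inl ⟨j, rfl⟩
  · intro o o' h
    cases o <;> cases o'
    · rfl
    · have := congrArg List.length h
      simp [move] at this
      omega
    · have := congrArg List.length h
      simp [move] at this
      omega
    · simpa [move] using h

noncomputable def jointLaw (d : ℕ) [NeZero d] (μ : ℝ≥0) : Measure (Joint d) :=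
  (Measure.infinitePi fun _ : Vertex d => poissonMeasure μ).prod
    (Measure.infinitePi fun _ : Vertex d × ℕ =>
      (uniformOn (Set.univ : Set (Fin d))).prod (uniformOn (Set.univ : Set (Option (Fin d)))))

theorem map_toSample (μ : ℝ≥0) :
    (jointLaw d μ).map Joint.toSample = sampleLaw μ fun i : Vertex d × ℕ => step d i.1 := by
  have hf : ∀ p : Vertex d × ℕ, Measurable fun q : Fin d × Option (Fin d) =>
      if p.1 = [] then [q.1] else move p.1 q.2 := fun p => measurable_of_countable _
  have h1 := Measure.infinitePi_map_pi (μ := fun _ : Vertex d × ℕ =>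
    (uniformOn (Set.univ : Set (Fin d))).prod (uniformOn (Set.univ : Set (Option (Fin d))))) hf
  have h2 : ∀ p : Vertex d × ℕ, ((uniformOn (Set.univ : Set (Fin d))).prod
      (uniformOn (Set.univ : Set (Option (Fin d))))).map (fun q : Fin d × Option (Fin d) =>
      if p.1 = [] then [q.1] else move p.1 q.2) = step d p.1 := by
    rintro ⟨v, k⟩
    cases v with
    | nil =>
      simp only [if_true]
      rw [step_root]
      conv_rhs => rw [← Measure.fst_prod (μ := uniformOn (Set.univ : Set (Fin d)))
        (ν := uniformOn (Set.univ : Set (Option (Fin d)))), Measure.fst,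
        Measure.map_map (measurable_of_finite _) measurable_fst]
      rfl
    | cons i w =>
      simp only [reduceCtorEq, if_false]
      rw [step_cons]
      conv_rhs => rw [← Measure.snd_prod (μ := uniformOn (Set.univ : Set (Fin d)))
        (ν := uniformOn (Set.univ : Set (Option (Fin d)))), Measure.snd,
        Measure.map_map (measurable_of_finite _) measurable_snd]
      rfl
  simp_rw [h2] at h1
  rw [jointLaw, sampleLaw, ← h1]
  have h3 := Measure.map_prod_map (Measure.infinitePi fun _ : Vertex d => poissonMeasure μ)
    (Measure.infinitePi fun _ : Vertex d × ℕ =>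
      (uniformOn (Set.univ : Set (Fin d))).prod (uniformOn (Set.univ : Set (Option (Fin d)))))
    measurable_id (g := fun ζ (p : Vertex d × ℕ) =>
      if p.1 = [] then [(ζ p).1] else move p.1 (ζ p).2)
    (measurable_pi_lambda _ fun p => (hf p).comp (measurable_pi_apply p))
  rw [Measure.map_id] at h3
  rw [h3]
  rfl

theorem measurePreserving_toRootEnv (μ : ℝ≥0) :
    MeasurePreserving (Joint.toRootEnv (d := d)) (jointLaw d μ)
      ((uniformSeq (Fin d)).prod (envLaw d μ)) := by
  set P := Measure.infinitePi fun _ : Vertex d => poissonMeasure μ with hP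
  set S := Measure.infinitePi fun _ : Vertex d => uniformSeq (Option (Fin d)) with hS
  have m1 : MeasurePreserving (fun ζ : Vertex d × ℕ → Fin d × Option (Fin d) =>
      (fun p => (ζ p).1, fun p => (ζ p).2)) _ _ :=
    ⟨by fun_prop, infinitePi_map_unzip (fun _ : Vertex d × ℕ => uniformOn (Set.univ : Set (Fin d)))
      (fun _ => uniformOn (Set.univ : Set (Option (Fin d))))⟩
  have m2 : MeasurePreserving (fun (ζ : Vertex d × ℕ → Fin d) (k : ℕ) => ζ ([], k))
      (Measure.infinitePi fun _ : Vertex d × ℕ => uniformOn (Set.univ : Set (Fin d)))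
      (uniformSeq (Fin d)) :=
    ⟨by fun_prop, Measure.map_infinitePi_infinitePi_of_inj
      (P := fun _ : Vertex d × ℕ => uniformOn (Set.univ : Set (Fin d)))
      (f := fun k : ℕ => (([] : Vertex d), k)) fun a b h => (Prod.mk.inj h).2⟩
  have m3 : MeasurePreserving (fun (ζ : Vertex d × ℕ → Option (Fin d)) v (k : ℕ) => ζ (v, k))
      (Measure.infinitePi fun _ : Vertex d × ℕ => uniformOn (Set.univ : Set (Option (Fin d)))) S :=
    ⟨by fun_prop, Measure.infinitePi_map_curry
      (fun (_ : Vertex d) (_ : ℕ) => uniformOn (Set.univ : Set (Option (Fin d))))⟩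
  have m4 : MeasurePreserving (fun (x : (Vertex d → ℕ) × (Vertex d → ℕ → Option (Fin d))) v =>
      (x.1 v, x.2 v)) (P.prod S) (envLaw d μ) := by
    refine ⟨by fun_prop, ?_⟩
    rw [hP, hS, ← infinitePi_map_unzip, Measure.map_map (by fun_prop) (by fun_prop)]
    exact Measure.map_id
  have m5 := (MeasurePreserving.id P).prod ((m2.prod m3).comp m1)
  have m6 := (MeasurePreserving.id (uniformSeq (Fin d))).prod m4
  have m7 : MeasurePreserving
      (fun x : (Vertex d → ℕ) × ((ℕ → Fin d) × (Vertex d → ℕ → Option (Fin d))) =>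
        (x.2.1, (x.1, x.2.2))) (P.prod ((uniformSeq (Fin d)).prod S))
      ((uniformSeq (Fin d)).prod (P.prod S)) := by
    have a1 := (measurePreserving_prodAssoc P (uniformSeq (Fin d)) S).symm
      MeasurableEquiv.prodAssoc
    have a2 := (Measure.measurePreserving_swap (μ := P) (ν := uniformSeq (Fin d))).prod
      (MeasurePreserving.id S)
    have a3 := measurePreserving_prodAssoc (uniformSeq (Fin d)) P S
    exact a3.comp (a2.comp a1)
  exact m6.comp (m7.comp m5)

/-- The probability of recurrence in terms of the environment. -/
theorem law_recurrent_eq_env (μ : ℝ≥0) :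
    law d μ {ω | Recurrent ω} = ((uniformSeq (Fin d)).prod (envLaw d μ))
      {q | exits (rootEnv q.1 q.2) 1 = ⊤} := by
  have hmeas : MeasurableSet {q : (ℕ → Fin d) × Env d | exits (rootEnv q.1 q.2) 1 = ⊤} :=
    ((measurable_exits 1).comp measurable_rootEnv) (measurableSet_singleton _)
  have hmz : Measurable (Joint.toSample (d := d)) := by
    refine measurable_fst.prodMk (measurable_pi_lambda _ fun p => ?_)
    have hf : Measurable fun q : Fin d × Option (Fin d) =>
      if p.1 = [] then [q.1] else move p.1 q.2 := measurable_of_countable _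
    exact hf.comp ((measurable_pi_apply p).comp measurable_snd)
  rw [law_recurrent_eq, ← map_toSample, Measure.map_apply hmz (measurableSet_frequently _ _),
    ← (measurePreserving_toRootEnv μ).measure_preimage hmeas.nullMeasurableSet]
  refine measure_congr ?_
  have hgood : ∀ᵐ q ∂((uniformSeq (Fin d)).prod (envLaw d μ)), ∀ v, Regular (q.2 v).2 := by
    have := ae_forall_regular (d := d) μ
    rw [← Measure.snd_prod (μ := uniformSeq (Fin d)) (ν := envLaw d μ)] at this
    exact ae_of_ae_map measurable_snd.aemeasurable this
  filter_upwards [(measurePreserving_toRootEnv μ).quasiMeasurePreserving.ae hgood] with z hz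
  refine propext ?_
  change (∃ᶠ n in atTop, history stackCoord z.toSample n ∈ {h | (after h).head.2.2 = []}) ↔
    exits (rootEnv z.toRootEnv.1 z.toRootEnv.2) 1 = ⊤
  simp_rw [history_toSample]
  rw [frequently_root_iff, exits_eq_top_iff, exists_stable_iff _ (rootSite_rootEnv _ _)]
  intro v hv a
  rw [rootEnv_of_ne _ _ hv]
  exact (((hz v).tendsto_atTop none).eventually_ge_atTop a).exists

end Transfer

/-! ### Transience for small densities -/

theorem tsum_poisson_mean (μ : ℝ≥0) :
    ∑' j : ℕ, (j : ℝ≥0∞) * poissonMeasure μ {j} = μ := by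
  rw [tsum_eq_zero_add' ENNReal.summable, Nat.cast_zero, zero_mul, zero_add]
  have h : ∀ j : ℕ, ((j + 1 : ℕ) : ℝ≥0∞) * poissonMeasure μ {j + 1} =
      μ * poissonMeasure μ {j} := by
    intro j
    rw [poissonMeasure_singleton, poissonMeasure_singleton]
    rw [← ENNReal.ofReal_natCast, ← ENNReal.ofReal_mul (by positivity),
      show (μ : ℝ≥0∞) = ENNReal.ofReal μ by simp, ← ENNReal.ofReal_mul (by positivity)]
    congr 1
    rw [Nat.factorial_succ]
    push_cast
    have : (j.factorial : ℝ) ≠ 0 := by positivity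
    field_simp
    ring
  simp_rw [h]
  rw [ENNReal.tsum_mul_left]
  have h1 : ∑' j : ℕ, poissonMeasure μ {j} = 1 := by
    have := lintegral_countable' (μ := poissonMeasure μ) (fun _ : ℕ => (1 : ℝ≥0∞))
    simpa using this.symm
  rw [h1, mul_one]

theorem lintegral_uniform {α : Type*} [Fintype α] [Nonempty α] [MeasurableSpace α]
    [MeasurableSingletonClass α] (f : α → ℝ≥0∞) :
    ∫⁻ a, f a ∂(uniformOn (Set.univ : Set α)) = (∑ a, f a) / Fintype.card α := by
  rw [lintegral_fintype, ENNReal.div_eq_inv_mul, Finset.mul_sum]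
  refine Finset.sum_congr rfl fun a _ => ?_
  rw [uniformOn_univ, Measure.count_singleton, one_div, mul_comm]

/-- The weight of a list of awake frogs. -/
noncomputable def weight (t : ℝ≥0) (l : List (Entry d)) : ℝ≥0∞ :=
  (l.map fun q => (t : ℝ≥0∞) ^ q.2.2.length).sum

theorem weight_newFrogs (t : ℝ≥0) (y : Vertex d) (j : ℕ) :
    weight t (newFrogs y j) = j * (t : ℝ≥0∞) ^ y.length := by
  simp [weight, newFrogs, Function.comp_def]

theorem weight_after_cons (t : ℝ≥0) (b : Vertex d × ℕ) (h : List (Vertex d × ℕ)) :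
    weight t (after (b :: h)).queue = weight t (after h).queue.tail +
      (t : ℝ≥0∞) ^ b.1.length * (1 + if b.1 ∈ (after h).seen then 0 else (b.2 : ℝ≥0∞)) := by
  rw [after_cons_queue, weight, List.map_append, List.sum_append, List.map_cons, List.sum_cons]
  simp only [weight]
  congr 1
  split_ifs with hs
  · simp
  · have := weight_newFrogs (d := d) t b.1 b.2
    rw [weight] at this
    rw [this]
    ring

/-- The vertices seen in a history of positive probability form a subtree. -/
theorem seen_closed [NeZero d] {μ : ℝ≥0} {h : List (Vertex d × ℕ)} (hp : historyProb μ h ≠ 0) :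
    (∀ v ∈ (after h).seen, v.tail ∈ (after h).seen) ∧
      ∀ q ∈ (after h).queue, q.2.2 ∈ (after h).seen := by
  induction h with
  | nil => simp [after, start]
  | cons b h ih =>
    rw [historyProb, mul_ne_zero_iff] at hp
    obtain ⟨h1, h2⟩ := ih hp.1
    have hx := h2 _ (head_mem h)
    have hstep : step d (after h).head.2.2 {b.1} ≠ 0 := (mul_ne_zero_iff.1 hp.2).1
    have hadj : b.1 ∈ (tree d).neighborSet (after h).head.2.2 := by
      by_contra hc
      apply hstep
      rw [step, uniformOn_eq_zero_iff (neighborSet_finite d _)]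
      ext w
      simp only [Set.mem_inter_iff, Set.mem_singleton_iff, Set.mem_empty_iff_false, iff_false]
      rintro ⟨hw, rfl⟩
      exact hc hw
    have htail : b.1.tail ∈ (after h).seen := by
      rcases hadj with ⟨i, hi⟩ | ⟨i, hi⟩
      · rw [hi]; exact hx
      · have := h1 _ (h1 _ hx)
        rw [hi] at this
        exact this
    rw [after_cons_seen]
    refine ⟨fun v hv => ?_, fun q hq => ?_⟩
    · rcases Finset.mem_insert.1 hv with rfl | hv
      · exact Finset.mem_insert_of_mem htail
      · exact Finset.mem_insert_of_mem (h1 v hv)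
    · rw [after_cons_queue] at hq
      rcases List.mem_append.1 hq with hq | hq
      · exact Finset.mem_insert_of_mem (h2 q (List.mem_of_mem_tail hq))
      rcases List.mem_cons.1 hq with rfl | hq
      · exact Finset.mem_insert_self _ _
      · split_ifs at hq
        · simp at hq
        · simp only [newFrogs, List.mem_map] at hq
          obtain ⟨i, -, rfl⟩ := hq
          exact Finset.mem_insert_self _ _

theorem tsum_answer (μ : ℝ≥0) (s : Exploration d) (a : ℝ≥0∞) (g : Vertex d → ℝ≥0∞) :
    ∑' b, (a + g b.1 * (1 + if b.1 ∈ s.seen then 0 else (b.2 : ℝ≥0∞))) * answerProb μ s b =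
      ∫⁻ y, (a + g y * (1 + if y ∈ s.seen then 0 else (μ : ℝ≥0∞))) ∂(step d s.head.2.2) := by
  rw [lintegral_countable', ENNReal.tsum_prod']
  refine tsum_congr fun y => ?_
  have h1 : ∑' j : ℕ, poissonMeasure μ {j} = 1 := by
    have := lintegral_countable' (μ := poissonMeasure μ) (fun _ : ℕ => (1 : ℝ≥0∞))
    simpa using this.symm
  by_cases hs : y ∈ s.seen
  · simp only [answerProb, hs, if_true]
    rw [tsum_eq_single 0]
    · simp
    · intro j hj; simp [hj]
  · simp only [answerProb, hs, if_false]
    have : ∀ j : ℕ, (a + g y * (1 + (j : ℝ≥0∞))) * (step d s.head.2.2 {y} * poissonMeasure μ {j}) =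
        (a + g y) * step d s.head.2.2 {y} * poissonMeasure μ {j} +
          g y * step d s.head.2.2 {y} * ((j : ℝ≥0∞) * poissonMeasure μ {j}) := fun j => by ring
    simp_rw [this]
    rw [ENNReal.tsum_add, ENNReal.tsum_mul_left, ENNReal.tsum_mul_left, h1, tsum_poisson_mean]
    ring

/-- Moving the head up meets a seen vertex, by `seen_closed`, and wakes no frog; moving it to any of
the `d` children yields at most `1 + μ` frogs in the mean, each one level deeper. Hypothesis `h1` is
this balance below the root, `h2` the one at the root. The surplus `c` in both is the loss of
expected weight per step. -/
theorem weight_decrease [NeZero d] {μ t c : ℝ≥0}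
    (h1 : 1 + d * (1 + μ) * t ^ 2 + (d + 1) * c * t ≤ (d + 1) * t)
    (h2 : (1 + μ) * t + c ≤ 1) {h : List (Vertex d × ℕ)} (hp : historyProb μ h ≠ 0) :
    ∑' b, weight t (after (b :: h)).queue * answerProb μ (after h) b +
      c * (t : ℝ≥0∞) ^ (after h).head.2.2.length ≤ weight t (after h).queue := by
  obtain ⟨hc1, hc2⟩ := seen_closed hp
  have hx := hc2 _ (head_mem h)
  simp_rw [weight_after_cons]
  rw [tsum_answer μ (after h) _ fun y => (t : ℝ≥0∞) ^ y.length]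
  have hW : weight t (after h).queue = weight t (after h).queue.tail +
      (t : ℝ≥0∞) ^ (after h).head.2.2.length := by
    conv_lhs => rw [queue_eq h, weight, List.map_cons, List.sum_cons]
    rw [weight]; ring
  rw [hW, lintegral_add_left measurable_const, lintegral_const, measure_univ, mul_one, add_assoc]
  refine add_le_add le_rfl ?_
  have hd : (d : ℝ≥0) ≠ 0 := by exact_mod_cast NeZero.ne d
  generalize (after h).head.2.2 = x at *
  cases x with
  | nil =>
    rw [step_root, lintegral_map measurable_from_top (measurable_of_finite _), lintegral_uniform]
    have hle : ∑ i : Fin d, (t : ℝ≥0∞) ^ [i].length *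
        (1 + if [i] ∈ (after h).seen then 0 else (μ : ℝ≥0∞)) ≤ ∑ i : Fin d, (t * (1 + μ) : ℝ≥0∞) := by
      refine Finset.sum_le_sum fun i _ => ?_
      simp only [List.length_singleton, pow_one]
      gcongr
      split_ifs <;> simp
    refine (add_le_add (ENNReal.div_le_div_right hle _) le_rfl).trans ?_
    simp only [Finset.sum_const, Finset.card_univ, Fintype.card_fin, nsmul_eq_mul,
      List.length_nil, pow_zero, mul_one]
    rw [ENNReal.mul_div_right_comm, ENNReal.div_self (by exact_mod_cast NeZero.ne d) (by simp),
      one_mul]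
    calc (t : ℝ≥0∞) * (1 + μ) + c = (((1 + μ) * t + c : ℝ≥0) : ℝ≥0∞) := by push_cast; ring
      _ ≤ 1 := by exact_mod_cast h2
  | cons i w =>
    rw [step_cons, lintegral_map measurable_from_top (measurable_of_finite _), lintegral_uniform,
      Fintype.sum_option]
    have hw : w ∈ (after h).seen := hc1 _ hx
    simp only [move, List.tail_cons, hw, if_true, add_zero, mul_one, Fintype.card_option,
      Fintype.card_fin, List.length_cons]
    have hle : ∑ j : Fin d, (t : ℝ≥0∞) ^ (w.length + 1 + 1) *
        (1 + if j :: i :: w ∈ (after h).seen then 0 else (μ : ℝ≥0∞)) ≤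
        ∑ j : Fin d, ((t : ℝ≥0∞) ^ (w.length + 1 + 1) * (1 + μ)) := by
      refine Finset.sum_le_sum fun i _ => ?_
      gcongr
      split_ifs <;> simp
    refine (add_le_add (ENNReal.div_le_div_right (add_le_add le_rfl hle) _) le_rfl).trans ?_
    simp only [Finset.sum_const, Finset.card_univ, Fintype.card_fin, nsmul_eq_mul]
    have key : (t ^ w.length + d * (t ^ (w.length + 1 + 1) * (1 + μ))) / ((d + 1 : ℕ) : ℝ≥0) +
        c * t ^ (w.length + 1) ≤ t ^ (w.length + 1) := by
      have hd1 : (0 : ℝ≥0) < ((d + 1 : ℕ) : ℝ≥0) := by positivity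
      refine le_of_mul_le_mul_left ?_ hd1
      rw [mul_add, mul_div_cancel₀ _ hd1.ne']
      calc _ = t ^ w.length * (1 + d * (1 + μ) * t ^ 2 + (d + 1) * c * t) := by push_cast; ring
        _ ≤ t ^ w.length * ((d + 1) * t) := by gcongr
        _ = _ := by push_cast; ring
    have h3 := ENNReal.coe_le_coe.2 key
    rw [ENNReal.coe_add, ENNReal.coe_div (by positivity)] at h3
    push_cast at h3 ⊢
    exact h3

theorem ae_historyProb_ne_zero [NeZero d] (μ : ℝ≥0) (n : ℕ) :
    ∀ᵐ x ∂(sampleLaw μ fun i : Vertex d × ℕ => step d i.1),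
      historyProb μ (history stackCoord x n) ≠ 0 := by
  rw [ae_iff]
  simp only [not_not]
  have := (measure_preimage_eq_zero_iff_of_countable
    (μ := sampleLaw μ fun i : Vertex d × ℕ => step d i.1)
    (f := fun x => history stackCoord x n) (s := {h | historyProb μ h = 0})
    (Set.to_countable _)).2 ?_
  · exact this
  · intro h hh
    have h1 := map_history_singleton stackCoord readsOnce_stackCoord μ
      (fun i : Vertex d × ℕ => step d i.1) (fun _ => rfl) n h
    rw [Measure.map_apply (measurable_history _ n) (measurableSet_singleton h)] at h1
    rw [h1]
    split_ifs
    · exact hh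
    · rfl

/-- The initial weight is one and the expected weight drops by at least `c` times the probability
that the head is at the root. These probabilities are summable, and Borel–Cantelli applies. -/
theorem law_recurrent_eq_zero [NeZero d] {μ t c : ℝ≥0} (hc : 0 < c)
    (h1 : 1 + d * (1 + μ) * t ^ 2 + (d + 1) * c * t ≤ (d + 1) * t)
    (h2 : (1 + μ) * t + c ≤ 1) : law d μ {ω | Recurrent ω} = 0 := by
  rw [law_recurrent_eq]
  set P := sampleLaw μ fun i : Vertex d × ℕ => step d i.1 with hP
  set W : ℕ → ℝ≥0∞ := fun n => ∫⁻ x, weight t (after (history stackCoord x n)).queue ∂P with hW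
  set A : ℕ → ℝ≥0∞ := fun n =>
    P {x | history stackCoord x n ∈ {h | (after h).head.2.2 = []}} with hA
  have hstep : ∀ n, W (n + 1) + c * A n ≤ W n := by
    intro n
    simp only [hW]
    rw [lintegral_history_succ stackCoord readsOnce_stackCoord μ _ (fun _ => rfl) n
      fun h => weight t (after h).queue]
    have h3 : (c : ℝ≥0∞) * A n ≤ ∫⁻ x, c *
        (t : ℝ≥0∞) ^ (after (history stackCoord x n)).head.2.2.length ∂P := by
      have hm : MeasurableSet {x : (Vertex d → ℕ) × (Vertex d × ℕ → Vertex d) |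
          history stackCoord x n ∈ {h | (after h).head.2.2 = []}} :=
        measurable_history stackCoord n (MeasurableSet.of_discrete (s := {h | (after h).head.2.2 = []}))
      rw [← lintegral_indicator_const hm]
      refine lintegral_mono fun x => ?_
      by_cases hx : x ∈ {x : (Vertex d → ℕ) × (Vertex d × ℕ → Vertex d) | history stackCoord x n ∈ {h | (after h).head.2.2 = []}}
      · rw [Set.indicator_of_mem hx]
        have : (after (history stackCoord x n)).head.2.2 = [] := hx
        rw [this]; simp
      · rw [Set.indicator_of_notMem hx]; exact zero_le
    refine (add_le_add le_rfl h3).trans ?_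
    rw [← lintegral_add_left]
    · refine lintegral_mono_ae ?_
      filter_upwards [ae_historyProb_ne_zero (d := d) μ n] with x hx
      exact weight_decrease h1 h2 hx
    · exact Measurable.comp (g := fun h : List (Vertex d × ℕ) =>
        ∑' b, weight t (after (b :: h)).queue * answerProb μ (after h) b) measurable_from_top
        (measurable_history stackCoord n)
  have hsum : ∀ n, W n + c * ∑ k ∈ Finset.range n, A k ≤ 1 := by
    intro n
    induction n with
    | zero =>
      simp only [hW, history, after, start, weight]
      simp
    | succ n ih =>
      rw [Finset.sum_range_succ, mul_add, ← add_assoc, add_right_comm]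
      exact (add_le_add (hstep n) le_rfl).trans ih
  have hfin : ∑' n, A n ≠ ⊤ := by
    have h3 : (c : ℝ≥0∞) * ∑' n, A n ≤ 1 := by
      rw [ENNReal.tsum_eq_iSup_nat, ENNReal.mul_iSup]
      exact iSup_le fun n => le_add_self.trans (hsum n)
    intro h
    rw [h, ENNReal.mul_top (by exact_mod_cast hc.ne')] at h3
    simp at h3
  exact measure_setOfPred_frequently_eq_zero hfin

theorem law_recurrent_eq_zero_of_lt (hd : 2 ≤ d) {μ : ℝ≥0} (hμ : (μ : ℝ) < d / 16) :
    law d μ {ω | Recurrent ω} = 0 := by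
  have : NeZero d := ⟨by omega⟩
  have hd' : (2 : ℝ) ≤ d := by exact_mod_cast hd
  set r : ℝ := Real.sqrt (d * (1 + μ)) with hr
  have hpos : 0 < (d : ℝ) * (1 + μ) := by positivity
  have hr2 : r ^ 2 = d * (1 + μ) := Real.sq_sqrt hpos.le
  have hr0 : 0 < r := Real.sqrt_pos.2 hpos
  -- The assumption gives `4 d (1 + μ) < 4 d + d ^ 2 / 4`, and this is at most `(d + 1) ^ 2` for `d
  -- ≥ 2`, with equality at `d = 2`.
  have hlt : 2 * r < d + 1 := by
    refine lt_of_pow_lt_pow_left₀ 2 (by positivity) ?_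
    rw [mul_pow, hr2]
    nlinarith
  have hc : 0 < 1 - 2 * r / (d + 1) := by
    rw [sub_pos, div_lt_one (by positivity)]
    exact hlt
  -- The value `1 / r` minimizes `1 / t + d (1 + μ) t`; then `c` is exactly the slack that the first
  -- condition leaves.
  obtain ⟨t, ht⟩ : ∃ t : ℝ≥0, (t : ℝ) = 1 / r :=
    ⟨(1 / r).toNNReal, Real.coe_toNNReal _ (by positivity)⟩
  obtain ⟨c, hc'⟩ : ∃ c : ℝ≥0, (c : ℝ) = 1 - 2 * r / (d + 1) :=
    ⟨(1 - 2 * r / (d + 1)).toNNReal, Real.coe_toNNReal _ hc.le⟩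
  refine law_recurrent_eq_zero (t := t) (c := c) ?_ ?_ ?_
  · rw [← NNReal.coe_pos, hc']; exact hc
  · rw [← NNReal.coe_le_coe]
    push_cast
    rw [ht, hc']
    refine le_of_eq ?_
    have : (d : ℝ) + 1 ≠ 0 := by positivity
    rw [← hr2]
    field_simp
    ring
  · rw [← NNReal.coe_le_coe]
    push_cast
    rw [ht, hc']
    have h3 : (1 + (μ : ℝ)) * (1 / r) ≤ 2 * r / (d + 1) := by
      rw [mul_one_div, div_le_div_iff₀ hr0 (by positivity)]
      nlinarith
    linarith

/-! ### Tools for infinite product measures -/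

theorem measurePreserving_split {ι α β Ω : Type*} [MeasurableSpace Ω]
    (p : ι → Measure Ω) [∀ i, IsProbabilityMeasure (p i)] {f : α → ι} {g : β → ι}
    (hf : Function.Injective f) (hg : Function.Injective g) (hfg : ∀ a b, f a ≠ g b) :
    MeasurePreserving (fun (x : ι → Ω) => (fun a => x (f a), fun b => x (g b)))
      (Measure.infinitePi p)
      ((Measure.infinitePi fun a => p (f a)).prod (Measure.infinitePi fun b => p (g b))) :=
  ⟨by fun_prop, infinitePi_map_split p hf hg hfg⟩

theorem measurePreserving_coord_rest {ι Ω : Type*} [MeasurableSpace Ω]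
    (p : ι → Measure Ω) [∀ i, IsProbabilityMeasure (p i)] (i : ι) :
    MeasurePreserving (fun (x : ι → Ω) => (x i, fun j : {j // j ≠ i} => x j))
      (Measure.infinitePi p) ((p i).prod (Measure.infinitePi fun j : {j // j ≠ i} => p j)) := by
  have h1 := measurePreserving_split p (f := fun _ : Unit => i) (g := fun j : {j // j ≠ i} => j.1)
    (fun _ _ _ => rfl) Subtype.val_injective (fun _ b h => b.2 h.symm)
  have h2 := measurePreserving_eval_infinitePi (fun _ : Unit => p i) ()
  exact (h2.prod (MeasurePreserving.id _)).comp h1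

/-- Changing one coordinate in a quasi-measure-preserving way. -/
theorem quasiMeasurePreserving_update {ι Ω : Type*} [MeasurableSpace Ω] [DecidableEq ι]
    (p : ι → Measure Ω) [∀ i, IsProbabilityMeasure (p i)] (i : ι) {T : Ω → Ω}
    (hT : Measure.QuasiMeasurePreserving T (p i) (p i)) :
    Measure.QuasiMeasurePreserving (fun x : ι → Ω => Function.update x i (T (x i)))
      (Measure.infinitePi p) (Measure.infinitePi p) := by
  have h1 := measurePreserving_coord_rest p i
  set G : Ω × ({j // j ≠ i} → Ω) → ι → Ω :=
    fun q j => if h : j = i then q.1 else q.2 ⟨j, h⟩ with hG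
  have hGm : Measurable G := by
    refine measurable_pi_lambda _ fun j => ?_
    by_cases h : j = i
    · simp only [hG, h, dite_true]; exact measurable_fst
    · simp only [hG, h, dite_false]; exact (measurable_pi_apply _).comp measurable_snd
  have hGid : ∀ x : ι → Ω, G (x i, fun j : {j // j ≠ i} => x j) = x := by
    intro x
    funext j
    by_cases h : j = i
    · subst h; simp [hG]
    · simp [hG, h]
  have h2 : MeasurePreserving G ((p i).prod (Measure.infinitePi fun j : {j // j ≠ i} => p j))
      (Measure.infinitePi p) := by
    refine ⟨hGm, ?_⟩
    rw [← h1.map_eq, Measure.map_map hGm h1.measurable]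
    convert Measure.map_id
    funext x
    exact hGid x
  have h3 : Measure.QuasiMeasurePreserving (Prod.map T id)
      ((p i).prod (Measure.infinitePi fun j : {j // j ≠ i} => p j))
      ((p i).prod (Measure.infinitePi fun j : {j // j ≠ i} => p j)) :=
    MeasureTheory.QuasiMeasurePreserving.prodMap hT (Measure.QuasiMeasurePreserving.id _)
  have h4 := h2.quasiMeasurePreserving.comp (h3.comp h1.quasiMeasurePreserving)
  convert h4 using 1
  funext x j
  by_cases h : j = i
  · subst h; simp [hG]
  · simp [hG, h]

/-- Probability measures on sequences that agree on initial cylinders are equal. -/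
theorem ext_of_initial {α : Type*} [MeasurableSpace α] [MeasurableSingletonClass α] [Countable α]
    {ν ν' : Measure (ℕ → α)} [IsProbabilityMeasure ν] [IsProbabilityMeasure ν']
    (h : ∀ n (w : ℕ → α), ν {x | ∀ k < n, x k = w k} = ν' {x | ∀ k < n, x k = w k}) : ν = ν' := by
  have hr : ∀ n, ν.map (Finset.restrict (Finset.range n)) =
      ν'.map (Finset.restrict (π := fun _ => α) (Finset.range n)) := by
    intro n
    refine Measure.ext_of_singleton fun w => ?_
    rw [Measure.map_apply (by fun_prop) (measurableSet_singleton w),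
      Measure.map_apply (by fun_prop) (measurableSet_singleton w)]
    by_cases hn : n = 0
    · subst hn
      have : ∀ S : Set (ℕ → α), S = Finset.restrict (π := fun _ => α) (Finset.range 0) ⁻¹' {w} → S = Set.univ := by
        rintro S rfl
        ext x
        simp only [Set.mem_preimage, Set.mem_singleton_iff, Set.mem_univ, iff_true]
        funext ⟨k, hk⟩
        simp at hk
      rw [this _ rfl, measure_univ, measure_univ]
    · have hset : Finset.restrict (π := fun _ => α) (Finset.range n) ⁻¹' {w} = {x | ∀ k < n, x k =
          if hk : k < n then w ⟨k, Finset.mem_range.2 hk⟩ else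
            w ⟨0, Finset.mem_range.2 (Nat.pos_of_ne_zero hn)⟩} := by
        ext x
        simp only [Set.mem_preimage, Set.mem_singleton_iff, Set.mem_ofPred_eq]
        constructor
        · rintro rfl k hk
          simp [hk]
        · intro hx
          funext ⟨k, hk⟩
          have := hx k (Finset.mem_range.1 hk)
          simpa [Finset.mem_range.1 hk] using this
      rw [hset]
      exact h n _
  refine IsProjectiveLimit.unique (P := fun I : Finset ℕ => ν'.map (Finset.restrict I))
    (fun I => ?_) (fun I => rfl)
  obtain ⟨n, hn⟩ : ∃ n, I ⊆ Finset.range n := I.exists_nat_subset_range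
  have h1 : Finset.restrict (π := fun _ => α) I =
      Finset.restrict₂ hn ∘ Finset.restrict (Finset.range n) := rfl
  rw [h1, ← Measure.map_map (by fun_prop) (by fun_prop), hr,
    Measure.map_map (by fun_prop) (by fun_prop)]
  rfl

theorem uniformSeq_initial {α : Type*} [MeasurableSpace α] [MeasurableSingletonClass α]
    [Fintype α] [Nonempty α] (n : ℕ) (w : ℕ → α) :
    uniformSeq α {x | ∀ k < n, x k = w k} = ((Fintype.card α : ℝ≥0∞)⁻¹) ^ n := by
  have : {x : ℕ → α | ∀ k < n, x k = w k} = Set.pi (Finset.range n) fun k => {w k} := by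
    ext x; simp [Set.mem_pi]
  rw [this, uniformSeq, Measure.infinitePi_pi _ fun _ _ => measurableSet_singleton _]
  simp [uniformOn_univ]

/-- A zero-one law: an event that is invariant under permutations of the coordinates which
displace any given finite set of coordinates is trivial. -/
theorem prob_zero_or_one_of_permutations {ι Ω : Type*} [MeasurableSpace Ω] (p : Measure Ω)
    [IsProbabilityMeasure p] {E : Set (ι → Ω)} (hE : MeasurableSet E)
    (hinv : ∀ F : Finset ι, ∃ π : Equiv.Perm ι, (∀ i ∈ F, π i ∉ F) ∧
      ∀ᵐ x ∂(Measure.infinitePi fun _ : ι => p), (fun i => x (π i)) ∈ E ↔ x ∈ E) :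
    Measure.infinitePi (fun _ : ι => p) E = 0 ∨ Measure.infinitePi (fun _ : ι => p) E = 1 := by
  set P := Measure.infinitePi fun _ : ι => p with hP
  -- Approximate `E` by a cylinder `C` over `F`. Since `π` displaces `F`, the events `C` and `τ ⁻¹'
  -- C` are independent, so that `P E = P (E ∩ τ ⁻¹' E)` is close to `P C ^ 2` and hence to `P E ^
  -- 2`.
  have key : ∀ ε : ℝ, 0 < ε → |P.real E - P.real E ^ 2| ≤ 4 * ε := by
    intro ε hε
    have hdense : P.MeasureDense (measurableCylinders fun _ : ι => Ω) :=
      Measure.MeasureDense.of_generateFrom_isSetAlgebra_finite P isSetAlgebra_measurableCylinders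
        generateFrom_measurableCylinders.symm
    obtain ⟨C, hC, hCE⟩ := hdense.approx E hE (measure_ne_top _ _) ε hε
    obtain ⟨F, S, hS, rfl⟩ := (mem_measurableCylinders C).1 hC
    have hCm := hdense.measurable _ hC
    obtain ⟨π, hπ, hinv⟩ := hinv F
    set τ : (ι → Ω) → ι → Ω := fun x i => x (π i) with hτ
    have hτP : MeasurePreserving τ P P :=
      ⟨by fun_prop, Measure.map_infinitePi_infinitePi_of_inj (P := fun _ : ι => p) π.injective⟩
    set C := cylinder (α := fun _ => Ω) F S with hCdef
    have hindep : P.real (C ∩ τ ⁻¹' C) = P.real C * P.real C := by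
      have hs := measurePreserving_split (fun _ : ι => p) (f := fun i : F => i.1)
        (g := fun i : F => π i.1) Subtype.val_injective
        (π.injective.comp Subtype.val_injective) (fun a b h => hπ b b.2 (h ▸ a.2))
      have h1 : C ∩ τ ⁻¹' C = (fun (x : ι → Ω) =>
          ((fun i : F => x i.1), fun i : F => x (π i.1))) ⁻¹' (S ×ˢ S) := rfl
      have h2 : P C = Measure.infinitePi (fun _ : F => p) S := by
        have h3 := Measure.map_infinitePi_infinitePi_of_inj (P := fun _ : ι => p)
          (f := fun i : F => i.1) Subtype.val_injective
        rw [← h3, Measure.map_apply (by fun_prop) hS]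
        rfl
      rw [measureReal_def, measureReal_def, ← ENNReal.toReal_mul, h1,
        hs.measure_preimage (hS.prod hS).nullMeasurableSet, Measure.prod_prod, h2]
    have hd : P.real (E ∆ C) < ε := by
      rw [measureReal_def]
      exact (ENNReal.lt_ofReal_iff_toReal_lt (measure_ne_top _ _)).1 hCE
    have hdτ : P.real ((τ ⁻¹' E) ∆ (τ ⁻¹' C)) < ε := by
      have : (τ ⁻¹' E) ∆ (τ ⁻¹' C) = τ ⁻¹' (E ∆ C) := rfl
      rw [this, measureReal_def, hτP.measure_preimage (hE.symmDiff hCm).nullMeasurableSet]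
      exact hd
    have hEτ : P.real (E ∩ τ ⁻¹' E) = P.real E := by
      refine measureReal_congr ?_
      filter_upwards [hinv] with x hx
      refine propext ?_
      change (x ∈ E ∧ τ x ∈ E) ↔ x ∈ E
      rw [hτ]
      dsimp only
      rw [hx, and_self]
    have h1 : |P.real E - P.real C| ≤ P.real (E ∆ C) :=
      abs_measureReal_sub_le_measureReal_symmDiff hE.nullMeasurableSet hCm.nullMeasurableSet
    have h2 : |P.real (E ∩ τ ⁻¹' E) - P.real (C ∩ τ ⁻¹' C)| ≤
        P.real ((E ∩ τ ⁻¹' E) ∆ (C ∩ τ ⁻¹' C)) :=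
      abs_measureReal_sub_le_measureReal_symmDiff
        (hE.inter (hτP.measurable hE)).nullMeasurableSet
        (hCm.inter (hτP.measurable hCm)).nullMeasurableSet
    have h3 : P.real ((E ∩ τ ⁻¹' E) ∆ (C ∩ τ ⁻¹' C)) ≤
        P.real (E ∆ C) + P.real ((τ ⁻¹' E) ∆ (τ ⁻¹' C)) := by
      refine (measureReal_mono (fun x hx => ?_)).trans (measureReal_union_le _ _)
      simp only [Set.mem_symmDiff, Set.mem_inter_iff, Set.mem_union] at hx ⊢
      tauto
    rw [hEτ, hindep] at h2
    have h4 := abs_le.1 h1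
    have h5 := abs_le.1 (h2.trans h3)
    have hE1 : P.real E ≤ 1 := measureReal_le_one
    have hC1 : P.real C ≤ 1 := measureReal_le_one
    have hE0 : 0 ≤ P.real E := measureReal_nonneg
    have hC0 : 0 ≤ P.real C := measureReal_nonneg
    rw [abs_le]
    constructor <;> nlinarith
  have h0 : P.real E - P.real E ^ 2 = 0 := by
    by_contra hne
    have := key (|P.real E - P.real E ^ 2| / 8) (by positivity)
    have h1 : 0 < |P.real E - P.real E ^ 2| := abs_pos.2 hne
    linarith
  have h1 : P.real E * (1 - P.real E) = 0 := by linarith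
  rcases mul_eq_zero.1 h1 with h | h
  · left
    rwa [measureReal_def, ENNReal.toReal_eq_zero_iff, or_iff_left (measure_ne_top _ _)] at h
  · right
    have h2 : P.real E = 1 := by linarith
    rw [measureReal_def] at h2
    rw [← ENNReal.ofReal_toReal (measure_ne_top P E), h2, ENNReal.ofReal_one]

/-! ### Decomposition of the environment -/

theorem measurePreserving_node (μ : ℝ≥0) :
    MeasurePreserving (fun e : Env d => (e [], fun i => sub i e)) (envLaw d μ)
      ((siteLaw d μ).prod (Measure.infinitePi fun _ : Fin d => envLaw d μ)) := by
  have h1 := measurePreserving_split (fun _ : Vertex d => siteLaw d μ)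
    (f := fun _ : Unit => ([] : Vertex d)) (g := fun q : Fin d × Vertex d => q.2 ++ [q.1])
    (fun _ _ _ => rfl) (fun q q' h => by
      have := List.append_inj' h rfl
      exact Prod.ext (by simpa using this.2) this.1) (fun _ q h => by simp at h)
  have h2 := measurePreserving_eval_infinitePi (fun _ : Unit => siteLaw d μ) ()
  have h3 : MeasurePreserving (fun (x : Fin d × Vertex d → Site d) i v => x (i, v))
      (Measure.infinitePi fun _ : Fin d × Vertex d => siteLaw d μ)
      (Measure.infinitePi fun _ : Fin d => envLaw d μ) :=
    ⟨by fun_prop, Measure.infinitePi_map_curry fun (_ : Fin d) (_ : Vertex d) => siteLaw d μ⟩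
  exact (h2.prod h3).comp h1

theorem measurePreserving_descendant (μ : ℝ≥0) (v : Vertex d) :
    MeasurePreserving (fun (e : Env d) w => e (w ++ v)) (envLaw d μ) (envLaw d μ) :=
  ⟨by fun_prop, Measure.map_infinitePi_infinitePi_of_inj (P := fun _ : Vertex d => siteLaw d μ)
    (List.append_left_injective v)⟩

/-! ### Gluing an environment from its parts -/

def glue (q : Site d × (Fin d → Env d)) : Env d :=
  fun v => if h : v = [] then q.1 else q.2 (v.getLast h) v.dropLast

@[simp] theorem glue_nil (q : Site d × (Fin d → Env d)) : glue q [] = q.1 := by simp [glue]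

@[simp] theorem sub_glue (q : Site d × (Fin d → Env d)) (i : Fin d) : sub i (glue q) = q.2 i := by
  funext v
  simp [sub, glue]

theorem glue_node (e : Env d) : glue (e [], fun i => sub i e) = e := by
  funext v
  rcases List.eq_nil_or_concat v with rfl | ⟨w, i, rfl⟩
  · simp
  · simp [glue, sub]

theorem measurable_glue : Measurable (glue (d := d)) := by
  refine measurable_pi_lambda _ fun v => ?_
  by_cases h : v = []
  · simp only [glue, h, dite_true]; exact measurable_fst
  · simp only [glue, h, dite_false]
    exact (measurable_pi_apply _).comp ((measurable_pi_apply _).comp measurable_snd)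

theorem exits_glue (q : Site d × (Fin d → Env d)) (m : ℕ) :
    exits (glue q) m = node q.1.1 q.1.2 (fun i => exits (q.2 i)) m := by
  rw [exits_eq_node]; simp

noncomputable def childrenLaw (d : ℕ) (μ : ℝ≥0) : Measure (Fin d → Env d) :=
  Measure.infinitePi fun _ => envLaw d μ

instance (μ : ℝ≥0) : IsProbabilityMeasure (childrenLaw d μ) := by
  unfold childrenLaw; infer_instance

theorem measurePreserving_glue (μ : ℝ≥0) :
    MeasurePreserving (glue (d := d)) ((siteLaw d μ).prod (childrenLaw d μ)) (envLaw d μ) := by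
  refine ⟨measurable_glue, ?_⟩
  rw [childrenLaw, ← (measurePreserving_node μ).map_eq,
    Measure.map_map measurable_glue (measurePreserving_node μ).measurable]
  convert Measure.map_id
  funext e
  exact glue_node e

/-! ### Stacks with a given sequence of downward instructions -/

/-- The stack whose upward instructions are those of `b` and whose downward instructions are
taken from `τ`, in order. -/
def merge (b : ℕ → Option (Fin d)) (τ : ℕ → Fin d) (k : ℕ) : Option (Fin d) :=
  if b k = none then none else some (τ (Nat.count (fun j => b j ≠ none) k))

theorem merge_eq_none_iff {b : ℕ → Option (Fin d)} {τ : ℕ → Fin d} {k : ℕ} :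
    merge b τ k = none ↔ b k = none := by
  unfold merge; split_ifs with h <;> simp [h]

theorem instrCount_merge_none (b : ℕ → Option (Fin d)) (τ : ℕ → Fin d) (n : ℕ) :
    instrCount (merge b τ) none n + Nat.count (fun j => b j ≠ none) n = n := by
  induction n with
  | zero => simp [instrCount]
  | succ n ih =>
    rw [instrCount_succ, Nat.count_succ, if_congr merge_eq_none_iff rfl rfl]
    by_cases h : b n = none
    · rw [if_pos h, if_neg (by simp [h])]; omega
    · rw [if_neg h, if_pos h]; omega

theorem instrCount_merge_some (b : ℕ → Option (Fin d)) (τ : ℕ → Fin d) (i : Fin d) (n : ℕ) :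
    instrCount (merge b τ) (some i) n =
      Nat.count (fun k => τ k = i) (Nat.count (fun j => b j ≠ none) n) := by
  induction n with
  | zero => simp [instrCount]
  | succ n ih =>
    rw [instrCount_succ, Nat.count_succ, ih, merge]
    by_cases h : b n = none
    · simp [h]
    · simp [h, Nat.count_succ]

theorem measurable_merge :
    Measurable fun q : (ℕ → Option (Fin d)) × (ℕ → Fin d) => merge q.1 q.2 := by
  refine measurable_pi_lambda _ fun k => ?_
  have hc : ∀ k, Measurable fun q : (ℕ → Option (Fin d)) × (ℕ → Fin d) =>
      Nat.count (fun j => q.1 j ≠ none) k := by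
    intro k
    induction k with
    | zero => simp only [Nat.count_zero]; exact measurable_const
    | succ k ih =>
      simp only [Nat.count_succ]
      refine ih.add (Measurable.ite ?_ measurable_const measurable_const)
      exact (measurableSet_eq_fun ((measurable_pi_apply k).comp measurable_fst)
        measurable_const).compl
  have h1 : Measurable fun q : (ℕ → Fin d) × ℕ => some (q.1 q.2) :=
    measurable_from_prod_countable_left fun n => measurable_from_top.comp (measurable_pi_apply n)
  exact Measurable.ite (measurableSet_eq_fun ((measurable_pi_apply k).comp measurable_fst)
    measurable_const) measurable_const (h1.comp (measurable_snd.prodMk (hc k)))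

theorem merge_initial [NeZero d] (w : ℕ → Option (Fin d)) (n : ℕ) : ∃ t : ℕ → Fin d, ∀ b τ,
    (∀ k < n, merge b τ k = w k) ↔ (∀ k < n, b k = none ↔ w k = none) ∧
      ∀ j < Nat.count (fun k => w k ≠ none) n, τ j = t j := by
  induction n with
  | zero => exact ⟨fun _ => 0, by simp⟩
  | succ n ih =>
    obtain ⟨t, ht⟩ := ih
    have hcount : ∀ b : ℕ → Option (Fin d), (∀ k < n, b k = none ↔ w k = none) →
        Nat.count (fun j => b j ≠ none) n = Nat.count (fun k => w k ≠ none) n := by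
      intro b hb
      rw [Nat.count_eq_card_filter_range, Nat.count_eq_card_filter_range]
      congr 1
      refine Finset.filter_congr fun k hk => ?_
      rw [Ne, hb k (Finset.mem_range.1 hk)]
    have hsplit : ∀ p : ℕ → Prop, (∀ k < n + 1, p k) ↔ (∀ k < n, p k) ∧ p n :=
      fun p => ⟨fun h => ⟨fun k hk => h k (by omega), h n (by omega)⟩,
        fun ⟨h1, h2⟩ k hk => (Nat.lt_succ_iff_lt_or_eq.1 hk).elim (h1 k) (fun h => h ▸ h2)⟩
    cases hw : w n with
    | none =>
      refine ⟨t, fun b τ => ?_⟩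
      rw [hsplit, hsplit (fun k => b k = none ↔ w k = none), ht, Nat.count_succ, hw,
        merge_eq_none_iff]
      simp only [ne_eq, not_true_eq_false, if_false, add_zero, iff_true]
      tauto
    | some i =>
      refine ⟨Function.update t (Nat.count (fun k => w k ≠ none) n) i, fun b τ => ?_⟩
      rw [hsplit, hsplit (fun k => b k = none ↔ w k = none), ht, Nat.count_succ, hw]
      simp only [ne_eq, reduceCtorEq, not_false_eq_true, if_true, iff_false]
      rw [show (∀ j < Nat.count (fun k => ¬ w k = none) n + 1, τ j = Function.update t
        (Nat.count (fun k => w k ≠ none) n) i j) ↔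
        (∀ j < Nat.count (fun k => w k ≠ none) n, τ j = t j) ∧
          τ (Nat.count (fun k => w k ≠ none) n) = i from ?_]
      · constructor
        · rintro ⟨⟨h1, h2⟩, h3⟩
          rw [merge, hcount b h1] at h3
          split_ifs at h3 with hb
          exact ⟨⟨h1, hb⟩, h2, by simpa using h3⟩
        · rintro ⟨⟨h1, hb⟩, h2, h3⟩
          refine ⟨⟨h1, h2⟩, ?_⟩
          rw [merge, hcount b h1, if_neg hb, h3]
      · constructor
        · intro h
          refine ⟨fun j hj => ?_, ?_⟩
          · have := h j (by simp only [ne_eq] at hj; omega)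
            rwa [Function.update_of_ne (by omega)] at this
          · have := h _ (Nat.lt_succ_self _)
            rwa [Function.update_self] at this
        · rintro ⟨h1, h2⟩ j hj
          rcases Nat.lt_succ_iff_lt_or_eq.1 hj with hj | hj
          · rw [Function.update_of_ne (by simp only [ne_eq]; omega)]
            exact h1 j hj
          · rw [hj]
            simp only [ne_eq] at h2 ⊢
            rw [Function.update_self, h2]

/-- In a uniform stack the positions of the upward instructions are independent of the sequence of
downward directions, which is uniform. On cylinders this is the identity `d / (d + 1) * (1 / d) = 1
/ (d + 1)`, once for each downward instruction. -/
theorem measurePreserving_merge [NeZero d] :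
    MeasurePreserving (fun q : (ℕ → Option (Fin d)) × (ℕ → Fin d) => merge q.1 q.2)
      ((uniformSeq (Option (Fin d))).prod (uniformSeq (Fin d))) (uniformSeq (Option (Fin d))) := by
  refine ⟨measurable_merge, ?_⟩
  have : IsProbabilityMeasure (((uniformSeq (Option (Fin d))).prod (uniformSeq (Fin d))).map
      fun q : (ℕ → Option (Fin d)) × (ℕ → Fin d) => merge q.1 q.2) :=
    Measure.isProbabilityMeasure_map measurable_merge.aemeasurable
  refine ext_of_initial fun n w => ?_
  obtain ⟨t, ht⟩ := merge_initial w n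
  have hmeas : MeasurableSet {x : ℕ → Option (Fin d) | ∀ k < n, x k = w k} := by
    have : {x : ℕ → Option (Fin d) | ∀ k < n, x k = w k} = ⋂ k, ⋂ (_ : k < n), {x | x k = w k} := by
      ext; simp
    rw [this]
    exact MeasurableSet.iInter fun k => MeasurableSet.iInter fun _ =>
      measurableSet_eq_fun (measurable_pi_apply k) measurable_const
  rw [Measure.map_apply measurable_merge hmeas, uniformSeq_initial]
  have hset : (fun q : (ℕ → Option (Fin d)) × (ℕ → Fin d) => merge q.1 q.2) ⁻¹'
      {x | ∀ k < n, x k = w k} =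
      (Set.pi (Finset.range n) fun k => {o | o = none ↔ w k = none}) ×ˢ
        {τ | ∀ j < Nat.count (fun k => w k ≠ none) n, τ j = t j} := by
    ext ⟨b, τ⟩
    simp only [Set.mem_preimage, Set.mem_ofPred_eq, ht, Set.mem_prod, Set.mem_pi, Finset.mem_coe,
      Finset.mem_range]
  rw [hset, Measure.prod_prod, uniformSeq_initial, uniformSeq,
    Measure.infinitePi_pi _ fun _ _ => MeasurableSet.of_discrete]
  have hd : (d : ℝ≥0∞) ≠ 0 := by exact_mod_cast NeZero.ne d
  have hone : ∀ k, uniformOn Set.univ {o : Option (Fin d) | o = none ↔ w k = none} =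
      (if w k ≠ none then (d : ℝ≥0∞) else 1) * (d + 1 : ℝ≥0∞)⁻¹ := by
    intro k
    rw [uniformOn_univ, ENNReal.div_eq_inv_mul, mul_comm, Fintype.card_option, Fintype.card_fin]
    congr 1
    · by_cases hk : w k = none
      · have : {o : Option (Fin d) | o = none ↔ w k = none} = {none} := by ext o; simp [hk]
        rw [this, Measure.count_singleton]
        simp [hk]
      · have : {o : Option (Fin d) | o = none ↔ w k = none} =
            ((Finset.univ.map Function.Embedding.some : Finset (Option (Fin d))) : Set _) := by
          ext o
          cases o <;> simp [hk]
        rw [this, Measure.count_apply_finset]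
        simp [hk]
    · push_cast; rfl
  simp_rw [hone]
  rw [Finset.prod_mul_distrib, Finset.prod_const, Finset.card_range, Finset.prod_ite,
    Finset.prod_const, Finset.prod_const_one, mul_one, ← Nat.count_eq_card_filter_range,
    Fintype.card_fin, Fintype.card_option, Fintype.card_fin, mul_right_comm, ← mul_pow,
    ENNReal.mul_inv_cancel hd (by simp), one_pow, one_mul]
  push_cast
  rfl

/-! ### Reflection at the top -/

/-- Suppose that `A` departures suffice, and that `B` of them go down. The hypothesis at `B` says
that the children return at least `B` frogs, so `A ≥ m + B`, and the `A - B` remaining departures go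
up. -/
theorem le_node_merge {τ : ℕ → Fin d} {Y : Fin d → ℕ → ℕ∞}
    (h : ∀ A : ℕ, (A : ℕ∞) < 1 + ∑ i, Y i (Nat.count (fun k => τ k = i) A))
    (N : ℕ) (b : ℕ → Option (Fin d)) (m : ℕ) : (m : ℕ∞) ≤ node N (merge b τ) Y m := by
  rw [le_node_iff]
  intro A hA
  set B := Nat.count (fun j => b j ≠ none) A with hB
  have h1 := instrCount_merge_none b τ A
  have h2 := h B
  simp_rw [instrCount_merge_some, ← hB] at hA
  set S := ∑ i, Y i (Nat.count (fun k => τ k = i) B) with hS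
  have hfin : S ≠ ⊤ := by
    intro h0
    rw [h0, add_top] at hA
    exact absurd hA (by simp)
  obtain ⟨s, hs⟩ := ENat.ne_top_iff_exists.1 hfin
  rw [← hs] at hA h2
  norm_cast at hA h2 ⊢
  split_ifs at hA <;> omega

/-- If the frog model is recurrent with positive probability, then so is the event that at least
as many frogs leave as enter. -/
theorem law_recurrent_le [NeZero d] (μ : ℝ≥0) :
    law d μ {ω | Recurrent ω} ≤ envLaw d μ {e | ∀ m : ℕ, (m : ℕ∞) ≤ exits e m} := by
  set R : Set ((ℕ → Fin d) × (Fin d → Env d)) := {q | ∀ A : ℕ, (A : ℕ∞) <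
    1 + ∑ i, exits (q.2 i) (Nat.count (fun k => q.1 k = i) A)} with hR
  have hexm : ∀ i : Fin d, Measurable fun q : (ℕ → Fin d) × (Fin d → Env d) =>
      fun m => exits (q.2 i) m := fun i => measurable_pi_lambda _ fun m =>
    (measurable_exits m).comp ((measurable_pi_apply i).comp measurable_snd)
  have hcm : ∀ (i : Fin d) A, Measurable fun q : (ℕ → Fin d) × (Fin d → Env d) =>
      Nat.count (fun k => q.1 k = i) A := by
    intro i A
    induction A with
    | zero => simp only [Nat.count_zero]; exact measurable_const
    | succ A ih =>
      simp only [Nat.count_succ]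
      exact ih.add (Measurable.ite (measurableSet_eq_fun ((measurable_pi_apply A).comp
        measurable_fst) measurable_const) measurable_const measurable_const)
  have hRm : MeasurableSet R := by
    have : R = ⋂ A : ℕ, {q | (A : ℕ∞) <
        1 + ∑ i, exits (q.2 i) (Nat.count (fun k => q.1 k = i) A)} := by
      ext q; simp [hR]
    rw [this]
    refine MeasurableSet.iInter fun A => ?_
    have hev : Measurable fun q : (ℕ → ℕ∞) × ℕ => q.1 q.2 :=
      measurable_from_prod_countable_left fun n => measurable_pi_apply n
    have hsum : Measurable fun q : (ℕ → Fin d) × (Fin d → Env d) =>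
        fun i => exits (q.2 i) (Nat.count (fun k => q.1 k = i) A) :=
      measurable_pi_lambda _ fun i => hev.comp ((hexm i).prodMk (hcm i A))
    have hG : Measurable fun y : Fin d → ℕ∞ => 1 + ∑ i, y i := measurable_of_countable _
    exact (hG.comp hsum) (Set.to_countable (Set.Ioi (A : ℕ∞))).measurableSet
  have h1 : law d μ {ω | Recurrent ω} = ((uniformSeq (Fin d)).prod (childrenLaw d μ)) R := by
    have hmp := (MeasurePreserving.id (uniformSeq (Fin d))).prod
      ((measurePreserving_snd (μ := siteLaw d μ) (ν := childrenLaw d μ)).comp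
        (measurePreserving_node μ))
    rw [law_recurrent_eq_env, ← hmp.measure_preimage hRm.nullMeasurableSet]
    congr 1
    ext ⟨τ, e⟩
    exact exits_rootEnv_eq_top_iff τ e
  have hEm : MeasurableSet {e : Env d | ∀ m : ℕ, (m : ℕ∞) ≤ exits e m} := by
    have : {e : Env d | ∀ m : ℕ, (m : ℕ∞) ≤ exits e m} =
        ⋂ m : ℕ, {e | (m : ℕ∞) ≤ exits e m} := by
      ext e; simp
    rw [this]
    exact MeasurableSet.iInter fun m => measurable_exits m
      (Set.to_countable (Set.Ici (m : ℕ∞))).measurableSet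
  have hmp1 := (measurePreserving_glue (d := d) μ).comp
    (((MeasurePreserving.id (poissonMeasure μ)).prod (measurePreserving_merge (d := d))).prod
      (MeasurePreserving.id (childrenLaw d μ)))
  have hmp2 : MeasurePreserving
      (fun q : (ℕ × ((ℕ → Option (Fin d)) × (ℕ → Fin d))) × (Fin d → Env d) => (q.1.2.2, q.2))
      (((poissonMeasure μ).prod ((uniformSeq (Option (Fin d))).prod (uniformSeq (Fin d)))).prod
        (childrenLaw d μ)) ((uniformSeq (Fin d)).prod (childrenLaw d μ)) :=
    (measurePreserving_snd.comp measurePreserving_snd).prod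
      (MeasurePreserving.id (childrenLaw d μ))
  rw [h1, ← hmp2.measure_preimage hRm.nullMeasurableSet,
    ← hmp1.measure_preimage hEm.nullMeasurableSet]
  refine measure_mono fun q hq m => ?_
  change (m : ℕ∞) ≤ exits (glue ((q.1.1, merge q.1.2.1 q.1.2.2), q.2)) m
  rw [exits_glue]
  exact le_node_merge hq _ _ m

/-! ### Local changes of the environment -/

/-- An admissible `A` is at least `m`. For large `m` only large arguments of the counts and of the
`Y i` occur, where the two sides agree; regularity makes the arguments of `Y i` large. -/
theorem node_eventuallyEq {s s' : ℕ → Option (Fin d)} {Y Y' : Fin d → ℕ → ℕ∞} (N : ℕ)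
    (hs : ∀ o, instrCount s o =ᶠ[atTop] instrCount s' o) (hr : Regular s)
    (hY : ∀ i, Y i =ᶠ[atTop] Y' i) : node N s Y =ᶠ[atTop] node N s' Y' := by
  have h1 : ∀ᶠ A in atTop, (∀ o, instrCount s o A = instrCount s' o A) ∧
      ∀ i, Y i (instrCount s (some i) A) = Y' i (instrCount s (some i) A) :=
    (eventually_all.2 hs).and
      (eventually_all.2 fun i => (hr.tendsto_atTop (some i)).eventually (hY i))
  obtain ⟨M, hM⟩ := eventually_atTop.1 h1
  filter_upwards [eventually_ge_atTop M] with m hm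
  have hA : ∀ {Z : Fin d → ℕ → ℕ∞} {t : ℕ → Option (Fin d)} {A : ℕ},
      ((m + if m = 0 then 0 else N : ℕ) : ℕ∞) + ∑ i, Z i (instrCount t (some i) A) ≤ A →
      M ≤ A := by
    intro Z t A h
    have h2 : ((m + if m = 0 then 0 else N : ℕ) : ℕ∞) ≤ A := le_self_add.trans h
    norm_cast at h2
    omega
  refine le_antisymm (le_iInf fun A => ?_) (le_iInf fun A => ?_)
  · obtain ⟨h2, h3⟩ := hM A.1 (hA A.2)
    refine iInf_le_of_le ⟨A.1, ?_⟩ (by rw [h2])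
    refine le_of_eq_of_le ?_ A.2
    congr 1
    exact Finset.sum_congr rfl fun i _ => by rw [h3, h2]
  · obtain ⟨h2, h3⟩ := hM A.1 (hA A.2)
    refine iInf_le_of_le ⟨A.1, ?_⟩ (by rw [h2])
    refine le_of_eq_of_le ?_ A.2
    congr 1
    exact Finset.sum_congr rfl fun i _ => by rw [← h2, h3]

theorem exits_eq_node' (e : Env d) :
    exits e = node (e []).1 (e []).2 (fun i => exits (sub i e)) := funext (exits_eq_node e)

theorem exits_eventuallyEq {e e' : Env d} (D : ℕ) (hD : ∀ v, D ≤ v.length → e v = e' v)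
    (hN : ∀ v, (e v).1 = (e' v).1)
    (hs : ∀ v o, instrCount (e v).2 o =ᶠ[atTop] instrCount (e' v).2 o)
    (hr : ∀ v, Regular (e v).2) : exits e =ᶠ[atTop] exits e' := by
  induction D generalizing e e' with
  | zero =>
    have : e = e' := funext fun v => hD v (Nat.zero_le _)
    rw [this]
  | succ D ih =>
    rw [exits_eq_node', exits_eq_node' e', ← hN []]
    refine node_eventuallyEq _ (hs []) (hr []) fun i => ih (fun v hv => ?_) (fun v => hN _)
      (fun v => hs _) (fun v => hr _)
    exact hD _ (by simp; omega)

/-- A change below `v` that does not affect the tree at `v` for many frogs does not affect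
the whole tree for many frogs. -/
theorem exits_eventuallyEq_of_descendant {e e' : Env d} (v : Vertex d)
    (hv : ∀ w, ¬ v <:+ w → e w = e' w) (hr : ∀ w, Regular (e w).2)
    (h : exits (fun w => e (w ++ v)) =ᶠ[atTop] exits fun w => e' (w ++ v)) :
    exits e =ᶠ[atTop] exits e' := by
  induction v using List.reverseRecOn generalizing e e' with
  | nil => simpa using h
  | append_singleton v i ih =>
    have h0 : e [] = e' [] := hv [] (by simp)
    rw [exits_eq_node', exits_eq_node' e', ← h0]
    refine node_eventuallyEq _ (fun o => EventuallyEq.rfl) (hr []) fun j => ?_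
    by_cases hj : j = i
    · subst hj
      refine ih (fun w hw => hv _ ?_) (fun w => hr _) ?_
      · rintro ⟨t, ht⟩
        rw [← List.append_assoc] at ht
        exact hw ⟨t, List.append_cancel_right ht⟩
      · simpa [sub] using h
    · have : sub j e = sub j e' := by
        funext w
        refine hv _ ?_
        rintro ⟨t, ht⟩
        rw [← List.append_assoc] at ht
        exact hj (by simpa using (List.append_inj' ht rfl).2.symm)
      rw [this]

/-- The stack `s` preceded by the instruction `o`. -/
def consStack {α : Type*} (o : α) (s : ℕ → α) : ℕ → α
  | 0 => o
  | n + 1 => s n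

theorem instrCount_consStack (o o' : Option (Fin d)) (s : ℕ → Option (Fin d)) (n : ℕ) :
    instrCount (consStack o s) o' (n + 1) = instrCount s o' n + if o = o' then 1 else 0 := by
  induction n with
  | zero => rw [instrCount_succ, instrCount_zero, instrCount_zero]; rfl
  | succ n ih =>
    rw [instrCount_succ, ih, instrCount_succ, add_right_comm]
    rfl

theorem node_succ_sleepers (N : ℕ) (s : ℕ → Option (Fin d)) (Y : Fin d → ℕ → ℕ∞) {m : ℕ}
    (hm : m ≠ 0) : node (N + 1) s Y m = node N s Y (m + 1) := by
  unfold node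
  rw [if_neg hm, if_neg (Nat.succ_ne_zero m), show m + (N + 1) = m + 1 + N by omega]

/-- The frog that uses the additional instruction goes directly to the child `i`, so one frog more
at the top and the instruction in front amount to a shift of the argument of `Y i` by one. -/
theorem node_consStack (N : ℕ) (i : Fin d) (s : ℕ → Option (Fin d)) (Y : Fin d → ℕ → ℕ∞) {m : ℕ}
    (hm : m ≠ 0) : node N (consStack (some i) s) Y (m + 1) =
      node N s (fun j k => Y j (k + if i = j then 1 else 0)) m := by
  have key : ∀ A : ℕ, ((m + 1 + if m + 1 = 0 then 0 else N : ℕ) : ℕ∞) +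
      ∑ j, Y j (instrCount (consStack (some i) s) (some j) (A + 1)) ≤ (A + 1 : ℕ) ↔
      ((m + if m = 0 then 0 else N : ℕ) : ℕ∞) +
      ∑ j, Y j (instrCount s (some j) A + if i = j then 1 else 0) ≤ A := by
    intro A
    simp only [instrCount_consStack, Option.some.injEq]
    rw [if_neg hm, if_neg (Nat.succ_ne_zero m)]
    generalize ∑ j, Y j (instrCount s (some j) A + if i = j then 1 else 0) = S
    cases S using ENat.recTopCoe with
    | top => simp [add_top]
    | coe S => norm_cast; omega
  have hc : ∀ A, instrCount (consStack (some i) s) none (A + 1) = instrCount s none A := by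
    intro A
    rw [instrCount_consStack, if_neg (by simp), add_zero]
  refine le_antisymm (le_iInf fun A => ?_) (le_iInf fun A => ?_)
  · exact iInf_le_of_le ⟨A.1 + 1, (key A.1).2 A.2⟩ (by rw [hc])
  · obtain ⟨A, hA⟩ := A
    cases A with
    | zero =>
      have h2 : ((m + 1 + if m + 1 = 0 then 0 else N : ℕ) : ℕ∞) ≤ (0 : ℕ) := le_self_add.trans hA
      have h3 := Nat.cast_le.1 h2
      omega
    | succ A => exact iInf_le_of_le ⟨A, (key A).1 hA⟩ (by rw [hc])

/-! ### Moving an additional sleeper towards the top -/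

def addSleeper (v : Vertex d) (N : Vertex d → ℕ) : Vertex d → ℕ := Function.update N v (N v + 1)

def pushStack (v : Vertex d) (i : Fin d) (σ : Vertex d → ℕ → Option (Fin d)) :
    Vertex d → ℕ → Option (Fin d) := Function.update σ v (consStack (some i) (σ v))

def mkEnv (N : Vertex d → ℕ) (σ : Vertex d → ℕ → Option (Fin d)) : Env d := fun v => (N v, σ v)

theorem exits_addSleeper_nil (N : Vertex d → ℕ) (σ : Vertex d → ℕ → Option (Fin d)) {m : ℕ}
    (hm : m ≠ 0) : exits (mkEnv (addSleeper [] N) σ) m = exits (mkEnv N σ) (m + 1) := by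
  rw [exits_eq_node, exits_eq_node]
  have h1 : ∀ i, sub i (mkEnv (addSleeper [] N) σ) = sub i (mkEnv N σ) := by
    intro i; funext w; simp [sub, mkEnv, addSleeper]
  simp only [h1]
  have h2 : (mkEnv (addSleeper [] N) σ []).1 = N [] + 1 := by simp [mkEnv, addSleeper]
  rw [h2, node_succ_sleepers _ _ _ hm]
  rfl

/-- When many frogs enter, both sites are visited. A sleeper at the child is then the same as a
sleeper at the top whose move is prescribed by an additional instruction towards that child. -/
theorem exits_addSleeper_child (i : Fin d) (N : Vertex d → ℕ) (σ : Vertex d → ℕ → Option (Fin d))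
    (hr : Regular (σ [])) : exits (mkEnv (addSleeper [i] N) σ) =ᶠ[atTop]
      exits (mkEnv (addSleeper [] N) (pushStack [] i σ)) := by
  have h1 : exits (mkEnv (addSleeper [] N) (pushStack [] i σ)) =ᶠ[atTop]
      node (N []) (σ []) fun j k => exits (sub j (mkEnv N σ)) (k + if i = j then 1 else 0) := by
    filter_upwards [eventually_ne_atTop 0] with m hm
    rw [exits_addSleeper_nil _ _ hm, exits_eq_node]
    have h2 : mkEnv N (pushStack [] i σ) [] = (N [], consStack (some i) (σ [])) := by
      simp [mkEnv, pushStack]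
    have h3 : ∀ j, sub j (mkEnv N (pushStack [] i σ)) = sub j (mkEnv N σ) := by
      intro j; funext w; simp [sub, mkEnv, pushStack]
    simp only [h2, h3]
    rw [node_consStack _ _ _ _ hm]
  refine EventuallyEq.trans ?_ h1.symm
  rw [exits_eq_node']
  have h4 : mkEnv (addSleeper [i] N) σ [] = (N [], σ []) := by simp [mkEnv, addSleeper]
  rw [h4]
  refine node_eventuallyEq _ (fun o => EventuallyEq.rfl) hr fun j => ?_
  by_cases hj : i = j
  · subst hj
    filter_upwards [eventually_ne_atTop 0] with m hm
    have h5 : sub i (mkEnv (addSleeper [i] N) σ) = mkEnv (addSleeper [] fun w => N (w ++ [i]))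
        fun w => σ (w ++ [i]) := by
      funext w
      by_cases hw : w = []
      · subst hw; simp [sub, mkEnv, addSleeper]
      · simp [sub, mkEnv, addSleeper, hw]
    rw [h5, exits_addSleeper_nil _ _ hm, if_pos rfl]
    rfl
  · have h5 : sub j (mkEnv (addSleeper [i] N) σ) = sub j (mkEnv N σ) := by
      funext w
      have : w ++ [j] ≠ [i] := by
        intro h
        have := (List.append_inj' (s₁ := w) (s₂ := []) h rfl).2
        simp at this
        exact hj this.symm
      simp [sub, mkEnv, addSleeper, this]
    rw [h5]
    simp [hj]

theorem exits_addSleeper_cons (i : Fin d) (v : Vertex d) (N : Vertex d → ℕ)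
    (σ : Vertex d → ℕ → Option (Fin d)) (hr : ∀ w, Regular (σ w)) :
    exits (mkEnv (addSleeper (i :: v) N) σ) =ᶠ[atTop]
      exits (mkEnv (addSleeper v N) (pushStack v i σ)) := by
  refine exits_eventuallyEq_of_descendant v (fun w hw => ?_) (fun w => hr w) ?_
  · have h1 : w ≠ v := fun h => hw (h ▸ List.suffix_refl _)
    have h2 : w ≠ i :: v := fun h => hw (h ▸ List.suffix_cons _ _)
    simp [mkEnv, addSleeper, pushStack, h1, h2]
  · have := exits_addSleeper_child i (fun w => N (w ++ v)) (fun w => σ (w ++ v)) (hr _)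
    convert this using 2
    · funext w
      by_cases hw : w = [i]
      · subst hw; simp [mkEnv, addSleeper]
      · have : w ++ v ≠ i :: v := fun h => hw (List.append_cancel_right (cs := [i]) (bs := v) h)
        simp [mkEnv, addSleeper, hw, this]
    · funext w
      by_cases hw : w = []
      · subst hw; simp [mkEnv, addSleeper, pushStack]
      · simp [mkEnv, addSleeper, pushStack, hw]

/-! ### The law of the stacks -/

noncomputable def stackLaw (d : ℕ) : Measure (Vertex d → ℕ → Option (Fin d)) :=
  Measure.infinitePi fun _ => uniformSeq (Option (Fin d))

instance : IsProbabilityMeasure (stackLaw d) := by unfold stackLaw; infer_instance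

noncomputable def sleeperLaw (d : ℕ) (μ : ℝ≥0) : Measure (Vertex d → ℕ) :=
  Measure.infinitePi fun _ => poissonMeasure μ

instance (μ : ℝ≥0) : IsProbabilityMeasure (sleeperLaw d μ) := by unfold sleeperLaw; infer_instance

theorem measurable_mkEnv :
    Measurable fun x : (Vertex d → ℕ) × (Vertex d → ℕ → Option (Fin d)) => mkEnv x.1 x.2 := by
  unfold mkEnv; fun_prop

theorem measurePreserving_mkEnv (μ : ℝ≥0) :
    MeasurePreserving (fun x : (Vertex d → ℕ) × (Vertex d → ℕ → Option (Fin d)) => mkEnv x.1 x.2)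
      ((sleeperLaw d μ).prod (stackLaw d)) (envLaw d μ) := by
  refine ⟨measurable_mkEnv, ?_⟩
  rw [sleeperLaw, stackLaw, ← infinitePi_map_unzip,
    Measure.map_map measurable_mkEnv (by fun_prop)]
  exact Measure.map_id

theorem ae_stackLaw_regular : ∀ᵐ σ ∂(stackLaw d), ∀ v, Regular (σ v) := by
  rw [ae_all_iff]
  intro v
  have h1 := ae_regular (d := d)
  have h2 := Measure.infinitePi_map_eval (fun _ : Vertex d => uniformSeq (Option (Fin d))) v
  rw [← h2] at h1
  exact ae_of_ae_map (measurable_pi_apply v).aemeasurable h1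

theorem measurable_consStack {α : Type*} [MeasurableSpace α] :
    Measurable fun q : α × (ℕ → α) => consStack q.1 q.2 := by
  refine measurable_pi_lambda _ fun n => ?_
  cases n with
  | zero => exact measurable_fst
  | succ n => exact (measurable_pi_apply n).comp measurable_snd

/-- Prescribing the first instruction is conditioning on an event of positive probability, hence
preserves almost sure statements. -/
theorem quasiMeasurePreserving_consStack {α : Type*} [MeasurableSpace α]
    [MeasurableSingletonClass α] [Fintype α] [Nonempty α] (o : α) :
    Measure.QuasiMeasurePreserving (consStack o) (uniformSeq α) (uniformSeq α) := by
  have h1 : MeasurePreserving (fun q : α × (ℕ → α) => consStack q.1 q.2)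
      ((uniformOn Set.univ).prod (uniformSeq α)) (uniformSeq α) := by
    have h2 := measurePreserving_split (fun _ : ℕ => (uniformOn Set.univ : Measure α))
      (f := fun _ : Unit => 0) (g := Nat.succ) (fun _ _ _ => rfl) Nat.succ_injective
      (fun _ b => (Nat.succ_ne_zero b).symm)
    have h3 := measurePreserving_eval_infinitePi
      (fun _ : Unit => (uniformOn Set.univ : Measure α)) ()
    have h4 := (h3.prod (MeasurePreserving.id _)).comp h2
    refine ⟨measurable_consStack, ?_⟩
    change ((uniformOn Set.univ).prod (Measure.infinitePi fun b : ℕ => uniformOn Set.univ)).map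
      _ = _
    rw [← h4.map_eq, Measure.map_map measurable_consStack h4.measurable]
    have h5 : (fun q : α × (ℕ → α) => consStack q.1 q.2) ∘
        (Prod.map (Function.eval ()) id ∘ fun x => (fun _ : Unit => x 0, fun b => x b.succ)) =
        id := by
      funext s n
      cases n <;> rfl
    rw [h5, Measure.map_id]
    rfl
  have hm : Measurable (consStack o) := measurable_consStack.comp measurable_prodMk_left
  refine ⟨hm, Measure.AbsolutelyContinuous.mk fun E hE h0 => ?_⟩
  rw [Measure.map_apply hm hE]
  rw [← h1.measure_preimage hE.nullMeasurableSet,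
    Measure.measure_prod_null (measurable_consStack hE)] at h0
  have h2 : (uniformOn Set.univ : Measure α) {o} ≠ 0 := by
    rw [uniformOn_univ, Measure.count_singleton]
    simp
  by_contra hne
  refine h2 (measure_mono_null ?_ h0)
  rintro _ rfl
  exact hne

theorem quasiMeasurePreserving_pushStack (v : Vertex d) (i : Fin d) :
    Measure.QuasiMeasurePreserving (pushStack v i) (stackLaw d) (stackLaw d) :=
  quasiMeasurePreserving_update (fun _ : Vertex d => uniformSeq (Option (Fin d))) v
    (quasiMeasurePreserving_consStack (some i))

/-! ### Exchange of blocks of instructions and the zero-one law for stacks -/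

/-- The permutation of the natural numbers that exchanges `j` and `j + K` for `j < K`. -/
def blockSwap (K : ℕ) : Equiv.Perm ℕ :=
  Function.Involutive.toPerm
    (fun j => if j < K then j + K else if j < 2 * K then j - K else j) (fun j => by
      dsimp only
      split_ifs <;> omega)

theorem blockSwap_of_lt {K j : ℕ} (h : j < K) : blockSwap K j = j + K := if_pos h

theorem blockSwap_of_le {K j : ℕ} (h : 2 * K ≤ j) : blockSwap K j = j := by
  change (if j < K then j + K else if j < 2 * K then j - K else j) = j
  split_ifs <;> omega

theorem blockSwap_lt {K j n : ℕ} (hn : 2 * K ≤ n) (h : j < n) : blockSwap K j < n := by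
  change (if j < K then j + K else if j < 2 * K then j - K else j) < n
  split_ifs <;> omega

theorem blockSwap_blockSwap (K j : ℕ) : blockSwap K (blockSwap K j) = j :=
  (blockSwap K).symm_apply_apply j

theorem instrCount_comp_blockSwap (s : ℕ → Option (Fin d)) (o : Option (Fin d)) {K n : ℕ}
    (hn : 2 * K ≤ n) : instrCount (fun k => s (blockSwap K k)) o n = instrCount s o n := by
  unfold instrCount
  rw [Nat.count_eq_card_filter_range, Nat.count_eq_card_filter_range]
  refine Finset.card_bij' (fun j _ => blockSwap K j) (fun j _ => blockSwap K j) ?_ ?_ ?_ ?_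
  · intro j hj
    simp only [Finset.mem_filter, Finset.mem_range] at hj ⊢
    exact ⟨blockSwap_lt hn hj.1, hj.2⟩
  · intro j hj
    simp only [Finset.mem_filter, Finset.mem_range, blockSwap_blockSwap] at hj ⊢
    exact ⟨blockSwap_lt hn hj.1, hj.2⟩
  · intro j _; exact blockSwap_blockSwap K j
  · intro j _; exact blockSwap_blockSwap K j

/-- Exchange of instructions within the stacks at the vertices of small depth. -/
def swapStacks (D K : ℕ) (σ : Vertex d → ℕ → Option (Fin d)) : Vertex d → ℕ → Option (Fin d) :=
  fun v k => σ v (if v.length < D then blockSwap K k else k)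

/-- With `D` and `K` large, the exchange moves a given finite set of instructions off itself, as
`prob_zero_or_one_of_permutations` requires. -/
theorem stackLaw_zero_or_one {E : Set (Vertex d → ℕ → Option (Fin d))} (hE : MeasurableSet E)
    (h : ∀ D K, ∀ᵐ σ ∂(stackLaw d), swapStacks D K σ ∈ E ↔ σ ∈ E) :
    stackLaw d E = 0 ∨ stackLaw d E = 1 := by
  have hc : MeasurePreserving (fun (ζ : Vertex d × ℕ → Option (Fin d)) v (k : ℕ) => ζ (v, k))
      (Measure.infinitePi fun _ : Vertex d × ℕ => uniformOn (Set.univ : Set (Option (Fin d))))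
      (stackLaw d) :=
    ⟨by fun_prop, Measure.infinitePi_map_curry
      (fun (_ : Vertex d) (_ : ℕ) => uniformOn (Set.univ : Set (Option (Fin d))))⟩
  rw [← hc.measure_preimage hE.nullMeasurableSet]
  refine prob_zero_or_one_of_permutations _ (hc.measurable hE) fun F => ?_
  obtain ⟨n, hn⟩ : ∃ n, ∀ q ∈ F, q.1.length < n ∧ q.2 < n := by
    refine ⟨F.sup (fun q => q.1.length + q.2) + 1, fun q hq => ?_⟩
    have h1 : q.1.length + q.2 ≤ F.sup fun q => q.1.length + q.2 :=
      Finset.le_sup (f := fun q : Vertex d × ℕ => q.1.length + q.2) hq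
    omega
  have hinv : Function.Involutive fun q : Vertex d × ℕ =>
      (q.1, if q.1.length < n then blockSwap n q.2 else q.2) := by
    rintro ⟨v, k⟩
    by_cases hv : v.length < n <;> simp [hv, blockSwap_blockSwap]
  refine ⟨hinv.toPerm, fun q hq h2 => ?_, ?_⟩
  · have h3 := (hn _ h2).2
    have h4 := hn _ hq
    change (if q.1.length < n then blockSwap n q.2 else q.2) < n at h3
    rw [if_pos h4.1, blockSwap_of_lt h4.2] at h3
    omega
  · exact hc.quasiMeasurePreserving.ae (h n n)

/-! ### The surplus of exits over entrances -/

/-- When many frogs `m + a` enter, at least `m + b` frogs leave. -/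
def EventuallyLE (a b : ℕ) (e : Env d) : Prop :=
  ∀ᶠ m : ℕ in atTop, ((m + b : ℕ) : ℕ∞) ≤ exits e (m + a)

theorem eventuallyLE_congr {a b : ℕ} {e e' : Env d} (h : exits e =ᶠ[atTop] exits e') :
    EventuallyLE a b e ↔ EventuallyLE a b e' := by
  refine eventually_congr ?_
  filter_upwards [(tendsto_add_atTop_nat a).eventually h] with m hm
  rw [hm]

theorem eventuallyLE_succ_succ {a b : ℕ} {e : Env d} :
    EventuallyLE (a + 1) (b + 1) e ↔ EventuallyLE a b e := by
  unfold EventuallyLE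
  conv_rhs => rw [← map_add_atTop_eq_nat 1, eventually_map]
  refine eventually_congr (Eventually.of_forall fun m => ?_)
  rw [show m + (b + 1) = m + 1 + b by omega, show m + (a + 1) = m + 1 + a by omega]

theorem eventuallyLE_addSleeper_nil {a b : ℕ} {N : Vertex d → ℕ}
    {σ : Vertex d → ℕ → Option (Fin d)} :
    EventuallyLE a b (mkEnv (addSleeper [] N) σ) ↔ EventuallyLE (a + 1) b (mkEnv N σ) := by
  refine eventually_congr ?_
  filter_upwards [eventually_ne_atTop 0] with m hm
  rw [exits_addSleeper_nil N σ (m := m + a) (by omega)]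
  rfl

theorem measurableSet_eventuallyLE (a b : ℕ) : MeasurableSet {e : Env d | EventuallyLE a b e} := by
  have : {e : Env d | EventuallyLE a b e} =
      ⋃ M, ⋂ m, ⋂ (_ : M ≤ m), {e | ((m + b : ℕ) : ℕ∞) ≤ exits e (m + a)} := by
    ext e
    simp [EventuallyLE, eventually_atTop]
  rw [this]
  exact MeasurableSet.iUnion fun M => MeasurableSet.iInter fun m => MeasurableSet.iInter fun _ =>
    measurable_exits _ (Set.to_countable (Set.Ici ((m + b : ℕ) : ℕ∞))).measurableSet

theorem measurable_mkEnv_right (N : Vertex d → ℕ) : Measurable (mkEnv N) :=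
  measurable_mkEnv.comp measurable_prodMk_left

theorem swapStacks_of_lt {D : ℕ} (K : ℕ) (σ : Vertex d → ℕ → Option (Fin d)) {v : Vertex d}
    (hv : v.length < D) : swapStacks D K σ v = fun k => σ v (blockSwap K k) := by
  funext k; rw [swapStacks, if_pos hv]

theorem swapStacks_of_le {D : ℕ} (K : ℕ) (σ : Vertex d → ℕ → Option (Fin d)) {v : Vertex d}
    (hv : D ≤ v.length) : swapStacks D K σ v = σ v := by
  funext k; rw [swapStacks, if_neg (not_lt.2 hv)]

/-- Exchanging blocks at small depth does not change the counts of instructions after `2 * K`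
departures, hence not the exits for many entering frogs. This makes the event exchangeable, for
fixed numbers of sleepers. -/
theorem eventuallyLE_zero_or_one (a b : ℕ) (N : Vertex d → ℕ) :
    (∀ᵐ σ ∂(stackLaw d), ¬ EventuallyLE a b (mkEnv N σ)) ∨
      ∀ᵐ σ ∂(stackLaw d), EventuallyLE a b (mkEnv N σ) := by
  have hm : MeasurableSet {σ | EventuallyLE a b (mkEnv N σ)} :=
    measurableSet_eventuallyLE a b |> measurable_mkEnv_right N
  have h := stackLaw_zero_or_one hm fun D K => ?_
  · rcases h with h | h
    · left
      rw [ae_iff]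
      simpa using h
    · right
      rw [← mem_ae_iff_prob_eq_one hm] at h
      exact h
  · filter_upwards [ae_stackLaw_regular] with σ hσ
    have he : exits (mkEnv N σ) =ᶠ[atTop] exits (mkEnv N (swapStacks D K σ)) := ?_
    · exact (eventuallyLE_congr he).symm
    refine exits_eventuallyEq D (fun v hv => ?_) (fun v => rfl) (fun v o => ?_) fun v => hσ v
    · simp [mkEnv, swapStacks_of_le K σ hv]
    · filter_upwards [eventually_ge_atTop (2 * K)] with n hn
      simp only [mkEnv]
      rcases lt_or_ge v.length D with hv | hv
      · rw [swapStacks_of_lt K σ hv, instrCount_comp_blockSwap _ _ hn]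
      · rw [swapStacks_of_le K σ hv]

/-! ### The surplus for almost all stacks as a function of the sleepers -/

def AEEventuallyLE (a b : ℕ) (N : Vertex d → ℕ) : Prop :=
  ∀ᵐ σ ∂(stackLaw d), EventuallyLE a b (mkEnv N σ)

theorem aeEventuallyLE_succ_succ {a b : ℕ} {N : Vertex d → ℕ} :
    AEEventuallyLE (a + 1) (b + 1) N ↔ AEEventuallyLE a b N := by
  simp only [AEEventuallyLE, eventuallyLE_succ_succ]

/-- By induction the sleeper is moved to the parent at the price of an instruction pushed on the
stack there. The push is nonsingular, so an almost sure statement survives it; conversely,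
`eventuallyLE_zero_or_one` lifts a statement that holds after the push to almost all stacks. -/
theorem aeEventuallyLE_addSleeper {a b : ℕ} {N : Vertex d → ℕ} (v : Vertex d) :
    AEEventuallyLE a b (addSleeper v N) ↔ AEEventuallyLE (a + 1) b N := by
  induction v with
  | nil => simp only [AEEventuallyLE, eventuallyLE_addSleeper_nil]
  | cons i v ih =>
    rw [← ih]
    have hq := quasiMeasurePreserving_pushStack v i
    constructor
    · intro h
      rcases eventuallyLE_zero_or_one a b (addSleeper v N) with h1 | h1
      · exfalso
        have : ∀ᵐ σ ∂(stackLaw d), False := by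
          filter_upwards [h, hq.ae h1, ae_stackLaw_regular] with σ h2 h3 h4
          exact h3 ((eventuallyLE_congr (exits_addSleeper_cons i v N σ h4)).1 h2)
        rw [eventually_false_iff_eq_bot, ae_eq_bot] at this
        exact IsProbabilityMeasure.ne_zero (stackLaw d) this
      · exact h1
    · intro h
      filter_upwards [hq.ae h, ae_stackLaw_regular] with σ h3 h4
      exact (eventuallyLE_congr (exits_addSleeper_cons i v N σ h4)).2 h3

theorem aeEventuallyLE_update {a b : ℕ} (N : Vertex d → ℕ) (v : Vertex d) (n : ℕ) :
    AEEventuallyLE a b (Function.update N v n) ↔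
      AEEventuallyLE (a + n) b (Function.update N v 0) := by
  induction n generalizing a with
  | zero => rfl
  | succ n ih =>
    have : Function.update N v (n + 1) = addSleeper v (Function.update N v n) := by
      simp [addSleeper]
    rw [this, aeEventuallyLE_addSleeper, ih, show a + 1 + n = a + (n + 1) by omega]

/-- The sleepers in a finite set matter only through their total number, which is added to the
entering frogs. Finite permutations of the sites are therefore harmless, and the zero-one law
applies to the numbers of sleepers too. -/
theorem aeEventuallyLE_restrict {a b : ℕ} (N : Vertex d → ℕ) (S : Finset (Vertex d)) :
    AEEventuallyLE a b N ↔
      AEEventuallyLE (a + ∑ v ∈ S, N v) b (fun v => if v ∈ S then 0 else N v) := by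
  induction S using Finset.induction_on with
  | empty => simp
  | insert v S hv ih =>
    have h1 : (fun w => if w ∈ S then 0 else N w) =
        Function.update (fun w => if w ∈ S then 0 else N w) v (N v) := by
      rw [Function.eq_update_iff]
      simp [hv]
    have h2 : (fun w => if w ∈ insert v S then 0 else N w) =
        Function.update (fun w => if w ∈ S then 0 else N w) v 0 := by
      funext w
      by_cases hw : w = v
      · subst hw; simp
      · simp [hw]
    rw [ih, h1, aeEventuallyLE_update, h2, Finset.sum_insert hv]
    rw [show a + ∑ v ∈ S, N v + N v = a + (N v + ∑ v ∈ S, N v) by omega]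

theorem aeEventuallyLE_comp_perm {a b : ℕ} (N : Vertex d → ℕ) (π : Equiv.Perm (Vertex d))
    (S : Finset (Vertex d)) (hS : ∀ v, v ∉ S → π v = v) :
    AEEventuallyLE a b (fun v => N (π v)) ↔ AEEventuallyLE a b N := by
  have hmem : ∀ v, π v ∈ S ↔ v ∈ S := by
    intro v
    by_cases hv : v ∈ S
    · refine iff_of_true ?_ hv
      by_contra h
      exact h (by rwa [π.injective (hS _ h)])
    · rw [hS v hv]
  rw [aeEventuallyLE_restrict N S, aeEventuallyLE_restrict _ S]
  have h1 : ∑ v ∈ S, N (π v) = ∑ v ∈ S, N v :=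
    Finset.sum_nbij' π π.symm (fun v hv => (hmem v).2 hv)
      (fun v hv => (hmem _).1 (by simpa using hv)) (by simp) (by simp) (by simp)
  rw [h1]
  have h2 : (fun v => if v ∈ S then 0 else N (π v)) = fun v => if v ∈ S then 0 else N v := by
    funext v
    split_ifs with hv
    · rfl
    · rw [hS v hv]
  rw [h2]

theorem measurableSet_aeEventuallyLE (a b : ℕ) :
    MeasurableSet {N : Vertex d → ℕ | AEEventuallyLE a b N} := by
  have hm : MeasurableSet {x : (Vertex d → ℕ) × (Vertex d → ℕ → Option (Fin d)) |
      ¬ EventuallyLE a b (mkEnv x.1 x.2)} :=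
    (measurable_mkEnv (measurableSet_eventuallyLE a b)).compl
  have := measurable_measure_prodMk_left (ν := stackLaw d) hm
  exact this (measurableSet_singleton 0)

theorem aeEventuallyLE_zero_or_one [NeZero d] (μ : ℝ≥0) (a b : ℕ) :
    sleeperLaw d μ {N | AEEventuallyLE a b N} = 0 ∨
      sleeperLaw d μ {N | AEEventuallyLE a b N} = 1 := by
  refine prob_zero_or_one_of_permutations _ (measurableSet_aeEventuallyLE a b) fun F => ?_
  have : Infinite (Vertex d) := inferInstanceAs (Infinite (List (Fin d)))
  have : Encodable (Vertex d) := Encodable.ofCountable _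
  have : Denumerable (Vertex d) := Denumerable.ofEncodableOfInfinite _
  set f := Denumerable.eqv (Vertex d)
  obtain ⟨n, hn⟩ : ∃ n, ∀ v ∈ F, f v < n := by
    refine ⟨F.sup (fun v => f v) + 1, fun v hv => Nat.lt_succ_of_le ?_⟩
    exact Finset.le_sup (f := fun v => f v) hv
  refine ⟨(f.trans (blockSwap n)).trans f.symm, fun v hv h2 => ?_, ae_of_all _ fun N => ?_⟩
  · have h3 := hn _ h2
    simp only [Equiv.trans_apply, Equiv.apply_symm_apply, blockSwap_of_lt (hn v hv)] at h3
    omega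
  · refine aeEventuallyLE_comp_perm N _ ((Finset.range (2 * n)).map f.symm.toEmbedding)
      fun v hv => ?_
    have : 2 * n ≤ f v := by
      by_contra h
      exact hv (Finset.mem_map.2 ⟨f v, Finset.mem_range.2 (by omega), by simp⟩)
    simp [blockSwap_of_le this]

theorem quasiMeasurePreserving_of_forall_singleton {α β : Type*} [MeasurableSpace α]
    [DiscreteMeasurableSpace α] [MeasurableSpace β] [Countable β] {ν : Measure α} {ν' : Measure β}
    (h : ∀ b, ν' {b} ≠ 0) (f : α → β) : Measure.QuasiMeasurePreserving f ν ν' := by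
  refine ⟨measurable_from_top.mono le_rfl le_rfl |>.mono (by
    intro s _; exact MeasurableSet.of_discrete) le_rfl, ?_⟩
  intro E hE
  have : E = ∅ := by
    refine Set.eq_empty_of_forall_notMem fun b hb => h b ?_
    exact measure_mono_null (Set.singleton_subset_iff.2 hb) hE
  rw [this, measure_empty]

theorem poissonMeasure_singleton_ne_zero {μ : ℝ≥0} (hμ : μ ≠ 0) (n : ℕ) :
    poissonMeasure μ {n} ≠ 0 := by
  rw [poissonMeasure_singleton]
  have : 0 < μ := pos_iff_ne_zero.2 hμ
  simp only [ne_eq, ENNReal.ofReal_eq_zero, not_le]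
  positivity

theorem quasiMeasurePreserving_addSleeper {μ : ℝ≥0} (hμ : μ ≠ 0) (v : Vertex d) :
    Measure.QuasiMeasurePreserving (addSleeper v) (sleeperLaw d μ) (sleeperLaw d μ) :=
  quasiMeasurePreserving_update (fun _ : Vertex d => poissonMeasure μ) v
    (quasiMeasurePreserving_of_forall_singleton (poissonMeasure_singleton_ne_zero hμ)
      fun n => n + 1)

/-- If the frog model is recurrent with positive probability, then the surplus of exits over
entrances tends to infinity with the number of entrances. -/
theorem ae_eventuallyLE [NeZero d] {μ : ℝ≥0} (hμ : μ ≠ 0) (hR : law d μ {ω | Recurrent ω} ≠ 0)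
    (b : ℕ) : ∀ᵐ e ∂(envLaw d μ), EventuallyLE 0 b e := by
  have hall : ∀ b, ∀ᵐ N ∂(sleeperLaw d μ), AEEventuallyLE 0 b N := by
    intro b
    have hpos : sleeperLaw d μ {N | AEEventuallyLE 0 b N} ≠ 0 := by
      induction b with
      | zero =>
        intro h0
        refine hR (le_antisymm ((law_recurrent_le μ).trans ?_) zero_le)
        have h1 : ∀ᵐ e ∂(envLaw d μ), ¬ EventuallyLE 0 0 e := by
          have h2 := (measurePreserving_mkEnv (d := d) μ)
          rw [← h2.map_eq]
          refine (ae_map_iff h2.measurable.aemeasurable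
            (measurableSet_eventuallyLE 0 0).compl).2 ?_
          refine (Measure.ae_prod_iff_ae_ae
            (measurable_mkEnv (measurableSet_eventuallyLE 0 0)).compl).2 ?_
          have h3 : ∀ᵐ N ∂(sleeperLaw d μ), ¬ AEEventuallyLE 0 0 N := by
            rw [ae_iff]; simpa using h0
          filter_upwards [h3] with N hN
          exact (eventuallyLE_zero_or_one 0 0 N).resolve_right hN
        refine le_of_eq (measure_mono_null (fun e he => ?_) (ae_iff.1 h1))
        simp only [Set.mem_ofPred_eq, not_not]
        exact Eventually.of_forall fun m => he m
      -- If the surplus `b + 1` failed almost surely, it would fail after adding a sleeper at the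
      -- top. That sleeper turns `(0, b + 1)` into `(1, b + 1)`, which is `(0, b)`.
      | succ b ih =>
        intro h0
        have h1 := (aeEventuallyLE_zero_or_one (d := d) μ 0 b).resolve_left ih
        rw [← mem_ae_iff_prob_eq_one (measurableSet_aeEventuallyLE 0 b)] at h1
        have h2 : ∀ᵐ N ∂(sleeperLaw d μ), ¬ AEEventuallyLE 0 (b + 1) N := by
          rw [ae_iff]; simpa using h0
        have h3 := (quasiMeasurePreserving_addSleeper hμ ([] : Vertex d)).ae h2
        have : ∀ᵐ N ∂(sleeperLaw d μ), False := by
          filter_upwards [h1, h3] with N h4 h5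
          rw [aeEventuallyLE_addSleeper, aeEventuallyLE_succ_succ] at h5
          exact h5 h4
        rw [eventually_false_iff_eq_bot, ae_eq_bot] at this
        exact IsProbabilityMeasure.ne_zero (sleeperLaw d μ) this
    have h1 := (aeEventuallyLE_zero_or_one (d := d) μ 0 b).resolve_left hpos
    rw [← mem_ae_iff_prob_eq_one (measurableSet_aeEventuallyLE 0 b)] at h1
    exact h1
  have h2 := (measurePreserving_mkEnv (d := d) μ)
  rw [← h2.map_eq, ae_map_iff h2.measurable.aemeasurable (measurableSet_eventuallyLE 0 b)]
  exact (Measure.ae_prod_iff_ae_ae (measurable_mkEnv (measurableSet_eventuallyLE 0 b))).2 (hall b)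

/-! ### Amplification of the surplus -/

/-- Whenever `k ≥ x` frogs enter, at least `k + b` frogs leave. -/
def Surplus (x : ℝ) (b : ℕ) (e : Env d) : Prop :=
  ∀ k : ℕ, x ≤ k → ((k + b : ℕ) : ℕ∞) ≤ exits e k

/-- From `n` onwards the instructions at the top are balanced, and the trees at the children have
no deficit. -/
def Balanced (n : ℕ) (e : Env d) : Prop :=
  (∀ A, n ≤ A → ∀ i, 3 * instrCount (e []).2 none A ≤ 4 * instrCount (e []).2 (some i) A ∧
    A ≤ 2 * (d + 1) * instrCount (e []).2 (some i) A) ∧ ∀ i, Surplus n 0 (sub i e)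

theorem sum_instrCount (s : ℕ → Option (Fin d)) (A : ℕ) :
    instrCount s none A + ∑ i, instrCount s (some i) A = A := by
  induction A with
  | zero => simp [instrCount_zero]
  | succ A ih =>
    simp only [instrCount_succ, Finset.sum_add_distrib]
    have : (if s A = none then 1 else 0) + ∑ i, (if s A = some i then 1 else 0) = 1 := by
      cases h : s A <;> simp
    omega

/-- The `A` departures cover the entering frogs and the returns, which exceed the downward
departures by at least `∑ i, β i`. The excess must go up. -/
theorem add_sum_le_of_surplus {s : ℕ → Option (Fin d)} {Y : Fin d → ℕ → ℕ∞} {N m A : ℕ}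
    (hA : ((m + if m = 0 then 0 else N : ℕ) : ℕ∞) + ∑ i, Y i (instrCount s (some i) A) ≤ A)
    {β : Fin d → ℕ} (hβ : ∀ i, ((instrCount s (some i) A + β i : ℕ) : ℕ∞) ≤
      Y i (instrCount s (some i) A)) : m + ∑ i, β i ≤ instrCount s none A := by
  have h1 : ((m + if m = 0 then 0 else N : ℕ) : ℕ∞) +
      ∑ i, ((instrCount s (some i) A + β i : ℕ) : ℕ∞) ≤ A :=
    (add_le_add le_rfl (Finset.sum_le_sum fun i _ => hβ i)).trans hA
  have h2 : (m + if m = 0 then 0 else N) + ∑ i, (instrCount s (some i) A + β i) ≤ A := by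
    exact_mod_cast h1
  have h3 := sum_instrCount s A
  rw [Finset.sum_add_distrib] at h2
  omega

theorem Surplus.mono {x x' : ℝ} {b b' : ℕ} {e : Env d} (h : Surplus x b e) (hx : x ≤ x')
    (hb : b' ≤ b) : Surplus x' b' e := fun k hk =>
  le_trans (by exact_mod_cast Nat.add_le_add_left hb k) (h k (hx.trans hk))

/-- With `m ≥ 2 * (d + 1) * n`, the second balance condition sends at least `n` frogs to each child,
so no child has a deficit and at least `m` frogs go up; the first condition then gives each child
about as many. -/
theorem Balanced.le {n : ℕ} {e : Env d} (h : Balanced n e) {m A : ℕ} (hm : 2 * (d + 1) * n ≤ m)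
    (hA : ((m + if m = 0 then 0 else (e []).1 : ℕ) : ℕ∞) +
      ∑ i, exits (sub i e) (instrCount (e []).2 (some i) A) ≤ A) :
    (∀ i, ((instrCount (e []).2 (some i) A : ℕ) : ℕ∞) ≤
      exits (sub i e) (instrCount (e []).2 (some i) A)) ∧ m ≤ instrCount (e []).2 none A ∧
      ∀ i, 3 * instrCount (e []).2 none A ≤ 4 * instrCount (e []).2 (some i) A := by
  have h0 : m ≤ A := by
    have h2 : ((m + if m = 0 then 0 else (e []).1 : ℕ) : ℕ∞) ≤ A := le_self_add.trans hA
    have := Nat.cast_le.1 h2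
    omega
  have hn : n ≤ A := le_trans (by nlinarith) (hm.trans h0)
  have h1 : ∀ i, ((instrCount (e []).2 (some i) A : ℕ) : ℕ∞) ≤
      exits (sub i e) (instrCount (e []).2 (some i) A) := by
    intro i
    refine h.2 i _ ?_
    have h3 := (h.1 A hn i).2
    have h4 : 2 * (d + 1) * n ≤ 2 * (d + 1) * instrCount (e []).2 (some i) A :=
      hm.trans (h0.trans h3)
    exact_mod_cast Nat.le_of_mul_le_mul_left h4 (by omega)
  refine ⟨h1, ?_, fun i => (h.1 A hn i).1⟩
  have := add_sum_le_of_surplus hA (β := fun _ => 0) (fun i => by simpa using h1 i)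
  simpa using this

theorem sum_pair {i j : Fin d} (hij : i ≠ j) (a b : ℕ) :
    ∑ l, (if l = i then a else if l = j then b else 0) = a + b := by
  have : ∀ l, (if l = i then a else if l = j then b else 0) =
      (if l = i then a else 0) + if l = j then b else 0 := by
    intro l
    by_cases h : l = i
    · subst h; simp [hij]
    · simp [h]
  simp [this, Finset.sum_add_distrib]

/-- At least `y` frogs go up, so every child receives at least `3 / 4 * y` frogs and two children
contribute their surpluses. The surplus is summed while the scale grows by `4 / 3`. -/
theorem Balanced.surplus {n : ℕ} {e : Env d} (h : Balanced n e) {y : ℝ}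
    (hy : (2 * (d + 1) * n : ℕ) ≤ y) {i j : Fin d} (hij : i ≠ j) {a b : ℕ}
    (hi : Surplus (3 / 4 * y) a (sub i e)) (hj : Surplus (3 / 4 * y) b (sub j e)) :
    Surplus y (a + b) e := by
  intro m hm
  rw [exits_eq_node]
  refine le_node_iff.2 fun A hA => ?_
  obtain ⟨h1, h2, h3⟩ := h.le (by exact_mod_cast hy.trans hm) hA
  have h4 : ∀ l, 3 / 4 * y ≤ (instrCount (e []).2 (some l) A : ℝ) := by
    intro l
    have h5 : (3 * instrCount (e []).2 none A : ℝ) ≤ 4 * instrCount (e []).2 (some l) A := by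
      exact_mod_cast h3 l
    have h6 : (m : ℝ) ≤ instrCount (e []).2 none A := by exact_mod_cast h2
    linarith
  have h7 := add_sum_le_of_surplus hA (β := fun l => if l = i then a else if l = j then b else 0)
    (fun l => ?_)
  · rw [sum_pair hij] at h7
    exact_mod_cast h7
  · split_ifs with h8 h9
    · subst h8; exact hi _ (h4 _)
    · subst h9; exact hj _ (h4 _)
    · exact h1 l

/-- A child with a surplus `c ≥ 3 / 4 * y` raises the number of frogs going up to `7 / 4 * y`, so
that every child receives `21 / 16 * y ≥ y` frogs. Surpluses now add up at the same scale `y`. -/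
theorem Balanced.surplus' {n : ℕ} {e : Env d} (h : Balanced n e) {y : ℝ}
    (hy : (2 * (d + 1) * n : ℕ) ≤ y) {i j : Fin d} (hij : i ≠ j) {a b c : ℕ} (hc : 3 / 4 * y ≤ c)
    (hl : ∃ l, Surplus (3 / 4 * y) c (sub l e))
    (hi : Surplus y a (sub i e)) (hj : Surplus y b (sub j e)) : Surplus y (a + b) e := by
  intro m hm
  rw [exits_eq_node]
  refine le_node_iff.2 fun A hA => ?_
  obtain ⟨h1, h2, h3⟩ := h.le (by exact_mod_cast hy.trans hm) hA
  have h5 : ∀ l, (3 * instrCount (e []).2 none A : ℝ) ≤ 4 * instrCount (e []).2 (some l) A := by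
    intro l
    exact_mod_cast h3 l
  have h6 : (m : ℝ) ≤ instrCount (e []).2 none A := by exact_mod_cast h2
  obtain ⟨l, hl⟩ := hl
  have h10 := add_sum_le_of_surplus hA (β := fun l' => if l' = l then c else 0) (fun l' => by
    split_ifs with h8
    · subst h8; exact hl _ (by have := h5 l'; linarith)
    · exact h1 l')
  have h11 : (m + c : ℝ) ≤ instrCount (e []).2 none A := by
    simp only [Finset.sum_ite_eq', Finset.mem_univ, if_true] at h10
    exact_mod_cast h10
  have hy0 : 0 ≤ y := le_trans (by positivity) hy
  have h4 : ∀ l, y ≤ (instrCount (e []).2 (some l) A : ℝ) := by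
    intro l
    have := h5 l
    linarith
  have h7 := add_sum_le_of_surplus hA (β := fun l => if l = i then a else if l = j then b else 0)
    (fun l => ?_)
  · rw [sum_pair hij] at h7
    exact_mod_cast h7
  · split_ifs with h8 h9
    · subst h8; exact hi _ (h4 _)
    · subst h9; exact hj _ (h4 _)
    · exact h1 l

/-! ### Probabilities -/

theorem exists_forall_measureReal_le {Ω : Type*} [MeasurableSpace Ω] (P : Measure Ω)
    [IsProbabilityMeasure P] {S : ℕ → Set Ω} (hS : ∀ n, MeasurableSet (S n)) (hanti : Antitone S)
    (h : ∀ᵐ x ∂P, ∃ n, x ∉ S n) {ε : ℝ} (hε : 0 < ε) : ∃ n0, ∀ n ≥ n0, P.real (S n) ≤ ε := by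
  have h1 := tendsto_measure_iInter_atTop (μ := P) (fun n => (hS n).nullMeasurableSet) hanti
    ⟨0, measure_ne_top _ _⟩
  have h2 : P (⋂ n, S n) = 0 := by
    refine measure_mono_null (fun x hx => ?_) (ae_iff.1 h)
    simpa using hx
  rw [h2] at h1
  have h3 := (ENNReal.tendsto_toReal ENNReal.zero_ne_top).comp h1
  obtain ⟨n0, hn0⟩ := eventually_atTop.1 (h3.eventually_le_const (u := ε) (by simpa using hε))
  exact ⟨n0, hn0⟩

theorem measurableSet_surplus (x : ℝ) (b : ℕ) : MeasurableSet {e : Env d | Surplus x b e} := by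
  have : {e : Env d | Surplus x b e} =
      ⋂ k : ℕ, ⋂ (_ : x ≤ k), {e | ((k + b : ℕ) : ℕ∞) ≤ exits e k} := by
    ext e; simp [Surplus]
  rw [this]
  exact MeasurableSet.iInter fun m => MeasurableSet.iInter fun _ =>
    measurable_exits _ (Set.to_countable (Set.Ici ((m + b : ℕ) : ℕ∞))).measurableSet

theorem measurable_sub (i : Fin d) : Measurable (sub i : Env d → Env d) := by
  unfold sub; fun_prop

theorem measurableSet_balanced (n : ℕ) : MeasurableSet {e : Env d | Balanced n e} := by
  have : {e : Env d | Balanced n e} =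
      (⋂ A, ⋂ (_ : n ≤ A), ⋂ i, {e | 3 * instrCount (e []).2 none A ≤
        4 * instrCount (e []).2 (some i) A ∧ A ≤ 2 * (d + 1) * instrCount (e []).2 (some i) A}) ∩
      ⋂ i, sub i ⁻¹' {e | Surplus n 0 e} := by
    ext e; simp [Balanced]
  rw [this]
  have hs : Measurable fun e : Env d => (e []).2 := (measurable_pi_apply ([] : Vertex d)).snd
  have hc : ∀ o A, Measurable fun e : Env d => instrCount (e []).2 o A :=
    fun o A => measurable_instrCount_comp o hs measurable_const
  refine MeasurableSet.inter (MeasurableSet.iInter fun A => MeasurableSet.iInter fun _ =>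
    MeasurableSet.iInter fun i => ?_) (MeasurableSet.iInter fun i =>
      measurable_sub i (measurableSet_surplus _ _))
  exact (measurableSet_le ((hc none A).const_mul 3) ((hc (some i) A).const_mul 4)).inter
    (measurableSet_le measurable_const ((hc (some i) A).const_mul _))

theorem measurePreserving_sub (μ : ℝ≥0) (i : Fin d) :
    MeasurePreserving (sub i) (envLaw d μ) (envLaw d μ) := measurePreserving_descendant μ [i]

theorem measurePreserving_sub_sub (μ : ℝ≥0) {i j : Fin d} (hij : i ≠ j) :
    MeasurePreserving (fun e => (sub i e, sub j e)) (envLaw d μ)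
      ((envLaw d μ).prod (envLaw d μ)) :=
  measurePreserving_split (fun _ : Vertex d => siteLaw d μ) (List.append_left_injective [i])
    (List.append_left_injective [j]) (fun a b h => by
      have := (List.append_inj' h rfl).2
      simp at this
      exact hij this)

/-- The subtrees at `i` and `j` are independent copies of the environment; if one good subtree
suffices, failure requires two independent failures, whence the square. -/
theorem measureReal_both_le (μ : ℝ≥0) {i j : Fin d} (hij : i ≠ j) {S D T : Set (Env d)}
    (hT : MeasurableSet T) (h : ∀ e ∈ D, sub i e ∈ T ∨ sub j e ∈ T → e ∈ S) :
    (envLaw d μ).real Sᶜ ≤ (envLaw d μ).real Dᶜ + (envLaw d μ).real Tᶜ ^ 2 := by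
  have h1 : Sᶜ ⊆ Dᶜ ∪ (fun e => (sub i e, sub j e)) ⁻¹' (Tᶜ ×ˢ Tᶜ) := by
    intro e he
    by_cases hD : e ∈ D
    · right
      have := fun h' => he (h e hD h')
      exact not_or.1 this
    · exact Or.inl hD
  refine (measureReal_mono h1).trans ((measureReal_union_le _ _).trans ?_)
  rw [measureReal_def _ ((fun e => (sub i e, sub j e)) ⁻¹' (Tᶜ ×ˢ Tᶜ)),
    (measurePreserving_sub_sub μ hij).measure_preimage (hT.compl.prod hT.compl).nullMeasurableSet,
    Measure.prod_prod, ENNReal.toReal_mul, sq]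
  exact le_rfl

theorem measureReal_either_le (μ : ℝ≥0) (i j : Fin d) {S D T : Set (Env d)}
    (hT : MeasurableSet T) (h : ∀ e ∈ D, sub i e ∈ T → sub j e ∈ T → e ∈ S) :
    (envLaw d μ).real Sᶜ ≤ (envLaw d μ).real Dᶜ + 2 * (envLaw d μ).real Tᶜ := by
  have h1 : Sᶜ ⊆ Dᶜ ∪ (sub i ⁻¹' Tᶜ ∪ sub j ⁻¹' Tᶜ) := by
    intro e he
    by_contra hc
    simp only [Set.mem_union, Set.mem_compl_iff, Set.mem_preimage, not_or, not_not] at hc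
    exact he (h e hc.1 hc.2.1 hc.2.2)
  have h2 : ∀ i, (envLaw d μ).real (sub i ⁻¹' Tᶜ) = (envLaw d μ).real Tᶜ := by
    intro i
    rw [measureReal_def, (measurePreserving_sub μ i).measure_preimage hT.compl.nullMeasurableSet]
    rfl
  refine (measureReal_mono h1).trans ((measureReal_union_le _ _).trans ?_)
  have h3 := measureReal_union_le (μ := envLaw d μ) (sub i ⁻¹' Tᶜ) (sub j ⁻¹' Tᶜ)
  rw [h2, h2] at h3
  linarith

theorem ae_exists_balanced {μ : ℝ≥0} (h0 : ∀ᵐ e ∂(envLaw d μ), EventuallyLE 0 0 e) :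
    ∀ᵐ e ∂(envLaw d μ), ∃ n, Balanced n e := by
  have h1 : ∀ᵐ e ∂(envLaw d μ), ∀ i, EventuallyLE 0 0 (sub i e) :=
    ae_all_iff.2 fun i => (measurePreserving_sub μ i).quasiMeasurePreserving.ae h0
  filter_upwards [h1, ae_forall_regular μ] with e h2 h3
  have hr := h3 []
  have h4 : ∀ᶠ A : ℕ in atTop, ∀ i, 3 * instrCount (e []).2 none A ≤
      4 * instrCount (e []).2 (some i) A ∧ A ≤ 2 * (d + 1) * instrCount (e []).2 (some i) A := by
    refine eventually_all.2 fun i => ?_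
    have hp : (0 : ℝ) < 1 / (d + 1) := by positivity
    -- The margins fit since `3 * (7 / 6) = 4 * (7 / 8)`.
    have a1 := (hr none).eventually_lt_const (u := 7 / 6 * (1 / (d + 1 : ℝ))) (by linarith)
    have a2 := (hr (some i)).eventually_const_lt (u := 7 / 8 * (1 / (d + 1 : ℝ))) (by linarith)
    filter_upwards [a1, a2, eventually_gt_atTop 0] with A b1 b2 b3
    have b4 : (0 : ℝ) < A := by exact_mod_cast b3
    rw [div_lt_iff₀ b4] at b1
    rw [lt_div_iff₀ b4] at b2
    constructor
    · have : (3 * instrCount (e []).2 none A : ℝ) ≤ 4 * instrCount (e []).2 (some i) A := by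
        linarith
      exact_mod_cast this
    · have hd : (0 : ℝ) < d + 1 := by positivity
      have b5 : (7 / 8 * A : ℝ) < (d + 1) * instrCount (e []).2 (some i) A := by
        have := mul_lt_mul_of_pos_left b2 hd
        field_simp at this
        linarith
      have : (A : ℝ) ≤ 2 * (d + 1) * instrCount (e []).2 (some i) A := by linarith
      exact_mod_cast this
  have h5 : ∀ᶠ n : ℕ in atTop, ∀ i, Surplus n 0 (sub i e) := by
    refine eventually_all.2 fun i => ?_
    obtain ⟨M, hM⟩ := eventually_atTop.1 (h2 i)
    filter_upwards [eventually_ge_atTop M] with n hn k hk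
    exact hM k (hn.trans (by exact_mod_cast hk))
  obtain ⟨M, hM⟩ := eventually_atTop.1 h4
  obtain ⟨n, h6, h7⟩ := (h5.and (eventually_ge_atTop M)).exists
  exact ⟨n, fun A hA => hM A (h7.trans hA), h6⟩

theorem Balanced.mono {n n' : ℕ} (hn : n ≤ n') {e : Env d} (h : Balanced n e) : Balanced n' e :=
  ⟨fun A hA => h.1 A (hn.trans hA), fun i => (h.2 i).mono (by exact_mod_cast hn) le_rfl⟩

/-- If the surplus tends to infinity, then with positive probability infinitely many frogs leave
when sufficiently many enter. -/
theorem exists_exits_eq_top_pos (hd : 2 ≤ d) {μ : ℝ≥0}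
    (h : ∀ b, ∀ᵐ e ∂(envLaw d μ), EventuallyLE 0 b e) :
    ∃ k : ℕ, envLaw d μ {e | exits e k = ⊤} ≠ 0 := by
  obtain ⟨i, j, hij⟩ : ∃ i j : Fin d, i ≠ j :=
    ⟨⟨0, by omega⟩, ⟨1, by omega⟩, by simp⟩
  set P := envLaw d μ with hP
  set H : ℝ → ℕ → Set (Env d) := fun x b => {e | Surplus x b e} with hH
  have hHm : ∀ x b, MeasurableSet (H x b) := measurableSet_surplus
  obtain ⟨n, hn⟩ := exists_forall_measureReal_le P
    (S := fun n => {e | Balanced n e}ᶜ) (fun n => (measurableSet_balanced n).compl)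
    (fun a b hab => Set.compl_subset_compl.2 fun e he => he.mono hab)
    (by simpa using ae_exists_balanced (h 0)) (ε := 1 / 50) (by norm_num)
  set G : Set (Env d) := {e | Balanced n e} with hG
  have hGP : P.real Gᶜ ≤ 1 / 50 := hn n le_rfl
  obtain ⟨n1, hn1⟩ := exists_forall_measureReal_le P
    (S := fun n : ℕ => (H n 1)ᶜ) (fun n => (hHm n 1).compl)
    (fun a b hab => Set.compl_subset_compl.2 fun e he => he.mono (by exact_mod_cast hab) le_rfl)
    (by
      filter_upwards [h 1] with e he
      obtain ⟨M, hM⟩ := eventually_atTop.1 he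
      refine ⟨M, ?_⟩
      simp only [hH, Set.mem_compl_iff, not_not]
      exact fun k hk => hM k (by exact_mod_cast hk)) (ε := 2 / 50) (by norm_num)
  set K : ℕ := 2 * (d + 1) * n with hK
  have hKn : n ≤ K := by rw [hK]; nlinarith
  have hKn2 : 2 * n ≤ K := by rw [hK]; nlinarith
  set x0 : ℝ := max (K : ℝ) n1 with hx0
  have hx0K : (K : ℝ) ≤ x0 := le_max_left _ _
  have hstart : P.real (H x0 1)ᶜ ≤ 2 / 50 :=
    (measureReal_mono (Set.compl_subset_compl.2 fun e he => Surplus.mono he (le_max_right _ _)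
      le_rfl)).trans (hn1 n1 le_rfl)
  have hHn : ∀ e ∈ G, ∀ l, ∀ x : ℝ, (n : ℝ) ≤ x → Surplus x 0 (sub l e) :=
    fun e he l x hx => (he.2 l).mono hx le_rfl
  -- passing to the next scale
  have hdouble : ∀ y b, (K : ℝ) ≤ y →
      P.real (H y (b + b))ᶜ ≤ P.real Gᶜ + 2 * P.real (H (3 / 4 * y) b)ᶜ := fun y b hy =>
    measureReal_either_le μ i j (hHm _ _) fun e he h1 h2 => Balanced.surplus he hy hij h1 h2
  have hKreal : (2 * n : ℝ) ≤ K := by exact_mod_cast hKn2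
  have hsame : ∀ y b, (K : ℝ) ≤ y →
      P.real (H y b)ᶜ ≤ P.real Gᶜ + P.real (H (3 / 4 * y) b)ᶜ ^ 2 := fun y b hy =>
    measureReal_both_le μ hij (hHm _ _) fun e he h1 => by
      change Surplus y b e
      have hny : (n : ℝ) ≤ 3 / 4 * y := by linarith [Nat.cast_nonneg (α := ℝ) n]
      rcases h1 with h1 | h1
      · simpa only [add_zero, zero_add] using Balanced.surplus he hy hij h1 (hHn e he j _ hny)
      · simpa only [add_zero, zero_add] using Balanced.surplus he hy hij (hHn e he i _ hny) h1
  -- Two steps by `4 / 3` enlarge the scale by `16 / 9` and double the surplus. The first raises the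
  -- failure probability to at most `1 / 50 + 2 * (2 / 50) = 1 / 10`, the second brings it back to
  -- `1 / 50 + (1 / 10) ^ 2 ≤ 2 / 50`.
  have hscale : ∀ k : ℕ, P.real (H ((16 / 9) ^ k * x0) (2 ^ k))ᶜ ≤ 2 / 50 := by
    intro k
    induction k with
    | zero => simpa using hstart
    | succ k ih =>
      have hpow : (1 : ℝ) ≤ (16 / 9) ^ k := one_le_pow₀ (by norm_num)
      have hxk : (K : ℝ) ≤ (16 / 9) ^ k * x0 := by
        nlinarith [Nat.cast_nonneg (α := ℝ) K]
      have hK0 := Nat.cast_nonneg (α := ℝ) K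
      have h1 := hdouble (4 / 3 * ((16 / 9) ^ k * x0)) (2 ^ k) (by linarith)
      rw [show (3 / 4 * (4 / 3 * ((16 / 9) ^ k * x0)) : ℝ) = (16 / 9) ^ k * x0 by ring,
        ← two_mul, ← pow_succ'] at h1
      have h2 := hsame ((16 / 9) ^ (k + 1) * x0) (2 ^ (k + 1)) (by rw [pow_succ]; linarith)
      rw [show (3 / 4 * ((16 / 9) ^ (k + 1) * x0) : ℝ) = 4 / 3 * ((16 / 9) ^ k * x0) by ring] at h2
      have h3 : 0 ≤ P.real (H (4 / 3 * ((16 / 9) ^ k * x0)) (2 ^ (k + 1)))ᶜ := measureReal_nonneg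
      nlinarith
  -- As `2 > 16 / 9`, the surplus overtakes the scale, however large the initial scale `x0` is.
  obtain ⟨k, hk⟩ : ∃ k : ℕ, (16 / 9 : ℝ) ^ k * x0 ≤ 2 ^ k := by
    obtain ⟨k, hk⟩ := pow_unbounded_of_one_lt x0 (show (1 : ℝ) < 9 / 8 by norm_num)
    refine ⟨k, ?_⟩
    have : (2 : ℝ) ^ k = (16 / 9) ^ k * (9 / 8) ^ k := by rw [← mul_pow]; norm_num
    rw [this]
    gcongr
  set x : ℝ := (16 / 9) ^ k * x0 with hx
  set c : ℕ := 2 ^ k with hc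
  have hxc : x ≤ c := by rw [hc]; exact_mod_cast hk
  have hxK : (K : ℝ) ≤ x := by
    have hpow : (1 : ℝ) ≤ (16 / 9) ^ k := one_le_pow₀ (by norm_num)
    nlinarith [Nat.cast_nonneg (α := ℝ) K]
  set y : ℝ := 4 / 3 * x with hy
  have hyx : 3 / 4 * y = x := by rw [hy]; ring
  have hyK : (K : ℝ) ≤ y := by linarith [Nat.cast_nonneg (α := ℝ) K]
  have hny : (n : ℝ) ≤ y := by linarith [Nat.cast_nonneg (α := ℝ) n]
  -- On `D` some child has a surplus `c` that is at least its own scale `x = 3 / 4 * y`, as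
  -- `Balanced.surplus'` requires.
  set D : Set (Env d) := {e | e ∈ G ∧ (sub i e ∈ H x c ∨ sub j e ∈ H x c)} with hD
  have hDP : P.real Dᶜ ≤ 1 / 40 := by
    have h1 := measureReal_both_le μ hij (S := D) (D := G) (hHm x c) fun e he h1 => ⟨he, h1⟩
    have h2 := hscale k
    have h3 : 0 ≤ P.real (H x c)ᶜ := measureReal_nonneg
    nlinarith
  have hDl : ∀ e ∈ D, ∃ l, Surplus (3 / 4 * y) c (sub l e) := by
    rintro e ⟨-, h1 | h1⟩
    · exact ⟨i, by rw [hyx]; exact h1⟩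
    · exact ⟨j, by rw [hyx]; exact h1⟩
  have hdouble' : ∀ b, P.real (H y (b + b))ᶜ ≤ P.real Dᶜ + 2 * P.real (H y b)ᶜ := fun b =>
    measureReal_either_le μ i j (hHm _ _) fun e he h1 h2 =>
      Balanced.surplus' he.1 hyK hij (hyx.trans_le hxc) (hDl e he) h1 h2
  have hsame' : ∀ b, P.real (H y b)ᶜ ≤ P.real Dᶜ + P.real (H y b)ᶜ ^ 2 := fun b =>
    measureReal_both_le μ hij (hHm _ _) fun e he h1 => by
      change Surplus y b e
      rcases h1 with h1 | h1
      · simpa only [add_zero, zero_add] using Balanced.surplus' he.1 hyK hij (hyx.trans_le hxc) (hDl e he) h1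
          (hHn e he.1 j _ hny)
      · simpa only [add_zero, zero_add] using Balanced.surplus' he.1 hyK hij (hyx.trans_le hxc) (hDl e he)
          (hHn e he.1 i _ hny) h1
  -- At the fixed scale `y`, doubling gives a failure probability `p ≤ 1 / 40 + 2 * (1 / 20) = 1 /
  -- 8`, and `hsame'` gives `p ≤ 1 / 40 + p ^ 2`; together they imply `p ≤ 1 / 20`.
  have hgrow : ∀ l : ℕ, P.real (H y (2 ^ l * (c + c)))ᶜ ≤ 1 / 20 := by
    intro l
    have hnn : ∀ b, 0 ≤ P.real (H y b)ᶜ := fun b => measureReal_nonneg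
    induction l with
    | zero =>
      rw [pow_zero, one_mul]
      have h1 := hdouble y c hyK
      rw [hyx] at h1
      have h2 := hsame' (c + c)
      have h3 := hscale k
      have h4 := hnn (c + c)
      nlinarith
    | succ l ih =>
      rw [pow_succ', two_mul, add_mul]
      have h1 := hdouble' (2 ^ l * (c + c))
      have h2 := hsame' (2 ^ l * (c + c) + 2 ^ l * (c + c))
      have h4 := hnn (2 ^ l * (c + c) + 2 ^ l * (c + c))
      nlinarith
  have hc1 : 1 ≤ c := Nat.one_le_two_pow
  -- If the exits were finite almost surely, an arbitrarily large surplus at the scale `y` would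
  -- have small probability, against `hgrow`.
  refine ⟨⌈y⌉₊, fun hzero => ?_⟩
  obtain ⟨l, hl⟩ := exists_forall_measureReal_le P (S := fun l => H y (2 ^ l * (c + c)))
    (fun l => hHm _ _)
    (fun a b hab e he => Surplus.mono he le_rfl
      (Nat.mul_le_mul_right _ (Nat.pow_le_pow_right (by norm_num) hab)))
    (by
      filter_upwards [measure_eq_zero_iff_ae_notMem.1 hzero] with e he
      by_contra hcon
      push Not at hcon
      refine he (ENat.eq_top_iff_forall_ge.2 fun m => ?_)
      refine le_trans ?_ (hcon m ⌈y⌉₊ (Nat.le_ceil y))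
      have h1 : m < 2 ^ m := Nat.lt_two_pow_self
      have h2 : 2 ^ m ≤ 2 ^ m * (c + c) := Nat.le_mul_of_pos_right _ (by omega)
      exact_mod_cast (by omega : m ≤ ⌈y⌉₊ + 2 ^ m * (c + c))) (ε := 1 / 20) (by norm_num)
  have h1 := hl l le_rfl
  have h2 := hgrow l
  rw [probReal_compl_eq_one_sub (hHm _ _)] at h2
  linarith

/-- A single frog suffices for infinitely many exits, with positive probability. -/
theorem exits_one_eq_top_pos {μ : ℝ≥0} (hμ : μ ≠ 0) {k : ℕ}
    (hk : envLaw d μ {e | exits e k = ⊤} ≠ 0) : envLaw d μ {e | exits e 1 = ⊤} ≠ 0 := by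
  have hm : ∀ k, MeasurableSet {e : Env d | exits e k = ⊤} :=
    fun k => measurable_exits k (measurableSet_singleton _)
  have hstep : ∀ k, envLaw d μ {e | exits e (k + 1) = ⊤} ≠ 0 →
      envLaw d μ {e | exits e 1 = ⊤} ≠ 0 := by
    intro k
    induction k with
    | zero => exact id
    | succ k ih =>
      refine fun h => ih fun h0 => h ?_
      have h1 := measurePreserving_mkEnv (d := d) μ
      rw [← h1.measure_preimage (hm _).nullMeasurableSet] at h0 ⊢
      have h2 : Measure.QuasiMeasurePreserving (Prod.map (addSleeper []) id)
          ((sleeperLaw d μ).prod (stackLaw d)) ((sleeperLaw d μ).prod (stackLaw d)) :=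
        MeasureTheory.QuasiMeasurePreserving.prodMap (quasiMeasurePreserving_addSleeper hμ [])
          (Measure.QuasiMeasurePreserving.id _)
      refine measure_mono_null (fun x hx => ?_) (h2.preimage_null h0)
      change exits (mkEnv (addSleeper [] x.1) x.2) (k + 1) = ⊤
      rw [exits_addSleeper_nil _ _ (Nat.succ_ne_zero k)]
      exact hx
  cases k with
  | zero =>
    refine fun h0 => hk (measure_mono_null (fun e he => ?_) h0)
    exact top_le_iff.1 (he ▸ exits_mono e zero_le_one)
  | succ k => exact hstep k hk

/-! ### Positive probability of recurrence implies probability one -/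

def AgreeBelow (k : ℕ) (e e' : Env d) : Prop := ∀ v, v.length < k → e v = e' v

theorem AgreeBelow.sub {k : ℕ} {e e' : Env d} (h : AgreeBelow (k + 1) e e') (i : Fin d) :
    AgreeBelow k (sub i e) (sub i e') := fun v hv => h _ (by simpa using hv)

/-- Given an environment up to depth `k`, either there is a vertex at depth `k` such that
infinitely many frogs leave if infinitely many frogs leave the tree at this vertex, or at least
as many frogs leave as enter. -/
theorem exists_pivot_or_le (k : ℕ) (e : Env d) {m : ℕ} (hm : m ≠ 0) :
    (∃ v : Vertex d, v.length = k ∧ ∀ e', AgreeBelow k e e' →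
      exits (fun w => e' (w ++ v)) 1 = ⊤ → exits e' m = ⊤) ∨
    ∀ e', AgreeBelow k e e' → (m : ℕ∞) ≤ exits e' m := by
  classical
  induction k generalizing e m with
  | zero =>
    left
    refine ⟨[], rfl, fun e' _ h => ?_⟩
    simp only [List.append_nil] at h
    exact top_le_iff.1 (h ▸ exits_mono e' (Nat.one_le_iff_ne_zero.2 hm))
  | succ k ih =>
    by_cases hb : ∀ e', AgreeBelow (k + 1) e e' → (m : ℕ∞) ≤ exits e' m
    · exact Or.inr hb
    left
    push Not at hb
    obtain ⟨e₁, he₁, hlt⟩ := hb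
    have hroot : ∀ e', AgreeBelow (k + 1) e e' → e' [] = e [] :=
      fun e' h => (h [] (by simp)).symm
    have hle : exits e₁ m ≤ (m - 1 : ℕ) := by
      obtain ⟨n, hn⟩ := ENat.ne_top_iff_exists.1 (ne_top_of_lt hlt)
      rw [← hn] at hlt ⊢
      norm_cast at hlt ⊢
      omega
    rw [exits_eq_node, node_le_iff, hroot e₁ he₁] at hle
    obtain ⟨A, hA, hup⟩ := hle
    set c : Fin d → ℕ → ℕ := fun i A => instrCount (e []).2 (some i) A with hc
    set Piv : ℕ → Prop := fun A => ∃ i, c i A ≠ 0 ∧ ∃ v : Vertex d, v.length = k ∧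
      ∀ e', AgreeBelow k (sub i e) e' → exits (fun w => e' (w ++ v)) 1 = ⊤ →
        exits e' (c i A) = ⊤ with hPiv
    -- without a pivot there is no deficit
    have hnot : ∀ e' B, AgreeBelow (k + 1) e e' → ¬ Piv B →
        ((m + if m = 0 then 0 else (e []).1 : ℕ) : ℕ∞) + ∑ i, exits (sub i e') (c i B) ≤ B →
        m ≤ instrCount (e []).2 none B := by
      intro e' B he' hB hst
      have := add_sum_le_of_surplus hst (β := fun _ => 0) fun i => by
        rw [add_zero]
        by_cases hi : c i B = 0
        · rw [hc] at hi
          dsimp only at hi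
          rw [hi]
          simp
        · refine (ih (sub i e) hi).resolve_left (fun h => hB ⟨i, hi, h⟩) _ (he'.sub i)
      simpa using this
    have hex : ∃ B, Piv B := by
      refine ⟨A, ?_⟩
      by_contra hcon
      have := hnot e₁ A he₁ hcon hA
      omega
    -- Take the least number of departures from the top at which some child `i` has a pivot; it is
    -- at most `A`, since `A` sends up fewer than `m` frogs. A smaller number admissible for `e'`
    -- would send up at least `m` frogs, but cannot send more than `A` does. From the least number
    -- on, the pivot makes the exits of the child `i` infinite. So no number is admissible.
    obtain ⟨i, hi, v, hv, hpiv⟩ := Nat.find_spec hex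
    have hfindA : Nat.find hex ≤ A := by
      refine Nat.find_min' hex ?_
      by_contra hcon
      have := hnot e₁ A he₁ hcon hA
      omega
    refine ⟨v ++ [i], by simp [hv], fun e' he' htop => ?_⟩
    have h1 : exits (sub i e') (c i (Nat.find hex)) = ⊤ := by
      refine hpiv _ (he'.sub i) ?_
      convert htop using 2
      funext w
      simp [sub]
    rw [exits_eq_node, ← top_le_iff, hroot e' he', le_node_iff]
    intro B hB
    exfalso
    rcases lt_or_ge B (Nat.find hex) with h2 | h2
    · have h3 := hnot e' B he' (Nat.find_min hex h2) hB
      have h4 := instrCount_mono (e []).2 none (h2.le.trans hfindA)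
      omega
    · have h3 : exits (sub i e') (c i B) = ⊤ :=
        top_le_iff.1 (h1 ▸ exits_mono _ (instrCount_mono _ _ h2))
      have h4 := Finset.single_le_sum (f := fun i => exits (sub i e') (c i B))
        (fun _ _ => zero_le) (Finset.mem_univ i)
      have h5 := (h4.trans le_add_self).trans hB
      simp only [h3] at h5
      exact absurd h5 (by simp)

/-- No frog leaves the root upwards, so at least one exit already means infinitely many. In the
second alternative of `exists_pivot_or_le` the model is recurrent in any case, and the vertex is
arbitrary. -/
theorem exists_pivot_rootEnv [NeZero d] {k : ℕ} (hk : k ≠ 0) (τ : ℕ → Fin d) (e : Env d) :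
    ∃ v : Vertex d, v.length = k ∧ ∀ e', AgreeBelow k e e' →
      exits (fun w => e' (w ++ v)) 1 = ⊤ → exits (rootEnv τ e') 1 = ⊤ := by
  have hagree : ∀ e', AgreeBelow k e e' → AgreeBelow k (rootEnv τ e) (rootEnv τ e') := by
    intro e' h v hv
    by_cases h0 : v = []
    · subst h0; simp [rootEnv]
    · rw [rootEnv_of_ne _ _ h0, rootEnv_of_ne _ _ h0, h v hv]
  rcases exists_pivot_or_le k (rootEnv τ e) one_ne_zero with ⟨v, hv, h⟩ | h
  · refine ⟨v, hv, fun e' he' htop => h _ (hagree e' he') ?_⟩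
    have : (fun w => rootEnv τ e' (w ++ v)) = fun w => e' (w ++ v) := by
      funext w
      refine rootEnv_of_ne _ _ fun h0 => hk ?_
      rw [← hv, (List.append_eq_nil_iff.1 h0).2, List.length_nil]
    rwa [this]
  · refine ⟨List.replicate k 0, by simp, fun e' he' _ => ?_⟩
    by_contra hne
    have h1 := h _ (hagree e' he')
    rw [exits_eq_top_iff, not_not] at hne
    obtain ⟨u, hu⟩ := hne
    have h2 : exits (rootEnv τ e') 1 ≤ (0 : ℕ) := by
      refine exits_le_iff.2 ⟨u, hu, le_of_eq ?_⟩
      simp [instrCount, rootEnv]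
    exact absurd (h1.trans h2) (by simp)

/-- Events that depend on the environment at small depth only make recurrence at most a factor
less likely. -/
theorem mul_measure_le_inter_recurrent [NeZero d] (μ : ℝ≥0) (τ : ℕ → Fin d) {k : ℕ} (hk : k ≠ 0)
    {C : Set (Env d)} (hC : MeasurableSet C)
    (hCk : ∀ e e', AgreeBelow k e e' → e ∈ C → e' ∈ C) :
    envLaw d μ {e | exits e 1 = ⊤} * envLaw d μ C ≤
      envLaw d μ (C ∩ {e | exits (rootEnv τ e) 1 = ⊤}) := by
  have hR : MeasurableSet {e : Env d | exits (rootEnv τ e) 1 = ⊤} :=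
    ((measurable_exits 1).comp (measurable_rootEnv.comp measurable_prodMk_left))
      (measurableSet_singleton ⊤)
  have hs := measurePreserving_split (fun _ : Vertex d => siteLaw d μ)
    (f := fun v : {v : Vertex d // v.length < k} => v.1)
    (g := fun v : {v : Vertex d // k ≤ v.length} => v.1) Subtype.val_injective
    Subtype.val_injective (fun a b h => absurd (h ▸ a.2) (not_lt.2 b.2))
  set ρ₁ := Measure.infinitePi fun _ : {v : Vertex d // v.length < k} => siteLaw d μ
  set ρ₂ := Measure.infinitePi fun _ : {v : Vertex d // k ≤ v.length} => siteLaw d μ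
  set g : ({v : Vertex d // v.length < k} → Site d) × ({v : Vertex d // k ≤ v.length} → Site d) →
      Env d := fun q v => if h : v.length < k then q.1 ⟨v, h⟩ else q.2 ⟨v, not_lt.1 h⟩ with hg
  have hgm : Measurable g := by
    refine measurable_pi_lambda _ fun v => ?_
    by_cases h : v.length < k
    · simp only [hg, h, dite_true]; exact (measurable_pi_apply _).comp measurable_fst
    · simp only [hg, h, dite_false]; exact (measurable_pi_apply _).comp measurable_snd
  have hgP : MeasurePreserving g (ρ₁.prod ρ₂) (envLaw d μ) := by
    refine ⟨hgm, ?_⟩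
    rw [← hs.map_eq, Measure.map_map hgm hs.measurable]
    have hid : (g ∘ fun x : Env d => (fun a : {v : Vertex d // v.length < k} => x a.1,
        fun b : {v : Vertex d // k ≤ v.length} => x b.1)) = id := by
      funext e v
      simp only [hg, Function.comp_apply, id]
      split_ifs <;> rfl
    rw [hid, Measure.map_id]
    rfl
  rw [← hgP.measure_preimage hC.nullMeasurableSet,
    ← hgP.measure_preimage (hC.inter hR).nullMeasurableSet, Measure.prod_apply (hgm hC),
    Measure.prod_apply (hgm (hC.inter hR)),
    ← lintegral_const_mul _ (measurable_measure_prodMk_left (hgm hC))]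
  refine lintegral_mono fun x => ?_
  have hag : ∀ y y', AgreeBelow k (g (x, y)) (g (x, y')) := by
    intro y y' v hv
    simp [hg, hv]
  by_cases hx : ∃ y, g (x, y) ∈ C
  · obtain ⟨y, hy⟩ := hx
    -- The pivot is determined by the environment above depth `k`, so the environment of its subtree
    -- is still fresh and makes infinitely many frogs leave with the unconditional probability.
    obtain ⟨v, hv, hpiv⟩ := exists_pivot_rootEnv hk τ (g (x, y))
    have hdesc : MeasurePreserving
        (fun (z : {v : Vertex d // k ≤ v.length} → Site d) (w : Vertex d) =>
          z ⟨w ++ v, by simp [hv]⟩) ρ₂ (envLaw d μ) :=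
      ⟨by fun_prop, Measure.map_infinitePi_infinitePi_of_inj
        (P := fun _ : {v : Vertex d // k ≤ v.length} => siteLaw d μ)
        (f := fun w : Vertex d => ⟨w ++ v, by simp [hv]⟩)
        (fun a b h => List.append_left_injective v (congrArg Subtype.val h))⟩
    refine (mul_le_of_le_one_right zero_le prob_le_one).trans ?_
    have htop : MeasurableSet {e : Env d | exits e 1 = ⊤} :=
      measurable_exits 1 (measurableSet_singleton ⊤)
    rw [← hdesc.measure_preimage htop.nullMeasurableSet]
    refine measure_mono fun z hz => ⟨hCk _ _ (hag y z) hy, hpiv _ (hag y z) ?_⟩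
    have : (fun w => g (x, z) (w ++ v)) = fun w => z ⟨w ++ v, by simp [hv]⟩ := by
      funext w
      simp [hg, hv]
    rw [this]
    exact hz
  · have : Prod.mk x ⁻¹' (g ⁻¹' C) = ∅ :=
      Set.eq_empty_of_forall_notMem fun y hy => hx ⟨y, hy⟩
    rw [this, measure_empty, mul_zero]
    exact zero_le

/-- If recurrence failed with positive probability, the failure could be approximated by an event
`C` of finite depth. Recurrence has probability at least `q * P C` within `C`, although `C` is
nearly contained in the failure; this is the argument of Lévy's zero-one law. -/
theorem exits_rootEnv_ae_eq_top [NeZero d] {μ : ℝ≥0}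
    (hq : envLaw d μ {e | exits e 1 = ⊤} ≠ 0) (τ : ℕ → Fin d) :
    ∀ᵐ e ∂(envLaw d μ), exits (rootEnv τ e) 1 = ⊤ := by
  set P := envLaw d μ with hP
  set R : Set (Env d) := {e : Env d | exits (rootEnv τ e) 1 = ⊤} with hRdef
  have hR : MeasurableSet R :=
    ((measurable_exits 1).comp (measurable_rootEnv.comp measurable_prodMk_left))
      (measurableSet_singleton ⊤)
  set q := P.real {e | exits e 1 = ⊤} with hqdef
  have hq0 : 0 < q := by
    rw [hqdef, measureReal_def]
    exact ENNReal.toReal_pos hq (measure_ne_top _ _)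
  have hq1 : q ≤ 1 := measureReal_le_one
  have key : ∀ ε : ℝ, 0 < ε → q * P.real Rᶜ ≤ 2 * ε := by
    intro ε hε
    have hdense : P.MeasureDense (measurableCylinders fun _ : Vertex d => Site d) :=
      Measure.MeasureDense.of_generateFrom_isSetAlgebra_finite P isSetAlgebra_measurableCylinders
        generateFrom_measurableCylinders.symm
    obtain ⟨C, hC, hCR⟩ := hdense.approx Rᶜ hR.compl (measure_ne_top _ _) ε hε
    have hCm := hdense.measurable _ hC
    obtain ⟨F, S, hS, rfl⟩ := (mem_measurableCylinders C).1 hC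
    set C := cylinder (α := fun _ => Site d) F S with hCdef
    obtain ⟨k, hk0, hk⟩ : ∃ k, k ≠ 0 ∧ ∀ v ∈ F, v.length < k := by
      refine ⟨F.sup (fun v => v.length) + 1, by omega, fun v hv => Nat.lt_succ_of_le ?_⟩
      exact Finset.le_sup (f := fun v : Vertex d => v.length) hv
    have h1 := mul_measure_le_inter_recurrent μ τ hk0 hCm fun e e' hag he => by
      rw [hCdef, mem_cylinder] at he ⊢
      convert he using 1
      funext v
      exact (hag v.1 (hk v.1 v.2)).symm
    have h2 : q * P.real C ≤ P.real (C ∩ R) := by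
      rw [hqdef, measureReal_def, measureReal_def, measureReal_def, ← ENNReal.toReal_mul]
      exact ENNReal.toReal_mono (measure_ne_top _ _) h1
    have hd : P.real (Rᶜ ∆ C) < ε := by
      rw [measureReal_def]
      exact (ENNReal.lt_ofReal_iff_toReal_lt (measure_ne_top _ _)).1 hCR
    have h3 : P.real (C ∩ R) ≤ P.real (Rᶜ ∆ C) :=
      measureReal_mono fun x hx => Or.inr ⟨hx.1, fun h => h hx.2⟩
    have h4 : |P.real Rᶜ - P.real C| ≤ P.real (Rᶜ ∆ C) :=
      abs_measureReal_sub_le_measureReal_symmDiff hR.compl.nullMeasurableSet hCm.nullMeasurableSet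
    have h5 := abs_le.1 h4
    nlinarith
  have h0 : P.real Rᶜ = 0 := by
    by_contra hne
    have hpos : 0 < P.real Rᶜ := lt_of_le_of_ne measureReal_nonneg (Ne.symm hne)
    have := key (q * P.real Rᶜ / 4) (by positivity)
    have : 0 < q * P.real Rᶜ := by positivity
    linarith
  rw [measureReal_def, ENNReal.toReal_eq_zero_iff, or_iff_left (measure_ne_top _ _)] at h0
  exact h0

/-- If the frog model is recurrent with positive probability, then it is recurrent almost
surely. -/
theorem ae_recurrent_of_pos (hd : 2 ≤ d) {μ : ℝ≥0} (hμ : μ ≠ 0)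
    (hR : law d μ {ω | Recurrent ω} ≠ 0) : ∀ᵐ ω ∂(law d μ), Recurrent ω := by
  have : NeZero d := ⟨by omega⟩
  obtain ⟨k, hk⟩ := exists_exits_eq_top_pos hd fun b => ae_eventuallyLE hμ hR b
  have hq := exits_one_eq_top_pos hμ hk
  have hmeas : MeasurableSet {x : (ℕ → Fin d) × Env d | exits (rootEnv x.1 x.2) 1 = ⊤} :=
    ((measurable_exits 1).comp measurable_rootEnv) (measurableSet_singleton _)
  have h1 : ∀ᵐ x ∂((uniformSeq (Fin d)).prod (envLaw d μ)), exits (rootEnv x.1 x.2) 1 = ⊤ :=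
    (Measure.ae_prod_iff_ae_ae hmeas).2 (ae_of_all _ fun τ => exits_rootEnv_ae_eq_top hq τ)
  have h2 : law d μ {ω | Recurrent ω} = 1 := by
    rw [law_recurrent_eq_env]
    exact (mem_ae_iff_prob_eq_one hmeas).1 h1
  exact (mem_ae_iff_prob_eq_one measurableSet_recurrent).2 h2

/-! ### Monotonicity in the density of sleepers -/

/-- A configuration that is stable with more sleepers is stable with fewer. -/
theorem exits_mono_sleepers {e e' : Env d} (hs : ∀ v, (e v).2 = (e' v).2)
    (hN : ∀ v, (e v).1 ≤ (e' v).1) (m : ℕ) : exits e m ≤ exits e' m := by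
  refine le_iInf fun u => exits_le_iff.2 ⟨u.1, fun v => le_trans ?_ (u.2 v), by rw [hs]⟩
  have h1 : fromAbove e m u.1 v = fromAbove e' m u.1 v := by
    cases v with
    | nil => rfl
    | cons i w => simp only [fromAbove, hs]
  have h2 : fromBelow e u.1 v = fromBelow e' u.1 v := by simp only [fromBelow, hs]
  unfold inflow
  rw [h1, h2]
  have := hN v
  split_ifs <;> omega

theorem measurePreserving_add_poisson (a b : ℝ≥0) :
    MeasurePreserving (fun x : ℕ × ℕ => x.1 + x.2) ((poissonMeasure a).prod (poissonMeasure b))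
      (poissonMeasure (a + b)) :=
  ⟨measurable_fst.add measurable_snd, poissonMeasure_conv_poissonMeasure a b⟩

theorem measurePreserving_add_sleepers (a b : ℝ≥0) :
    MeasurePreserving (fun (x : (Vertex d → ℕ) × (Vertex d → ℕ)) v => x.1 v + x.2 v)
      ((sleeperLaw d a).prod (sleeperLaw d b)) (sleeperLaw d (a + b)) := by
  refine ⟨by fun_prop, ?_⟩
  have h := Measure.infinitePi_map_pi
    (μ := fun _ : Vertex d => (poissonMeasure a).prod (poissonMeasure b))
    (f := fun _ x => x.1 + x.2) fun _ => (measurePreserving_add_poisson a b).measurable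
  simp_rw [(measurePreserving_add_poisson a b).map_eq] at h
  rw [sleeperLaw, sleeperLaw, sleeperLaw, ← h, ← infinitePi_map_unzip,
    Measure.map_map (by fun_prop) (by fun_prop)]
  rfl

/-- A `Poi(μ + δ)` number is a `Poi(μ)` number plus an independent one; the two models are coupled
with the same stacks. -/
theorem law_recurrent_mono [NeZero d] {μ μ' : ℝ≥0} (h : μ ≤ μ') :
    law d μ {ω | Recurrent ω} ≤ law d μ' {ω | Recurrent ω} := by
  obtain ⟨δ, rfl⟩ := exists_add_of_le h
  have hmeas : MeasurableSet {q : (ℕ → Fin d) × Env d | exits (rootEnv q.1 q.2) 1 = ⊤} :=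
    ((measurable_exits 1).comp measurable_rootEnv) (measurableSet_singleton _)
  have h1 := (MeasurePreserving.id (uniformSeq (Fin d))).prod
    ((measurePreserving_mkEnv (d := d) (μ + δ)).comp
      ((measurePreserving_add_sleepers (d := d) μ δ).prod (MeasurePreserving.id (stackLaw d))))
  have h2 := (MeasurePreserving.id (uniformSeq (Fin d))).prod
    ((measurePreserving_mkEnv (d := d) μ).comp
      ((measurePreserving_fst (μ := sleeperLaw d μ) (ν := sleeperLaw d δ)).prod
        (MeasurePreserving.id (stackLaw d))))
  rw [law_recurrent_eq_env, law_recurrent_eq_env, ← h1.measure_preimage hmeas.nullMeasurableSet,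
    ← h2.measure_preimage hmeas.nullMeasurableSet]
  refine measure_mono fun x hx => top_le_iff.1 (le_of_eq_of_le (Eq.symm hx) ?_)
  refine exits_mono_sleepers (fun v => ?_) (fun v => ?_) 1
  · by_cases hv : v = []
    · subst hv; simp [rootEnv]
    · simp [rootEnv_of_ne _ _ hv, mkEnv]
  · by_cases hv : v = []
    · subst hv; simp [rootEnv]
    · simp [rootEnv_of_ne _ _ hv, mkEnv]

/-! ### Resampling coordinates of a product measure -/

open Classical in
/-- The coordinates in `S` are taken from `x` and the other coordinates from `y`. -/
noncomputable def mix {ι Ω : Type*} (S : Set ι) (x y : ι → Ω) : ι → Ω :=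
  fun i => if i ∈ S then x i else y i

theorem mix_of_mem {ι Ω : Type*} {S : Set ι} (x y : ι → Ω) {i : ι} (h : i ∈ S) :
    mix S x y i = x i := if_pos h

theorem mix_of_notMem {ι Ω : Type*} {S : Set ι} (x y : ι → Ω) {i : ι} (h : i ∉ S) :
    mix S x y i = y i := if_neg h

theorem measurePreserving_mix {ι Ω : Type*} [MeasurableSpace Ω] (p : ι → Measure Ω)
    [∀ i, IsProbabilityMeasure (p i)] (S : Set ι) :
    MeasurePreserving (fun x : (ι → Ω) × (ι → Ω) => mix S x.1 x.2)
      ((Measure.infinitePi p).prod (Measure.infinitePi p)) (Measure.infinitePi p) := by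
  classical
  have hm : Measurable fun x : (ι → Ω) × (ι → Ω) => mix S x.1 x.2 := by
    refine measurable_pi_lambda _ fun i => ?_
    by_cases h : i ∈ S
    · simp only [mix_of_mem _ _ h]; fun_prop
    · simp only [mix_of_notMem _ _ h]; fun_prop
  refine ⟨hm, ?_⟩
  set f : ι → Ω × Ω → Ω := fun i q => if i ∈ S then q.1 else q.2 with hf
  have hfm : ∀ i, Measurable (f i) := by
    intro i
    by_cases h : i ∈ S
    · simp only [hf, if_pos h]; exact measurable_fst
    · simp only [hf, if_neg h]; exact measurable_snd
  have h1 := Measure.infinitePi_map_pi (μ := fun i => (p i).prod (p i)) hfm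
  have h2 : ∀ i, ((p i).prod (p i)).map (f i) = p i := by
    intro i
    by_cases h : i ∈ S
    · simp only [hf, if_pos h]; exact measurePreserving_fst.map_eq
    · simp only [hf, if_neg h]; exact measurePreserving_snd.map_eq
  simp_rw [h2] at h1
  rw [← infinitePi_map_unzip, Measure.map_map hm (by fun_prop)]
  exact h1

/-- If `F` depends on the coordinates in `S` only, and the `G c` depend on the other coordinates
only, then the latter may be resampled. -/
theorem lintegral_mix {ι Ω X : Type*} [MeasurableSpace Ω] (p : ι → Measure Ω)
    [∀ i, IsProbabilityMeasure (p i)] (S : Set ι) {F : (ι → Ω) → X} {G : X → (ι → Ω) → ℝ≥0∞}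
    (hF : ∀ x y, F (mix S x y) = F x) (hG : ∀ c x y, G c (mix S x y) = G c y)
    (hm : Measurable fun q : (ι → Ω) × (ι → Ω) => G (F q.1) q.2) :
    ∫⁻ x, G (F x) x ∂(Measure.infinitePi p) =
      ∫⁻ x, ∫⁻ y, G (F x) y ∂(Measure.infinitePi p) ∂(Measure.infinitePi p) := by
  have hd : Measurable fun x => G (F x) x := hm.comp (measurable_id.prodMk measurable_id)
  rw [← (measurePreserving_mix p S).lintegral_comp hd, lintegral_prod]
  · simp only [hF, hG]
  · simp only [hF, hG]
    exact hm.aemeasurable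

/-! ### Simple random walk -/

/-- The average of `h` over the neighbours of a vertex. -/
noncomputable def stepMean (h : Vertex d → ℝ) : Vertex d → ℝ
  | [] => (∑ i, h [i]) / d
  | k :: t => (h t + ∑ i, h (i :: k :: t)) / (d + 1)

theorem lintegral_step [NeZero d] {h : Vertex d → ℝ} (h0 : ∀ v, 0 ≤ h v) (u : Vertex d) :
    ∫⁻ w, ENNReal.ofReal (h w) ∂(step d u) = ENNReal.ofReal (stepMean h u) := by
  cases u with
  | nil =>
    rw [step_root, lintegral_map (measurable_of_countable _) (measurable_of_countable _),
      lintegral_uniform, Fintype.card_fin, stepMean,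
      ENNReal.ofReal_div_of_pos (by exact_mod_cast Nat.pos_of_ne_zero (NeZero.ne d)),
      ENNReal.ofReal_sum_of_nonneg fun i _ => h0 _, ENNReal.ofReal_natCast,
      ENNReal.div_eq_inv_mul]
  | cons k t =>
    rw [step_cons, lintegral_map (measurable_of_countable _) (measurable_of_countable _),
      lintegral_uniform, Fintype.card_option, Fintype.card_fin, stepMean,
      ENNReal.ofReal_div_of_pos (by positivity), Fintype.sum_option,
      ENNReal.ofReal_add (h0 _) (Finset.sum_nonneg fun i _ => h0 _),
      ENNReal.ofReal_sum_of_nonneg fun i _ => h0 _]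
    congr 1
    rw [← Nat.cast_succ, ENNReal.ofReal_natCast]

theorem lintegral_walk (g : Vertex d → ℝ≥0∞) (v : Vertex d) (n : ℕ) :
    ∫⁻ S, g (S n) ∂(walkLaw d v) =
      ∫⁻ ξ, g (path v ξ n) ∂(Measure.infinitePi fun p : ℕ × Vertex d => step d p.2) :=
  lintegral_map (f := fun S : ℕ → Vertex d => g (S n))
    ((measurable_of_countable g).comp (measurable_pi_apply n)) (measurable_path v)

/-- The Markov property: the path up to time `n` uses only instructions for earlier times, so the
instruction for time `n` may be resampled. -/
theorem lintegral_walk_succ [NeZero d] (g : Vertex d → ℝ≥0∞) (v : Vertex d) (n : ℕ) :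
    ∫⁻ S, g (S (n + 1)) ∂(walkLaw d v) = ∫⁻ S, ∫⁻ w, g w ∂(step d (S n)) ∂(walkLaw d v) := by
  have hm : ∀ n, Measurable fun ξ : ℕ × Vertex d → Vertex d => path v ξ n :=
    fun n => (measurable_pi_apply n).comp (measurable_path v)
  rw [lintegral_walk, lintegral_walk fun x => ∫⁻ w, g w ∂(step d x)]
  have h1 := lintegral_mix (fun p : ℕ × Vertex d => step d p.2) {q | q.1 < n}
    (F := fun ξ => path v ξ n) (G := fun w ξ => g (ξ (n, w)))
  refine (h1 ?_ ?_ ?_).trans (lintegral_congr fun ξ => ?_)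
  · intro x y
    have : ∀ k ≤ n, path v (mix {q | q.1 < n} x y) k = path v x k := by
      intro k
      induction k with
      | zero => intro _; rfl
      | succ k ih =>
        intro hk
        have hk' : (k, path v x k) ∈ {q : ℕ × Vertex d | q.1 < n} := by
          simp only [Set.mem_ofPred_eq]; omega
        rw [path, path, ih (by omega), mix_of_mem x y hk']
    exact this n le_rfl
  · intro c x y
    rw [mix_of_notMem]
    simp
  · have h2 : Measurable fun q : (ℕ × Vertex d → Vertex d) × Vertex d => g (q.1 (n, q.2)) :=
      measurable_from_prod_countable_left fun w =>
        show Measurable fun f : ℕ × Vertex d → Vertex d => g (f (n, w)) from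
          (measurable_of_countable g).comp (measurable_pi_apply (n, w))
    exact h2.comp (measurable_snd.prodMk ((hm n).comp measurable_fst))
  · have h3 := Measure.infinitePi_map_eval (fun p : ℕ × Vertex d => step d p.2) (n, path v ξ n)
    simp only at h3
    rw [← h3]
    exact (lintegral_map (f := g) (measurable_of_countable g)
      (measurable_pi_apply (n, path v ξ n))).symm

theorem le_lintegral_walk [NeZero d] {h : Vertex d → ℝ} (h0 : ∀ v, 0 ≤ h v)
    (hs : ∀ v, h v ≤ stepMean h v) (v : Vertex d) (n : ℕ) :
    ENNReal.ofReal (h v) ≤ ∫⁻ S, ENNReal.ofReal (h (S n)) ∂(walkLaw d v) := by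
  induction n with
  | zero =>
    rw [lintegral_walk fun w => ENNReal.ofReal (h w)]
    simp [path]
  | succ n ih =>
    rw [lintegral_walk_succ fun w => ENNReal.ofReal (h w)]
    refine ih.trans (lintegral_mono fun S => ?_)
    rw [lintegral_step h0]
    exact ENNReal.ofReal_le_ofReal (hs _)

theorem lintegral_walk_le [NeZero d] {h : Vertex d → ℝ} (h0 : ∀ v, 0 ≤ h v) {ρ : ℝ} (hρ : 0 ≤ ρ)
    (hs : ∀ v, stepMean h v ≤ ρ * h v) (v : Vertex d) (n : ℕ) :
    ∫⁻ S, ENNReal.ofReal (h (S n)) ∂(walkLaw d v) ≤ ENNReal.ofReal (ρ ^ n * h v) := by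
  induction n with
  | zero =>
    rw [lintegral_walk fun w => ENNReal.ofReal (h w)]
    simp [path]
  | succ n ih =>
    rw [lintegral_walk_succ fun w => ENNReal.ofReal (h w)]
    have hm : Measurable fun S : ℕ → Vertex d => ENNReal.ofReal (h (S n)) :=
      (measurable_of_countable fun w => ENNReal.ofReal (h w)).comp (measurable_pi_apply n)
    calc ∫⁻ S, ∫⁻ w, ENNReal.ofReal (h w) ∂(step d (S n)) ∂(walkLaw d v)
        ≤ ∫⁻ S, ENNReal.ofReal ρ * ENNReal.ofReal (h (S n)) ∂(walkLaw d v) := by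
          refine lintegral_mono fun S => ?_
          rw [lintegral_step h0, ← ENNReal.ofReal_mul hρ]
          exact ENNReal.ofReal_le_ofReal (hs _)
      _ = ENNReal.ofReal ρ * ∫⁻ S, ENNReal.ofReal (h (S n)) ∂(walkLaw d v) :=
          lintegral_const_mul _ hm
      _ ≤ ENNReal.ofReal ρ * ENNReal.ofReal (ρ ^ n * h v) := by gcongr
      _ = ENNReal.ofReal (ρ ^ (n + 1) * h v) := by
          rw [← ENNReal.ofReal_mul hρ, pow_succ']; ring_nf

/-! ### The potential of a vertex -/

/-- The number `d ^ (-D)`, where `D` is the distance from `x` in the tree. -/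
noncomputable def decay (x : Vertex d) : Vertex d → ℝ
  | [] => (d : ℝ)⁻¹ ^ x.length
  | i :: u => if (i :: u) <:+ x then d * decay x u else decay x u / d

theorem decay_cons_of_suffix {x : Vertex d} {i : Fin d} {u : Vertex d} (h : (i :: u) <:+ x) :
    decay x (i :: u) = d * decay x u := by rw [decay, if_pos h]

theorem decay_cons_of_not_suffix {x : Vertex d} {i : Fin d} {u : Vertex d}
    (h : ¬ (i :: u) <:+ x) : decay x (i :: u) = decay x u / d := by rw [decay, if_neg h]

theorem decay_nonneg (x u : Vertex d) : 0 ≤ decay x u := by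
  induction u with
  | nil => rw [decay]; positivity
  | cons i u ih => rw [decay]; split_ifs <;> positivity

theorem suffix_of_cons_suffix {i : Fin d} {u x : Vertex d} (h : (i :: u) <:+ x) : u <:+ x :=
  (List.suffix_cons i u).trans h

theorem decay_mul_pow_of_suffix [NeZero d] {x u : Vertex d} (h : u <:+ x) :
    decay x u * (d : ℝ) ^ x.length = d ^ u.length := by
  have hd : (d : ℝ) ≠ 0 := by exact_mod_cast NeZero.ne d
  induction u with
  | nil => rw [decay, ← mul_pow, inv_mul_cancel₀ hd]; simp
  | cons i u ih =>
    rw [decay_cons_of_suffix h, mul_assoc, ih (suffix_of_cons_suffix h), List.length_cons, pow_succ']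

theorem decay_self [NeZero d] (x : Vertex d) : decay x x = 1 := by
  have hd : (d : ℝ) ≠ 0 := by exact_mod_cast NeZero.ne d
  have := decay_mul_pow_of_suffix (List.suffix_refl x)
  exact mul_right_cancel₀ (pow_ne_zero _ hd) (this.trans (one_mul _).symm)

theorem one_le_cast [NeZero d] : (1 : ℝ) ≤ d := by
  exact_mod_cast Nat.one_le_iff_ne_zero.2 (NeZero.ne d)

theorem decay_le_one [NeZero d] (x u : Vertex d) : decay x u ≤ 1 := by
  have hd := one_le_cast (d := d)
  induction u with
  | nil => rw [decay]; exact pow_le_one₀ (by positivity) (inv_le_one_of_one_le₀ hd)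
  | cons i u ih =>
    by_cases h : (i :: u) <:+ x
    · have h1 := decay_mul_pow_of_suffix h
      have h2 : (d : ℝ) ^ (i :: u).length ≤ d ^ x.length := pow_le_pow_right₀ hd h.length_le
      rw [← h1] at h2
      exact le_of_mul_le_mul_right (by linarith) (by positivity : (0 : ℝ) < d ^ x.length)
    · rw [decay_cons_of_not_suffix h]
      exact (div_le_self (decay_nonneg _ _) hd).trans ih

theorem decay_mul_pow_le [NeZero d] (x u : Vertex d) :
    decay x u * (d : ℝ) ^ u.length ≤ d ^ x.length := by
  have hd := one_le_cast (d := d)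
  induction u with
  | nil => simpa using (decay_le_one x ([] : Vertex d)).trans (one_le_pow₀ hd)
  | cons i u ih =>
    by_cases h : (i :: u) <:+ x
    · have h2 : (d : ℝ) ^ (i :: u).length ≤ d ^ x.length := pow_le_pow_right₀ hd h.length_le
      exact (mul_le_of_le_one_left (by positivity) (decay_le_one _ _)).trans h2
    · rw [decay_cons_of_not_suffix h, List.length_cons, pow_succ]
      have : decay x u / d * (d ^ u.length * d) = decay x u * (d : ℝ) ^ u.length := by
        field_simp
      rwa [this]

theorem pow_le_decay [NeZero d] (x u : Vertex d) :
    (d : ℝ)⁻¹ ^ (x.length + u.length) ≤ decay x u := by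
  have hd := one_le_cast (d := d)
  induction u with
  | nil => rw [decay]; exact le_rfl
  | cons i u ih =>
    rw [List.length_cons, ← add_assoc, pow_succ]
    by_cases h : (i :: u) <:+ x
    · rw [decay_cons_of_suffix h]
      have h0 := decay_nonneg x u
      have h1 : (d : ℝ)⁻¹ ≤ d := (inv_le_one_of_one_le₀ hd).trans hd
      calc (d : ℝ)⁻¹ ^ (x.length + u.length) * (d : ℝ)⁻¹ ≤ decay x u * d := by gcongr
        _ = d * decay x u := mul_comm _ _
    · rw [decay_cons_of_not_suffix h, div_eq_mul_inv]
      gcongr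

theorem append_singleton_suffix_iff {u x : Vertex d} {i j : Fin d} :
    u ++ [i] <:+ x ++ [j] ↔ i = j ∧ u <:+ x := by
  constructor
  · rintro ⟨t, ht⟩
    rw [← List.append_assoc] at ht
    obtain ⟨h1, h2⟩ := List.append_inj' ht rfl
    exact ⟨by simpa using h2, t, h1⟩
  · rintro ⟨rfl, t, rfl⟩
    exact ⟨t, by simp⟩

theorem decay_append [NeZero d] (x u : Vertex d) (i : Fin d) :
    decay (x ++ [i]) (u ++ [i]) = decay x u := by
  have hd : (d : ℝ) ≠ 0 := by exact_mod_cast NeZero.ne d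
  induction u with
  | nil =>
    rw [List.nil_append, decay_cons_of_suffix ⟨x, rfl⟩, decay, decay, List.length_append,
      List.length_singleton, pow_succ]
    field_simp
  | cons k u ih =>
    have h : (k :: (u ++ [i])) <:+ x ++ [i] ↔ (k :: u) <:+ x := by
      have := append_singleton_suffix_iff (u := k :: u) (x := x) (i := i) (j := i)
      simpa using this
    rw [List.cons_append]
    by_cases hk : (k :: u) <:+ x
    · rw [decay_cons_of_suffix hk, decay_cons_of_suffix (h.2 hk), ih]
    · rw [decay_cons_of_not_suffix hk, decay_cons_of_not_suffix (mt h.1 hk), ih]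

theorem decay_append_of_ne (x u : Vertex d) {i j : Fin d} (hij : i ≠ j) :
    decay (x ++ [j]) (u ++ [i]) = (d : ℝ)⁻¹ ^ (u.length + x.length + 2) := by
  have hns : ∀ u : Vertex d, ¬ u ++ [i] <:+ x ++ [j] :=
    fun u h => hij (append_singleton_suffix_iff.1 h).1
  induction u with
  | nil =>
    have := hns []
    rw [List.nil_append] at this ⊢
    rw [decay_cons_of_not_suffix this, decay, List.length_append, List.length_singleton,
      List.length_nil, zero_add, pow_succ _ (x.length + 1), div_eq_mul_inv]
  | cons k u ih =>
    have := hns (k :: u)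
    rw [List.cons_append] at this ⊢
    rw [decay_cons_of_not_suffix this, ih, div_eq_mul_inv, ← pow_succ, List.length_cons]
    congr 1
    omega

open Classical in
/-- A subharmonic function that is close to `1` deep in the tree at `x`, and close to `0` at
large depth otherwise. -/
noncomputable def potential (x u : Vertex d) : ℝ :=
  if x <:+ u then 1 - decay x u / (d + 1) else d / (d + 1) * decay x u

theorem potential_self [NeZero d] (x : Vertex d) : potential x x = d / (d + 1) * decay x x := by
  rw [potential, if_pos (List.suffix_refl x), decay_self]
  field_simp
  ring

theorem potential_of_suffix [NeZero d] {x u : Vertex d} (h : u <:+ x) :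
    potential x u = d / (d + 1) * decay x u := by
  by_cases hx : x <:+ u
  · have : u = x := h.eq_of_length (le_antisymm h.length_le hx.length_le)
    rw [this, potential_self]
  · rw [potential, if_neg hx]

theorem potential_nonneg [NeZero d] (x u : Vertex d) : 0 ≤ potential x u := by
  have h0 := decay_nonneg x u
  unfold potential
  split_ifs
  · have h1 := decay_le_one x u
    have hd := one_le_cast (d := d)
    have : decay x u / (d + 1) ≤ 1 := by
      rw [div_le_one (by positivity)]; linarith
    linarith
  · positivity

theorem potential_le [NeZero d] (x u : Vertex d) :
    potential x u ≤ (if x <:+ u then 1 else 0) + decay x u := by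
  have h0 := decay_nonneg x u
  unfold potential
  split_ifs
  · have : 0 ≤ decay x u / (d + 1) := by positivity
    linarith
  · have : (d : ℝ) / (d + 1) ≤ 1 := by
      rw [div_le_one (by positivity)]; linarith
    nlinarith

/-- In the `(d + 1)`-regular tree the walk hits a vertex at distance `D` with probability `d ^ (-D)`
and, from `x`, ends up below `x` with probability `d / (d + 1)`. So `potential x` is the probability
to end up in the subtree at `x`, a harmonic function. The parent that the root lacks would have a
smaller value, so the function is merely subharmonic there. -/
theorem potential_le_stepMean [NeZero d] {x : Vertex d} (hx : x ≠ []) (u : Vertex d) :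
    potential x u ≤ stepMean (potential x) u := by
  have hd := one_le_cast (d := d)
  have hd0 : (0 : ℝ) < d := by linarith
  have hsum : ∀ u : Vertex d, u <:+ x → u ≠ x →
      ∑ i, potential x (i :: u) = d / (d + 1) * (decay x u * d + (d - 1) * (decay x u / d)) := by
    intro u hu hne
    obtain ⟨t, rfl⟩ := hu
    have ht : t ≠ [] := fun h => hne (by rw [h]; rfl)
    obtain ⟨s, j, rfl⟩ : ∃ s j, t = s ++ [j] :=
      ⟨t.dropLast, t.getLast ht, (List.dropLast_append_getLast ht).symm⟩
    have hj : (j :: u) <:+ s ++ [j] ++ u := ⟨s, by simp⟩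
    have hval : ∀ i, potential (s ++ [j] ++ u) (i :: u) = d / (d + 1) *
        (if i = j then decay (s ++ [j] ++ u) u * d else decay (s ++ [j] ++ u) u / d) := by
      intro i
      by_cases hi : i = j
      · subst hi
        rw [potential_of_suffix hj, decay_cons_of_suffix hj, if_pos rfl, mul_comm (d : ℝ) (decay _ _)]
      · have hns : ¬ (i :: u) <:+ s ++ [j] ++ u := by
          rintro ⟨r, hr⟩
          have h1 : r ++ [i] ++ u = s ++ [j] ++ u := by simpa using hr
          have h2 := List.append_cancel_right h1
          exact hi (by simpa using (List.append_inj' h2 rfl).2)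
        have hns2 : ¬ s ++ [j] ++ u <:+ i :: u := by
          intro h
          have h1 := h.length_le
          simp only [List.length_append, List.length_cons, List.length_nil] at h1
          have h3 := h.eq_of_length (by
            simp only [List.length_append, List.length_cons, List.length_nil]; omega)
          exact hns (h3 ▸ List.suffix_refl _)
        rw [potential, if_neg hns2, decay_cons_of_not_suffix hns, if_neg hi]
    simp_rw [hval, ← Finset.mul_sum]
    congr 1
    rw [← Finset.add_sum_erase _ _ (Finset.mem_univ j), if_pos rfl]
    congr 1
    rw [Finset.sum_congr rfl fun i hi => if_neg (Finset.ne_of_mem_erase hi), Finset.sum_const,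
      Finset.card_erase_of_mem (Finset.mem_univ j), Finset.card_univ, Fintype.card_fin, nsmul_eq_mul,
      Nat.cast_sub (Nat.one_le_iff_ne_zero.2 (NeZero.ne d)), Nat.cast_one]
  cases u with
  | nil =>
    have h0 := decay_nonneg x ([] : Vertex d)
    rw [stepMean, hsum [] (List.nil_suffix) (Ne.symm hx), potential_of_suffix List.nil_suffix,
      le_div_iff₀ hd0]
    have h1 : 0 ≤ (d - 1) * (decay x ([] : Vertex d) / d) := by
      have : 0 ≤ (d : ℝ) - 1 := by linarith
      positivity
    have h2 : (0 : ℝ) ≤ d / (d + 1) := by positivity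
    nlinarith
  | cons k t =>
    rw [stepMean, le_div_iff₀ (by positivity)]
    by_cases hu : (k :: t) <:+ x
    · have ht := suffix_of_cons_suffix hu
      have hq := decay_cons_of_suffix hu
      have hdt : potential x t = d / (d + 1) * (decay x (k :: t) / d) := by
        rw [potential_of_suffix ht, hq]; field_simp
      by_cases hux : k :: t = x
      · have hval : ∀ i, potential x (i :: k :: t) = 1 - 1 / d / (d + 1) := by
          intro i
          have hns : ¬ (i :: k :: t) <:+ x := by
            intro h; have := h.length_le; rw [← hux] at this; simp at this
          rw [potential, if_pos (hux ▸ List.suffix_cons _ _), decay_cons_of_not_suffix hns,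
            hux, decay_self]
        simp_rw [hval]
        rw [hdt, hux, potential_self, decay_self, Finset.sum_const, Finset.card_univ,
          Fintype.card_fin, nsmul_eq_mul]
        refine le_of_eq ?_
        field_simp
        ring
      · rw [hsum _ hu hux, hdt, potential_of_suffix hu]
        refine le_of_eq ?_
        field_simp
        ring
    · have hq := decay_cons_of_not_suffix hu
      have hns : ∀ i, ¬ (i :: k :: t) <:+ x := fun i h => hu (suffix_of_cons_suffix h)
      by_cases hxu : x <:+ k :: t
      · have hxt : x <:+ t := by
          rcases List.suffix_cons_iff.1 hxu with h | h
          · exact absurd (h ▸ List.suffix_refl _) hu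
          · exact h
        have hval : ∀ i, potential x (i :: k :: t) = 1 - decay x (k :: t) / d / (d + 1) := by
          intro i
          rw [potential, if_pos (hxu.trans (List.suffix_cons _ _)),
            decay_cons_of_not_suffix (hns i)]
        simp_rw [hval]
        rw [potential, potential, if_pos hxu, if_pos hxt, hq, Finset.sum_const, Finset.card_univ,
          Fintype.card_fin, nsmul_eq_mul]
        refine le_of_eq ?_
        field_simp
        ring
      · have hxt : ¬ x <:+ t := fun h => hxu (h.trans (List.suffix_cons _ _))
        have hval : ∀ i, potential x (i :: k :: t) = d / (d + 1) * (decay x (k :: t) / d) := by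
          intro i
          have : ¬ x <:+ i :: k :: t := by
            intro h
            rcases List.suffix_cons_iff.1 h with h | h
            · exact hns i (h ▸ List.suffix_refl _)
            · exact hxu h
          rw [potential, if_neg this, decay_cons_of_not_suffix (hns i)]
        simp_rw [hval]
        rw [potential, potential, if_neg hxu, if_neg hxt, hq, Finset.sum_const, Finset.card_univ,
          Fintype.card_fin, nsmul_eq_mul]
        refine le_of_eq ?_
        field_simp

/-- The probability that the walk is in the tree at `x` after many steps. -/
theorem exists_time_walk (hd : 2 ≤ d) (M : ℕ) : ∃ T : ℕ, ∀ x u : Vertex d, x.length = M →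
    x ≠ [] → u.length ≤ M →
    ENNReal.ofReal (decay x u / 2) ≤ walkLaw d u {S | x <:+ S T} := by
  have : NeZero d := ⟨by omega⟩
  have hd2 : (2 : ℝ) ≤ d := by exact_mod_cast hd
  set r : ℝ := √d with hr
  have hr1 : 1 < r := by rw [hr, Real.lt_sqrt zero_le_one]; linarith
  have hr0 : 0 < r := by linarith
  have hrr : r * r = d := Real.mul_self_sqrt (by linarith)
  -- This function bounds the `decay` part of the potential up to the factor `d ^ M`, and its
  -- expectation along the walk decreases by the factor `2 * √d / (d + 1) < 1` at every step.
  set h : Vertex d → ℝ := fun v => r⁻¹ ^ v.length with hh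
  have h0 : ∀ v, 0 ≤ h v := fun v => by positivity
  set ρ : ℝ := 2 * r / (d + 1) with hρ
  have hρ0 : 0 ≤ ρ := by positivity
  have hρ1 : ρ < 1 := by
    rw [hρ, div_lt_one (by positivity), ← hrr]; nlinarith [sq_nonneg (r - 1)]
  have hstep : ∀ v, stepMean h v ≤ ρ * h v := by
    intro v
    cases v with
    | nil =>
      simp only [stepMean, hh, List.length_singleton, pow_one, Finset.sum_const, Finset.card_univ,
        Fintype.card_fin, nsmul_eq_mul, List.length_nil, pow_zero, mul_one]
      rw [mul_div_cancel_left₀ _ (by linarith : (d : ℝ) ≠ 0), hρ, inv_eq_one_div,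
        div_le_div_iff₀ hr0 (by positivity)]
      nlinarith
    | cons k t =>
      simp only [stepMean, hh, List.length_cons, Finset.sum_const, Finset.card_univ,
        Fintype.card_fin, nsmul_eq_mul]
      refine le_of_eq ?_
      rw [hρ, ← hrr]
      simp only [pow_succ]
      field_simp
      ring
  -- The error must be below `decay x u / 6` for all `x` and `u` at once: distances are at most `2 *
  -- M`, and `d / (d + 1) ≥ 2 / 3 = 1 / 2 + 1 / 6`.
  obtain ⟨T, hT⟩ := exists_pow_lt_of_lt_one
    (show (0 : ℝ) < (d : ℝ)⁻¹ ^ (M + M) * ((d : ℝ) ^ M)⁻¹ / 6 by positivity) hρ1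
  refine ⟨T, fun x u hx hx0 hu => ?_⟩
  have h1 := le_lintegral_walk (potential_nonneg x) (potential_le_stepMean hx0) u T
  have h2 := lintegral_walk_le h0 hρ0 hstep u T
  have hdom : ∀ v, ENNReal.ofReal (potential x v) ≤
      Set.indicator {v | x <:+ v} 1 v + ENNReal.ofReal (d ^ M) * ENNReal.ofReal (h v) := by
    intro v
    have h3 : decay x v ≤ d ^ M * h v := by
      have h4 := decay_mul_pow_le x v
      rw [hx] at h4
      have h5 : h v * r ^ v.length = 1 := by
        rw [hh]; simp only; rw [← mul_pow, inv_mul_cancel₀ hr0.ne', one_pow]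
      have h6 : (1 : ℝ) ≤ r ^ v.length := one_le_pow₀ hr1.le
      have h7 : (d : ℝ) ^ v.length = r ^ v.length * r ^ v.length := by rw [← hrr, mul_pow]
      have h8 : decay x v * r ^ v.length ≤ d ^ M := by
        refine le_trans ?_ h4
        rw [h7]
        have := decay_nonneg x v
        gcongr
        nlinarith
      calc decay x v = decay x v * r ^ v.length * h v := by rw [mul_assoc, mul_comm _ (h v), h5, mul_one]
        _ ≤ d ^ M * h v := by gcongr
    rw [← ENNReal.ofReal_mul (by positivity)]
    by_cases hxv : x <:+ v
    · rw [Set.indicator_of_mem (show v ∈ {v | x <:+ v} from hxv), Pi.one_apply,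
        ← ENNReal.ofReal_one, ← ENNReal.ofReal_add zero_le_one (by have := h0 v; positivity)]
      refine ENNReal.ofReal_le_ofReal ((potential_le x v).trans ?_)
      rw [if_pos hxv]; linarith
    · rw [Set.indicator_of_notMem (show v ∉ {v | x <:+ v} from hxv), zero_add]
      refine ENNReal.ofReal_le_ofReal ((potential_le x v).trans ?_)
      rw [if_neg hxv]; linarith
  have hmS : Measurable fun S : ℕ → Vertex d => S T := measurable_pi_apply T
  have hmh : Measurable fun S : ℕ → Vertex d => ENNReal.ofReal (h (S T)) :=
    (measurable_of_countable fun w => ENNReal.ofReal (h w)).comp hmS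
  have hmi : Measurable fun S : ℕ → Vertex d =>
      Set.indicator {v | x <:+ v} (1 : Vertex d → ℝ≥0∞) (S T) :=
    (measurable_of_countable (Set.indicator {v | x <:+ v} (1 : Vertex d → ℝ≥0∞))).comp hmS
  have hmx : MeasurableSet {S : ℕ → Vertex d | x <:+ S T} :=
    hmS (MeasurableSet.of_discrete (s := {v | x <:+ v}))
  have h3 : ∫⁻ S, ENNReal.ofReal (potential x (S T)) ∂(walkLaw d u) ≤
      walkLaw d u {S | x <:+ S T} + ENNReal.ofReal (d ^ M * (ρ ^ T * h u)) := by
    calc _ ≤ ∫⁻ S, (Set.indicator {v | x <:+ v} 1 (S T) +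
          ENNReal.ofReal (d ^ M) * ENNReal.ofReal (h (S T))) ∂(walkLaw d u) :=
          lintegral_mono fun S => hdom (S T)
      _ = ∫⁻ S, Set.indicator {v | x <:+ v} 1 (S T) ∂(walkLaw d u) +
          ENNReal.ofReal (d ^ M) * ∫⁻ S, ENNReal.ofReal (h (S T)) ∂(walkLaw d u) := by
          rw [lintegral_add_left hmi, lintegral_const_mul _ hmh]
      _ ≤ _ := by
          rw [ENNReal.ofReal_mul (by positivity)]
          gcongr
          exact le_of_eq (lintegral_indicator_one hmx)
  have h4 : d ^ M * (ρ ^ T * h u) ≤ decay x u / 6 := by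
    have h5 := pow_le_decay x u
    rw [hx] at h5
    have h6 : h u ≤ 1 := pow_le_one₀ (by positivity) (inv_le_one_of_one_le₀ hr1.le)
    have h7 : (d : ℝ)⁻¹ ^ (M + M) ≤ (d : ℝ)⁻¹ ^ (M + u.length) :=
      pow_le_pow_of_le_one (by positivity) (inv_le_one_of_one_le₀ one_le_cast) (by omega)
    have h8 : (0 : ℝ) < d ^ M := by positivity
    calc d ^ M * (ρ ^ T * h u) ≤ d ^ M * (ρ ^ T * 1) := by gcongr
      _ ≤ d ^ M * ((d : ℝ)⁻¹ ^ (M + M) * ((d : ℝ) ^ M)⁻¹ / 6) := by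
          rw [mul_one]; gcongr
      _ = (d : ℝ)⁻¹ ^ (M + M) / 6 := by field_simp
      _ ≤ decay x u / 6 := by linarith
  have h5 : d / (d + 1) * decay x u ≤ potential x u := by
    by_cases hxu : x <:+ u
    · have : x = u := hxu.eq_of_length (le_antisymm hxu.length_le (by omega))
      rw [← this, potential_self]
    · rw [potential, if_neg hxu]
  have h6 : decay x u / 2 + decay x u / 6 ≤ potential x u := by
    refine le_trans ?_ h5
    have : (2 / 3 : ℝ) ≤ d / (d + 1) := by
      rw [div_le_div_iff₀ (by norm_num) (by positivity)]; linarith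
    have := mul_le_mul_of_nonneg_right this (decay_nonneg x u)
    linarith
  have h7 : ENNReal.ofReal (decay x u / 2) + ENNReal.ofReal (decay x u / 6) ≤
      walkLaw d u {S | x <:+ S T} + ENNReal.ofReal (decay x u / 6) := by
    have := decay_nonneg x u
    rw [← ENNReal.ofReal_add (by positivity) (by positivity)]
    exact (ENNReal.ofReal_le_ofReal h6).trans (h1.trans (h3.trans (by gcongr)))
  exact (ENNReal.add_le_add_iff_right ENNReal.ofReal_ne_top).1 h7

/-! ### Finite trees -/

/-- The vertex `p.2` of the subtree at the child `p.1` of the root, as a vertex of the tree. -/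
def appendEmb (d : ℕ) : Fin d × Vertex d ↪ Vertex d :=
  ⟨fun p => p.2 ++ [p.1], fun p q h => by
    obtain ⟨h1, h2⟩ := List.append_inj' h rfl
    exact Prod.ext (by simpa using h2) h1⟩

@[simp]
theorem appendEmb_apply (p : Fin d × Vertex d) : appendEmb d p = p.2 ++ [p.1] := rfl

/-- The vertices of depth less than `n`. -/
def nodes (d : ℕ) : ℕ → Finset (Vertex d)
  | 0 => ∅
  | n + 1 => insert [] ((Finset.univ ×ˢ nodes d n).map (appendEmb d))

/-- The vertices of depth `n`. -/
def leaves (d : ℕ) : ℕ → Finset (Vertex d)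
  | 0 => {[]}
  | n + 1 => (Finset.univ ×ˢ leaves d n).map (appendEmb d)

theorem mem_nodes {n : ℕ} {u : Vertex d} : u ∈ nodes d n ↔ u.length < n := by
  induction n generalizing u with
  | zero => simp [nodes]
  | succ n ih =>
    rcases List.eq_nil_or_concat' u with rfl | ⟨v, i, rfl⟩
    · simp [nodes]
    · simp only [nodes, Finset.mem_insert, List.append_eq_nil_iff, List.cons_ne_nil, and_false,
        false_or, Finset.mem_map, Finset.mem_product, Finset.mem_univ, true_and, appendEmb_apply,
        Prod.exists, List.length_append, List.length_singleton,
        Nat.add_lt_add_iff_right, ← ih]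
      constructor
      · rintro ⟨a, w, hw, h⟩
        rwa [(List.append_inj' h rfl).1] at hw
      · exact fun h => ⟨i, v, h, rfl⟩

theorem mem_leaves {n : ℕ} {u : Vertex d} : u ∈ leaves d n ↔ u.length = n := by
  induction n generalizing u with
  | zero => simp [leaves]
  | succ n ih =>
    rcases List.eq_nil_or_concat' u with rfl | ⟨v, i, rfl⟩
    · simp [leaves]
    · simp only [leaves, Finset.mem_map, Finset.mem_product, Finset.mem_univ, true_and, appendEmb_apply,
        Prod.exists, List.length_append, List.length_singleton,
        Nat.add_right_cancel_iff, ← ih]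
      constructor
      · rintro ⟨a, w, hw, h⟩
        rwa [(List.append_inj' h rfl).1] at hw
      · exact fun h => ⟨i, v, h, rfl⟩

theorem card_leaves (n : ℕ) : (leaves d n).card = d ^ n := by
  induction n with
  | zero => rfl
  | succ n ih => rw [leaves, Finset.card_map, Finset.card_product, ih, Finset.card_univ,
      Fintype.card_fin, pow_succ']

open Classical in
/-- The mass of a set of vertices of depth less than `n`, a vertex of depth `k` having mass
`d ^ (-k)`. -/
noncomputable def mass (n : ℕ) (P : Set (Vertex d)) : ℝ :=
  ∑ u ∈ nodes d n, if u ∈ P then (d : ℝ)⁻¹ ^ u.length else 0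

theorem mass_nonneg (n : ℕ) (P : Set (Vertex d)) : 0 ≤ mass n P := by
  classical
  refine Finset.sum_nonneg fun u _ => ?_
  split_ifs <;> positivity

theorem mass_mono {n : ℕ} {P Q : Set (Vertex d)} (h : P ⊆ Q) : mass n P ≤ mass n Q := by
  classical
  refine Finset.sum_le_sum fun u _ => ?_
  by_cases hu : u ∈ P
  · rw [if_pos hu, if_pos (h hu)]
  · rw [if_neg hu]
    split_ifs <;> positivity

theorem mass_succ (n : ℕ) {P : Set (Vertex d)} (h : [] ∈ P) :
    mass (n + 1) P = 1 + (∑ i, mass n {u | u ++ [i] ∈ P}) / d := by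
  classical
  rw [mass, nodes, Finset.sum_insert (by simp), if_pos h, Finset.sum_map,
    Finset.sum_product, Finset.sum_div]
  simp only [mass, appendEmb_apply, List.length_append,
    List.length_singleton, List.length_nil, pow_zero, Finset.sum_div, Set.mem_ofPred_eq]
  congr 1
  refine Finset.sum_congr rfl fun i _ => Finset.sum_congr rfl fun u _ => ?_
  split_ifs
  · rw [pow_succ, div_eq_mul_inv]
  · simp

/-! ### Activation in a finite tree -/

/-- The vertices of depth less than `n` that are activated, if the leaves in `A` are entered from
the root and an active vertex `u` in `R` sends a particle to the leaf `x` if `b (u, x)`: a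
particle that goes to a leaf activates its ancestors. -/
inductive Act (n : ℕ) (R : Set (Vertex d)) (b : Vertex d × Vertex d → Bool) (A : Set (Vertex d)) :
    Vertex d → Prop
  | entry {x w : Vertex d} : x ∈ A → x.length = n → w <:+ x → w.length < n → Act n R b A w
  | step {u x w : Vertex d} : Act n R b A u → u ∈ R → x.length = n → b (u, x) = true → w <:+ x →
      w.length < n → Act n R b A w

theorem Act.length_lt {n : ℕ} {R : Set (Vertex d)} {b : Vertex d × Vertex d → Bool}
    {A : Set (Vertex d)} {w : Vertex d} (h : Act n R b A w) : w.length < n := by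
  cases h <;> assumption

theorem Act.congr {n : ℕ} {R : Set (Vertex d)} {b b' : Vertex d × Vertex d → Bool}
    {A : Set (Vertex d)} {w : Vertex d} (h : Act n R b A w)
    (hb : ∀ u ∈ R, ∀ x : Vertex d, u.length < n → x.length = n → b (u, x) = b' (u, x)) :
    Act n R b' A w := by
  induction h with
  | entry h1 h2 h3 h4 => exact .entry h1 h2 h3 h4
  | step h1 h2 h3 h4 h5 h6 ih => exact .step ih h2 h3 ((hb _ h2 _ h1.length_lt h3) ▸ h4) h5 h6

theorem act_congr {n : ℕ} {R : Set (Vertex d)} {b b' : Vertex d × Vertex d → Bool}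
    {A : Set (Vertex d)}
    (hb : ∀ u ∈ R, ∀ x : Vertex d, u.length < n → x.length = n → b (u, x) = b' (u, x)) :
    Act n R b A = Act n R b' A :=
  funext fun _ => propext ⟨fun h => h.congr hb, fun h => h.congr fun u hu x h1 h2 =>
    (hb u hu x h1 h2).symm⟩

/-- The part of `b` in the subtree at the child `i` of the root. -/
def subConfig (i : Fin d) (b : Vertex d × Vertex d → Bool) : Vertex d × Vertex d → Bool :=
  fun q => b (q.1 ++ [i], q.2 ++ [i])

/-- The vertices below the children of the root that belong to `U`. -/
def rows (U : Finset (Fin d)) : Set (Vertex d) := {v | ∃ i ∈ U, ∃ u, v = u ++ [i]}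

theorem Act.append {n : ℕ} {U : Finset (Fin d)} {b : Vertex d × Vertex d → Bool}
    {A : Set (Vertex d)} {i : Fin d} (hi : i ∈ U) {ρ : Vertex d}
    (hρ : ρ ++ [i] ∈ A) {u : Vertex d} (h : Act n Set.univ (subConfig i b) {ρ} u) :
    Act (n + 1) (rows U) b A (u ++ [i]) := by
  induction h with
  | entry h1 h2 h3 h4 =>
    obtain rfl := h1
    exact .entry hρ (by simpa using h2) (append_singleton_suffix_iff.2 ⟨rfl, h3⟩) (by simpa using h4)
  | step h1 _ h3 h4 h5 h6 ih =>
    exact .step ih ⟨i, hi, _, rfl⟩ (by simpa using h3) h4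
      (append_singleton_suffix_iff.2 ⟨rfl, h5⟩) (by simpa using h6)

/-- The leaves to which the active vertices in the subtree at `i` send a particle. -/
def marks (n : ℕ) (i : Fin d) (ρ : Vertex d) (b : Vertex d × Vertex d → Bool) : Set (Vertex d) :=
  {x | x.length = n + 1 ∧ ∃ u, Act n Set.univ (subConfig i b) {ρ} u ∧ b (u ++ [i], x) = true}

theorem Act.of_marks {n : ℕ} {U : Finset (Fin d)} {b : Vertex d × Vertex d → Bool}
    {A : Set (Vertex d)} {i : Fin d} (hi : i ∈ U) {ρ : Vertex d} (hρ : ρ ++ [i] ∈ A) {v : Vertex d}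
    (h : Act (n + 1) (rows (U.erase i)) b (A ∪ marks n i ρ b) v) :
    Act (n + 1) (rows U) b A v := by
  induction h with
  | entry h1 h2 h3 h4 =>
    rcases h1 with h1 | ⟨_, u, hu, h1⟩
    · exact .entry h1 h2 h3 h4
    · exact .step (hu.append hi hρ) ⟨i, hi, u, rfl⟩ h2 h1 h3 h4
  | step _ h2 h3 h4 h5 h6 ih =>
    obtain ⟨j, hj, u, rfl⟩ := h2
    exact .step ih ⟨j, Finset.mem_of_mem_erase hj, u, rfl⟩ h3 h4 h5 h6

theorem Act.of_root {n : ℕ} {b : Vertex d × Vertex d → Bool} {ρ : Vertex d}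
    (hρ : ρ.length = n + 1) {v : Vertex d}
    (h : Act (n + 1) (rows Finset.univ) b ({ρ} ∪ {x | x.length = n + 1 ∧ b ([], x) = true}) v) :
    Act (n + 1) Set.univ b {ρ} v := by
  induction h with
  | entry h1 h2 h3 h4 =>
    rcases h1 with h1 | h1
    · exact .entry h1 h2 h3 h4
    · exact .step (.entry rfl hρ List.nil_suffix (by simp)) trivial h2 h1.2 h3 h4
  | step _ _ h3 h4 h5 h6 ih => exact .step ih trivial h3 h4 h5 h6

/-- The total mass of the active vertices in the subtrees that belong to `U`. -/
noncomputable def massBelow (n : ℕ) (U : Finset (Fin d)) (A : Set (Vertex d))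
    (b : Vertex d × Vertex d → Bool) : ℝ :=
  ∑ i ∈ U, mass n {u | Act (n + 1) (rows U) b A (u ++ [i])}

theorem massBelow_nonneg (n : ℕ) (U : Finset (Fin d)) (A : Set (Vertex d))
    (b : Vertex d × Vertex d → Bool) : 0 ≤ massBelow n U A b :=
  Finset.sum_nonneg fun _ _ => mass_nonneg _ _

/-- A lower bound by a particular order of activation: first the subtree at `i` runs on its own from
the single entrance `ρ`, then its particles count as entrances to the other subtrees. Later
entrances to the subtree at `i` are ignored, which keeps the two stages independent. -/
theorem add_massBelow_le {n : ℕ} {U : Finset (Fin d)} {b : Vertex d × Vertex d → Bool}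
    {A : Set (Vertex d)} {i : Fin d} (hi : i ∈ U) {ρ : Vertex d} (hρ : ρ ++ [i] ∈ A) :
    mass n {u | Act n Set.univ (subConfig i b) {ρ} u} +
      massBelow n (U.erase i) (A ∪ marks n i ρ b) b ≤ massBelow n U A b := by
  rw [massBelow, massBelow, ← Finset.add_sum_erase U _ hi]
  refine add_le_add (mass_mono fun u hu => Act.append hi hρ hu)
    (Finset.sum_le_sum fun j _ => mass_mono fun u hu => ?_)
  exact Act.of_marks hi hρ hu

theorem one_add_massBelow_le {n : ℕ} {b : Vertex d × Vertex d → Bool} {ρ : Vertex d}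
    (hρ : ρ.length = n + 1) :
    1 + massBelow n Finset.univ ({ρ} ∪ {x | x.length = n + 1 ∧ b ([], x) = true}) b / d ≤
      mass (n + 1) {u | Act (n + 1) Set.univ b {ρ} u} := by
  rw [mass_succ n (show [] ∈ {u | Act (n + 1) Set.univ b {ρ} u} from
    .entry rfl hρ List.nil_suffix (by simp)), massBelow]
  gcongr
  refine mass_mono fun u hu => ?_
  exact Act.of_root hρ hu

/-! ### Random configurations -/

theorem measurable_of_factor {α β X : Type*} [MeasurableSpace α] [MeasurableSpace β]
    [DiscreteMeasurableSpace β] [MeasurableSpace X] {r : α → β} (hr : Measurable r) {f : α → X}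
    (h : ∀ a b, r a = r b → f a = f b) : Measurable f := by
  intro s _
  have : f ⁻¹' s = r ⁻¹' (r '' (f ⁻¹' s)) := by
    refine Set.Subset.antisymm (Set.subset_preimage_image _ _) ?_
    rintro a ⟨b, hb, hab⟩
    rwa [Set.mem_preimage, ← h b a hab]
  rw [this]
  exact hr (MeasurableSet.of_discrete)

theorem measurable_of_agree {ι X : Type*} [MeasurableSpace X] (D : Finset ι)
    {f : (ι → Bool) → X} (h : ∀ b b', (∀ q ∈ D, b q = b' q) → f b = f b') : Measurable f := by
  refine measurable_of_factor (r := fun (b : ι → Bool) (q : D) => b q)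
    (measurable_pi_lambda _ fun q => measurable_pi_apply _) fun b b' hb => h b b' fun q hq => ?_
  exact congrFun hb ⟨q, hq⟩

theorem measurable_of_agree₂ {ι X : Type*} [MeasurableSpace X] (D : Finset ι)
    {f : (ι → Bool) × (ι → Bool) → X}
    (h : ∀ a a' b b', (∀ q ∈ D, a q = a' q) → (∀ q ∈ D, b q = b' q) → f (a, b) = f (a', b')) :
    Measurable f := by
  refine measurable_of_factor (r := fun p : (ι → Bool) × (ι → Bool) =>
    ((fun q : D => p.1 q, fun q : D => p.2 q) : (D → Bool) × (D → Bool)))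
    ((measurable_pi_lambda _ fun q => (measurable_pi_apply _).comp measurable_fst).prodMk
      (measurable_pi_lambda _ fun q => (measurable_pi_apply _).comp measurable_snd)) ?_
  rintro ⟨a, b⟩ ⟨a', b'⟩ hab
  obtain ⟨h1, h2⟩ := Prod.ext_iff.1 hab
  exact h a a' b b' (fun q hq => congrFun h1 ⟨q, hq⟩) fun q hq => congrFun h2 ⟨q, hq⟩

/-- The law of the indicator function of a nonzero Poisson number. -/
noncomputable def bern (r : ℝ≥0) : Measure Bool :=
  (poissonMeasure r).map fun n => decide (n ≠ 0)

instance (r : ℝ≥0) : IsProbabilityMeasure (bern r) :=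
  Measure.isProbabilityMeasure_map (measurable_of_countable _).aemeasurable

theorem bern_false (r : ℝ≥0) : bern r {false} = ENNReal.ofReal (Real.exp (-r)) := by
  rw [bern, Measure.map_apply (measurable_of_countable _) (measurableSet_singleton _)]
  have : (fun n : ℕ => decide (n ≠ 0)) ⁻¹' {false} = {0} := by ext n; simp
  rw [this, poissonMeasure_singleton]
  simp

/-- Independent indicator functions of nonzero Poisson numbers. -/
noncomputable def configLaw {ι : Type*} (l : ι → ℝ≥0) : Measure (ι → Bool) :=
  Measure.infinitePi fun q => bern (l q)

instance {ι : Type*} (l : ι → ℝ≥0) : IsProbabilityMeasure (configLaw l) := by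
  unfold configLaw; infer_instance

theorem configLaw_avoid {ι : Type*} (l : ι → ℝ≥0) (F : Finset ι) :
    configLaw l {b | ∀ q ∈ F, b q = false} = ENNReal.ofReal (Real.exp (-∑ q ∈ F, (l q : ℝ))) := by
  have : {b : ι → Bool | ∀ q ∈ F, b q = false} = Set.pi F fun _ => {false} := by
    ext b; simp [Set.mem_pi]
  rw [this, configLaw, Measure.infinitePi_pi _ fun _ _ => measurableSet_singleton _]
  simp_rw [bern_false]
  rw [← ENNReal.ofReal_prod_of_nonneg fun _ _ => (Real.exp_pos _).le, ← Real.exp_sum,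
    Finset.sum_neg_distrib]

theorem measurePreserving_comp_injective {ι κ : Type*} (l : ι → ℝ≥0) {e : κ → ι}
    (he : Function.Injective e) :
    MeasurePreserving (fun b : ι → Bool => b ∘ e) (configLaw l) (configLaw (l ∘ e)) :=
  ⟨measurable_pi_lambda _ fun _ => measurable_pi_apply _,
    Measure.map_infinitePi_infinitePi_of_inj (P := fun q => bern (l q)) he⟩

/-! ### Exploring a finite tree -/

/-- The map from the tree to the subtree at the child `i` of the root. -/
def childEmb (i : Fin d) : Vertex d ↪ Vertex d :=
  ⟨fun u => u ++ [i], List.append_left_injective [i]⟩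

@[simp]
theorem childEmb_apply (i : Fin d) (u : Vertex d) : childEmb i u = u ++ [i] := rfl

/-- No leaf in `A` belongs to a subtree in `W`. -/
def Avoids (n : ℕ) (A : Set (Vertex d)) (W : Finset (Fin d)) : Prop :=
  ∀ j ∈ W, ∀ x : Vertex d, x.length = n → x ++ [j] ∉ A

theorem Avoids.union {n : ℕ} {A B : Set (Vertex d)} {W : Finset (Fin d)} :
    Avoids n (A ∪ B) W ↔ Avoids n A W ∧ Avoids n B W := by
  simp only [Avoids, Set.mem_union, not_or]
  grind

/-- The pairs on which activation up to depth `n` depends. -/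
def relevant (d n : ℕ) : Finset (Vertex d × Vertex d) := nodes d n ×ˢ leaves d n

theorem mem_relevant {n : ℕ} {q : Vertex d × Vertex d} :
    q ∈ relevant d n ↔ q.1.length < n ∧ q.2.length = n := by
  rw [relevant, Finset.mem_product, mem_nodes, mem_leaves]

theorem act_congr_relevant {n : ℕ} {b b' : Vertex d × Vertex d → Bool}
    (h : ∀ q ∈ relevant d n, b q = b' q) (R A : Set (Vertex d)) :
    Act n R b A = Act n R b' A :=
  act_congr fun _ _ _ h1 h2 => h _ (mem_relevant.2 ⟨h1, h2⟩)

theorem act_subConfig_congr {n : ℕ} {b b' : Vertex d × Vertex d → Bool}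
    (h : ∀ q ∈ relevant d (n + 1), b q = b' q) (i : Fin d) (R A : Set (Vertex d)) :
    Act n R (subConfig i b) A = Act n R (subConfig i b') A :=
  act_congr fun _ _ _ h1 h2 => h _ (mem_relevant.2 ⟨by simpa using h1, by simpa using h2⟩)

theorem marks_congr {n : ℕ} {b b' : Vertex d × Vertex d → Bool}
    (h : ∀ q ∈ relevant d (n + 1), b q = b' q) (i : Fin d) (ρ : Vertex d) :
    marks n i ρ b = marks n i ρ b' := by
  ext x
  simp only [marks, Set.mem_ofPred_eq, act_subConfig_congr h]
  refine and_congr_right fun hx => exists_congr fun u => and_congr_right fun hu => ?_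
  rw [h _ (mem_relevant.2 ⟨by simpa using hu.length_lt, hx⟩)]

theorem massBelow_congr {n : ℕ} {b b' : Vertex d × Vertex d → Bool}
    (h : ∀ q ∈ relevant d (n + 1), b q = b' q) (U : Finset (Fin d)) (A : Set (Vertex d)) :
    massBelow n U A b = massBelow n U A b' := by
  simp only [massBelow, act_congr_relevant h]

/-- The exponential weight of a number. -/
noncomputable def expWeight (x : ℝ) : ℝ≥0∞ := ENNReal.ofReal (Real.exp (-x))

theorem expWeight_add (x y : ℝ) : expWeight (x + y) = expWeight x * expWeight y := by
  rw [expWeight, neg_add, Real.exp_add, ENNReal.ofReal_mul (Real.exp_pos _).le]; rfl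

theorem expWeight_anti {x y : ℝ} (h : x ≤ y) : expWeight y ≤ expWeight x :=
  ENNReal.ofReal_le_ofReal (Real.exp_le_exp.2 (neg_le_neg h))

theorem expWeight_le_one {x : ℝ} (h : 0 ≤ x) : expWeight x ≤ 1 := by
  refine (expWeight_anti h).trans ?_
  simp [expWeight]

theorem expWeight_ne_top (x : ℝ) : expWeight x ≠ ∞ := ENNReal.ofReal_ne_top

theorem expWeight_mul_natCast (x : ℝ) (k : ℕ) : expWeight (k * x) = expWeight x ^ k := by
  rw [expWeight, expWeight, ← ENNReal.ofReal_pow (Real.exp_pos _).le, ← Real.exp_nat_mul]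
  congr 2
  ring

theorem expWeight_rpow (x t : ℝ) : expWeight x ^ t = expWeight (t * x) := by
  rw [expWeight, ENNReal.ofReal_rpow_of_pos (Real.exp_pos _), ← Real.exp_mul, expWeight]
  congr 2
  ring

open Classical in
/-- The exponential moment of the active mass in the subtrees in `U` is bounded by a sum over the
possible sets of subtrees that are never entered. -/
theorem lintegral_massBelow_le {n : ℕ} {c : ℝ} (hc : 0 ≤ c) (l : Vertex d × Vertex d → ℝ≥0)
    (ψ : ℕ → ℝ≥0∞)
    (H : ∀ (i : Fin d) (ρ : Vertex d) (W : Finset (Fin d)), ρ.length = n → i ∉ W →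
      ∫⁻ b, expWeight (c * mass n {u | Act n Set.univ (subConfig i b) {ρ} u}) *
        (if Avoids n (marks n i ρ b) W then 1 else 0) ∂(configLaw l) ≤ ψ W.card)
    (U : Finset (Fin d)) (A : Set (Vertex d)) :
    ∫⁻ b, expWeight (c * massBelow n U A b) ∂(configLaw l) ≤
      ∑ W ∈ U.powerset, if Avoids n A W then ψ W.card ^ (U.card - W.card) else 0 := by
  induction U using Finset.strongInduction generalizing A with
  | H U ih =>
    -- If no subtree in `U` is entered, the summand `W = U` equals one and suffices.
    by_cases hU : Avoids n A U
    · refine le_trans ?_ (Finset.single_le_sum (fun _ _ => zero_le)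
        (Finset.mem_powerset_self U))
      rw [if_pos hU, Nat.sub_self, pow_zero]
      refine (lintegral_mono fun b => expWeight_le_one ?_).trans_eq (lintegral_one.trans measure_univ)
      exact mul_nonneg hc (massBelow_nonneg _ _ _ _)
    -- Otherwise an entered subtree `i` is run first. Its configuration is independent of the rows
    -- of the others, and the induction hypothesis applies to `U.erase i` with its particles as
    -- additional entrances.
    · obtain ⟨i, hi, ρ, hρn, hρ⟩ : ∃ i ∈ U, ∃ ρ : Vertex d, ρ.length = n ∧ ρ ++ [i] ∈ A := by
        unfold Avoids at hU
        push Not at hU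
        exact hU
      have hcard := Finset.card_erase_of_mem hi
      have hpos : 1 ≤ U.card := Finset.card_pos.2 ⟨i, hi⟩
      set m : Set (Vertex d) × Set (Vertex d) → ℝ≥0∞ := fun q => expWeight (c * mass n q.1) with hm
      set F : (Vertex d × Vertex d → Bool) → Set (Vertex d) × Set (Vertex d) := fun b =>
        ({u | Act n Set.univ (subConfig i b) {ρ} u}, marks n i ρ b) with hF
      set G : Set (Vertex d) × Set (Vertex d) → (Vertex d × Vertex d → Bool) → ℝ≥0∞ := fun q b =>
        m q * expWeight (c * massBelow n (U.erase i) (A ∪ q.2) b) with hG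
      have hFc : ∀ b b', (∀ q ∈ relevant d (n + 1), b q = b' q) → F b = F b' := by
        intro b b' h
        simp only [hF, marks_congr h, act_subConfig_congr h]
      have h1 : ∫⁻ b, expWeight (c * massBelow n U A b) ∂(configLaw l) ≤
          ∫⁻ b, G (F b) b ∂(configLaw l) := by
        refine lintegral_mono fun b => ?_
        simp only [hG, hm, hF]
        rw [← expWeight_add, ← mul_add]
        exact expWeight_anti (mul_le_mul_of_nonneg_left (add_massBelow_le hi hρ) hc)
      have h2 : ∫⁻ b, G (F b) b ∂(configLaw l) =
          ∫⁻ x, ∫⁻ y, G (F x) y ∂(configLaw l) ∂(configLaw l) := by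
        refine lintegral_mix (fun q => bern (l q)) {q | ∃ u, q.1 = u ++ [i]} ?_ ?_ ?_
        · intro x y
          have hs : subConfig i (mix {q | ∃ u, q.1 = u ++ [i]} x y) = subConfig i x :=
            funext fun q => mix_of_mem x y ⟨q.1, rfl⟩
          have hk : ∀ u v : Vertex d, mix {q : Vertex d × Vertex d | ∃ u, q.1 = u ++ [i]} x y
              (u ++ [i], v) = x (u ++ [i], v) := fun u v => mix_of_mem x y ⟨u, rfl⟩
          simp only [hF, marks, hs, hk]
        · intro q x y
          simp only [hG, massBelow]
          rw [act_congr (b' := y)]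
          rintro _ ⟨j, hj, u, rfl⟩ v _ _
          refine mix_of_notMem x y ?_
          rintro ⟨u', h⟩
          exact Finset.ne_of_mem_erase hj (by simpa using (List.append_inj' h rfl).2)
        · refine measurable_of_agree₂ (relevant d (n + 1)) fun a a' b b' ha hb => ?_
          simp only [hFc a a' ha, hG, massBelow_congr hb]
      have h3 : ∀ x, ∫⁻ y, G (F x) y ∂(configLaw l) ≤
          ∑ W ∈ (U.erase i).powerset, m (F x) * (if Avoids n (A ∪ marks n i ρ x) W then
            ψ W.card ^ ((U.erase i).card - W.card) else 0) := by
        intro x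
        have hmeas : Measurable fun y => expWeight (c * massBelow n (U.erase i) (A ∪ (F x).2) y) :=
          measurable_of_agree (relevant d (n + 1)) fun b b' hb => by rw [massBelow_congr hb]
        rw [hG]
        simp only
        rw [lintegral_const_mul _ hmeas, ← Finset.mul_sum]
        gcongr
        exact ih (U.erase i) (Finset.erase_ssubset hi) _
      calc ∫⁻ b, expWeight (c * massBelow n U A b) ∂(configLaw l)
          ≤ ∫⁻ x, ∑ W ∈ (U.erase i).powerset, m (F x) * (if Avoids n (A ∪ marks n i ρ x) W then
            ψ W.card ^ ((U.erase i).card - W.card) else 0) ∂(configLaw l) :=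
            h1.trans (h2.trans_le (lintegral_mono h3))
        _ = ∑ W ∈ (U.erase i).powerset, ∫⁻ x, m (F x) * (if Avoids n (A ∪ marks n i ρ x) W then
            ψ W.card ^ ((U.erase i).card - W.card) else 0) ∂(configLaw l) := by
            refine lintegral_finsetSum _ fun W _ => ?_
            exact measurable_of_agree (relevant d (n + 1)) fun b b' hb => by
              rw [hFc b b' hb, marks_congr hb]
        _ ≤ ∑ W ∈ (U.erase i).powerset,
            if Avoids n A W then ψ W.card ^ (U.card - W.card) else 0 := by
            refine Finset.sum_le_sum fun W hW => ?_
            have hWU := Finset.mem_powerset.1 hW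
            have hWi : i ∉ W := fun h => Finset.notMem_erase i U (hWU h)
            have hWc := Finset.card_le_card hWU
            by_cases hA : Avoids n A W
            -- The sets `W` never entered avoid the particles from `i` as well; this run costs one
            -- factor `ψ W.card`, and there is one such factor for each subtree in `U` outside `W`.
            · simp only [Avoids.union, hA, true_and, if_true]
              have hexp : U.card - W.card = (U.erase i).card - W.card + 1 := by omega
              rw [hexp, pow_succ']
              calc ∫⁻ x, m (F x) * (if Avoids n (marks n i ρ x) W then
                    ψ W.card ^ ((U.erase i).card - W.card) else 0) ∂(configLaw l)
                  = ∫⁻ x, (m (F x) * (if Avoids n (marks n i ρ x) W then 1 else 0)) *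
                    ψ W.card ^ ((U.erase i).card - W.card) ∂(configLaw l) := by
                    refine lintegral_congr fun x => ?_
                    split_ifs <;> simp
                _ = (∫⁻ x, m (F x) * (if Avoids n (marks n i ρ x) W then 1 else 0)
                    ∂(configLaw l)) * ψ W.card ^ ((U.erase i).card - W.card) := by
                    refine lintegral_mul_const _ ?_
                    exact measurable_of_agree (relevant d (n + 1)) fun b b' hb => by
                      rw [hFc b b' hb, marks_congr hb]
                _ ≤ _ := by
                    gcongr
                    exact H i ρ W hρn hWi
            · simp [Avoids.union, hA]
        _ ≤ _ := Finset.sum_le_sum_of_subset (Finset.powerset_mono.2 (Finset.erase_subset i U))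

theorem sum_le_of_append {l : Vertex d × Vertex d → ℝ≥0} {u : Vertex d} {n : ℕ}
    {W : Finset (Fin d)} {r : ℝ}
    (h : ∀ j ∈ W, ∀ x : Vertex d, x.length = n → r ≤ l (u, x ++ [j])) :
    W.card * (d ^ n * r) ≤ ∑ p ∈ W ×ˢ leaves d n, (l (u, p.2 ++ [p.1]) : ℝ) := by
  calc (W.card : ℝ) * (d ^ n * r) = ∑ p ∈ W ×ˢ leaves d n, r := by
        rw [Finset.sum_const, Finset.card_product, card_leaves, nsmul_eq_mul]
        push_cast
        ring
    _ ≤ _ := by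
        refine Finset.sum_le_sum fun p hp => ?_
        obtain ⟨h1, h2⟩ := Finset.mem_product.1 hp
        exact h _ h1 _ (mem_leaves.1 h2)

theorem configLaw_avoid_le {l : Vertex d × Vertex d → ℝ≥0} {n : ℕ} {W : Finset (Fin d)}
    (V : Finset (Vertex d)) (r : Vertex d → ℝ)
    (h : ∀ u ∈ V, ∀ j ∈ W, ∀ x : Vertex d, x.length = n → r u ≤ l (u, x ++ [j])) :
    configLaw l {b | ∀ u ∈ V, ∀ j ∈ W, ∀ x : Vertex d, x.length = n → b (u, x ++ [j]) = false} ≤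
      expWeight (∑ u ∈ V, W.card * (d ^ n * r u)) := by
  have hset : {b : Vertex d × Vertex d → Bool |
      ∀ u ∈ V, ∀ j ∈ W, ∀ x : Vertex d, x.length = n → b (u, x ++ [j]) = false} =
      {b | ∀ q ∈ V ×ˢ ((W ×ˢ leaves d n).map (appendEmb d)), b q = false} := by
    ext b
    simp only [Set.mem_ofPred_eq, Finset.mem_product, Finset.mem_map, appendEmb_apply, Prod.forall,
      Prod.exists, mem_leaves]
    constructor
    · rintro h u x ⟨hu, j, y, ⟨hj, hy⟩, rfl⟩
      exact h u hu j hj y hy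
    · exact fun h u hu j hj x hx => h u _ ⟨hu, j, x, ⟨hj, hx⟩, rfl⟩
  rw [hset, configLaw_avoid, Finset.sum_product]
  refine expWeight_anti (Finset.sum_le_sum fun u hu => ?_)
  rw [Finset.sum_map]
  exact sum_le_of_append fun j hj x hx => h u hu j hj x hx

theorem lintegral_rpow_le {Ω : Type*} [MeasurableSpace Ω] {P : Measure Ω} [IsProbabilityMeasure P]
    {f : Ω → ℝ≥0∞} (hf : AEMeasurable f P) {t : ℝ} (h0 : 0 ≤ t) (h1 : t ≤ 1) :
    ∫⁻ a, f a ^ t ∂P ≤ (∫⁻ a, f a ∂P) ^ t := by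
  have := ENNReal.lintegral_mul_norm_pow_le (μ := P) hf (aemeasurable_const (b := (1 : ℝ≥0∞))) h0
    (sub_nonneg.2 h1) (by ring)
  simpa using this

open Classical in
/-- The particles from the active vertices of one subtree avoid the subtrees in `W` with an
exponentially small probability. -/
theorem lintegral_marks_le [NeZero d] {n : ℕ} {s : ℝ}
    {l : Vertex d × Vertex d → ℝ≥0}
    (hl : ∀ u x : Vertex d, u.length < n + 1 → x.length = n + 1 →
      s * d * decay x u ≤ l (u, x)) (i : Fin d) {ρ : Vertex d} {Γ : ℝ≥0∞}
    (hΓ : ∫⁻ b, expWeight (s * mass n {u | Act n Set.univ b {ρ} u})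
      ∂(configLaw fun q => l (q.1 ++ [i], q.2 ++ [i])) ≤ Γ)
    {W : Finset (Fin d)} (hi : i ∉ W) :
    ∫⁻ b, expWeight (s / d * mass n {u | Act n Set.univ (subConfig i b) {ρ} u}) *
        (if Avoids n (marks n i ρ b) W then 1 else 0) ∂(configLaw l) ≤
      Γ ^ ((1 + W.card) / d : ℝ) := by
  have hd : (0 : ℝ) < d := by linarith [one_le_cast (d := d)]
  set F : (Vertex d × Vertex d → Bool) → Set (Vertex d) :=
    fun b => {u | Act n Set.univ (subConfig i b) {ρ} u} with hF
  set E : Set (Vertex d) → Set (Vertex d × Vertex d → Bool) := fun a =>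
    {b | ∀ u ∈ ((nodes d n).filter (· ∈ a)).map (childEmb i),
      ∀ j ∈ W, ∀ x : Vertex d, x.length = n → b (u, x ++ [j]) = false} with hE
  have hEm : ∀ a (b : Vertex d × Vertex d → Bool), b ∈ E a ↔ ∀ u ∈ a, u.length < n → ∀ j ∈ W,
      ∀ x : Vertex d, x.length = n → b (u ++ [i], x ++ [j]) = false := by
    intro a b
    simp only [hE, Set.mem_ofPred_eq, Finset.mem_map, Finset.mem_filter, mem_nodes,
      childEmb_apply, forall_exists_index, and_imp]
    constructor
    · exact fun h u h1 h2 j hj x hx => h _ u h2 h1 rfl j hj x hx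
    · rintro h _ u h1 h2 rfl j hj x hx
      exact h u h2 h1 j hj x hx
  have hEcongr : ∀ a b b', (∀ q ∈ relevant d (n + 1), b q = b' q) → (b ∈ E a ↔ b' ∈ E a) := by
    intro a b b' h
    rw [hEm, hEm]
    refine forall_congr' fun u => forall_congr' fun h1 => forall_congr' fun h2 =>
      forall_congr' fun j => forall_congr' fun hj => forall_congr' fun x => forall_congr' fun hx => ?_
    rw [h (u ++ [i], x ++ [j]) (mem_relevant.2 ⟨by simpa using h2, by simpa using hx⟩)]
  set G : Set (Vertex d) → (Vertex d × Vertex d → Bool) → ℝ≥0∞ := fun a b =>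
    expWeight (s / d * mass n a) * (E a).indicator 1 b with hG
  have h1 : ∀ b, expWeight (s / d * mass n {u | Act n Set.univ (subConfig i b) {ρ} u}) *
      (if Avoids n (marks n i ρ b) W then 1 else 0) = G (F b) b := by
    intro b
    simp only [hG, hF]
    congr 1
    have : Avoids n (marks n i ρ b) W ↔ b ∈ E {u | Act n Set.univ (subConfig i b) {ρ} u} := by
      rw [hEm]
      constructor
      · intro h u hu _ j hj x hx
        have := h j hj x hx
        simp only [marks, Set.mem_ofPred_eq, not_and, not_exists, List.length_append,
          List.length_singleton, hx, forall_const, Bool.not_eq_true] at this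
        exact this u hu
      · rintro h j hj x hx ⟨_, u, hu, hb⟩
        rw [h u hu hu.length_lt j hj x hx] at hb
        exact Bool.false_ne_true hb
    by_cases hb : Avoids n (marks n i ρ b) W
    · rw [if_pos hb, Set.indicator_of_mem (this.1 hb), Pi.one_apply]
    · rw [if_neg hb, Set.indicator_of_notMem (mt this.2 hb)]
  have hmE : ∀ a, MeasurableSet (E a) := by
    intro a
    have : Measurable fun b => b ∈ E a :=
      measurable_of_agree (relevant d (n + 1)) fun b b' hb => propext (hEcongr a b b' hb)
    exact measurableSet_setOfPred.2 this
  have h2 : ∫⁻ b, G (F b) b ∂(configLaw l) =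
      ∫⁻ x, ∫⁻ y, G (F x) y ∂(configLaw l) ∂(configLaw l) := by
    -- Activity inside the subtree at `i` is decided by particles with targets in this subtree, the
    -- marks in `W` by particles with targets elsewhere.
    refine lintegral_mix (fun q => bern (l q)) {q | ∃ x, q.2 = x ++ [i]} ?_ ?_ ?_
    · intro x y
      have hs : subConfig i (mix {q | ∃ x, q.2 = x ++ [i]} x y) = subConfig i x :=
        funext fun q => mix_of_mem x y ⟨q.2, rfl⟩
      simp only [hF, hs]
    · intro a x y
      simp only [hG]
      congr 1
      have : mix {q | ∃ x, q.2 = x ++ [i]} x y ∈ E a ↔ y ∈ E a := by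
        rw [hEm, hEm]
        refine forall_congr' fun u => forall_congr' fun h1 => forall_congr' fun h2 =>
          forall_congr' fun j => forall_congr' fun hj => forall_congr' fun v =>
          forall_congr' fun hx => ?_
        rw [mix_of_notMem]
        rintro ⟨v', h⟩
        have : j = i := by simpa using (List.append_inj' h rfl).2
        exact hi (this ▸ hj)
      by_cases hy : y ∈ E a
      · rw [Set.indicator_of_mem hy, Set.indicator_of_mem (this.2 hy)]; rfl
      · rw [Set.indicator_of_notMem hy, Set.indicator_of_notMem (mt this.1 hy)]
    · refine measurable_of_agree₂ (relevant d (n + 1)) fun a a' b b' ha hb => ?_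
      have : F a = F a' := by simp only [hF, act_subConfig_congr ha]
      simp only [hG, this, Set.indicator, hEcongr (F a') b b' hb, Pi.one_apply]
  -- An active vertex of depth `k` sends particles to the `d ^ n` leaves of another subtree at total
  -- rate at least `s / d * d ^ (-k)`. Avoiding `W` therefore multiplies the exponent by `1 +
  -- W.card`, and the power `(1 + W.card) / d ≤ 1` is taken out of the expectation by Jensen's
  -- inequality.
  have h3 : ∀ x, ∫⁻ y, G (F x) y ∂(configLaw l) ≤
      expWeight (s * mass n (F x)) ^ ((1 + W.card) / d : ℝ) := by
    intro x
    have hmain := configLaw_avoid_le (l := l) (n := n) (W := W)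
      (((nodes d n).filter (· ∈ F x)).map (childEmb i))
      (fun u => s * d * (d : ℝ)⁻¹ ^ (u.length + n + 1)) (by
        intro u hu j hj y hy
        obtain ⟨v, hv, rfl⟩ := Finset.mem_map.1 hu
        have hv' := mem_nodes.1 (Finset.mem_filter.1 hv).1
        rw [childEmb_apply]
        refine le_trans (le_of_eq ?_) (hl (v ++ [i]) (y ++ [j]) (by simpa using hv')
          (by simpa using hy))
        have hij : i ≠ j := by rintro rfl; exact hi hj
        rw [decay_append_of_ne _ _ hij, hy, List.length_append,
          List.length_singleton]
        congr 2
        omega)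
    have hsum : ∑ u ∈ ((nodes d n).filter (· ∈ F x)).map
        (childEmb i),
        (W.card : ℝ) * (d ^ n * (s * d * (d : ℝ)⁻¹ ^ (u.length + n + 1))) =
        s / d * W.card * mass n (F x) := by
      rw [Finset.sum_map, mass, ← Finset.sum_filter, Finset.mul_sum]
      refine Finset.sum_congr rfl fun u _ => ?_
      simp only [childEmb_apply, List.length_append, List.length_singleton]
      rw [show u.length + 1 + n + 1 = u.length + n + 2 by omega, pow_add, pow_add, inv_pow, inv_pow,
        inv_pow]
      field_simp
    rw [hsum] at hmain
    simp only [hG]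
    rw [lintegral_const_mul _ (measurable_one.indicator (hmE _)), lintegral_indicator_one (hmE _),
      expWeight_rpow]
    refine (mul_le_mul_right hmain _).trans (le_of_eq ?_)
    rw [← expWeight_add]
    congr 1
    ring
  have hinj : Function.Injective fun q : Vertex d × Vertex d => (q.1 ++ [i], q.2 ++ [i]) := by
    rintro ⟨a, b⟩ ⟨a', b'⟩ h
    simpa using h
  have hmp := measurePreserving_comp_injective l hinj
  have hma : Measurable fun b => expWeight (s * mass n {u | Act n Set.univ b {ρ} u}) :=
    measurable_of_agree (relevant d n) fun b b' hb => by rw [act_congr_relevant hb]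
  have hcard : (1 + W.card : ℝ) ≤ d := by
    have : (insert i W).card ≤ d := by
      simpa using Finset.card_le_univ (insert i W)
    rw [Finset.card_insert_of_notMem hi] at this
    have h : ((W.card + 1 : ℕ) : ℝ) ≤ d := by exact_mod_cast this
    push_cast at h
    linarith
  simp_rw [h1]
  rw [h2]
  calc ∫⁻ x, ∫⁻ y, G (F x) y ∂(configLaw l) ∂(configLaw l)
      ≤ ∫⁻ x, expWeight (s * mass n (F x)) ^ ((1 + W.card) / d : ℝ) ∂(configLaw l) :=
        lintegral_mono h3
    _ = ∫⁻ b, expWeight (s * mass n {u | Act n Set.univ b {ρ} u}) ^ ((1 + W.card) / d : ℝ)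
        ∂(configLaw fun q => l (q.1 ++ [i], q.2 ++ [i])) :=
        hmp.lintegral_comp (hma.pow_const _)
    _ ≤ (∫⁻ b, expWeight (s * mass n {u | Act n Set.univ b {ρ} u})
        ∂(configLaw fun q => l (q.1 ++ [i], q.2 ++ [i]))) ^ ((1 + W.card) / d : ℝ) :=
        lintegral_rpow_le hma.aemeasurable (by positivity) ((div_le_one hd).2 hcard)
    _ ≤ _ := ENNReal.rpow_le_rpow hΓ (by positivity)

/-- This closes the induction in `lintegral_mass_le`: entering only `d - w` subtrees is compensated
by the condition that each of them avoids the other `w`, so that the total power of `Γ` is at least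
one. -/
theorem one_add_mul_sub_ge {d w : ℕ} (h : w + 1 ≤ d) : (d : ℝ) ≤ (1 + w) * (d - w : ℕ) := by
  rw [Nat.cast_sub (by omega)]
  have h1 : (w : ℝ) + 1 ≤ d := by exact_mod_cast h
  nlinarith [(Nat.cast_nonneg w : (0 : ℝ) ≤ w)]

open Classical in
/-- The active mass of a tree of depth `n` has an exponentially small exponential moment. -/
theorem lintegral_mass_le [NeZero d] {s : ℝ} (hs : 0 ≤ s)
    (hγ : expWeight s * (expWeight s + 1) ^ (d - 1) ≤ 1) (n : ℕ) (l : Vertex d × Vertex d → ℝ≥0)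
    (hl : ∀ u x : Vertex d, u.length < n → x.length = n → s * d * decay x u ≤ l (u, x))
    (ρ : Vertex d) (hρ : ρ.length = n) :
    ∫⁻ b, expWeight (s * mass n {u | Act n Set.univ b {ρ} u}) ∂(configLaw l) ≤
      (expWeight s * (expWeight s + 1) ^ (d - 1)) ^ n := by
  have hd : (0 : ℝ) < d := by linarith [one_le_cast (d := d)]
  set γ := expWeight s * (expWeight s + 1) ^ (d - 1) with hγd
  induction n generalizing l ρ with
  | zero =>
    rw [pow_zero]
    exact (lintegral_mono fun b => expWeight_le_one (mul_nonneg hs (mass_nonneg _ _))).trans_eq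
      (lintegral_one.trans measure_univ)
  | succ n ih =>
    obtain ⟨ρ', i₀, rfl⟩ : ∃ ρ' i, ρ = ρ' ++ [i] := by
      rcases List.eq_nil_or_concat' ρ with rfl | h
      · simp at hρ
      · exact h
    set Γ : ℝ≥0∞ := γ ^ n with hΓ
    have hΓ1 : Γ ≤ 1 := pow_le_one₀ zero_le hγ
    set ψ : ℕ → ℝ≥0∞ := fun w => Γ ^ ((1 + w) / d : ℝ) with hψ
    set A : Set (Vertex d) → Set (Vertex d) := fun a => {ρ' ++ [i₀]} ∪ a with hA
    set F : (Vertex d × Vertex d → Bool) → Set (Vertex d) := fun b =>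
      {x | x.length = n + 1 ∧ b ([], x) = true} with hF
    have H : ∀ (i : Fin d) (ρ : Vertex d) (W : Finset (Fin d)), ρ.length = n → i ∉ W →
        ∫⁻ b, expWeight (s / d * mass n {u | Act n Set.univ (subConfig i b) {ρ} u}) *
          (if Avoids n (marks n i ρ b) W then 1 else 0) ∂(configLaw l) ≤ ψ W.card := by
      intro i ρ W hρ hi
      refine lintegral_marks_le hl i (ih _ (fun u x hu hx => ?_) ρ hρ) hi
      rw [← decay_append x u i]
      exact hl _ _ (by simpa using hu) (by simpa using hx)
    have h1 : ∫⁻ b, expWeight (s * mass (n + 1) {u | Act (n + 1) Set.univ b {ρ' ++ [i₀]} u})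
        ∂(configLaw l) ≤
        ∫⁻ b, expWeight s * expWeight (s / d * massBelow n Finset.univ (A (F b)) b)
          ∂(configLaw l) := by
      refine lintegral_mono fun b => ?_
      rw [← expWeight_add]
      refine expWeight_anti (le_trans (le_of_eq ?_)
        (mul_le_mul_of_nonneg_left (one_add_massBelow_le hρ) hs))
      simp only [hA, hF]
      ring
    set G : Set (Vertex d) → (Vertex d × Vertex d → Bool) → ℝ≥0∞ := fun a b =>
      expWeight s * expWeight (s / d * massBelow n Finset.univ (A a) b) with hG
    have hne : ∀ {q : Vertex d × Vertex d}, q.1 = [] → q.1 ∉ rows (Finset.univ : Finset (Fin d)) := by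
      rintro q hq ⟨i, _, u, h⟩
      simp [hq] at h
    have hFc : ∀ b b' : Vertex d × Vertex d → Bool, (∀ q ∈ relevant d (n + 1), b q = b' q) →
        F b = F b' := by
      intro b b' h
      ext x
      simp only [hF, Set.mem_ofPred_eq]
      refine and_congr_right fun hx => ?_
      rw [h _ (mem_relevant.2 ⟨by simp, hx⟩)]
    have h2 : ∫⁻ b, G (F b) b ∂(configLaw l) =
        ∫⁻ x, ∫⁻ y, G (F x) y ∂(configLaw l) ∂(configLaw l) := by
      refine lintegral_mix (fun q => bern (l q)) {q | q.1 = []} ?_ ?_ ?_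
      · intro x y
        have hk : ∀ v : Vertex d, mix {q : Vertex d × Vertex d | q.1 = []} x y ([], v) = x ([], v) :=
          fun v => mix_of_mem x y rfl
        simp only [hF, hk]
      · intro a x y
        simp only [hG, massBelow]
        rw [act_congr (b' := y)]
        exact fun u hu v _ _ => mix_of_notMem x y fun h => hne h hu
      · refine measurable_of_agree₂ (relevant d (n + 1)) fun a a' b b' ha hb => ?_
        simp only [hFc a a' ha, hG, massBelow_congr hb]
    have h3 : ∀ x, ∫⁻ y, G (F x) y ∂(configLaw l) ≤ ∑ W ∈ (Finset.univ.erase i₀).powerset,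
        (expWeight s * ψ W.card ^ (d - W.card)) * (if Avoids n (F x) W then 1 else 0) := by
      intro x
      have hmeas : Measurable fun y => expWeight (s / d * massBelow n Finset.univ (A (F x)) y) :=
        measurable_of_agree (relevant d (n + 1)) fun b b' hb => by rw [massBelow_congr hb]
      simp only [hG]
      rw [lintegral_const_mul _ hmeas]
      refine (mul_le_mul_right (lintegral_massBelow_le (by positivity) l ψ H Finset.univ _) _).trans ?_
      rw [Finset.mul_sum, ← Finset.sum_subset (Finset.powerset_mono.2 (Finset.erase_subset i₀ _))]
      · refine Finset.sum_le_sum fun W _ => ?_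
        rw [Finset.card_univ, Fintype.card_fin]
        by_cases hW : Avoids n (A (F x)) W
        · rw [if_pos hW, if_pos (Avoids.union.1 hW).2, mul_one]
        · rw [if_neg hW, mul_zero]
          exact zero_le
      · intro W hW hW'
        have hi : i₀ ∈ W := by
          by_contra h
          exact hW' (Finset.mem_powerset.2 (Finset.subset_erase.2 ⟨Finset.subset_univ _, h⟩))
        rw [if_neg, mul_zero]
        exact fun h => h i₀ hi ρ' (by simpa using hρ) (Or.inl rfl)
    -- The particles from the root vertex avoid `W` with probability at most `exp (-s) ^ W.card`,
    -- and the remaining subtrees contribute at most `Γ`. The binomial theorem over all `W` without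
    -- `i₀`, which is entered through `ρ`, yields the factor `(exp (-s) + 1) ^ (d - 1)`.
    have h4 : ∀ W ∈ (Finset.univ.erase i₀).powerset,
        (expWeight s * ψ W.card ^ (d - W.card)) *
          ∫⁻ x, (if Avoids n (F x) W then 1 else 0) ∂(configLaw l) ≤
        expWeight s * Γ * (expWeight s ^ W.card * 1 ^ ((Finset.univ.erase i₀).card - W.card)) := by
      intro W hW
      have hWc : W.card + 1 ≤ d := by
        have := Finset.card_le_card (Finset.mem_powerset.1 hW)
        rw [Finset.card_erase_of_mem (Finset.mem_univ _), Finset.card_univ, Fintype.card_fin] at this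
        have := NeZero.pos d
        omega
      have h5 : ψ W.card ^ (d - W.card) ≤ Γ := by
        rw [hψ]
        simp only
        rw [← ENNReal.rpow_mul_natCast]
        refine (ENNReal.rpow_le_rpow_of_exponent_ge hΓ1 ?_).trans_eq (ENNReal.rpow_one Γ)
        rw [div_mul_eq_mul_div, le_div_iff₀ hd, one_mul]
        exact one_add_mul_sub_ge hWc
      have h6 : ∫⁻ x, (if Avoids n (F x) W then 1 else 0) ∂(configLaw l) ≤ expWeight s ^ W.card := by
        have hset : ∀ x, (if Avoids n (F x) W then (1 : ℝ≥0∞) else 0) =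
            Set.indicator {b : Vertex d × Vertex d → Bool | ∀ u ∈ ({[]} : Finset (Vertex d)),
              ∀ j ∈ W, ∀ x : Vertex d, x.length = n → b (u, x ++ [j]) = false} 1 x := by
          intro x
          rw [Set.indicator_apply, Pi.one_apply]
          refine if_congr ?_ rfl rfl
          simp only [Avoids, hF, Set.mem_ofPred_eq, Finset.mem_singleton, forall_eq,
            List.length_append, List.length_singleton, not_and, Bool.not_eq_true]
          refine forall_congr' fun j => forall_congr' fun hj => forall_congr' fun v =>
            forall_congr' fun hv => ?_
          simp [hv]
        simp_rw [hset]
        refine (lintegral_indicator_one_le _).trans ?_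
        refine (configLaw_avoid_le (l := l) (n := n) (W := W) {[]}
          (fun _ => s * d * (d : ℝ)⁻¹ ^ (n + 1)) ?_).trans (le_of_eq ?_)
        · intro u hu j hj x hx
          rw [Finset.mem_singleton.1 hu]
          have := hl [] (x ++ [j]) (by simp) (by simpa using hx)
          rwa [decay, List.length_append, List.length_singleton, hx] at this
        · rw [Finset.sum_singleton, ← expWeight_mul_natCast]
          congr 1
          rw [inv_pow, pow_succ]
          field_simp
      rw [one_pow, mul_one]
      gcongr
    calc _ ≤ ∫⁻ x, ∑ W ∈ (Finset.univ.erase i₀).powerset, (expWeight s * ψ W.card ^ (d - W.card)) *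
          (if Avoids n (F x) W then 1 else 0) ∂(configLaw l) :=
          h1.trans (h2.trans_le (lintegral_mono h3))
      _ = ∑ W ∈ (Finset.univ.erase i₀).powerset, (expWeight s * ψ W.card ^ (d - W.card)) *
          ∫⁻ x, (if Avoids n (F x) W then 1 else 0) ∂(configLaw l) := by
          have hmW : ∀ W, Measurable fun x => if Avoids n (F x) W then (1 : ℝ≥0∞) else 0 :=
            fun W => measurable_of_agree (relevant d (n + 1)) fun b b' hb => by rw [hFc b b' hb]
          rw [lintegral_finsetSum _ fun W _ => (hmW W).const_mul _]
          exact Finset.sum_congr rfl fun W _ => lintegral_const_mul _ (hmW W)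
      _ ≤ ∑ W ∈ (Finset.univ.erase i₀).powerset, expWeight s * Γ *
          (expWeight s ^ W.card * 1 ^ ((Finset.univ.erase i₀).card - W.card)) :=
          Finset.sum_le_sum h4
      _ = γ ^ (n + 1) := by
          rw [← Finset.mul_sum, Finset.sum_pow_mul_eq_add_pow,
            Finset.card_erase_of_mem (Finset.mem_univ _), Finset.card_univ, Fintype.card_fin,
            pow_succ, hΓ, hγd]
          ring

/-- With `exp (-s) ≤ 1 / d` the left side is at most `exp (1 - 1 / d - log d)`, and `log d > 1 - 1 /
d`. -/
theorem expWeight_mul_lt_one (hd : 2 ≤ d) {s : ℝ} (hs : Real.log d ≤ s) :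
    expWeight s * (expWeight s + 1) ^ (d - 1) < 1 := by
  have hd0 : (0 : ℝ) < d := by positivity
  have hd1 : (1 : ℝ) ≤ d := by exact_mod_cast (by omega : 1 ≤ d)
  have h1 : Real.exp (-s) ≤ (d : ℝ)⁻¹ := by
    rw [← Real.exp_log (inv_pos.2 hd0), Real.log_inv]
    exact Real.exp_le_exp.2 (neg_le_neg hs)
  have h2 : Real.exp (-s) * (Real.exp (-s) + 1) ^ (d - 1) < 1 := by
    calc Real.exp (-s) * (Real.exp (-s) + 1) ^ (d - 1)
        ≤ (d : ℝ)⁻¹ * (Real.exp ((d : ℝ)⁻¹)) ^ (d - 1) := by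
          gcongr
          exact (add_le_add_left h1 1).trans (Real.add_one_le_exp _)
      _ = Real.exp (1 - (d : ℝ)⁻¹ - Real.log d) := by
          rw [← Real.exp_nat_mul, Nat.cast_sub (by omega), Real.exp_sub, Real.exp_log hd0, mul_comm,
            div_eq_mul_inv]
          congr 2
          field_simp
          push_cast
          ring
      _ < 1 := by
          rw [Real.exp_lt_one_iff]
          have h3 : (d : ℝ)⁻¹ ≠ 1 := by
            rw [ne_eq, inv_eq_one]
            exact_mod_cast (by omega : d ≠ 1)
          have := Real.log_lt_sub_one_of_pos (inv_pos.2 hd0) h3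
          rw [Real.log_inv] at this
          linarith
  have h0 := (Real.exp_pos (-s)).le
  rw [expWeight, ← ENNReal.ofReal_one, ← ENNReal.ofReal_add h0 zero_le_one, ← ENNReal.ofReal_pow
    (by positivity), ← ENNReal.ofReal_mul h0]
  exact ENNReal.ofReal_lt_ofReal_iff one_pos |>.2 h2

/-! ### The configuration of the frog model at a fixed time -/

theorem generateFrom_avoid (ι : Type*) :
    (MeasurableSpace.pi : MeasurableSpace (ι → Bool)) =
      MeasurableSpace.generateFrom {A | ∃ F : Finset ι, A = {b | ∀ q ∈ F, b q = false}} := by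
  refine le_antisymm (iSup_le fun i => ?_) (MeasurableSpace.generateFrom_le ?_)
  · rw [MeasurableSpace.comap_le_iff_le_map]
    intro s _
    rw [MeasurableSpace.map_def]
    have h0 : MeasurableSet[MeasurableSpace.generateFrom
        {A : Set (ι → Bool) | ∃ F : Finset ι, A = {b | ∀ q ∈ F, b q = false}}]
        {b : ι → Bool | b i = false} :=
      MeasurableSpace.measurableSet_generateFrom ⟨{i}, by simp⟩
    have h1 : MeasurableSet[MeasurableSpace.generateFrom
        {A : Set (ι → Bool) | ∃ F : Finset ι, A = {b | ∀ q ∈ F, b q = false}}]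
        {b : ι → Bool | b i = true} := by
      have : {b : ι → Bool | b i = true} = {b : ι → Bool | b i = false}ᶜ := by ext; simp
      rw [this]
      exact MeasurableSet.compl h0
    have hs : (fun b : ι → Bool => b i) ⁻¹' s =
        ({b | b i = false} ∩ {_b | false ∈ s}) ∪ ({b | b i = true} ∩ {_b | true ∈ s}) := by
      ext b
      cases h : b i <;> simp [h]
    rw [hs]
    exact (h0.inter (MeasurableSet.const _)).union (h1.inter (MeasurableSet.const _))
  · rintro _ ⟨F, rfl⟩
    have : {b : ι → Bool | ∀ q ∈ F, b q = false} = Set.pi F fun _ => {false} := by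
      ext b; simp [Set.mem_pi]
    rw [this]
    exact MeasurableSet.pi F.countable_toSet fun _ _ => measurableSet_singleton _

/-- The law of a random configuration is determined by the avoidance probabilities. -/
theorem eq_configLaw {ι : Type*} (l : ι → ℝ≥0) {ν : Measure (ι → Bool)} [IsProbabilityMeasure ν]
    (h : ∀ F : Finset ι, ν {b | ∀ q ∈ F, b q = false} =
      ENNReal.ofReal (Real.exp (-∑ q ∈ F, (l q : ℝ)))) : ν = configLaw l := by
  classical
  refine ext_of_generate_finite _ (generateFrom_avoid ι) ?_ ?_ (by simp)
  · rintro _ ⟨F, rfl⟩ _ ⟨F', rfl⟩ _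
    refine ⟨F ∪ F', ?_⟩
    ext b
    simp only [Set.mem_inter_iff, Set.mem_ofPred_eq, Finset.mem_union]
    exact ⟨fun h q hq => hq.elim (h.1 q) (h.2 q), fun h => ⟨fun q hq => h q (Or.inl hq),
      fun q hq => h q (Or.inr hq)⟩⟩
  · rintro _ ⟨F, rfl⟩
    rw [h, configLaw_avoid]

theorem lintegral_poisson_pow (μ : ℝ≥0) {r : ℝ} (hr : 0 ≤ r) :
    ∫⁻ n, ENNReal.ofReal r ^ n ∂(poissonMeasure μ) =
      ENNReal.ofReal (Real.exp (-(μ * (1 - r)))) := by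
  rw [lintegral_countable']
  have h : ∀ n : ℕ, ENNReal.ofReal r ^ n * poissonMeasure μ {n} =
      ENNReal.ofReal (Real.exp (-μ) * ((μ * r) ^ n / n.factorial)) := by
    intro n
    rw [poissonMeasure_singleton, ← ENNReal.ofReal_pow hr, ← ENNReal.ofReal_mul (by positivity)]
    congr 1
    rw [mul_pow]
    ring
  have hsum : HasSum (fun n : ℕ => Real.exp (-μ) * ((μ * r) ^ n / n.factorial))
      (Real.exp (-(μ * (1 - r)))) := by
    convert! (NormedSpace.expSeries_div_hasSum_exp (μ * r : ℝ)).mul_left (Real.exp (-μ)) using 1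
    rw [← Real.exp_eq_exp_ℝ, ← Real.exp_add]
    congr 1
    ring
  simp_rw [h]
  rw [← ENNReal.ofReal_tsum_of_nonneg (fun n => by positivity) hsum.summable, hsum.tsum_eq]

theorem measurableSet_walk (P : Vertex d → Prop) (T : ℕ) :
    MeasurableSet {S : ℕ → Vertex d | P (S T)} :=
  (measurable_pi_apply T) (MeasurableSet.of_discrete (s := {v | P v}))

theorem walkLaw_exists_suffix (u : Vertex d) (T M : ℕ) (L : Finset (Vertex d))
    (hL : ∀ x ∈ L, x.length = M) :
    walkLaw d u {S | ∃ x ∈ L, x <:+ S T} = ∑ x ∈ L, walkLaw d u {S | x <:+ S T} := by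
  have : {S : ℕ → Vertex d | ∃ x ∈ L, x <:+ S T} = ⋃ x ∈ L, {S | x <:+ S T} := by ext; simp
  rw [this, measure_biUnion_finset _ fun x _ => measurableSet_walk (fun v => x <:+ v) T]
  intro x hx y hy hxy
  refine Set.disjoint_left.2 fun S h1 h2 => hxy ?_
  have hlen := (hL x hx).trans (hL y hy).symm
  exact (List.suffix_of_suffix_length_le h1 h2 hlen.le).eq_of_length hlen

open Classical in
/-- Whether, at the time `T` after it has been woken up, a frog from `u ≠ []` is in the subtree at
the vertex `x` of depth `M`. -/
noncomputable def frogConfig (M T : ℕ) (ω : Sample d) : Vertex d × Vertex d → Bool := fun q =>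
  decide (q.1 ≠ [] ∧ q.2.length = M ∧ ∃ k < ω.1 q.1, q.2 <:+ ω.2 (q.1, k) T)

theorem measurable_frogConfig (M T : ℕ) : Measurable (frogConfig (d := d) M T) := by
  refine measurable_pi_lambda _ fun q => ?_
  have hm : MeasurableSet {ω : Sample d |
      q.1 ≠ [] ∧ q.2.length = M ∧ ∃ k < ω.1 q.1, q.2 <:+ ω.2 (q.1, k) T} := by
    refine (MeasurableSet.const _).inter ((MeasurableSet.const _).inter ?_)
    have : {ω : Sample d | ∃ k < ω.1 q.1, q.2 <:+ ω.2 (q.1, k) T} =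
        ⋃ k, {ω : Sample d | k < ω.1 q.1} ∩ {ω | q.2 <:+ ω.2 (q.1, k) T} := by
      ext; simp
    show MeasurableSet {ω : Sample d | ∃ k < ω.1 q.1, q.2 <:+ ω.2 (q.1, k) T}
    rw [this]
    refine MeasurableSet.iUnion fun k => MeasurableSet.inter ?_ ?_
    · exact ((measurable_pi_apply q.1).comp measurable_fst)
        (MeasurableSet.of_discrete (s := {n : ℕ | k < n}))
    · exact (show Measurable fun ω : Sample d => ω.2 (q.1, k) from
        (measurable_pi_apply (q.1, k)).comp measurable_snd)
        (measurableSet_walk (fun v => q.2 <:+ v) T)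
  refine measurable_to_bool ?_
  convert hm using 1
  ext ω
  simp [frogConfig]

open Classical in
/-- The intensities of `frogConfig`. -/
noncomputable def frogRate (d : ℕ) (μ : ℝ≥0) (M T : ℕ) : Vertex d × Vertex d → ℝ≥0 := fun q =>
  if q.1 ≠ [] ∧ q.2.length = M then μ * (walkLaw d q.1 {S | q.2 <:+ S T}).toNNReal else 0

/-- The probability that no frog from `V` hits the sets `L`. -/
theorem law_avoid [NeZero d] (μ : ℝ≥0) (T : ℕ) (V : Finset (Vertex d))
    (L : Vertex d → Set (Vertex d)) :
    law d μ {ω | ∀ u ∈ V, ∀ k < ω.1 u, ω.2 (u, k) T ∉ L u} =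
      ENNReal.ofReal (Real.exp (-∑ u ∈ V, μ * (walkLaw d u).real {S | S T ∈ L u})) := by
  have hmL : ∀ u, MeasurableSet {S : ℕ → Vertex d | S T ∈ L u} :=
    fun u => measurableSet_walk (· ∈ L u) T
  have hm : MeasurableSet {ω : Sample d | ∀ u ∈ V, ∀ k < ω.1 u, ω.2 (u, k) T ∉ L u} := by
    have : {ω : Sample d | ∀ u ∈ V, ∀ k < ω.1 u, ω.2 (u, k) T ∉ L u} =
        ⋂ u ∈ V, ⋂ k, ({ω : Sample d | k < ω.1 u}ᶜ ∪ {ω | ω.2 (u, k) T ∈ L u}ᶜ) := by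
      ext
      simp [imp_iff_not_or]
    rw [this]
    refine MeasurableSet.biInter V.countable_toSet fun u _ => MeasurableSet.iInter fun k =>
      MeasurableSet.union (MeasurableSet.compl ?_) (MeasurableSet.compl ?_)
    · exact ((measurable_pi_apply u).comp measurable_fst)
        (MeasurableSet.of_discrete (s := {n : ℕ | k < n}))
    · exact (show Measurable fun ω : Sample d => ω.2 (u, k) from
        (measurable_pi_apply (u, k)).comp measurable_snd) (hmL u)
  have hN : ∀ N : Vertex d → ℕ, (Measure.infinitePi fun f : Frog d => walkLaw d f.1)
      (Prod.mk N ⁻¹' {ω : Sample d | ∀ u ∈ V, ∀ k < ω.1 u, ω.2 (u, k) T ∉ L u}) =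
      ∏ u ∈ V, ENNReal.ofReal (1 - (walkLaw d u).real {S | S T ∈ L u}) ^ N u := by
    intro N
    set frogs : Finset (Frog d) := (V.sigma fun u => Finset.range (N u)).map
      ⟨fun p => (p.1, p.2), fun p q h => by
        obtain ⟨h1, h2⟩ := Prod.ext_iff.1 h
        exact Sigma.ext h1 (heq_of_eq h2)⟩ with hfrogs
    have hset : Prod.mk N ⁻¹' {ω : Sample d | ∀ u ∈ V, ∀ k < ω.1 u, ω.2 (u, k) T ∉ L u} =
        Set.pi frogs fun f => {S | S T ∈ L f.1}ᶜ := by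
      ext x
      simp only [hfrogs, Set.mem_preimage, Set.mem_ofPred_eq, Set.mem_pi, Finset.mem_coe,
        Finset.mem_map, Finset.mem_sigma, Finset.mem_range,
        Set.mem_compl_iff]
      constructor
      · rintro h _ ⟨⟨u, k⟩, ⟨hu, hk⟩, rfl⟩
        exact h u hu k hk
      · exact fun h u hu k hk => h (u, k) ⟨⟨u, k⟩, ⟨hu, hk⟩, rfl⟩
    rw [hset, Measure.infinitePi_pi _ fun f _ => (hmL f.1).compl, hfrogs, Finset.prod_map,
      Finset.prod_sigma]
    refine Finset.prod_congr rfl fun u _ => ?_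
    show ∏ k ∈ Finset.range (N u), walkLaw d u {S | S T ∈ L u}ᶜ = _
    rw [Finset.prod_const, Finset.card_range]
    rw [← probReal_compl_eq_one_sub (hmL u), ofReal_measureReal]
  rw [law, Measure.prod_apply hm]
  simp_rw [hN]
  have hind := iIndepFun_infinitePi (P := fun _ : Vertex d => poissonMeasure μ)
    (X := fun u n => ENNReal.ofReal (1 - (walkLaw d u).real {S | S T ∈ L u}) ^ n)
    fun _ => measurable_of_countable _
  rw [lintegral_prod_eq_prod_lintegral_of_indepFun V _ hind fun u =>
    (measurable_of_countable _).comp (measurable_pi_apply u)]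
  have hu : ∀ u : Vertex d, ∫⁻ N, ENNReal.ofReal (1 - (walkLaw d u).real {S | S T ∈ L u}) ^ N u
      ∂(Measure.infinitePi fun _ : Vertex d => poissonMeasure μ) =
      ENNReal.ofReal (Real.exp (-(μ * (walkLaw d u).real {S | S T ∈ L u}))) := by
    intro u
    have h1 := lintegral_poisson_pow μ
      (sub_nonneg.2 (measureReal_le_one (μ := walkLaw d u) (s := {S | S T ∈ L u})))
    rw [sub_sub_cancel] at h1
    rw [← h1]
    exact (measurePreserving_eval_infinitePi (fun _ : Vertex d => poissonMeasure μ) u).lintegral_comp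
      (measurable_of_countable _)
  simp_rw [hu]
  rw [← ENNReal.ofReal_prod_of_nonneg fun _ _ => (Real.exp_pos _).le, ← Real.exp_sum,
    Finset.sum_neg_distrib]

/-- Poisson thinning: the frogs from `u` are distributed over the disjoint subtrees at depth `M` as
independent Poisson numbers. It suffices to compare avoidance probabilities, by `eq_configLaw`, and
on disjoint subtrees the probabilities of the walk add up. -/
theorem map_frogConfig [NeZero d] (μ : ℝ≥0) (M T : ℕ) :
    (law d μ).map (frogConfig M T) = configLaw (frogRate d μ M T) := by
  classical
  have hm := measurable_frogConfig (d := d) M T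
  have : IsProbabilityMeasure ((law d μ).map (frogConfig M T)) :=
    Measure.isProbabilityMeasure_map hm.aemeasurable
  refine eq_configLaw _ fun F => ?_
  set F' := F.filter fun q => q.1 ≠ [] ∧ q.2.length = M with hF'
  set L : Vertex d → Finset (Vertex d) := fun u => (F'.filter fun q => q.1 = u).image Prod.snd with hL
  have hmem : ∀ u x, x ∈ L u ↔ (u, x) ∈ F' := by
    intro u x
    simp only [hL, Finset.mem_image, Finset.mem_filter, Prod.exists, exists_eq_right]
  have hlen : ∀ u, ∀ x ∈ L u, x.length = M := fun u x hx =>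
    (Finset.mem_filter.1 ((hmem u x).1 hx)).2.2
  have hset : frogConfig (d := d) M T ⁻¹' {b | ∀ q ∈ F, b q = false} =
      {ω | ∀ u ∈ F'.image Prod.fst, ∀ k < ω.1 u, ω.2 (u, k) T ∉ {v | ∃ x ∈ L u, x <:+ v}} := by
    ext ω
    simp only [Set.mem_preimage, Set.mem_ofPred_eq, frogConfig, decide_eq_false_iff_not, hmem,
      not_exists, not_and]
    constructor
    · intro h u _ k hk x hx hs
      have h1 := Finset.mem_filter.1 hx
      exact h _ h1.1 h1.2.1 h1.2.2 k hk hs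
    · rintro h ⟨u, x⟩ hq hu hx k hk hs
      have h1 : (u, x) ∈ F' := Finset.mem_filter.2 ⟨hq, hu, hx⟩
      exact h u (Finset.mem_image.2 ⟨_, h1, rfl⟩) k hk x h1 hs
  have hm2 : MeasurableSet {b : Vertex d × Vertex d → Bool | ∀ q ∈ F, b q = false} := by
    have : Measurable fun b : Vertex d × Vertex d → Bool => ∀ q ∈ F, b q = false :=
      measurable_of_agree F fun b b' hb => by
        refine propext (forall_congr' fun q => forall_congr' fun hq => ?_)
        rw [hb q hq]
    exact measurableSet_setOfPred.2 this
  rw [Measure.map_apply hm hm2, hset, law_avoid μ T _ fun u => {v | ∃ x ∈ L u, x <:+ v}]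
  congr 3
  have h1 : ∀ u, (μ : ℝ) * (walkLaw d u).real {S | S T ∈ {v | ∃ x ∈ L u, x <:+ v}} =
      ∑ q ∈ F' with q.1 = u, (μ : ℝ) * (walkLaw d q.1).real {S | q.2 <:+ S T} := by
    intro u
    rw [← Finset.mul_sum]
    congr 1
    have h2 := walkLaw_exists_suffix u T M (L u) (hlen u)
    have h3 : (walkLaw d u).real {S | S T ∈ {v | ∃ x ∈ L u, x <:+ v}} =
        ∑ x ∈ L u, (walkLaw d u).real {S | x <:+ S T} := by
      simp only [Measure.real, Set.mem_ofPred_eq]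
      rw [h2, ENNReal.toReal_sum fun _ _ => measure_ne_top _ _]
    rw [h3, hL, Finset.sum_image]
    · refine Finset.sum_congr rfl fun q hq => ?_
      rw [(Finset.mem_filter.1 hq).2]
    · intro q hq q' hq' h
      exact Prod.ext ((Finset.mem_filter.1 hq).2.trans (Finset.mem_filter.1 hq').2.symm) h
  rw [Finset.sum_congr rfl fun u _ => h1 u]
  rw [Finset.sum_fiberwise_of_maps_to fun q hq => Finset.mem_image_of_mem Prod.fst hq, hF',
    Finset.sum_filter]
  refine Finset.sum_congr rfl fun q _ => ?_
  unfold frogRate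
  split_ifs
  · rw [NNReal.coe_mul]; rfl
  · simp

/-! ### Counting returns -/

open Classical in
/-- The active vertices in the subtree at `i` that send a particle to the subtree at `j`. -/
noncomputable def returns (n : ℕ) (i j : Fin d) (ρ : Vertex d)
    (b : Vertex d × Vertex d → Bool) : Finset (Vertex d) :=
  (nodes d n).filter fun u => Act n Set.univ (subConfig i b) {ρ} u ∧
    ∃ x : Vertex d, x.length = n ∧ b (u ++ [i], x ++ [j]) = true

theorem returns_congr {n : ℕ} {b b' : Vertex d × Vertex d → Bool}
    (h : ∀ q ∈ relevant d (n + 1), b q = b' q) (i j : Fin d) (ρ : Vertex d) :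
    returns n i j ρ b = returns n i j ρ b' := by
  classical
  unfold returns
  refine Finset.filter_congr fun u hu => ?_
  rw [act_subConfig_congr h]
  refine and_congr_right fun _ => exists_congr fun x => and_congr_right fun hx => ?_
  rw [h (u ++ [i], x ++ [j])
    (mem_relevant.2 ⟨by simpa using mem_nodes.1 hu, by simpa using hx⟩)]

/-- The left side is the mean of `2 ^ (-ξ)` for an indicator `ξ` that vanishes with probability `exp
(-r)`. -/
theorem half_one_add_expWeight_le {r R : ℝ} (h0 : 0 ≤ r) (hR : r ≤ R) :
    2⁻¹ * (1 + expWeight r) ≤ expWeight (1 / (2 * (1 + R)) * r) := by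
  have h1 : Real.exp (-r) ≤ 1 / (1 + r) := by
    rw [Real.exp_neg, ← one_div]
    exact one_div_le_one_div_of_le (by linarith) (by linarith [Real.add_one_le_exp r])
  have h2 : 2⁻¹ * (1 + Real.exp (-r)) ≤ Real.exp (-(1 / (2 * (1 + R)) * r)) := by
    have h3 := Real.add_one_le_exp (-(1 / (2 * (1 + R)) * r))
    have h4 : 1 / (1 + r) ≤ 1 - r / (1 + R) := by
      have : r / (1 + R) ≤ r / (1 + r) := by gcongr
      have h5 : 1 / (1 + r) + r / (1 + r) = 1 := by field_simp
      linarith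
    have h6 : 1 / (2 * (1 + R)) * r = r / (1 + R) / 2 := by
      have : (1 + R) ≠ 0 := by linarith
      field_simp
    linarith
  have h5 : (2⁻¹ : ℝ≥0∞) = ENNReal.ofReal 2⁻¹ := by
    rw [ENNReal.ofReal_inv_of_pos two_pos]; simp
  rw [expWeight, expWeight, h5, ← ENNReal.ofReal_one,
    ← ENNReal.ofReal_add zero_le_one (Real.exp_pos _).le, ← ENNReal.ofReal_mul (by norm_num)]
  exact ENNReal.ofReal_le_ofReal h2

theorem expWeight_sum {α : Type*} (s : Finset α) (f : α → ℝ) :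
    expWeight (∑ i ∈ s, f i) = ∏ i ∈ s, expWeight (f i) := by
  unfold expWeight
  rw [← ENNReal.ofReal_prod_of_nonneg fun _ _ => (Real.exp_pos _).le, ← Real.exp_sum,
    Finset.sum_neg_distrib]

open Classical in
-- Given the active set of the subtree at `i`, the particles to the subtree at `j` are still
-- independent of it, and the rate at a vertex is at least `s / d` times its mass. Many returns are
-- thus as likely as a large active mass, up to the exponent.
theorem lintegral_half_pow_returns_le [NeZero d] {n : ℕ} {s : ℝ} (hs : 0 ≤ s)
    {i j : Fin d} (hij : i ≠ j) {l : Vertex d × Vertex d → ℝ≥0}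
    (hl : ∀ u x : Vertex d, u.length < n → x.length = n + 1 →
      s * d * decay x (u ++ [i]) ≤ l (u ++ [i], x)) {ρ : Vertex d} {Γ : ℝ≥0∞}
    (hΓ : ∫⁻ b, expWeight (s * mass n {u | Act n Set.univ b {ρ} u})
      ∂(configLaw fun q => l (q.1 ++ [i], q.2 ++ [i])) ≤ Γ) :
    ∫⁻ b, 2⁻¹ ^ (returns n i j ρ b).card ∂(configLaw l) ≤ Γ ^ (1 / (2 * (1 + s / d)) / d : ℝ) := by
  have hd1 := one_le_cast (d := d)
  have hd : (0 : ℝ) < d := by linarith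
  set c : ℝ := 1 / (2 * (1 + s / d)) with hc
  have hsd : 0 ≤ s / d := by positivity
  have hc0 : 0 ≤ c := by positivity
  have hc1 : c ≤ 1 := by
    rw [hc, div_le_one (by positivity)]; linarith
  set F : (Vertex d × Vertex d → Bool) → Set (Vertex d) :=
    fun b => {u | Act n Set.univ (subConfig i b) {ρ} u} with hF
  set ξ : Vertex d → (Vertex d × Vertex d → Bool) → Prop := fun u b =>
    ∃ x : Vertex d, x.length = n ∧ b (u ++ [i], x ++ [j]) = true with hξ
  set N : Set (Vertex d) → Finset (Vertex d) := fun a => (nodes d n).filter (· ∈ a) with hN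
  set G : Set (Vertex d) → (Vertex d × Vertex d → Bool) → ℝ≥0∞ := fun a b =>
    2⁻¹ ^ ((N a).filter fun u => ξ u b).card with hG
  have hξc : ∀ u ∈ nodes d n, ∀ b b' : Vertex d × Vertex d → Bool,
      (∀ q ∈ relevant d (n + 1), b q = b' q) → (ξ u b ↔ ξ u b') := by
    intro u hu b b' h
    refine exists_congr fun x => and_congr_right fun hx => ?_
    rw [h (u ++ [i], x ++ [j])
      (mem_relevant.2 ⟨by simpa using mem_nodes.1 hu, by simpa using hx⟩)]
  have hGc : ∀ a b b', (∀ q ∈ relevant d (n + 1), b q = b' q) → G a b = G a b' := by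
    intro a b b' h
    simp only [hG]
    rw [Finset.filter_congr fun u hu => hξc u (Finset.mem_filter.1 hu).1 b b' h]
  have h1 : ∀ b, (2⁻¹ : ℝ≥0∞) ^ (returns n i j ρ b).card = G (F b) b := by
    intro b
    simp only [hG, hN, hF, returns, Finset.filter_filter]
    rfl
  have h2 : ∫⁻ b, G (F b) b ∂(configLaw l) =
      ∫⁻ x, ∫⁻ y, G (F x) y ∂(configLaw l) ∂(configLaw l) := by
    refine lintegral_mix (fun q => bern (l q)) {q | ∃ x, q.2 = x ++ [i]} ?_ ?_ ?_
    · intro x y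
      have hs : subConfig i (mix {q | ∃ x, q.2 = x ++ [i]} x y) = subConfig i x :=
        funext fun q => mix_of_mem x y ⟨q.2, rfl⟩
      simp only [hF, hs]
    · intro a x y
      have : ∀ u v, mix {q : Vertex d × Vertex d | ∃ x, q.2 = x ++ [i]} x y (u ++ [i], v ++ [j]) =
          y (u ++ [i], v ++ [j]) := by
        intro u v
        refine mix_of_notMem _ _ ?_
        rintro ⟨v', h⟩
        have : j = i := by simpa using (List.append_inj' h rfl).2
        exact hij this.symm
      simp only [hG, hξ, this]
    · refine measurable_of_agree₂ (relevant d (n + 1)) fun a a' b b' ha hb => ?_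
      have : F a = F a' := by simp only [hF, act_subConfig_congr ha]
      simp only [this, hGc _ b b' hb]
  -- Expanding over subsets `V` on which all indicators vanish expresses `2 ^ (-card)` by avoidance
  -- events, for which lower bounds on the rates suffice.
  have h3 : ∀ a b, G a b =
      ∑ V ∈ (N a).powerset, 2⁻¹ ^ (N a).card * (if ∀ u ∈ V, ¬ ξ u b then 1 else 0) := by
    intro a b
    rw [← Finset.mul_sum, Finset.sum_boole]
    have : (N a).powerset.filter (fun V => ∀ u ∈ V, ¬ ξ u b) =
        ((N a).filter fun u => ¬ ξ u b).powerset := by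
      ext V
      simp only [Finset.mem_filter, Finset.mem_powerset, Finset.subset_iff]
      exact ⟨fun h u hu => ⟨h.1 hu, h.2 u hu⟩, fun h => ⟨fun u hu => (h hu).1, fun u hu => (h hu).2⟩⟩
    rw [this, Finset.card_powerset, ← Finset.card_filter_add_card_filter_not (s := N a)
      (fun u => ξ u b), pow_add, mul_assoc]
    push_cast
    rw [← mul_pow, ENNReal.inv_mul_cancel (by norm_num) (by norm_num), one_pow, mul_one]
  have h4 : ∀ V ⊆ nodes d n, ∫⁻ b, (if ∀ u ∈ V, ¬ ξ u b then 1 else 0) ∂(configLaw l) ≤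
      ∏ u ∈ V, expWeight (s / d * (d : ℝ)⁻¹ ^ u.length) := by
    intro V hV
    have hset : ∀ x, (if ∀ u ∈ V, ¬ ξ u x then (1 : ℝ≥0∞) else 0) =
        Set.indicator {b : Vertex d × Vertex d → Bool | ∀ u ∈ V.map (childEmb i),
          ∀ j' ∈ ({j} : Finset (Fin d)), ∀ x : Vertex d, x.length = n →
            b (u, x ++ [j']) = false} 1 x := by
      intro x
      rw [Set.indicator_apply, Pi.one_apply]
      refine if_congr ?_ rfl rfl
      simp [hξ]
    simp_rw [hset]
    refine (lintegral_indicator_one_le _).trans ?_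
    refine (configLaw_avoid_le (l := l) (n := n) (W := {j}) (V.map (childEmb i))
      (fun u => s * d * (d : ℝ)⁻¹ ^ (u.length + n + 1)) ?_).trans (le_of_eq ?_)
    · intro u hu j' hj' x hx
      obtain rfl := Finset.mem_singleton.1 hj'
      obtain ⟨v, hv, rfl⟩ := Finset.mem_map.1 hu
      rw [childEmb_apply]
      refine le_trans (le_of_eq ?_) (hl v (x ++ [j']) (mem_nodes.1 (hV hv)) (by simpa using hx))
      rw [decay_append_of_ne _ _ hij, hx, List.length_append, List.length_singleton]
      congr 2
      omega
    · rw [← expWeight_sum, Finset.sum_map]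
      congr 1
      refine Finset.sum_congr rfl fun u _ => ?_
      simp only [childEmb_apply, List.length_append, List.length_singleton, Finset.card_singleton,
        Nat.cast_one, one_mul]
      rw [show u.length + 1 + n + 1 = u.length + n + 2 by omega, pow_add, pow_add, inv_pow, inv_pow,
        inv_pow]
      field_simp
  have h5 : ∀ a, ∫⁻ y, G a y ∂(configLaw l) ≤ expWeight (s * mass n a) ^ (c / d) := by
    intro a
    have hmV : ∀ V ∈ (N a).powerset, Measurable fun b =>
        if ∀ u ∈ V, ¬ ξ u b then (1 : ℝ≥0∞) else 0 := by
      intro V hV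
      refine measurable_of_agree (relevant d (n + 1)) fun b b' hb => if_congr ?_ rfl rfl
      refine forall_congr' fun u => forall_congr' fun hu => not_congr (hξc u ?_ b b' hb)
      exact (Finset.mem_filter.1 (Finset.mem_powerset.1 hV hu)).1
    calc ∫⁻ y, G a y ∂(configLaw l)
        = ∑ V ∈ (N a).powerset, 2⁻¹ ^ (N a).card *
          ∫⁻ b, (if ∀ u ∈ V, ¬ ξ u b then 1 else 0) ∂(configLaw l) := by
          simp_rw [h3]
          rw [lintegral_finsetSum' _ fun V hV => ((hmV V hV).const_mul _).aemeasurable]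
          exact Finset.sum_congr rfl fun V hV => lintegral_const_mul _ (hmV V hV)
      _ ≤ ∑ V ∈ (N a).powerset, 2⁻¹ ^ (N a).card *
          ∏ u ∈ V, expWeight (s / d * (d : ℝ)⁻¹ ^ u.length) := by
          refine Finset.sum_le_sum fun V hV => mul_le_mul_right (h4 V ?_) _
          exact (Finset.mem_powerset.1 hV).trans (Finset.filter_subset _ _)
      _ = ∏ u ∈ N a, 2⁻¹ * (1 + expWeight (s / d * (d : ℝ)⁻¹ ^ u.length)) := by
          rw [← Finset.mul_sum, Finset.prod_mul_distrib, Finset.prod_const, Finset.prod_one_add]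
      _ ≤ ∏ u ∈ N a, expWeight (c * (s / d * (d : ℝ)⁻¹ ^ u.length)) := by
          refine Finset.prod_le_prod' fun u _ => half_one_add_expWeight_le (by positivity) ?_
          exact mul_le_of_le_one_right hsd (pow_le_one₀ (by positivity) (inv_le_one_of_one_le₀ hd1))
      _ = expWeight (s * mass n a) ^ (c / d) := by
          rw [← expWeight_sum, expWeight_rpow, mass, ← Finset.sum_filter, Finset.mul_sum,
            Finset.mul_sum]
          congr 1
          refine Finset.sum_congr rfl fun u _ => ?_
          ring
  have hinj : Function.Injective fun q : Vertex d × Vertex d => (q.1 ++ [i], q.2 ++ [i]) := by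
    rintro ⟨a, b⟩ ⟨a', b'⟩ h
    simpa using h
  have hma : Measurable fun b => expWeight (s * mass n {u | Act n Set.univ b {ρ} u}) :=
    measurable_of_agree (relevant d n) fun b b' hb => by rw [act_congr_relevant hb]
  simp_rw [h1]
  rw [h2]
  calc ∫⁻ x, ∫⁻ y, G (F x) y ∂(configLaw l) ∂(configLaw l)
      ≤ ∫⁻ x, expWeight (s * mass n (F x)) ^ (c / d) ∂(configLaw l) :=
        lintegral_mono fun x => h5 (F x)
    _ = ∫⁻ b, expWeight (s * mass n {u | Act n Set.univ b {ρ} u}) ^ (c / d)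
        ∂(configLaw fun q => l (q.1 ++ [i], q.2 ++ [i])) :=
        (measurePreserving_comp_injective l hinj).lintegral_comp (hma.pow_const _)
    _ ≤ (∫⁻ b, expWeight (s * mass n {u | Act n Set.univ b {ρ} u})
        ∂(configLaw fun q => l (q.1 ++ [i], q.2 ++ [i]))) ^ (c / d) :=
        lintegral_rpow_le hma.aemeasurable (by positivity) ((div_le_one hd).2 (hc1.trans hd1))
    _ ≤ _ := ENNReal.rpow_le_rpow hΓ (by positivity)

/-- In a deep tree there are many returns with high probability. -/
theorem exists_depth_returns (hd : 2 ≤ d) {s : ℝ} (hs : Real.log d ≤ s) {i j : Fin d} (hij : i ≠ j)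
    (k : ℕ) {ε : ℝ≥0∞} (hε : ε ≠ 0) : ∃ n : ℕ, ∀ l : Vertex d × Vertex d → ℝ≥0,
      (∀ u x : Vertex d, u.length < n → x.length = n + 1 →
        s * d * decay x (u ++ [i]) ≤ l (u ++ [i], x)) →
      ∀ ρ : Vertex d, ρ.length = n →
        configLaw l {b | (returns n i j ρ b).card < k} ≤ ε := by
  have : NeZero d := ⟨by omega⟩
  have hd1 := one_le_cast (d := d)
  have hd0 : (0 : ℝ) < d := by linarith
  have hs0 : 0 ≤ s := (Real.log_nonneg hd1).trans hs
  have hγ := expWeight_mul_lt_one hd hs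
  set γ := expWeight s * (expWeight s + 1) ^ (d - 1) with hγd
  set t : ℝ := 1 / (2 * (1 + s / d)) / d with ht
  have ht0 : 0 < t := by positivity
  have hγt : γ ^ t < 1 := ENNReal.rpow_lt_one hγ ht0
  -- Markov's inequality for `2 ^ (-card)` costs the factor `2 ^ k`, which is beaten by a large
  -- depth `n`.
  have hlim : Tendsto (fun n : ℕ => 2 ^ k * (γ ^ t) ^ n) atTop (nhds 0) := by
    have := ENNReal.Tendsto.const_mul (ENNReal.tendsto_pow_atTop_nhds_zero_of_lt_one hγt)
      (a := 2 ^ k) (Or.inr (by simp))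
    rwa [mul_zero] at this
  obtain ⟨n, hn⟩ := (hlim.eventually (gt_mem_nhds (pos_iff_ne_zero.2 hε))).exists
  refine ⟨n, fun l hl ρ hρ => le_trans ?_ hn.le⟩
  have h1 := lintegral_half_pow_returns_le hs0 hij hl (lintegral_mass_le hs0 hγ.le n
    (fun q => l (q.1 ++ [i], q.2 ++ [i])) (fun u x hu hx => by
      rw [← decay_append x u i]
      exact hl u (x ++ [i]) hu (by simpa using hx)) ρ hρ)
  have hm : Measurable fun b => (2⁻¹ : ℝ≥0∞) ^ (returns n i j ρ b).card :=
    measurable_of_agree (relevant d (n + 1)) fun b b' hb => by rw [returns_congr hb]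
  have h2 : configLaw l {b | (returns n i j ρ b).card < k} ≤
      configLaw l {b | (2⁻¹ : ℝ≥0∞) ^ k ≤ 2⁻¹ ^ (returns n i j ρ b).card} :=
    measure_mono fun b hb =>
      pow_le_pow_of_le_one zero_le (ENNReal.inv_le_one.2 one_le_two) (le_of_lt hb)
  have h3 := (mul_meas_ge_le_lintegral₀ hm.aemeasurable (2⁻¹ ^ k)).trans h1
  calc configLaw l {b | (returns n i j ρ b).card < k}
      ≤ 2 ^ k * (2⁻¹ ^ k * configLaw l {b | (2⁻¹ : ℝ≥0∞) ^ k ≤ 2⁻¹ ^ (returns n i j ρ b).card}) := by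
        rw [← mul_assoc, ← mul_pow, ENNReal.mul_inv_cancel (by norm_num) (by norm_num), one_pow,
          one_mul]
        exact h2
    _ ≤ 2 ^ k * (γ ^ n) ^ t := by gcongr
    _ = 2 ^ k * (γ ^ t) ^ n := by
        rw [← ENNReal.rpow_natCast γ, ← ENNReal.rpow_natCast (γ ^ t), ← ENNReal.rpow_mul, ← ENNReal.rpow_mul,
          mul_comm (n : ℝ)]

/-! ### Paths in the tree -/

/-- A walk from outside of the subtree at `v` that is in this subtree at a later time enters it
through `v`. -/
theorem exists_entrance {S : ℕ → Vertex d} (hS : ∀ n, (tree d).Adj (S n) (S (n + 1)))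
    {v : Vertex d} (h0 : ¬ v <:+ S 0) {T : ℕ} (hT : v <:+ S T) :
    ∃ m, S (m + 1) = v ∧ ∃ i, v = i :: S m := by
  induction T with
  | zero => exact absurd hT h0
  | succ T ih =>
    by_cases h : v <:+ S T
    · exact ih h
    · rcases hS T with ⟨i, hi⟩ | ⟨i, hi⟩
      · rcases List.suffix_cons_iff.1 (hi ▸ hT) with hv | hv
        · exact ⟨T, hi.trans hv.symm, i, hv⟩
        · exact absurd hv h
      · exact absurd (hi ▸ hT.trans (List.suffix_cons i _)) h

theorem ae_walkLaw [NeZero d] (v : Vertex d) :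
    ∀ᵐ S ∂(walkLaw d v), S 0 = v ∧ ∀ n, (tree d).Adj (S n) (S (n + 1)) := by
  have h : ∀ᵐ ξ ∂(Measure.infinitePi fun p : ℕ × Vertex d => step d p.2),
      ∀ p : ℕ × Vertex d, ξ p ∈ (tree d).neighborSet p.2 := by
    rw [ae_all_iff]
    intro p
    have h1 : ∀ᵐ w ∂(step d p.2), w ∈ (tree d).neighborSet p.2 := by
      rw [step]
      exact ae_cond_mem (MeasurableSet.of_discrete)
    exact (measurePreserving_eval_infinitePi (fun p : ℕ × Vertex d => step d p.2)
      p).quasiMeasurePreserving.ae h1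
  have hm : MeasurableSet {S : ℕ → Vertex d | S 0 = v ∧ ∀ n, (tree d).Adj (S n) (S (n + 1))} := by
    refine (measurableSet_walk (· = v) 0).inter ?_
    have : {S : ℕ → Vertex d | ∀ n, (tree d).Adj (S n) (S (n + 1))} =
        ⋂ n, {S | (S n, S (n + 1)) ∈ {q : Vertex d × Vertex d | (tree d).Adj q.1 q.2}} := by
      ext; simp
    show MeasurableSet {S : ℕ → Vertex d | ∀ n, (tree d).Adj (S n) (S (n + 1))}
    rw [this]
    refine MeasurableSet.iInter fun n => ?_
    exact (show Measurable fun S : ℕ → Vertex d => (S n, S (n + 1)) from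
      (measurable_pi_apply n).prodMk (measurable_pi_apply (n + 1))) (MeasurableSet.of_discrete)
  rw [walkLaw, ae_map_iff (measurable_path v).aemeasurable hm]
  exact h.mono fun ξ hξ => ⟨rfl, fun n => hξ (n, path v ξ n)⟩

theorem ae_law_walk [NeZero d] (μ : ℝ≥0) : ∀ᵐ ω ∂(law d μ), ∀ f : Frog d,
    ω.2 f 0 = f.1 ∧ ∀ n, (tree d).Adj (ω.2 f n) (ω.2 f (n + 1)) := by
  rw [ae_all_iff]
  intro f
  have h := (measurePreserving_eval_infinitePi (fun f : Frog d => walkLaw d f.1) f).comp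
    (measurePreserving_snd (μ := Measure.infinitePi fun _ : Vertex d => poissonMeasure μ))
  exact h.quasiMeasurePreserving.ae (ae_walkLaw f.1)

/-! ### Returns to the root -/

theorem frogConfig_eq_true {M T : ℕ} {ω : Sample d} {u x : Vertex d}
    (h : frogConfig M T ω (u, x) = true) : ∃ k < ω.1 u, x <:+ ω.2 (u, k) T :=
  (of_decide_eq_true h).2.2

/-- All frogs at the active vertices wake up, if the first frog enters the tree. -/
theorem active_of_act {ω : Sample d} (hω : ∀ f : Frog d, ω.2 f 0 = f.1 ∧
    ∀ n, (tree d).Adj (ω.2 f n) (ω.2 f (n + 1))) {n M T : ℕ} {i : Fin d} {ρ : Vertex d}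
    (hρ : ρ ++ [i] <:+ ω.2 ([], 0) T) {w : Vertex d}
    (hw : Act n Set.univ (subConfig i (frogConfig M T ω)) {ρ} w) :
    ∀ v : Vertex d, v <:+ w → ∀ k < ω.1 (v ++ [i]), Active ω (v ++ [i], k) := by
  have key : ∀ {g : Frog d} {v : Vertex d}, Active ω g → ¬ v ++ [i] <:+ g.1 →
      v ++ [i] <:+ ω.2 g T → ∀ k < ω.1 (v ++ [i]), Active ω (v ++ [i], k) := by
    intro g v hg h0 hT k hk
    obtain ⟨m, hm, _⟩ := exists_entrance (hω g).2 (by rwa [(hω g).1]) hT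
    exact hg.wake ⟨by simp, hk⟩ hm
  induction hw with
  | entry h1 h2 h3 h4 =>
    intro v hv
    obtain rfl := h1
    exact key (active_root ω) (by simp)
      ((append_singleton_suffix_iff.2 ⟨rfl, hv.trans h3⟩).trans hρ)
  | @step u x w _ _ _ h4 h5 _ ih =>
    -- Ancestors of `w` that are also ancestors of `u` are covered by the induction hypothesis. For
    -- any other `v` the frog from `u` starts outside the subtree at `v` and passes through `v` on
    -- its way.
    intro v hv
    by_cases hvu : v <:+ u
    · exact ih v hvu
    · obtain ⟨k, hk, hx⟩ := frogConfig_eq_true h4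
      exact key (ih u (List.suffix_refl u) k hk)
        (fun h => hvu (append_singleton_suffix_iff.1 h).2)
        ((append_singleton_suffix_iff.2 ⟨rfl, hv.trans h5⟩).trans hx)

/-- A bound on the number of returns in a transient realization. -/
theorem exists_returns_le {ω : Sample d} (hω : ∀ f : Frog d, ω.2 f 0 = f.1 ∧
    ∀ n, (tree d).Adj (ω.2 f n) (ω.2 f (n + 1))) (h : ¬ Recurrent ω) : ∃ K : ℕ,
    ∀ (n M T : ℕ) (i j : Fin d) (ρ : Vertex d), i ≠ j → ρ ++ [i] <:+ ω.2 ([], 0) T →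
      (returns n i j ρ (frogConfig M T ω)).card ≤ K := by
  classical
  rw [recurrent_iff_infinite, Set.not_infinite] at h
  -- The bound is the number of homes of frogs that ever visit the root. A frog from the subtree at
  -- `i` that is found in the subtree at `j` has crossed the root.
  refine ⟨(h.toFinset.image fun q => q.1.1).card, fun n M T i j ρ hij hρ => ?_⟩
  rw [← Finset.card_map (childEmb i)]
  refine Finset.card_le_card fun u hu => ?_
  obtain ⟨v, hv, rfl⟩ := Finset.mem_map.1 hu
  obtain ⟨hv, x, _, hx⟩ := (Finset.mem_filter.1 hv).2
  obtain ⟨k, hk, hx⟩ := frogConfig_eq_true hx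
  have hact := active_of_act hω hρ hv v (List.suffix_refl v) k hk
  have hj : [j] <:+ ω.2 (v ++ [i], k) T := (List.suffix_append x [j]).trans hx
  have h0 : ¬ [j] <:+ ω.2 (v ++ [i], k) 0 := by
    rw [(hω _).1]
    exact fun h =>
      hij ((append_singleton_suffix_iff (u := []) (x := v) (i := j) (j := i)).1 h).1.symm
  obtain ⟨m, _, a, ha⟩ := exists_entrance (hω _).2 h0 hj
  have hm : ω.2 (v ++ [i], k) m = [] := (List.cons.inj ha).2.symm
  exact Finset.mem_image.2 ⟨((v ++ [i], k), m), h.mem_toFinset.2 ⟨hact, hm⟩, rfl⟩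

/-- Resampling the walk of one frog. -/
theorem measurePreserving_resample [NeZero d] (μ : ℝ≥0) (A : Set (Frog d)) :
    MeasurePreserving (fun q : (Frog d → ℕ → Vertex d) × Sample d => (q.2.1, mix A q.1 q.2.2))
      ((Measure.infinitePi fun f : Frog d => walkLaw d f.1).prod (law d μ)) (law d μ) := by
  set P := Measure.infinitePi fun f : Frog d => walkLaw d f.1
  set Q := Measure.infinitePi fun _ : Vertex d => poissonMeasure μ
  have h1 := (measurePreserving_prodAssoc P Q P).symm
  have h2 := (Measure.measurePreserving_swap (μ := P) (ν := Q)).prod (MeasurePreserving.id P)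
  have h3 := measurePreserving_prodAssoc Q P P
  have h4 := (MeasurePreserving.id Q).prod (measurePreserving_mix (fun f : Frog d => walkLaw d f.1) A)
  exact h4.comp (h3.comp (h2.comp h1))

/-- The first frog is in the subtree of some vertex of given depth with a probability that is
bounded away from zero. -/
theorem le_walkLaw_entrance [NeZero d] {n T : ℕ} {i : Fin d}
    (hT : ∀ x : Vertex d, x.length = n + 1 →
      ENNReal.ofReal (decay x [] / 2) ≤ walkLaw d [] {S | x <:+ S T}) :
    ENNReal.ofReal (1 / (2 * d)) ≤
      walkLaw d [] {S | ∃ ρ ∈ leaves d n, ρ ++ [i] <:+ S T} := by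
  have hd : (0 : ℝ) < d := by linarith [one_le_cast (d := d)]
  have h1 := walkLaw_exists_suffix ([] : Vertex d) T (n + 1) ((leaves d n).map (childEmb i))
    fun x hx => by
      obtain ⟨v, hv, rfl⟩ := Finset.mem_map.1 hx
      simpa using mem_leaves.1 hv
  have hset : {S : ℕ → Vertex d | ∃ ρ ∈ leaves d n, ρ ++ [i] <:+ S T} =
      {S | ∃ x ∈ (leaves d n).map (childEmb i), x <:+ S T} := by
    ext S; simp
  rw [hset, h1, Finset.sum_map]
  calc ENNReal.ofReal (1 / (2 * d))
      = ∑ ρ ∈ leaves d n, ENNReal.ofReal ((d : ℝ)⁻¹ ^ (n + 1) / 2) := by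
        rw [Finset.sum_const, card_leaves, nsmul_eq_mul, ← ENNReal.ofReal_natCast,
          ← ENNReal.ofReal_mul (by positivity)]
        congr 1
        push_cast
        rw [inv_pow, pow_succ]
        field_simp
    _ ≤ _ := by
        refine Finset.sum_le_sum fun ρ hρ => ?_
        have hlen : (childEmb i ρ).length = n + 1 := by simpa using mem_leaves.1 hρ
        have := hT _ hlen
        rwa [decay, hlen] at this

theorem le_frogRate {μ : ℝ≥0} {M T : ℕ} {u x : Vertex d} (hu : u ≠ []) (hx : x.length = M) {r : ℝ}
    [NeZero d] (h : ENNReal.ofReal r ≤ walkLaw d u {S | x <:+ S T}) :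
    μ * r ≤ frogRate d μ M T (u, x) := by
  rw [frogRate, if_pos ⟨hu, hx⟩, NNReal.coe_mul]
  refine mul_le_mul_of_nonneg_left ?_ μ.2
  exact (ENNReal.ofReal_le_iff_le_toReal (measure_ne_top _ _)).1 h

theorem measurableSet_returns (n : ℕ) (i j : Fin d) (ρ : Vertex d) (k : ℕ) :
    MeasurableSet {b : Vertex d × Vertex d → Bool | (returns n i j ρ b).card < k} :=
  measurableSet_setOfPred.2 (measurable_of_agree (relevant d (n + 1)) fun b b' hb => by
    rw [returns_congr hb])

/-- The event that the first frog is in the subtree at `i`, and there are at least `k` returns. -/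
def manyReturns (n T : ℕ) (i j : Fin d) (k : ℕ) : Set (Sample d) :=
  {ω | ∃ ρ ∈ leaves d n, ρ ++ [i] <:+ ω.2 ([], 0) T ∧
    k ≤ (returns n i j ρ (frogConfig (n + 1) T ω)).card}

theorem measurableSet_entrance (n T : ℕ) (i : Fin d) (R : Vertex d → Set (Sample d))
    (hR : ∀ ρ, MeasurableSet (R ρ)) :
    MeasurableSet {ω : Sample d | ∃ ρ ∈ leaves d n, ρ ++ [i] <:+ ω.2 ([], 0) T ∧ ω ∈ R ρ} := by
  have : {ω : Sample d | ∃ ρ ∈ leaves d n, ρ ++ [i] <:+ ω.2 ([], 0) T ∧ ω ∈ R ρ} =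
      ⋃ ρ ∈ leaves d n, {ω : Sample d | ρ ++ [i] <:+ ω.2 ([], 0) T} ∩ R ρ := by
    ext
    simp only [Set.mem_ofPred_eq, Set.mem_iUnion, Set.mem_inter_iff, exists_prop]
  rw [this]
  refine MeasurableSet.biUnion (leaves d n).countable_toSet fun ρ _ => MeasurableSet.inter ?_ (hR ρ)
  exact (show Measurable fun ω : Sample d => ω.2 ([], 0) from
    (measurable_pi_apply ([], 0)).comp measurable_snd)
    (measurableSet_walk (fun v => ρ ++ [i] <:+ v) T)

theorem measurableSet_manyReturns (n T : ℕ) (i j : Fin d) (k : ℕ) :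
    MeasurableSet (manyReturns n T i j k) := by
  refine measurableSet_entrance n T i
    (fun ρ => {ω | k ≤ (returns n i j ρ (frogConfig (n + 1) T ω)).card}) fun ρ => ?_
  have := ((measurableSet_returns n i j ρ k).compl).preimage (measurable_frogConfig (n + 1) T)
  convert this using 1
  ext ω
  simp

/-- The first frog is below the child `i` at depth `n + 1` with probability at least `c = 1 / (2 *
d)`. The other frogs are independent of it, and whatever leaf it has reached, few returns have
probability at most `c / 2`; in fact `few` as a whole has at most this probability. -/
theorem exists_manyReturns (hd : 2 ≤ d) {μ : ℝ≥0} (hμ : 2 * d * Real.log d ≤ μ) {i j : Fin d}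
    (hij : i ≠ j) (k : ℕ) : ∃ n T : ℕ,
      ENNReal.ofReal (1 / (2 * d)) / 2 ≤ law d μ (manyReturns n T i j k) := by
  have : NeZero d := ⟨by omega⟩
  have hd0 : (0 : ℝ) < d := by linarith [one_le_cast (d := d)]
  set c := ENNReal.ofReal (1 / (2 * d)) with hc
  have hc0 : c / 2 ≠ 0 := by
    refine (ENNReal.half_pos ?_).ne'
    rw [hc, ne_eq, ENNReal.ofReal_eq_zero, not_le]
    positivity
  -- The rate from `u` to `x` is at least `μ * decay x u / 2 = s * d * decay x u` with `s = μ / (2 *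
  -- d)`; hence the condition `2 * d * log d ≤ μ`.
  have hs : Real.log d ≤ μ / (2 * d) := by
    rw [le_div_iff₀ (by positivity)]; linarith
  obtain ⟨n, hn⟩ := exists_depth_returns hd hs hij k hc0
  obtain ⟨T, hT⟩ := exists_time_walk hd (n + 1)
  refine ⟨n, T, ?_⟩
  set P := Measure.infinitePi fun f : Frog d => walkLaw d f.1 with hP
  have hrare : ∀ ρ : Vertex d, ρ.length = n →
      law d μ {ω | (returns n i j ρ (frogConfig (n + 1) T ω)).card < k} ≤ c / 2 := by
    intro ρ hρ
    have h1 := hn (frogRate d μ (n + 1) T) (fun u x hu hx => by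
      have h2 := le_frogRate (μ := μ) (u := u ++ [i]) (by simp) hx
        (hT x (u ++ [i]) hx (by rintro rfl; simp at hx) (by simp; omega))
      refine le_trans (le_of_eq ?_) h2
      field_simp) ρ hρ
    rw [← map_frogConfig, Measure.map_apply (measurable_frogConfig _ _)
      (measurableSet_returns n i j ρ k)] at h1
    exact h1
  set few : Set (Sample d) := {ω | ∃ ρ ∈ leaves d n, ρ ++ [i] <:+ ω.2 ([], 0) T ∧
    ω ∈ {ω | (returns n i j ρ (frogConfig (n + 1) T ω)).card < k}} with hfew
  have hfewm : MeasurableSet few := measurableSet_entrance n T i _ fun ρ =>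
    (measurableSet_returns n i j ρ k).preimage (measurable_frogConfig (n + 1) T)
  have hfewle : law d μ few ≤ c / 2 := by
    have hmp := measurePreserving_resample (d := d) μ {([], 0)}
    rw [← hmp.measure_preimage hfewm.nullMeasurableSet,
      Measure.prod_apply (hfewm.preimage hmp.measurable)]
    refine (lintegral_mono (g := fun _ => c / 2) fun x => ?_).trans (by simp)
    have hcfg : ∀ ω : Sample d, frogConfig (n + 1) T (ω.1, mix {([], 0)} x ω.2) =
        frogConfig (n + 1) T ω := by
      intro ω
      funext q
      have : q.1 ≠ [] → ∀ m, mix {([], 0)} x ω.2 (q.1, m) = ω.2 (q.1, m) := fun hq m =>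
        mix_of_notMem _ _ fun h => hq (Prod.ext_iff.1 h).1
      unfold frogConfig
      refine decide_eq_decide.2 (and_congr_right fun hq => ?_)
      simp only [this hq]
    have h0 : ∀ ω : Sample d, mix {([], 0)} x ω.2 (([], 0) : Frog d) = x ([], 0) :=
      fun ω => mix_of_mem _ _ rfl
    by_cases hx : ∃ ρ ∈ leaves d n, ρ ++ [i] <:+ x ([], 0) T
    · obtain ⟨ρ, hρ, hρx⟩ := hx
      refine (measure_mono fun ω hω => ?_).trans (hrare ρ (mem_leaves.1 hρ))
      obtain ⟨ρ', hρ', h1, h2⟩ := hω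
      simp only [Set.mem_ofPred_eq, hcfg, h0] at h1 h2
      have hlen : ρ'.length = ρ.length := (mem_leaves.1 hρ').trans (mem_leaves.1 hρ).symm
      have h3 := (List.suffix_of_suffix_length_le h1 hρx (by simp [hlen])).eq_of_length
        (by simp [hlen])
      rw [List.append_left_injective [i] h3] at h2
      exact h2
    · refine (measure_mono_null (t := ∅) (fun ω hω => hx ?_) measure_empty).trans_le zero_le
      obtain ⟨ρ', hρ', h1, _⟩ := hω
      simp only [h0] at h1
      exact ⟨ρ', hρ', h1⟩
  have hroot : c ≤ law d μ {ω | ∃ ρ ∈ leaves d n, ρ ++ [i] <:+ ω.2 ([], 0) T} := by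
    have h1 := (measurePreserving_eval_infinitePi (fun f : Frog d => walkLaw d f.1) ([], 0)).comp
      (measurePreserving_snd (μ := Measure.infinitePi fun _ : Vertex d => poissonMeasure μ))
    refine (le_walkLaw_entrance (i := i) fun x hx => hT x [] hx (by rintro rfl; simp at hx)
      (by simp)).trans_eq ?_
    exact (h1.measure_preimage (measurableSet_walk
      (fun v => ∃ ρ ∈ leaves d n, ρ ++ [i] <:+ v) T).nullMeasurableSet).symm
  have hcov : {ω : Sample d | ∃ ρ ∈ leaves d n, ρ ++ [i] <:+ ω.2 ([], 0) T} ⊆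
      manyReturns n T i j k ∪ few := by
    rintro ω ⟨ρ, hρ, h⟩
    rcases le_or_gt k (returns n i j ρ (frogConfig (n + 1) T ω)).card with hk | hk
    · exact Or.inl ⟨ρ, hρ, h, hk⟩
    · exact Or.inr ⟨ρ, hρ, h, hk⟩
  have hsum : c / 2 + c / 2 ≤ law d μ (manyReturns n T i j k) + c / 2 := by
    rw [ENNReal.add_halves]
    exact hroot.trans ((measure_mono hcov).trans ((measure_union_le _ _).trans (by gcongr)))
  exact (ENNReal.add_le_add_iff_right (ENNReal.div_ne_top ENNReal.ofReal_ne_top two_ne_zero)).1 hsum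

/-- The frog model is recurrent with positive probability if the density is large. -/
theorem law_recurrent_ne_zero_of_le (hd : 2 ≤ d) {μ : ℝ≥0} (hμ : 2 * d * Real.log d ≤ μ) :
    law d μ {ω | Recurrent ω} ≠ 0 := by
  have : NeZero d := ⟨by omega⟩
  intro h
  have hij : (⟨0, by omega⟩ : Fin d) ≠ ⟨1, by omega⟩ := by simp
  choose n T hnT using exists_manyReturns hd hμ hij
  set A : ℕ → Set (Sample d) := fun k => manyReturns (n k) (T k) ⟨0, by omega⟩ ⟨1, by omega⟩ k with hA
  -- Under transience the number of returns is bounded in each realization, so almost surely not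
  -- infinitely many of the events `A k` occur, although their probabilities are bounded away from
  -- zero.
  have hnull : law d μ (⋂ m, ⋃ k ≥ m, A k) = 0 := by
    have hrec : ∀ᵐ ω ∂(law d μ), ¬ Recurrent ω := measure_eq_zero_iff_ae_notMem.1 h
    refine measure_eq_zero_iff_ae_notMem.2 ?_
    filter_upwards [hrec, ae_law_walk μ] with ω h1 h2 h3
    obtain ⟨K, hK⟩ := exists_returns_le h2 h1
    obtain ⟨k, hk, ρ, _, hρ, hle⟩ := Set.mem_iUnion₂.1 (Set.mem_iInter.1 h3 (K + 1))
    have := hK (n k) (n k + 1) (T k) _ _ ρ hij hρ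
    omega
  have htend := tendsto_measure_iInter_atTop (μ := law d μ) (s := fun m => ⋃ k ≥ m, A k)
    (fun m => (MeasurableSet.iUnion fun k => MeasurableSet.iUnion fun _ =>
      measurableSet_manyReturns _ _ _ _ k).nullMeasurableSet)
    (fun m m' hm => Set.biUnion_subset_biUnion_left fun k hk => le_trans hm hk)
    ⟨0, measure_ne_top _ _⟩
  rw [hnull] at htend
  have hge := ge_of_tendsto' htend fun m =>
    (hnT m).trans (measure_mono (Set.subset_biUnion_of_mem (u := A) (show m ∈ {k | k ≥ m} from
      le_refl m)))
  have h0 : ENNReal.ofReal (1 / (2 * d)) / 2 ≠ 0 := by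
    refine (ENNReal.half_pos ?_).ne'
    rw [ne_eq, ENNReal.ofReal_eq_zero, not_le]
    have : (0 : ℝ) < d := by positivity
    positivity
  exact h0 (le_antisymm hge zero_le)

/-! ### The critical density -/

/-- The supremum of the densities with almost surely transient realizations. -/
noncomputable def criticalDensity (d : ℕ) : ℝ :=
  sSup {x : ℝ | ∃ μ : ℝ≥0, x = μ ∧ law d μ {ω | Recurrent ω} = 0}

theorem criticalDensity_bound (hd : 2 ≤ d) {x : ℝ}
    (hx : ∃ μ : ℝ≥0, x = μ ∧ law d μ {ω | Recurrent ω} = 0) : x ≤ 2 * d * Real.log d := by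
  have : NeZero d := ⟨by omega⟩
  obtain ⟨μ, rfl, h⟩ := hx
  by_contra hlt
  exact law_recurrent_ne_zero_of_le hd (not_le.1 hlt).le h

theorem le_criticalDensity (hd : 2 ≤ d) {μ : ℝ≥0} (h : law d μ {ω | Recurrent ω} = 0) :
    μ ≤ criticalDensity d :=
  le_csSup ⟨2 * d * Real.log d, fun _ hx => criticalDensity_bound hd hx⟩ ⟨μ, rfl, h⟩

theorem lt_criticalDensity (hd : 2 ≤ d) : (1 / 32 : ℝ) * d < criticalDensity d := by
  have h0 : (0 : ℝ) < d := by positivity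
  have h1 : (0 : ℝ) ≤ 3 / 64 * d := by positivity
  -- The value `3 / 64` lies strictly between `1 / 32` and `1 / 16`, which makes the bound strict.
  obtain ⟨μ, hμ⟩ : ∃ μ : ℝ≥0, (μ : ℝ) = 3 / 64 * d :=
    ⟨(3 / 64 * (d : ℝ)).toNNReal, Real.coe_toNNReal _ h1⟩
  have h2 := le_criticalDensity hd (law_recurrent_eq_zero_of_lt hd (μ := μ) (by linarith))
  linarith

theorem criticalDensity_lt (hd : 2 ≤ d) : criticalDensity d < 3 * d * Real.log d := by
  have h0 : (0 : ℝ) < d := by positivity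
  have h1 : 0 < Real.log d := Real.log_pos (by exact_mod_cast hd)
  have h2 : criticalDensity d ≤ 2 * d * Real.log d := by
    refine csSup_le ⟨0, 0, by simp, law_recurrent_eq_zero_of_lt hd (by simp; positivity)⟩
      fun x hx => criticalDensity_bound hd hx
  have h3 : 0 < d * Real.log d := by positivity
  linarith

theorem ae_recurrent_of_criticalDensity_lt (hd : 2 ≤ d) {μ : ℝ≥0} (hμ : criticalDensity d < μ) :
    ∀ᵐ ω ∂(law d μ), Recurrent ω := by
  refine ae_recurrent_of_pos hd ?_ fun h => absurd (le_criticalDensity hd h) (not_le.2 hμ)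
  rintro rfl
  have h1 := lt_criticalDensity hd
  have h0 : (0 : ℝ) ≤ 1 / 32 * d := by positivity
  simp only [NNReal.coe_zero] at hμ
  linarith

theorem ae_transient_of_lt_criticalDensity (hd : 2 ≤ d) {μ : ℝ≥0} (hμ : μ < criticalDensity d) :
    ∀ᵐ ω ∂(law d μ), Transient ω := by
  have : NeZero d := ⟨by omega⟩
  have hne : {x : ℝ | ∃ μ : ℝ≥0, x = μ ∧ law d μ {ω | Recurrent ω} = 0}.Nonempty :=
    ⟨0, 0, by simp, law_recurrent_eq_zero_of_lt hd (by simp; omega)⟩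
  obtain ⟨_, ⟨μ', rfl, h⟩, hlt⟩ := exists_lt_of_lt_csSup hne hμ
  have h1 := law_recurrent_mono (d := d) (NNReal.coe_lt_coe.1 hlt).le
  rw [h] at h1
  exact measure_eq_zero_iff_ae_notMem.1 (le_antisymm h1 zero_le)

end FrogModel

theorem theorem1 :
    ∃ μc : ℕ → ℝ,
      (∀ d : ℕ, 2 ≤ d →
        0 < μc d ∧
        (∀ μ : ℝ≥0, μc d < μ → ∀ᵐ ω ∂(FrogModel.law d μ), FrogModel.Recurrent ω) ∧
        (∀ μ : ℝ≥0, (μ : ℝ) < μc d → ∀ᵐ ω ∂(FrogModel.law d μ), FrogModel.Transient ω)) ∧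
      ∃ C C' : ℝ, 0 < C ∧ 0 < C' ∧
        ∀ d : ℕ, 2 ≤ d → C * d < μc d ∧ μc d < C' * d * Real.log d := by
  refine ⟨FrogModel.criticalDensity, fun d hd => ⟨?_, fun μ hμ =>
    FrogModel.ae_recurrent_of_criticalDensity_lt hd hμ, fun μ hμ =>
    FrogModel.ae_transient_of_lt_criticalDensity hd hμ⟩, 1 / 32, 3, by norm_num, by norm_num,
    fun d hd => ⟨FrogModel.lt_criticalDensity hd, FrogModel.criticalDensity_lt hd⟩⟩
  exact lt_of_le_of_lt (by positivity) (FrogModel.lt_criticalDensity hd)
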